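/- Let $\mathfrak g$ be a complex semisimple Lie algebra with Cartan subalgebra $\mathfrak h$, simple roots $\{\alpha_i\}_{i\in I}$, Cartan matrix $a_{ij}=2(\alpha_i,\alpha_j)/(\alpha_i,\alpha_i)$ and $d_i=(\alpha_i,\alpha_i)/2$, where $(\cdot,\cdot)$ is the invariant form such that the short roots of each simple ideal have squared length $2$. Let $\hbar\in\mathbb C^\times$. The Yangian $Y_\hbar(\mathfrak g)$ is the unital associative $\mathbb C$-algebra generated by $\xi_{i,r},x^\pm_{i,r}$ ($i\in I$, $r\in\mathbb N$) with relations, for all $i,j,r,s$, $[\xi_{i,r},\xi_{j,s}]=0$; $[\xi_{i,0},x^\pm_{j,s}]=\pm d_ia_{ij}x^\pm_{j,s}$; $[\xi_{i,r+1},x^\pm_{j,s}]-[\xi_{i,r},x^\pm_{j,s+1}]=\pm\hbar\frac{d_ia_{ij}}2(\xi_{i,r}x^\pm_{j,s}+x^\pm_{j,s}\xi_{i,r})$; $[x^\pm_{i,r+1},x^\pm_{j,s}]-[x^\pm_{i,r},x^\pm_{j,s+1}]=\pm\hbar\frac{d_ia_{ij}}2(x^\pm_{i,r}x^\pm_{j,s}+x^\pm_{j,s}x^\pm_{i,r})$;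 $[x^+_{i,r},x^-_{j,s}]=\delta_{ij}\xi_{i,r+s}$; and, for $i\ne j$ and $m=1-a_{ij}$, $\sum_{\pi\in\mathfrak S_m}[x^\pm_{i,r_{\pi(1)}},[\dots,[x^\pm_{i,r_{\pi(m)}},x^\pm_{j,s}]\dots]]=0$ for all $r_1,\dots,r_m$. For $a\in\mathbb C$ let $\tau_a$ be the automorphism $\tau_a(y_r)=\sum_{k=0}^r\binom rk a^{r-k}y_k$ ($y=\xi_i,x_i^\pm$), and $V(a)=\tau_a^*V$ for a representation $V$. On a finite-dimensional representation $V$ the series $\xi_i(u)=1+\hbar\sum_{r\ge0}\xi_{i,r}u^{-r-1}$ and $x_i^\pm(u)=\hbar\sum_{r\ge0}x^\pm_{i,r}u^{-r-1}$ are expansions at $u=\infty$ of rational $\mathrm{End}(V)$-valued functions; let $\sigma(V)\subset\mathbb C$ be the set of poles of all $\xi_i(u)^{\pm1},x_i^\pm(u)$. A Jordan curve is a finite disjoint union of (piecewise $C^1$, positively oriented) simple closed curves with pairwise disjoint inner domains, and $\oint_C f=\frac1{2\pi\iota}\int_C f$. For finite-dimensional representations $V,W$ and $s\in\mathbb C$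 with $(s+\sigma(V))\cap\sigma(W)=\emptyset$, set on $V\otimes W$ $$\Delta_s(\xi_{i,r})=\tau_s(\xi_{i,r})\otimes1+\hbar\sum_{p+q=r-1}\tau_s(\xi_{i,p})\otimes\xi_{i,q}+1\otimes\xi_{i,r},$$ $$\Delta_s(x^+_{i,r})=\tau_s(x^+_{i,r})\otimes1+\hbar^{-1}\oint_{C_2}\xi_i(v-s)\otimes x_i^+(v)\,v^r\,dv,$$ $$\Delta_s(x^-_{i,r})=\hbar^{-1}\oint_{C_1}x_i^-(v-s)\otimes\xi_i(v)\,v^r\,dv+1\otimes x^-_{i,r},$$ where $C_2$ is any Jordan curve enclosing $\sigma(W)$ and none of the points of $s+\sigma(V)$, and $C_1$ is any Jordan curve enclosing $s+\sigma(V)$ and none of the points of $\sigma(W)$. Theorem. Let $V,W,V_1,V_2,V_3$ be finite-dimensional representations of $Y_\hbar(\mathfrak g)$. (i) If $(s+\sigma(V))\cap\sigma(W)=\emptyset$, these formulae (which do not depend on the choice of $C_1,C_2$) define a unique action of $Y_\hbar(\mathfrak g)$ on $V\otimes W$; the resulting representation is denoted $V\otimes^D_sW$. On it $\xi_i(u)=\xi_i(u-s)\otimes\xi_i(u)$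 for $u\notin(s+\sigma(V))\cup\sigma(W)$; $x_i^+(u)=x_i^+(u-s)\otimes1+\oint_{C_2}\frac1{u-v}\xi_i(v-s)\otimes x_i^+(v)\,dv$ for $u$ outside $C_2$ and not in $s+\sigma(V)$; and $x_i^-(u)=\oint_{C_1}\frac1{u-v}x_i^-(v-s)\otimes\xi_i(v)\,dv+1\otimes x_i^-(u)$ for $u$ outside $C_1$ and not in $\sigma(W)$. (ii) The action of every element of $Y_\hbar(\mathfrak g)$ on $V\otimes^D_sW$ is a rational function of $s$, with poles contained in $\sigma(W)-\sigma(V)$. (iii) Whenever both sides are defined, the identification of vector spaces $(V_1\otimes^D_{s_1}V_2)\otimes^D_{s_2}V_3=V_1\otimes^D_{s_1+s_2}(V_2\otimes^D_{s_2}V_3)$ intertwines the action of $Y_\hbar(\mathfrak g)$. (iv) If $\mathbb C$ is the trivial representation (all generators act by $0$), then for every $s\in\mathbb C$ both products below are defined and $\mathbb C\otimes^D_sW=W$, $W\otimes^D_s\mathbb C=W(s)$. (v) For all $s,s'\in\mathbb C$, $V\otimes^D_{s+s'}W=V(s)\otimes^D_{s'}W$ and $V(s')\otimes^D_sW(s')=(V\otimes^D_sW)(s')$,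 one side being defined if and only if the other is. (vi) Whenever $V\otimes^D_sW$ is defined, $\sigma(V\otimes^D_sW)\subseteq(s+\sigma(V))\cup\sigma(W)$. -/

import Mathlib

open scoped TensorProduct Polynomial PowerSeries Pointwise

noncomputable section

set_option linter.unusedSimpArgs false

namespace DrinfeldYangian

/-! ### The Yangian -/

/-- The loop generators: `xi i r` is `ξ_{i,r}`, and `x 1 i r`, `x (-1) i r` are
`x⁺_{i,r}`, `x⁻_{i,r}`. -/
inductive Gen (I : Type*)
  | xi (i : I) (r : ℕ)
  | x (e : ℤˣ) (i : I) (r : ℕ)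

section Yangian

variable {I : Type*}

/-- `ξ_{i,r}` in the free algebra. -/
abbrev fxi (i : I) (r : ℕ) : FreeAlgebra ℂ (Gen I) := FreeAlgebra.ι ℂ (Gen.xi i r)

/-- `x^±_{i,r}` in the free algebra. -/
abbrev fx (e : ℤˣ) (i : I) (r : ℕ) : FreeAlgebra ℂ (Gen I) := FreeAlgebra.ι ℂ (Gen.x e i r)

/-- The commutator `[a, b]`. -/
abbrev comm {B : Type*} [Ring B] (a b : B) : B := a * b - b * a

/-- The operator `ad a = [a, ·]`, linear in `a`. -/
def adL (B : Type*) [Ring B] [Algebra ℂ B] : B →ₗ[ℂ] Module.End ℂ B :=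
  LinearMap.mul ℂ B - (LinearMap.mul ℂ B).flip

theorem adL_apply {B : Type*} [Ring B] [Algebra ℂ B] (a b : B) : adL B a b = comm a b := rfl

/-- The iterated commutator `[a₁,[a₂,…,[a_m,b]…]]`, i.e. `ad a₁ (ad a₂ (… (ad a_m b)))`. -/
def nestedComm {B : Type*} [Ring B] [Algebra ℂ B] {m : ℕ} (a : Fin m → B) (b : B) : B :=
  (List.ofFn fun p => adL B (a p)).prod b

/-- The scalar `e = ±1` as a complex number. -/
abbrev sgn (e : ℤˣ) : ℂ := ((e : ℤ) : ℂ)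

/-- Defining relations of the Yangian with Cartan matrix `A`, symmetrising
numbers `d` and parameter `h`. -/
inductive Rel (A : Matrix I I ℤ) (d : I → ℂ) (h : ℂ) :
    FreeAlgebra ℂ (Gen I) → FreeAlgebra ℂ (Gen I) → Prop
  | y1 (i j : I) (r s : ℕ) : Rel A d h (comm (fxi i r) (fxi j s)) 0
  | y2 (e : ℤˣ) (i j : I) (s : ℕ) :
      Rel A d h (comm (fxi i 0) (fx e j s)) ((sgn e * (d i * A i j)) • fx e j s)
  | y3 (e : ℤˣ) (i j : I) (r s : ℕ) :
      Rel A d h ((comm (fxi i (r + 1)) (fx e j s)) - (comm (fxi i r) (fx e j (s + 1))))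
        ((sgn e * (h * (d i * A i j) / 2)) • (fxi i r * fx e j s + fx e j s * fxi i r))
  | y4 (e : ℤˣ) (i j : I) (r s : ℕ) :
      Rel A d h ((comm (fx e i (r + 1)) (fx e j s)) - (comm (fx e i r) (fx e j (s + 1))))
        ((sgn e * (h * (d i * A i j) / 2)) • (fx e i r * fx e j s + fx e j s * fx e i r))
  | y5_same (i : I) (r s : ℕ) : Rel A d h (comm (fx 1 i r) (fx (-1) i s)) (fxi i (r + s))
  | y5_ne (i j : I) (r s : ℕ) : i ≠ j → Rel A d h (comm (fx 1 i r) (fx (-1) j s)) 0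
  | y6 (e : ℤˣ) (i j : I) (m : ℕ) (r : Fin m → ℕ) (s : ℕ) :
      i ≠ j → (m : ℤ) = 1 - A i j →
      Rel A d h (∑ p : Equiv.Perm (Fin m), nestedComm (fun k => fx e i (r (p k))) (fx e j s)) 0

/-- The Yangian, as a unital associative `ℂ`-algebra by generators and relations. -/
abbrev Yangian (A : Matrix I I ℤ) (d : I → ℂ) (h : ℂ) : Type _ := RingQuot (Rel A d h)

variable (A : Matrix I I ℤ) (d : I → ℂ) (h : ℂ)

/-- The class of a generator in the Yangian. -/
def yg (g : Gen I) : Yangian A d h := RingQuot.mkAlgHom ℂ (Rel A d h) (FreeAlgebra.ι ℂ g)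

/-- The generator `ξ_{i,r}` of the Yangian. -/
abbrev yxi (i : I) (r : ℕ) : Yangian A d h := yg A d h (Gen.xi i r)

/-- The generator `x^±_{i,r}` of the Yangian. -/
abbrev yx (e : ℤˣ) (i : I) (r : ℕ) : Yangian A d h := yg A d h (Gen.x e i r)

/-- A representation of the Yangian on `V`. -/
abbrev Rep (V : Type*) [AddCommGroup V] [Module ℂ V] : Type _ :=
  Yangian A d h →ₐ[ℂ] Module.End ℂ V

theorem map_nestedComm {B C : Type*} [Ring B] [Algebra ℂ B] [Ring C] [Algebra ℂ C]
    (f : B →ₐ[ℂ] C) {m : ℕ} (a : Fin m → B) (b : B) :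
    f (nestedComm a b) = nestedComm (fun k => f (a k)) (f b) := by
  unfold nestedComm
  induction m with
  | zero => simp
  | succ m ih =>
    simp only [List.ofFn_succ, List.prod_cons, Module.End.mul_apply, adL_apply]
    rw [← ih (fun k => a k.succ)]
    simp

/-! ### The trivial representation -/

/-- The counit: all generators are sent to zero. -/
def counit : Yangian A d h →ₐ[ℂ] ℂ :=
  RingQuot.liftAlgHom ℂ ⟨FreeAlgebra.lift ℂ (fun _ : Gen I => (0 : ℂ)), by
    intro p q hpq
    cases hpq with
    | y6 e i j m r s hij hm =>
      simp only [map_sum, map_nestedComm, FreeAlgebra.lift_ι_apply]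
      simp [nestedComm]
    | _ => simp⟩

/-- The trivial representation of the Yangian on `ℂ`. -/
def trivialRep : Rep A d h ℂ := (Algebra.ofId ℂ (Module.End ℂ ℂ)).comp (counit A d h)

/-! ### The shift automorphism -/

variable {A d h} in
theorem rel_eq {p q : FreeAlgebra ℂ (Gen I)} (H : Rel A d h p q) :
    RingQuot.mkAlgHom ℂ (Rel A d h) p = RingQuot.mkAlgHom ℂ (Rel A d h) q :=
  RingQuot.mkAlgHom_rel ℂ H

/-- The binomial shift `y_r ↦ ∑_{k ≤ r} (r choose k) a^{r-k} y_k` of a sequence. -/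
def shiftSeq {B : Type*} [AddCommGroup B] [Module ℂ B] (a : ℂ) (y : ℕ → B) (r : ℕ) : B :=
  ∑ k ∈ Finset.range (r + 1), ((r.choose k : ℂ) * a ^ (r - k)) • y k

/-- Value of `τ_a` on the generators. -/
def shiftGen (a : ℂ) : Gen I → Yangian A d h
  | .xi i r => shiftSeq a (yxi A d h i) r
  | .x e i r => shiftSeq a (yx A d h e i) r

/-- Linear extension of a sequence: `X ^ r ↦ y r`. -/
def modeMap {B : Type*} [AddCommGroup B] [Module ℂ B] (y : ℕ → B) : ℂ[X] →ₗ[ℂ] B :=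
  (Polynomial.basisMonomials ℂ).constr ℂ y

theorem modeMap_X_pow {B : Type*} [AddCommGroup B] [Module ℂ B] (y : ℕ → B) (r : ℕ) :
    modeMap y (Polynomial.X ^ r) = y r := by
  have := (Polynomial.basisMonomials ℂ).constr_basis ℂ y r
  simpa [modeMap, Polynomial.monomial_one_right_eq_X_pow] using this

theorem shiftSeq_eq {B : Type*} [AddCommGroup B] [Module ℂ B] (a : ℂ) (y : ℕ → B) (r : ℕ) :
    shiftSeq a y r = modeMap y ((Polynomial.X + Polynomial.C a) ^ r) := by
  rw [add_pow, map_sum, shiftSeq]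
  refine Finset.sum_congr rfl fun k _ => ?_
  rw [← modeMap_X_pow y k, ← map_smul]
  congr 1
  rw [Polynomial.smul_eq_C_mul]
  simp
  ring

theorem poly_ext {B : Type*} [AddCommGroup B] [Module ℂ B] {f g : ℂ[X] →ₗ[ℂ] B}
    (H : ∀ r, f (Polynomial.X ^ r) = g (Polynomial.X ^ r)) : f = g :=
  (Polynomial.basisMonomials ℂ).ext fun r => by
    simpa [Polynomial.monomial_one_right_eq_X_pow] using H r

theorem poly_ext₂ {B : Type*} [AddCommGroup B] [Module ℂ B] {f g : ℂ[X] →ₗ[ℂ] ℂ[X] →ₗ[ℂ] B}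
    (H : ∀ r s, f (Polynomial.X ^ r) (Polynomial.X ^ s) = g (Polynomial.X ^ r) (Polynomial.X ^ s)) :
    f = g :=
  poly_ext fun r => poly_ext fun s => H r s

theorem shiftSeq_zero {B : Type*} [AddCommGroup B] [Module ℂ B] (a : ℂ) (y : ℕ → B) :
    shiftSeq a y 0 = y 0 := by simp [shiftSeq]

section Relations

variable {B : Type*} [Ring B] [Algebra ℂ B]

theorem shift_product {y z w : ℕ → B} (H : ∀ r s, comm (y r) (z s) = w (r + s)) (a : ℂ)
    (r s : ℕ) : comm (shiftSeq a y r) (shiftSeq a z s) = shiftSeq a w (r + s) := by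
  have key : (adL B).compl₁₂ (modeMap y) (modeMap z) =
      (LinearMap.mul ℂ ℂ[X]).compr₂ (modeMap w) := by
    refine poly_ext₂ fun r s => ?_
    simp only [LinearMap.compl₁₂_apply, LinearMap.compr₂_apply, LinearMap.mul_apply', ← pow_add,
      modeMap_X_pow, adL_apply, H]
  have := LinearMap.congr_fun (LinearMap.congr_fun key ((Polynomial.X + Polynomial.C a) ^ r))
    ((Polynomial.X + Polynomial.C a) ^ s)
  simpa only [LinearMap.compl₁₂_apply, LinearMap.compr₂_apply, LinearMap.mul_apply', ← pow_add,
    adL_apply, ← shiftSeq_eq] using this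

theorem shift_weight {b : B} {z : ℕ → B} {c : ℂ} (H : ∀ s, comm b (z s) = c • z s) (a : ℂ)
    (s : ℕ) : comm b (shiftSeq a z s) = c • shiftSeq a z s := by
  have key : (adL B b).comp (modeMap z) = c • modeMap z := by
    refine poly_ext fun s => ?_
    simp only [LinearMap.comp_apply, LinearMap.smul_apply, modeMap_X_pow, adL_apply, H]
  have := LinearMap.congr_fun key ((Polynomial.X + Polynomial.C a) ^ s)
  simpa only [LinearMap.comp_apply, LinearMap.smul_apply, adL_apply, ← shiftSeq_eq] using this

theorem shift_quadratic {y z : ℕ → B} {c : ℂ}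
    (H : ∀ r s, comm (y (r + 1)) (z s) - comm (y r) (z (s + 1)) = c • (y r * z s + z s * y r))
    (a : ℂ) (r s : ℕ) :
    comm (shiftSeq a y (r + 1)) (shiftSeq a z s) - comm (shiftSeq a y r) (shiftSeq a z (s + 1)) =
      c • (shiftSeq a y r * shiftSeq a z s + shiftSeq a z s * shiftSeq a y r) := by
  have key : (adL B).compl₁₂ ((modeMap y).comp (LinearMap.mulLeft ℂ Polynomial.X)) (modeMap z) -
      (adL B).compl₁₂ (modeMap y) ((modeMap z).comp (LinearMap.mulLeft ℂ Polynomial.X)) =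
      c • ((LinearMap.mul ℂ B) + (LinearMap.mul ℂ B).flip).compl₁₂ (modeMap y) (modeMap z) := by
    refine poly_ext₂ fun r s => ?_
    simp only [LinearMap.compl₁₂_apply, LinearMap.sub_apply, LinearMap.smul_apply,
      LinearMap.comp_apply, LinearMap.mulLeft_apply, ← pow_succ', modeMap_X_pow, adL_apply, H,
      LinearMap.add_apply, LinearMap.flip_apply, LinearMap.mul_apply']
  have := LinearMap.congr_fun (LinearMap.congr_fun key ((Polynomial.X + Polynomial.C a) ^ r))
    ((Polynomial.X + Polynomial.C a) ^ s)
  simp only [LinearMap.compl₁₂_apply, LinearMap.sub_apply, LinearMap.smul_apply,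
      LinearMap.comp_apply, LinearMap.mulLeft_apply, adL_apply,
      LinearMap.add_apply, LinearMap.flip_apply, LinearMap.mul_apply'] at this
  have e (t : ℕ → B) (n : ℕ) : shiftSeq a t (n + 1) =
      modeMap t (Polynomial.X * (Polynomial.X + Polynomial.C a) ^ n) + a • shiftSeq a t n := by
    rw [shiftSeq_eq, shiftSeq_eq, ← map_smul, ← map_add]
    congr 1
    rw [Polynomial.smul_eq_C_mul]
    ring
  simp only [e]
  simp only [shiftSeq_eq]
  rw [← this]
  simp only [comm, mul_add, add_mul, smul_mul_assoc, mul_smul_comm]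
  abel

theorem shift_serre {m : ℕ} {y z : ℕ → B}
    (H : ∀ (r : Fin m → ℕ) (s : ℕ),
      ∑ p : Equiv.Perm (Fin m), nestedComm (fun k => y (r (p k))) (z s) = 0)
    (a : ℂ) (r : Fin m → ℕ) (s : ℕ) :
    ∑ p : Equiv.Perm (Fin m), nestedComm (fun k => shiftSeq a y (r (p k))) (shiftSeq a z s) = 0 := by
  let F (b : B) : MultilinearMap ℂ (fun _ : Fin m => ℂ[X]) B :=
    ((LinearMap.applyₗ b).compMultilinearMap
      (MultilinearMap.mkPiAlgebraFin ℂ m (Module.End ℂ B))).compLinearMap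
      (fun _ => (adL B).comp (modeMap y))
  have hF (b : B) (f : Fin m → ℂ[X]) : F b f = nestedComm (fun k => modeMap y (f k)) b := rfl
  have h1 (s : ℕ) : ∑ p : Equiv.Perm (Fin m), (F (z s)).domDomCongr p = 0 := by
    refine Module.Basis.ext_multilinear (fun _ => Polynomial.basisMonomials ℂ) fun v => ?_
    simp only [_root_.sum_apply, MultilinearMap.domDomCongr_apply, hF,
      Polynomial.coe_basisMonomials, Polynomial.monomial_one_right_eq_X_pow, modeMap_X_pow, H,
      _root_.zero_apply]
  have h2 (f : Fin m → ℂ[X]) (s : ℕ) :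
      ∑ p : Equiv.Perm (Fin m), nestedComm (fun k => modeMap y (f (p k))) (z s) = 0 := by
    have := congrArg (fun G => G f) (h1 s)
    simpa only [_root_.sum_apply, MultilinearMap.domDomCongr_apply, hF,
      _root_.zero_apply] using this
  simp only [shiftSeq_eq a y]
  have h3 (b c : B) (t : ℂ) (v : Fin m → B) :
      nestedComm v (b + t • c) = nestedComm v b + t • nestedComm v c := by
    simp [nestedComm]
  let G : B →ₗ[ℂ] B :=
    ∑ p : Equiv.Perm (Fin m), (List.ofFn fun k => adL B
      (modeMap y ((Polynomial.X + Polynomial.C a) ^ r (p k)))).prod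
  have hG (b : B) : G b = ∑ p : Equiv.Perm (Fin m), nestedComm
      (fun k => modeMap y ((Polynomial.X + Polynomial.C a) ^ r (p k))) b := by
    simp only [G, LinearMap.sum_apply]
    rfl
  rw [← hG, shiftSeq, map_sum]
  refine Finset.sum_eq_zero fun k _ => ?_
  rw [map_smul, hG, h2 (fun k => (Polynomial.X + Polynomial.C a) ^ r k) k, smul_zero]

end Relations

/-- The shift automorphism `τ_a` (as an endomorphism; its inverse is `τ_{-a}`):
`τ_a(y_r) = ∑_{k ≤ r} (r choose k) a^{r-k} y_k` for `y = ξ_i, x_i^±`. -/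
def tau (a : ℂ) : Yangian A d h →ₐ[ℂ] Yangian A d h :=
  RingQuot.liftAlgHom ℂ ⟨FreeAlgebra.lift ℂ (shiftGen A d h a), by
    intro p q hpq
    cases hpq with
    | y1 i j r s =>
      simp only [map_sub, map_mul, FreeAlgebra.lift_ι_apply, map_zero, shiftGen]
      have := shift_product (y := yxi A d h i) (z := yxi A d h j) (w := fun _ => 0)
        (fun r s => by
          have := rel_eq (Rel.y1 (A := A) (d := d) (h := h) i j r s)
          simp only [map_sub, map_mul, map_add, map_smul, map_zero, map_sum, map_nestedComm] at this
          exact this) a r s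
      simpa [shiftSeq] using this
    | y2 e i j s =>
      simp only [map_sub, map_mul, map_smul, FreeAlgebra.lift_ι_apply, shiftGen, shiftSeq_zero]
      exact shift_weight
        (fun s => by
          have := rel_eq (Rel.y2 (A := A) (d := d) (h := h) e i j s)
          simp only [map_sub, map_mul, map_add, map_smul, map_zero, map_sum, map_nestedComm] at this
          exact this) a s
    | y3 e i j r s =>
      simp only [map_sub, map_mul, map_add, map_smul, FreeAlgebra.lift_ι_apply, shiftGen]
      exact shift_quadratic
        (fun r s => by
          have := rel_eq (Rel.y3 (A := A) (d := d) (h := h) e i j r s)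
          simp only [map_sub, map_mul, map_add, map_smul, map_zero, map_sum, map_nestedComm] at this
          exact this)
        a r s
    | y4 e i j r s =>
      simp only [map_sub, map_mul, map_add, map_smul, FreeAlgebra.lift_ι_apply, shiftGen]
      exact shift_quadratic
        (fun r s => by
          have := rel_eq (Rel.y4 (A := A) (d := d) (h := h) e i j r s)
          simp only [map_sub, map_mul, map_add, map_smul, map_zero, map_sum, map_nestedComm] at this
          exact this)
        a r s
    | y5_same i r s =>
      simp only [map_sub, map_mul, FreeAlgebra.lift_ι_apply, shiftGen]
      exact shift_product
        (fun r s => by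
          have := rel_eq (Rel.y5_same (A := A) (d := d) (h := h) i r s)
          simp only [map_sub, map_mul, map_add, map_smul, map_zero, map_sum, map_nestedComm] at this
          exact this)
        a r s
    | y5_ne i j r s hij =>
      simp only [map_sub, map_mul, FreeAlgebra.lift_ι_apply, map_zero, shiftGen]
      have := shift_product (y := yx A d h 1 i) (z := yx A d h (-1) j) (w := fun _ => 0)
        (fun r s => by
          have := rel_eq (Rel.y5_ne (A := A) (d := d) (h := h) i j r s hij)
          simp only [map_sub, map_mul, map_add, map_smul, map_zero, map_sum, map_nestedComm] at this
          exact this) a r s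
      simpa [shiftSeq] using this
    | y6 e i j m r s hij hm =>
      simp only [map_sum, map_nestedComm, FreeAlgebra.lift_ι_apply, map_zero, shiftGen]
      exact shift_serre (fun r s => by
          have := rel_eq (Rel.y6 (A := A) (d := d) (h := h) e i j m r s hij hm)
          simp only [map_sub, map_mul, map_add, map_smul, map_zero, map_sum, map_nestedComm] at this
          exact this) a r s⟩

/-- The shifted representation `V(a) = τ_a^* V`. -/
def Rep.shift {A : Matrix I I ℤ} {d : I → ℂ} {h : ℂ} {V : Type*} [AddCommGroup V] [Module ℂ V]
    (ρ : Rep A d h V) (a : ℂ) : Rep A d h V := ρ.comp (tau A d h a)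

/-- Transport of a representation along a linear isomorphism. -/
def Rep.transport {A : Matrix I I ℤ} {d : I → ℂ} {h : ℂ} {V W : Type*}
    [AddCommGroup V] [Module ℂ V] [AddCommGroup W] [Module ℂ W]
    (e : V ≃ₗ[ℂ] W) (ρ : Rep A d h V) : Rep A d h W :=
  (e.conjAlgEquiv ℂ).toAlgHom.comp ρ

end Yangian

/-! ### Rational functions given by their expansion at infinity

A power series `φ` in `X = u⁻¹` with coefficients in `E` is the expansion at `u = ∞` of a rational
function iff `D(u) φ` is a polynomial in `u` for some non-zero scalar polynomial `D`. -/

section Rational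

variable {E : Type*} [Ring E] [Algebra ℂ E]

/-- The product `D(u) φ` has no negative powers of `u`. -/
def Clears (φ : E⟦X⟧) (D : ℂ[X]) : Prop :=
  ∀ n : ℕ, ∑ k ∈ Finset.range (D.natDegree + 1), D.coeff k • PowerSeries.coeff (n + 1 + k) φ = 0

/-- The non-negative powers of `u` in `D(u) φ`, evaluated at `u`. -/
def clearedValue (φ : E⟦X⟧) (D : ℂ[X]) (u : ℂ) : E :=
  ∑ k ∈ Finset.range (D.natDegree + 1), ∑ j ∈ Finset.range (k + 1),
    (D.coeff k * u ^ j) • PowerSeries.coeff (k - j) φ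

/-- `u` is not a pole of the rational function with expansion `φ` at infinity. -/
def RegularAt (φ : E⟦X⟧) (u : ℂ) : Prop := ∃ D : ℂ[X], Clears φ D ∧ D.eval u ≠ 0

/-- The set of (finite) poles of the rational function with expansion `φ` at infinity. -/
def poles (φ : E⟦X⟧) : Set ℂ := {u | ¬ RegularAt φ u}

open Classical in
/-- The value at `u` of the rational function with expansion `φ` at infinity (and `0` at a pole).
The value `D(u)⁻¹ • (D φ)(u)` does not depend on the choice of the denominator `D`. -/
def ratValue (φ : E⟦X⟧) (u : ℂ) : E :=
  if H : RegularAt φ u then (H.choose.eval u)⁻¹ • clearedValue φ H.choose u else 0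

end Rational

/-! ### Generating functions on a finite-dimensional representation -/

section Fields

variable {I : Type*} {A : Matrix I I ℤ} {d : I → ℂ} {h : ℂ}
variable {V : Type*} [AddCommGroup V] [Module ℂ V] (ρ : Rep A d h V)

/-- The series `ξ_i(u) = 1 + ħ ∑_r ξ_{i,r} u^{-r-1}`, in the variable `u⁻¹`. -/
def xiSeries (i : I) : (Module.End ℂ V)⟦X⟧ :=
  PowerSeries.mk fun n => match n with
    | 0 => 1
    | r + 1 => h • ρ (yxi A d h i r)

/-- The inverse series `ξ_i(u)⁻¹`. -/
def xiInvSeries (i : I) : (Module.End ℂ V)⟦X⟧ := PowerSeries.invOfUnit (xiSeries ρ i) 1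

/-- The series `x_i^±(u) = ħ ∑_r x_{i,r}^± u^{-r-1}`, in the variable `u⁻¹`. -/
def xSeries (e : ℤˣ) (i : I) : (Module.End ℂ V)⟦X⟧ :=
  PowerSeries.mk fun n => match n with
    | 0 => 0
    | r + 1 => h • ρ (yx A d h e i r)

/-- The rational function `ξ_i(u)`. -/
def xiFun (i : I) (u : ℂ) : Module.End ℂ V := ratValue (xiSeries ρ i) u

/-- The rational function `x_i^±(u)`. -/
def xFun (e : ℤˣ) (i : I) (u : ℂ) : Module.End ℂ V := ratValue (xSeries ρ e i) u

/-- `σ(V)`: the poles of the rational functions `ξ_i(u)^{±1}`, `x_i^±(u)`. -/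
def sigma : Set ℂ :=
  ⋃ i : I, poles (xiSeries ρ i) ∪ poles (xiInvSeries ρ i) ∪
    (poles (xSeries ρ 1 i) ∪ poles (xSeries ρ (-1) i))

end Fields

/-! ### Contour integrals -/

section Contours

/-- `(2πi)⁻¹ ∫_γ f(v) dv` for a path `γ` parametrised by `[0, 1]`. -/
def pathIntegral (γ : ℝ → ℂ) (f : ℂ → ℂ) : ℂ :=
  (2 * (Real.pi : ℂ) * Complex.I)⁻¹ * ∫ t in (0 : ℝ)..1, f (γ t) * deriv γ t

/-- The winding number of a closed path around `z`. -/
def winding (γ : ℝ → ℂ) (z : ℂ) : ℂ := pathIntegral γ fun v => (v - z)⁻¹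

/-- A simple closed, piecewise `C¹`, counterclockwise curve: the winding number takes the
values `0` (outside) and `1` (in the inner domain). -/
structure SimpleClosedCurve where
  path : ℝ → ℂ
  continuousOn : ContinuousOn path (Set.Icc 0 1)
  closed : path 0 = path 1
  simple : Set.InjOn path (Set.Ico 0 1)
  corners : Finset ℝ
  smooth : ∀ t ∈ Set.Ioo (0 : ℝ) 1, t ∉ corners → ContDiffAt ℝ 1 path t
  rectifiable : IntervalIntegrable (deriv path) MeasureTheory.volume 0 1
  positive : ∀ z, z ∉ path '' Set.Icc 0 1 → winding path z = 0 ∨ winding path z = 1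

/-- The image of the curve. -/
def SimpleClosedCurve.trace (c : SimpleClosedCurve) : Set ℂ := c.path '' Set.Icc 0 1

/-- The inner domain of the curve. -/
def SimpleClosedCurve.inner (c : SimpleClosedCurve) : Set ℂ :=
  {z | z ∉ c.trace ∧ winding c.path z = 1}

/-- A Jordan curve: a finite disjoint union of simple closed curves with pairwise disjoint inner
domains. -/
structure JordanCurve where
  num : ℕ
  curve : Fin num → SimpleClosedCurve
  disjoint_trace : Pairwise fun k l => Disjoint (curve k).trace (curve l).trace
  disjoint_inner : Pairwise fun k l => Disjoint (curve k).inner (curve l).inner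

namespace JordanCurve

variable (C : JordanCurve)

/-- The points enclosed by the Jordan curve. -/
def inside : Set ℂ := ⋃ k, (C.curve k).inner

/-- The points neither on the Jordan curve nor enclosed by it. -/
def outside : Set ℂ := {z | ∀ k, z ∉ (C.curve k).trace ∧ z ∉ (C.curve k).inner}

/-- `∮_C f`, normalised by `(2πi)⁻¹`. -/
def integral (f : ℂ → ℂ) : ℂ := ∑ k, pathIntegral (C.curve k).path f

/-- `∮_C F` for a function with values in a finite-dimensional space, computed on coordinates. -/
def vecIntegral {E : Type*} [AddCommGroup E] [Module ℂ E] [FiniteDimensional ℂ E]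
    (F : ℂ → E) : E :=
  ∑ k, C.integral (fun v => (Module.finBasis ℂ E).repr (F v) k) • Module.finBasis ℂ E k

end JordanCurve

end Contours

/-! ### The deformed Drinfeld tensor product -/

section Tensor

variable {I : Type*} {A : Matrix I I ℤ} {d : I → ℂ} {h : ℂ}
variable {V W : Type*} [AddCommGroup V] [Module ℂ V] [FiniteDimensional ℂ V]
  [AddCommGroup W] [Module ℂ W] [FiniteDimensional ℂ W]

/-- The operator `f ⊗ g` on `V ⊗ W`. -/
abbrev opTensor (f : Module.End ℂ V) (g : Module.End ℂ W) : Module.End ℂ (V ⊗[ℂ] W) :=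
  TensorProduct.map f g

/-- `V ⊗_s W` is defined when `s + σ(V)` and `σ(W)` are disjoint. -/
def Composable (s : ℂ) (ρV : Rep A d h V) (ρW : Rep A d h W) : Prop :=
  Disjoint (s +ᵥ sigma ρV) (sigma ρW)

/-- `V ⊗_s W` is defined, and `ρ` is the action of the Yangian on it: the loop generators act by
the formulae `Δ_s`, for every contour `C₂` enclosing `σ(W)` and no point of `s + σ(V)`, and every
contour `C₁` enclosing `s + σ(V)` and no point of `σ(W)`. -/
structure IsDrinfeldTensor (s : ℂ) (ρV : Rep A d h V) (ρW : Rep A d h W)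
    (ρ : Rep A d h (V ⊗[ℂ] W)) : Prop where
  composable : Composable s ρV ρW
  xi : ∀ (i : I) (r : ℕ), ρ (yxi A d h i r) =
    opTensor (ρV (tau A d h s (yxi A d h i r))) 1
      + h • ∑ p ∈ Finset.range r,
          opTensor (ρV (tau A d h s (yxi A d h i p))) (ρW (yxi A d h i (r - 1 - p)))
      + opTensor 1 (ρW (yxi A d h i r))
  x_plus : ∀ C₂ : JordanCurve, sigma ρW ⊆ C₂.inside → s +ᵥ sigma ρV ⊆ C₂.outside →
    ∀ (i : I) (r : ℕ), ρ (yx A d h 1 i r) =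
      opTensor (ρV (tau A d h s (yx A d h 1 i r))) 1
        + h⁻¹ • C₂.vecIntegral fun v =>
            v ^ r • opTensor (xiFun ρV i (v - s)) (xFun ρW 1 i v)
  x_minus : ∀ C₁ : JordanCurve, s +ᵥ sigma ρV ⊆ C₁.inside → sigma ρW ⊆ C₁.outside →
    ∀ (i : I) (r : ℕ), ρ (yx A d h (-1) i r) =
      (h⁻¹ • C₁.vecIntegral fun v =>
            v ^ r • opTensor (xFun ρV (-1) i (v - s)) (xiFun ρW i v))
        + opTensor 1 (ρW (yx A d h (-1) i r))

/-- The formulae `Δ_s` for the generating functions `ξ_i(u)`, `x_i^±(u)`, for `u` outside of the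
contours and away from the poles of the summands. -/
structure FieldFormulae (s : ℂ) (ρV : Rep A d h V) (ρW : Rep A d h W)
    (ρ : Rep A d h (V ⊗[ℂ] W)) : Prop where
  xi : ∀ (i : I) (u : ℂ), u ∉ s +ᵥ sigma ρV → u ∉ sigma ρW →
    xiFun ρ i u = opTensor (xiFun ρV i (u - s)) (xiFun ρW i u)
  x_plus : ∀ C₂ : JordanCurve, sigma ρW ⊆ C₂.inside → s +ᵥ sigma ρV ⊆ C₂.outside →
    ∀ (i : I) (u : ℂ), u ∈ C₂.outside → u ∉ s +ᵥ sigma ρV →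
      xFun ρ 1 i u = opTensor (xFun ρV 1 i (u - s)) 1
        + C₂.vecIntegral fun v => (u - v)⁻¹ • opTensor (xiFun ρV i (v - s)) (xFun ρW 1 i v)
  x_minus : ∀ C₁ : JordanCurve, s +ᵥ sigma ρV ⊆ C₁.inside → sigma ρW ⊆ C₁.outside →
    ∀ (i : I) (u : ℂ), u ∈ C₁.outside → u ∉ sigma ρW →
      xFun ρ (-1) i u =
        (C₁.vecIntegral fun v => (u - v)⁻¹ • opTensor (xFun ρV (-1) i (v - s)) (xiFun ρW i v))
        + opTensor 1 (xFun ρW (-1) i u)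

end Tensor

/-! ### Cartan data of a complex semisimple Lie algebra -/

section Cartan

variable {L : Type*} [LieRing L] [LieAlgebra ℂ L] [FiniteDimensional ℂ L]
  [LieAlgebra.IsSemisimple ℂ L]
variable (H : LieSubalgebra ℂ L) [H.IsCartanSubalgebra]

/-- The squared length of a root for the invariant form `(α, α) = ∑_β ⟨α, β^∨⟩²`, the sum being
over all roots. -/
def canonicalSqLength (α : H.root) : ℕ :=
  ∑ β : H.root, ((LieAlgebra.IsKilling.rootSystem H).pairingIn ℤ α β).natAbs ^ 2

/-- `α` and `β` are roots of the same simple ideal: they are joined by a chain of successively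
non-orthogonal roots. -/
def SameComponent (α β : H.root) : Prop :=
  Relation.ReflTransGen
    (fun γ δ : H.root => (LieAlgebra.IsKilling.rootSystem H).pairing γ δ ≠ 0) α β

/-- The least (canonical) squared length of a root of the same simple ideal as `α`. -/
def shortSqLength (α : H.root) : ℕ :=
  sInf {n | ∃ β, SameComponent H α β ∧ n = canonicalSqLength H β}

variable {H}
variable (b : (LieAlgebra.IsKilling.rootSystem H).Base)

/-- The Cartan matrix `a_ij = 2 (α_i, α_j) / (α_i, α_i) = ⟨α_j, α_i^∨⟩`. -/
def cartan : Matrix b.support b.support ℤ :=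
  Matrix.of fun i j => (LieAlgebra.IsKilling.rootSystem H).pairingIn ℤ j i

/-- `d_i = (α_i, α_i) / 2`, for the invariant form such that the short roots of every simple ideal
have squared length `2`. -/
def symmetriser (i : b.support) : ℂ := (canonicalSqLength H i : ℂ) / (shortSqLength H i : ℂ)

end Cartan

end DrinfeldYangian

/-!
On a finite-dimensional representation the generating series `ξ_i(u)^{±1}`, `x_i^±(u)` are rational:
up to a factor, the commutator with `ξ_{i,1} - (h/2) ξ_{i,0}²` maps each mode of `x_i^±` to the next
one, and its minimal polynomial yields a denominator. Accordingly, a series `∑ y_r u^{-r-1}` is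
treated as the functional `X^r ↦ y_r` on `ℂ[X]`; it is rational if a nonzero scalar polynomial kills
the functional.

**Contour integrals as twists.** For rational functions `φ`, `y` without common poles, let the twist
of `y` by `φ` be the part of `φ(u) y(u)` that has the poles of `y` (`IsTwist`). If `φ = P / D`,
where `q` is a denominator of `y` and `α D ≡ 1` modulo `q`, the twist is the polynomial `α P` acting
on the functional of `y` (`isTwist_iff`). By residue calculus the twist is also the integral of
`φ(v) y(v)` over a contour that separates the poles of `y` from those of `φ`
(`isTwist_iff_vecIntegral`). Calculating residues for disjoint unions of curves requires that a
point enclosed by one component does not lie on another one; this follows from the jump of the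
winding number (`SimpleClosedCurve.exists_winding_jump`). Hence the contour formulae say that
`V ⊗ W` is the fusion of the commuting actions on `V(s)` and `W`:
the series `ξ_i(u)` is the product of
those of the factors, and `x_i^±(u)` is a sum of `x_i^±(u)` of one factor and a twisted `x_i^±(u)`
of the other (`isDrinfeldTensor_iff`). This contains the independence of the contours, the
uniqueness of the action, the location of its poles and the formulae for its generating functions.

**The relations.** The fused currents satisfy the relations of the Yangian for these reasons.
* The relation `ξ_i(u) (u - v - b) x_j(v) = (u - v + b) x_j(v) ξ_i(u)` passes to the numerator of
  `ξ_i`, which yields the relations of `ξ_i` with the fused `x_j`, and the mixed terms in the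
  relations between `x_i` and `x_j` of the same sign.
* The commutator of `x_i⁺(u)` with `x_j⁻(v)` contains, besides the terms with the two parts of
  `ξ_i(u)`, the commutator of two twisted currents. It is supported on `u - v + a = 0`
  (`twisted_comm`). It vanishes (`bilin_eq_zero`), for if `λ` is a root of the minimal annihilator
  of `x_j⁻` on the first factor, then `λ - a` is not a pole of `x_i⁺` on the second factor:
  otherwise, the poles of the two factors being disjoint, `ξ_i` would be regular and invertible at
  `λ - a` on the first factor, and its relation with `x_j⁻` would lower the order of the pole `λ`
  (`LinRel.exists_kills_isCoprime`).
* In finite dimension the Serre relations are consequences of the others (`QuadRel.serre`). The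
  lowest one is a statement on primitive vectors for the adjoint action of `sl₂`. The coefficients
  of the logarithmic derivative of `ξ_i(u)` act on the modes of `x_j(v)` as the multiplication by
  `(v + b)^n - (v - b)^n`, and these polynomials span `ℂ[v]`, so that all modes are reached.

**Consequences.** Twists are unique, hence fusion is associative as soon as the three sets of poles
are pairwise disjoint (`IsFusion.assoc`). For the outer factors this is not a hypothesis, but if
`V₂ ≠ 0`, a pole of `V₃` which is not a pole of `V₂` is a pole of `V₂ ⊗ V₃`
(`disjoint_outer_poles`).
The statements on the trivial representation and on shifts are immediate for fusions. Finally, a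
Bézout identity for `D(v - s)` and `q(v)` whose coefficients are polynomials in `s`, and whose
right-hand side vanishes only at the differences of the roots (`hasBezoutFamily`), makes the twist
by `αP` rational in `s`.
-/

set_option linter.unusedSectionVars false

namespace DrinfeldYangian

/-! ### Series at infinity and functionals on polynomials -/

section Series

variable {E : Type*} [Ring E] [Algebra ℂ E]

/-- A polynomial in `u` as a Laurent series in `u⁻¹`: the coefficient of index `n` is that of
`u^{-n}`. -/
def polL : E[X] →+* LaurentSeries E :=
  Polynomial.eval₂RingHom' HahnSeries.C (HahnSeries.single (-1) 1) fun a => by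
    simp only [commute_iff_eq, HahnSeries.C_apply, HahnSeries.single_mul_single]
    simp

/-- A scalar polynomial as a polynomial with coefficients in `E`. -/
def scalarPoly : ℂ[X] →+* E[X] := Polynomial.mapRingHom (algebraMap ℂ E)

theorem polL_monomial (k : ℕ) (c : E) :
    polL (Polynomial.monomial k c) = HahnSeries.single (-(k : ℤ)) c := by
  simp [polL, Polynomial.eval₂RingHom', HahnSeries.single_mul_single]

theorem polL_C (c : E) : polL (Polynomial.C c) = HahnSeries.C c := by
  simpa using polL_monomial 0 c

theorem coeff_polL_mul (Θ : E[X]) (φ : LaurentSeries E) (n : ℤ) :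
    (polL Θ * φ).coeff n = Θ.sum fun k c => c * φ.coeff (n + k) := by
  induction Θ using Polynomial.induction_on' with
  | add p q hp hq =>
    rw [map_add, add_mul, HahnSeries.coeff_add, hp, hq,
      Polynomial.sum_add_index _ _ _ (by simp) (by simp [add_mul])]
  | monomial k c =>
    rw [polL_monomial, HahnSeries.coeff_single_mul, Polynomial.sum_monomial_index _ _ (by simp)]
    simp

theorem coeff_polL_neg (Θ : E[X]) (k : ℕ) : (polL Θ).coeff (-(k : ℤ)) = Θ.coeff k := by
  induction Θ using Polynomial.induction_on' with
  | add p q hp hq => simp [hp, hq]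
  | monomial j c =>
    rw [polL_monomial, HahnSeries.coeff_single, Polynomial.coeff_monomial]
    simp [eq_comm]

theorem coeff_polL_pos (Θ : E[X]) (k : ℕ) : (polL Θ).coeff (k + 1) = 0 := by
  induction Θ using Polynomial.induction_on' with
  | add p q hp hq => simp [hp, hq]
  | monomial j c =>
    rw [polL_monomial, HahnSeries.coeff_single, if_neg (by omega)]

theorem polL_injective : Function.Injective (polL (E := E)) := by
  intro p q H
  ext k
  rw [← coeff_polL_neg, H, coeff_polL_neg]

/-- Scalar polynomials are central among the Laurent series. -/
theorem polL_scalar_comm (D : ℂ[X]) (φ : LaurentSeries E) :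
    Commute (polL (scalarPoly D)) φ := by
  induction D using Polynomial.induction_on' with
  | add p q hp hq => simpa using hp.add_left hq
  | monomial j c =>
    ext n
    simp only [scalarPoly, Polynomial.coe_mapRingHom, Polynomial.map_monomial, polL_monomial,
      HahnSeries.coeff_single_mul, HahnSeries.coeff_mul_single]
    exact Algebra.commutes _ _

theorem scalarPoly_comm (D : ℂ[X]) (Θ : E[X]) : Commute (scalarPoly D) Θ :=
  polL_injective (by rw [map_mul, map_mul]; exact polL_scalar_comm D (polL Θ))

/-- Functionals on polynomials with values in `E`; `Y` stands for the series
`∑ Y(X^r) u^{-r-1}`. -/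
abbrev Functional (E : Type*) [AddCommGroup E] [Module ℂ E] := ℂ[X] →ₗ[ℂ] E

/-- The functional `p ↦ Res (p φ)` of a Laurent series, where `Res` is the coefficient of `u⁻¹`. -/
def resF (φ : LaurentSeries E) : Functional E := modeMap fun r => φ.coeff (r + 1)

theorem modeMap_apply {B : Type*} [AddCommGroup B] [Module ℂ B] (y : ℕ → B) (p : ℂ[X]) :
    modeMap y p = p.sum fun k c => c • y k := by
  induction p using Polynomial.induction_on' with
  | add p q hp hq =>
    rw [map_add, hp, hq, Polynomial.sum_add_index _ _ _ (by simp) (by simp [add_smul])]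
  | monomial k c =>
    rw [Polynomial.sum_monomial_index _ _ (by simp), ← Polynomial.C_mul_X_pow_eq_monomial,
      ← Polynomial.smul_eq_C_mul, map_smul, modeMap_X_pow]

theorem resF_X_pow (φ : LaurentSeries E) (r : ℕ) :
    resF φ (Polynomial.X ^ r) = φ.coeff (r + 1) := modeMap_X_pow _ _

theorem resF_add (φ ψ : LaurentSeries E) : resF (φ + ψ) = resF φ + resF ψ :=
  poly_ext fun r => by simp [resF_X_pow]

theorem resF_polL (Θ : E[X]) : resF (polL Θ) = 0 :=
  poly_ext fun r => by simp [resF_X_pow, coeff_polL_pos]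

/-- Left multiplication of functionals by `E`. -/
def leftMul : E →+* Module.End ℂ (Functional E) where
  toFun e :=
    { toFun := fun Y => (LinearMap.mulLeft ℂ e).comp Y
      map_add' := fun Y Z => by ext; simp [mul_add]
      map_smul' := fun c Y => by ext; simp }
  map_one' := by ext; simp
  map_mul' a b := by ext; simp [mul_assoc]
  map_zero' := by ext; simp
  map_add' a b := by ext; simp [add_mul]

/-- Multiplication of functionals by `X`. -/
def shiftX : Module.End ℂ (Functional E) where
  toFun Y := Y.comp (LinearMap.mulLeft ℂ Polynomial.X)
  map_add' Y Z := by ext; simp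
  map_smul' c Y := by ext; simp

/-- The action of `E[X]` on functionals: `(Θ Y)(p) = ∑ Θ_k Y(X^k p)`. In terms of series, it is
the multiplication by `Θ(u)`, modulo polynomials in `u`. -/
def act : E[X] →+* Module.End ℂ (Functional E) :=
  Polynomial.eval₂RingHom' leftMul shiftX fun a => by
    ext; simp [leftMul, shiftX]

theorem act_monomial (k : ℕ) (c : E) (Y : Functional E) (p : ℂ[X]) :
    act (Polynomial.monomial k c) Y p = c * Y (Polynomial.X ^ k * p) := by
  have (n : ℕ) (Y : Functional E) (p : ℂ[X]) :
      (shiftX ^ n : Module.End ℂ (Functional E)) Y p = Y (Polynomial.X ^ n * p) := by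
    induction n generalizing Y with
    | zero => simp
    | succ n ih =>
      rw [pow_succ, Module.End.mul_apply, ih]
      simp [shiftX, pow_succ', mul_assoc]
  simp only [act, Polynomial.eval₂RingHom', RingHom.coe_mk, MonoidHom.coe_mk, OneHom.coe_mk,
    Polynomial.eval₂_monomial, Module.End.mul_apply]
  simp [leftMul, this]

theorem act_apply (Θ : E[X]) (Y : Functional E) (p : ℂ[X]) :
    act Θ Y p = Θ.sum fun k c => c * Y (Polynomial.X ^ k * p) := by
  induction Θ using Polynomial.induction_on' with
  | add P Q hp hq =>
    rw [map_add, LinearMap.add_apply, LinearMap.add_apply, hp, hq,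
      Polynomial.sum_add_index _ _ _ (by simp) (by simp [add_mul])]
  | monomial k c => rw [act_monomial, Polynomial.sum_monomial_index _ _ (by simp)]

theorem act_scalar (D : ℂ[X]) (Y : Functional E) (p : ℂ[X]) :
    act (scalarPoly D) Y p = Y (D * p) := by
  induction D using Polynomial.induction_on' with
  | add P Q hp hq => simp [hp, hq, add_mul]
  | monomial k c =>
    rw [scalarPoly, Polynomial.coe_mapRingHom, Polynomial.map_monomial, act_monomial,
      ← Polynomial.C_mul_X_pow_eq_monomial, mul_assoc, ← Polynomial.smul_eq_C_mul, map_smul,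
      Algebra.smul_def]

theorem act_mul_apply (Θ Θ' : E[X]) (Y : Functional E) : act (Θ * Θ') Y = act Θ (act Θ' Y) := by
  rw [map_mul]; rfl

theorem act_apply_mul (Θ : E[X]) (Y : Functional E) (D p : ℂ[X]) :
    act Θ Y (D * p) = act Θ (act (scalarPoly D) Y) p := by
  rw [← act_mul_apply, ← scalarPoly_comm, act_mul_apply, act_scalar]

theorem resF_polL_mul (Θ : E[X]) (φ : LaurentSeries E) : resF (polL Θ * φ) = act Θ (resF φ) := by
  refine poly_ext fun r => ?_
  rw [resF_X_pow, coeff_polL_mul, act_apply]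
  simp only [← pow_add, resF_X_pow]
  refine Finset.sum_congr rfl fun k _ => ?_
  simp only [Nat.cast_add]
  ring_nf

/-- The functional is killed by the multiplication by `D`. -/
def Kills (D : ℂ[X]) (Y : Functional E) : Prop := ∀ p, Y (D * p) = 0

theorem kills_iff (D : ℂ[X]) (Y : Functional E) : Kills D Y ↔ act (scalarPoly D) Y = 0 := by
  simp only [Kills, LinearMap.ext_iff, act_scalar, LinearMap.zero_apply]

theorem Kills.mul_left {D : ℂ[X]} {Y : Functional E} (H : Kills D Y) (D' : ℂ[X]) :
    Kills (D' * D) Y := fun p => by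
  rw [mul_comm D', mul_assoc]; exact H _

theorem Kills.mul_right {D : ℂ[X]} {Y : Functional E} (H : Kills D Y) (D' : ℂ[X]) :
    Kills (D * D') Y := mul_comm D' D ▸ H.mul_left D'

theorem Kills.of_dvd {D D' : ℂ[X]} {Y : Functional E} (H : Kills D Y) (hd : D ∣ D') :
    Kills D' Y := by
  obtain ⟨c, rfl⟩ := hd
  exact H.mul_right c

theorem Kills.add {D : ℂ[X]} {Y Z : Functional E} (H : Kills D Y) (H' : Kills D Z) :
    Kills D (Y + Z) := fun p => by simp [H p, H' p]

theorem Kills.sub {D : ℂ[X]} {Y Z : Functional E} (H : Kills D Y) (H' : Kills D Z) :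
    Kills D (Y - Z) := fun p => by simp [H p, H' p]

theorem Kills.act {D : ℂ[X]} {Y : Functional E} (H : Kills D Y) (Θ : E[X]) :
    Kills D (DrinfeldYangian.act Θ Y) := fun p => by
  rw [act_apply_mul, (kills_iff D Y).1 H]; simp

/-- A functional killed by two coprime polynomials vanishes. -/
theorem Kills.eq_zero {D q : ℂ[X]} {Y : Functional E} (hc : IsCoprime D q) (H : Kills D Y)
    (H' : Kills q Y) : Y = 0 := by
  obtain ⟨a, b, hab⟩ := hc
  refine LinearMap.ext fun p => ?_
  rw [LinearMap.zero_apply, ← one_mul p, ← hab, add_mul, map_add, mul_comm a, mul_comm b,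
    mul_assoc, mul_assoc, H, H', add_zero]

/-- The ideal of polynomials killing a functional. -/
def annIdeal (Y : Functional E) : Ideal ℂ[X] where
  carrier := {D | Kills D Y}
  add_mem' H H' p := by rw [add_mul, map_add, H p, H' p, add_zero]
  zero_mem' p := by simp
  smul_mem' c _ H := H.mul_left c

theorem mem_annIdeal {D : ℂ[X]} {Y : Functional E} : D ∈ annIdeal Y ↔ Kills D Y := Iff.rfl

/-! ### Values of rational functions -/

/-- `g` represents `(u - X)⁻¹` on the functional `Y`: the functional is killed by
`(u - X) g - 1`. -/
def IsResolvent (Y : Functional E) (u : ℂ) (g : ℂ[X]) : Prop :=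
  ∀ p, Y ((Polynomial.C u - Polynomial.X) * g * p) = Y p

/-- The value at `u` of the rational function `∑ Y(X^r) u^{-r-1} = Y((u - X)⁻¹)` is `e`. -/
def HasValue (Y : Functional E) (u : ℂ) (e : E) : Prop := ∃ g, IsResolvent Y u g ∧ e = Y g

theorem IsResolvent.unique {Y : Functional E} {u : ℂ} {g g' : ℂ[X]} (H : IsResolvent Y u g)
    (H' : IsResolvent Y u g') : Y g = Y g' := by
  rw [← H' g, ← H g']; ring_nf

theorem HasValue.unique {Y : Functional E} {u : ℂ} {e e' : E} (H : HasValue Y u e)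
    (H' : HasValue Y u e') : e = e' := by
  obtain ⟨g, hg, rfl⟩ := H
  obtain ⟨g', hg', rfl⟩ := H'
  exact hg.unique hg'

theorem IsResolvent.iff_kills {Y : Functional E} {u : ℂ} {g : ℂ[X]} :
    IsResolvent Y u g ↔ Kills ((Polynomial.C u - Polynomial.X) * g - 1) Y := by
  refine forall_congr' fun p => ?_
  rw [sub_mul _ 1 p, map_sub, one_mul, sub_eq_zero]

/-- If `D(u) ≠ 0`, there is a polynomial `g` with `(u - X) g ≡ 1` modulo `D`. -/
theorem exists_resolvent {D : ℂ[X]} {u : ℂ} (H : D.eval u ≠ 0) :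
    ∃ g, D ∣ (Polynomial.C u - Polynomial.X) * g - 1 := by
  have hc : IsCoprime (Polynomial.C u - Polynomial.X) D := by
    rw [Polynomial.isCoprime_iff_aeval_ne_zero_of_isAlgClosed ℂ ℂ]
    intro a
    by_cases ha : a = u
    · right; subst ha; simpa using H
    · left; simpa [sub_eq_zero, eq_comm] using ha
  obtain ⟨a, b, hab⟩ := hc
  refine ⟨a, -b, ?_⟩
  rw [← hab]; ring

theorem IsResolvent.mix {Y : Functional E} {u : ℂ} {g : ℂ[X]} (H : IsResolvent Y u g) (g' : ℂ[X]) :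
    IsResolvent Y u (g + g' - (Polynomial.C u - Polynomial.X) * g * g') := by
  rw [IsResolvent.iff_kills] at H ⊢
  have := H.mul_left (1 - (Polynomial.C u - Polynomial.X) * g')
  convert this using 1
  ring

theorem HasValue.add {Y Z : Functional E} {u : ℂ} {e f : E} (H : HasValue Y u e)
    (H' : HasValue Z u f) : HasValue (Y + Z) u (e + f) := by
  obtain ⟨g, hg, rfl⟩ := H
  obtain ⟨g', hg', rfl⟩ := H'
  have h1 := hg.mix g'
  have h2 := hg'.mix g
  rw [show g' + g - (Polynomial.C u - Polynomial.X) * g' * g =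
    g + g' - (Polynomial.C u - Polynomial.X) * g * g' by ring] at h2
  refine ⟨g + g' - (Polynomial.C u - Polynomial.X) * g * g', fun p => ?_, ?_⟩
  · rw [LinearMap.add_apply, LinearMap.add_apply, h1, h2]
  · rw [LinearMap.add_apply, h1.unique hg, h2.unique hg']

theorem HasValue.map {E' : Type*} [Ring E'] [Algebra ℂ E'] {Y : Functional E} {u : ℂ} {e : E}
    (H : HasValue Y u e) (f : E →ₗ[ℂ] E') : HasValue (f.comp Y) u (f e) := by
  obtain ⟨g, hg, rfl⟩ := H
  exact ⟨g, fun p => by simp [hg p], rfl⟩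

theorem HasValue.smul {Y : Functional E} {u : ℂ} {e : E} (H : HasValue Y u e) (c : ℂ) :
    HasValue (c • Y) u (c • e) := by
  obtain ⟨g, hg, rfl⟩ := H
  exact ⟨g, fun p => by simp [hg p], rfl⟩

theorem hasValue_zero (u : ℂ) : HasValue (0 : Functional E) u 0 :=
  ⟨0, fun p => by simp, by simp⟩

/-! ### Expansions at infinity -/

/-- A power series in `u⁻¹` as a Laurent series. -/
abbrev toL : E⟦X⟧ →+* LaurentSeries E := HahnSeries.ofPowerSeries ℤ E

/-- The functional attached to the negative powers of `u` in a power series in `u⁻¹`. -/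
def modeF (φ : E⟦X⟧) : Functional E := modeMap fun r => PowerSeries.coeff (r + 1) φ

theorem modeF_X_pow (φ : E⟦X⟧) (r : ℕ) :
    modeF φ (Polynomial.X ^ r) = PowerSeries.coeff (r + 1) φ := modeMap_X_pow _ _

theorem toL_coeff (φ : E⟦X⟧) (n : ℕ) : (toL φ).coeff n = PowerSeries.coeff n φ :=
  HahnSeries.ofPowerSeries_apply_coeff φ n

theorem toL_coeff_neg (φ : E⟦X⟧) (n : ℕ) : (toL φ).coeff (-((n : ℤ) + 1)) = 0 := by
  rw [HahnSeries.ofPowerSeries_apply, HahnSeries.embDomain_of_notMem_range]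
  rintro ⟨k, hk⟩
  have : ((k : ℕ) : ℤ) = -((n : ℤ) + 1) := hk
  omega

theorem resF_toL (φ : E⟦X⟧) : resF (toL φ) = modeF φ :=
  poly_ext fun r => by
    rw [resF_X_pow, modeF_X_pow, ← toL_coeff]; simp

theorem clears_iff (φ : E⟦X⟧) (D : ℂ[X]) : Clears φ D ↔ Kills D (modeF φ) := by
  have key (n : ℕ) : modeF φ (D * Polynomial.X ^ n) =
      ∑ k ∈ Finset.range (D.natDegree + 1), D.coeff k • PowerSeries.coeff (n + 1 + k) φ := by
    conv_lhs => rw [D.as_sum_range_C_mul_X_pow, Finset.sum_mul, map_sum]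
    refine Finset.sum_congr rfl fun k _ => ?_
    rw [mul_assoc, ← pow_add, ← Polynomial.smul_eq_C_mul, map_smul, modeF_X_pow]
    congr 3; ring
  constructor
  · intro H
    have : (modeF φ).comp (LinearMap.mulLeft ℂ D) = 0 :=
      poly_ext fun n => by simpa using (key n).trans (H n)
    exact fun p => LinearMap.congr_fun this p
  · exact fun H n => (key n).symm.trans (H _)

theorem poles_eq (φ : E⟦X⟧) : poles φ = {u | ∀ D, Kills D (modeF φ) → D.eval u = 0} := by
  ext u
  simp [poles, RegularAt, clears_iff]

/-- The poles are the roots of the generator of the annihilator. -/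
theorem exists_kills_eq_poles {φ : E⟦X⟧} (H : ∃ D, D ≠ 0 ∧ Kills D (modeF φ)) :
    ∃ D, D ≠ 0 ∧ Kills D (modeF φ) ∧ ∀ u, D.eval u = 0 ↔ u ∈ poles φ := by
  obtain ⟨D, hD0, hD⟩ := H
  obtain ⟨g, hg⟩ := IsPrincipalIdealRing.principal (annIdeal (modeF φ))
  have hgm : Kills g (modeF φ) := by
    rw [← mem_annIdeal, hg]; exact Ideal.mem_span_singleton_self g
  have hdvd (D' : ℂ[X]) (h : Kills D' (modeF φ)) : g ∣ D' := by
    rw [← mem_annIdeal, hg] at h; exact Ideal.mem_span_singleton.1 h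
  refine ⟨g, ?_, hgm, fun u => ?_⟩
  · rintro rfl; exact hD0 (zero_dvd_iff.1 (hdvd D hD))
  · rw [poles_eq]
    refine ⟨fun h D' hD' => ?_, fun h => h g hgm⟩
    obtain ⟨c, rfl⟩ := hdvd D' hD'
    simp [h]

/-- The polynomial part of `D(u) φ`, equal to `D(u) φ` if `D` clears the denominator of `φ`. -/
def polyPart (φ : E⟦X⟧) (D : ℂ[X]) : E[X] :=
  ∑ k ∈ Finset.range (D.natDegree + 1), ∑ j ∈ Finset.range (k + 1),
    Polynomial.monomial j (D.coeff k • PowerSeries.coeff (k - j) φ)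

theorem eval_polyPart (φ : E⟦X⟧) (D : ℂ[X]) (u : ℂ) :
    (polyPart φ D).eval (algebraMap ℂ E u) = clearedValue φ D u := by
  simp only [polyPart, clearedValue, Polynomial.eval_finsetSum, Polynomial.eval_monomial]
  refine Finset.sum_congr rfl fun k _ => Finset.sum_congr rfl fun j _ => ?_
  rw [← map_pow, ← Algebra.commutes, ← Algebra.smul_def, smul_smul, mul_comm]

theorem kills_iff_polL (φ : E⟦X⟧) (D : ℂ[X]) :
    Kills D (modeF φ) ↔ polL (scalarPoly D) * toL φ = polL (polyPart φ D) := by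
  rw [kills_iff, ← resF_toL, ← resF_polL_mul]
  refine ⟨fun H => ?_, fun H => by rw [H, resF_polL]⟩
  ext n
  rcases lt_or_ge 0 n with hn | hn
  · obtain ⟨r, rfl⟩ : ∃ r : ℕ, n = r + 1 := ⟨(n - 1).toNat, by omega⟩
    rw [← resF_X_pow, H, coeff_polL_pos]; rfl
  · obtain ⟨m, rfl⟩ : ∃ m : ℕ, n = -(m : ℤ) := ⟨(-n).toNat, by omega⟩
    rw [coeff_polL_neg, coeff_polL_mul, polyPart, scalarPoly, Polynomial.coe_mapRingHom,
      Polynomial.sum_over_range' _ (by simp) (D.natDegree + 1)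
        (Nat.lt_succ_of_le Polynomial.natDegree_map_le)]
    simp only [Polynomial.finsetSum_coeff, Polynomial.coeff_monomial, Polynomial.coeff_map]
    refine Finset.sum_congr rfl fun k _ => ?_
    rw [Finset.sum_ite_eq' (Finset.range (k + 1)) m, ← Algebra.smul_def]
    split_ifs with hm
    · rw [Finset.mem_range] at hm
      rw [← toL_coeff]
      congr 2; omega
    · rw [Finset.mem_range] at hm
      rw [show (-(m : ℤ) + k) = -(((m - k - 1 : ℕ) : ℤ) + 1) by omega, toL_coeff_neg, smul_zero]

/-- `X ↦ (D(u) - D(X)) / (u - X)`. -/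
def quotPoly (D : ℂ[X]) (u : ℂ) : ℂ[X] :=
  ∑ k ∈ Finset.range (D.natDegree + 1), Polynomial.C (D.coeff k) *
    ∑ j ∈ Finset.range k, Polynomial.C u ^ j * Polynomial.X ^ (k - 1 - j)

theorem quotPoly_mul (D : ℂ[X]) (u : ℂ) :
    (Polynomial.C u - Polynomial.X) * quotPoly D u = Polynomial.C (D.eval u) - D := by
  rw [quotPoly, Finset.mul_sum]
  conv_rhs => rw [D.eval_eq_sum_range, map_sum]; rhs; rw [D.as_sum_range_C_mul_X_pow]
  rw [← Finset.sum_sub_distrib]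
  refine Finset.sum_congr rfl fun k _ => ?_
  rw [mul_left_comm, mul_comm (Polynomial.C u - Polynomial.X), (Commute.all _ _).geom_sum₂_mul]
  simp [mul_sub]

theorem clearedValue_eq (φ : E⟦X⟧) (D : ℂ[X]) (u : ℂ) :
    clearedValue φ D u = D.eval u • PowerSeries.coeff 0 φ + modeF φ (quotPoly D u) := by
  simp only [clearedValue, quotPoly, D.eval_eq_sum_range, map_sum, Finset.sum_smul]
  rw [← Finset.sum_add_distrib]
  refine Finset.sum_congr rfl fun k _ => ?_
  rw [Finset.sum_range_succ, add_comm, Nat.sub_self, Finset.mul_sum, map_sum]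
  congr 1
  refine Finset.sum_congr rfl fun j hj => ?_
  rw [← map_pow, ← mul_assoc, ← map_mul, ← Polynomial.smul_eq_C_mul, map_smul, modeF_X_pow]
  rw [Finset.mem_range] at hj
  congr 3; omega

theorem hasValue_of_kills {φ : E⟦X⟧} {D : ℂ[X]} (H : Kills D (modeF φ)) {u : ℂ}
    (hu : D.eval u ≠ 0) :
    HasValue (modeF φ) u ((D.eval u)⁻¹ • clearedValue φ D u - PowerSeries.coeff 0 φ) := by
  refine ⟨Polynomial.C (D.eval u)⁻¹ * quotPoly D u, ?_, ?_⟩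
  · rw [IsResolvent.iff_kills]
    have := H.mul_left (Polynomial.C (-(D.eval u)⁻¹))
    convert this using 1
    rw [mul_left_comm, quotPoly_mul, mul_sub, ← map_mul, inv_mul_cancel₀ hu]
    simp
  · rw [clearedValue_eq, smul_add, smul_smul, inv_mul_cancel₀ hu, one_smul, add_sub_cancel_left,
      ← Polynomial.smul_eq_C_mul, map_smul]

theorem regularAt_iff {φ : E⟦X⟧} {u : ℂ} :
    RegularAt φ u ↔ ∃ g, IsResolvent (modeF φ) u g := by
  constructor
  · rintro ⟨D, hD, hu⟩
    obtain ⟨g, hg, -⟩ := hasValue_of_kills ((clears_iff _ _).1 hD) hu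
    exact ⟨g, hg⟩
  · rintro ⟨g, hg⟩
    exact ⟨_, (clears_iff _ _).2 (IsResolvent.iff_kills.1 hg), by simp⟩

theorem ratValue_eq {φ : E⟦X⟧} {u : ℂ} {e : E} (H : HasValue (modeF φ) u e) :
    ratValue φ u = PowerSeries.coeff 0 φ + e := by
  have hr : RegularAt φ u := by
    obtain ⟨g, hg, -⟩ := H
    exact regularAt_iff.2 ⟨g, hg⟩
  rw [ratValue, dif_pos hr, ← (hasValue_of_kills ((clears_iff _ _).1 hr.choose_spec.1)
    hr.choose_spec.2).unique H]
  abel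

theorem ratValue_eq_zero {φ : E⟦X⟧} {u : ℂ} (H : u ∈ poles φ) : ratValue φ u = 0 := dif_neg H

/-- The value of a rational function away from the zeros of a denominator. -/
theorem ratValue_eq_eval {φ : E⟦X⟧} {D : ℂ[X]} (H : Kills D (modeF φ)) {u : ℂ}
    (hu : D.eval u ≠ 0) :
    ratValue φ u = (D.eval u)⁻¹ • (polyPart φ D).eval (algebraMap ℂ E u) := by
  rw [ratValue_eq (hasValue_of_kills H hu), eval_polyPart]; abel

end Series

/-! ### Integrals along simple closed curves -/

section Curves

namespace SimpleClosedCurve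

variable (c : SimpleClosedCurve)

theorem mem_trace {t : ℝ} (ht : t ∈ Set.Icc (0 : ℝ) 1) : c.path t ∈ c.trace :=
  Set.mem_image_of_mem _ ht

theorem isCompact_trace : IsCompact c.trace := isCompact_Icc.image_of_continuousOn c.continuousOn

theorem isPreconnected_trace : IsPreconnected c.trace :=
  isPreconnected_Icc.image _ c.continuousOn

theorem intervalIntegrable {f : ℂ → ℂ} (hf : ContinuousOn f c.trace) :
    IntervalIntegrable (fun t => f (c.path t) * deriv c.path t) MeasureTheory.volume 0 1 := by
  refine c.rectifiable.continuousOn_mul ?_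
  rw [Set.uIcc_of_le zero_le_one]
  exact hf.comp c.continuousOn fun t ht => c.mem_trace ht

theorem hasDerivAt {t : ℝ} (ht : t ∈ Set.Ioo (0 : ℝ) 1) (hc : t ∉ c.corners) :
    HasDerivAt c.path (deriv c.path t) t :=
  ((c.smooth t ht hc).differentiableAt one_ne_zero).hasDerivAt

/-- A function with a primitive has integral zero. -/
theorem pathIntegral_eq_zero_of_primitive {F f : ℂ → ℂ}
    (hF : ∀ v ∈ c.trace, HasDerivAt F (f v) v) (hf : ContinuousOn f c.trace) :
    pathIntegral c.path f = 0 := by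
  have := MeasureTheory.integral_eq_of_hasDerivAt_off_countable_of_le (F ∘ c.path)
    (fun t => f (c.path t) * deriv c.path t) zero_le_one (s := (c.corners : Set ℝ))
    c.corners.countable_toSet
    (ContinuousOn.comp (t := c.trace) (fun v hv => (hF v hv).continuousAt.continuousWithinAt)
      c.continuousOn fun t ht => c.mem_trace ht)
    (fun t ht => (hF _ (c.mem_trace (Set.Ioo_subset_Icc_self ht.1))).comp t
      (c.hasDerivAt ht.1 ht.2))
    (c.intervalIntegrable hf)
  rw [pathIntegral, this, Function.comp_apply, Function.comp_apply, c.closed, sub_self, mul_zero]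

theorem winding_continuousAt {z : ℂ} (hz : z ∉ c.trace) : ContinuousAt (winding c.path) z := by
  obtain ⟨δ, hδ, hb⟩ := Metric.isOpen_iff.1 c.isCompact_trace.isClosed.isOpen_compl z hz
  have hlow (w : ℂ) (hw : w ∈ Metric.ball z (δ / 2)) (t : ℝ) (ht : t ∈ Set.Icc (0 : ℝ) 1) :
      δ / 2 ≤ ‖c.path t - w‖ := by
    by_contra! H
    have : c.path t ∈ Metric.ball z δ := by
      rw [Metric.mem_ball, dist_eq_norm]
      rw [Metric.mem_ball, dist_eq_norm] at hw
      calc ‖c.path t - z‖ = ‖(c.path t - w) + (w - z)‖ := by ring_nf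
        _ ≤ ‖c.path t - w‖ + ‖w - z‖ := norm_add_le _ _
        _ < δ := by linarith
    exact hb this (c.mem_trace ht)
  refine ContinuousAt.const_mul ?_ _
  refine intervalIntegral.continuousAt_of_dominated_interval
    (bound := fun t => (δ / 2)⁻¹ * ‖deriv c.path t‖) ?_ ?_ ?_ ?_
  · filter_upwards [Metric.ball_mem_nhds z (half_pos hδ)] with w hw
    refine (c.intervalIntegrable (f := fun v => (v - w)⁻¹) ?_).aestronglyMeasurable.mono_measure
      (by rw [Set.uIoc_of_le zero_le_one])
    rintro _ ⟨t, ht, rfl⟩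
    refine ContinuousAt.continuousWithinAt (ContinuousAt.inv₀ (by fun_prop) ?_)
    intro h0
    have := hlow w hw t ht
    rw [h0, norm_zero] at this
    linarith
  · filter_upwards [Metric.ball_mem_nhds z (half_pos hδ)] with w hw
    refine Filter.Eventually.of_forall fun t ht => ?_
    rw [Set.uIoc_of_le zero_le_one] at ht
    rw [norm_mul, norm_inv]
    gcongr
    exact hlow w hw t (Set.Ioc_subset_Icc_self ht)
  · exact c.rectifiable.norm.const_mul _
  · refine Filter.Eventually.of_forall fun t ht => ?_
    rw [Set.uIoc_of_le zero_le_one] at ht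
    refine ContinuousAt.mul_const (ContinuousAt.inv₀ (by fun_prop) ?_) _
    intro h0
    have := hlow z (Metric.mem_ball_self (half_pos hδ)) t (Set.Ioc_subset_Icc_self ht)
    rw [h0, norm_zero] at this
    linarith

/-- The winding number is constant on connected sets disjoint from the curve. -/
theorem winding_eq_of_isPreconnected {S : Set ℂ} (hS : IsPreconnected S)
    (hd : Disjoint S c.trace) {z w : ℂ} (hz : z ∈ S) (hw : w ∈ S) :
    winding c.path z = winding c.path w := by
  exact hS.constant_of_mapsTo (T := {0, 1}) (Set.toFinite _).isDiscrete
    (fun v hv => (c.winding_continuousAt (Set.disjoint_left.1 hd hv)).continuousWithinAt)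
    (fun v hv => c.positive v (Set.disjoint_left.1 hd hv)) hz hw

theorem isOpen_inner : IsOpen c.inner := by
  rw [Metric.isOpen_iff]
  intro z hz
  obtain ⟨δ, hδ, hb⟩ := Metric.isOpen_iff.1 c.isCompact_trace.isClosed.isOpen_compl z hz.1
  refine ⟨δ, hδ, fun w hw => ⟨hb hw, ?_⟩⟩
  rw [c.winding_eq_of_isPreconnected (convex_ball z δ).isPreconnected
    (Set.disjoint_left.2 fun v hv => hb hv) hw (Metric.mem_ball_self hδ), hz.2]

end SimpleClosedCurve

/-- Lower bound for the integrand of the jump of the winding number, for a curve `g` that is close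
to the real axis, `τ` being the parameter. -/
theorem re_div_ge {ε τ : ℝ} (hε : 0 < ε) {g g' : ℂ} (hg : ‖g - τ‖ ≤ |τ| / 8)
    (hg' : ‖g' - 1‖ ≤ 1 / 8) :
    g ^ 2 + ε ^ 2 ≠ 0 ∧ 1 / (4 * (τ ^ 2 + ε ^ 2)) ≤ (g' / (g ^ 2 + ε ^ 2)).re := by
  set N : ℝ := τ ^ 2 + ε ^ 2 with hN
  have hN0 : 0 < N := by positivity
  set e : ℂ := (g ^ 2 + ε ^ 2) / N - 1 with he
  have hNC : (N : ℂ) ≠ 0 := by exact_mod_cast hN0.ne'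
  have hGe : g ^ 2 + ε ^ 2 = N * (1 + e) := by rw [he]; field_simp; ring
  have hde : ‖e‖ ≤ 1 / 3 := by
    have h1 : e = (g - τ) * ((g - τ) + 2 * τ) / N := by
      rw [he, eq_div_iff hNC, sub_mul, div_mul_cancel₀ _ hNC, hN]; push_cast; ring
    rw [h1, norm_div, norm_mul, Complex.norm_of_nonneg hN0.le, div_le_iff₀ hN0]
    have h2 : ‖(g - τ) + 2 * τ‖ ≤ |τ| / 8 + 2 * |τ| := by
      refine (norm_add_le _ _).trans (add_le_add hg ?_)
      simp
    calc ‖g - τ‖ * ‖(g - τ) + 2 * τ‖ ≤ (|τ| / 8) * (|τ| / 8 + 2 * |τ|) := by gcongr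
      _ = 17 / 64 * τ ^ 2 := by rw [← sq_abs τ]; ring
      _ ≤ 1 / 3 * N := by rw [hN]; nlinarith [sq_nonneg τ, sq_nonneg ε]
  have h1e : 2 / 3 ≤ ‖1 + e‖ := by
    have := norm_sub_norm_le (1 : ℂ) (-e)
    rw [sub_neg_eq_add, norm_neg, norm_one] at this
    linarith
  have h1e0 : 1 + e ≠ 0 := fun h => by rw [h, norm_zero] at h1e; norm_num at h1e
  refine ⟨by rw [hGe]; exact mul_ne_zero hNC h1e0, ?_⟩
  have h3 : g' / (g ^ 2 + ε ^ 2) = ((1 / N : ℝ) : ℂ) * (1 + ((g' - 1) - e) / (1 + e)) := by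
    rw [hGe]; push_cast; field_simp; ring
  have h4 : ‖((g' - 1) - e) / (1 + e)‖ ≤ 3 / 4 := by
    rw [norm_div, div_le_iff₀ (by linarith)]
    calc ‖(g' - 1) - e‖ ≤ ‖g' - 1‖ + ‖e‖ := norm_sub_le _ _
      _ ≤ 1 / 8 + 1 / 3 := add_le_add hg' hde
      _ ≤ 3 / 4 * ‖1 + e‖ := by linarith
  rw [h3, Complex.re_ofReal_mul, Complex.add_re, Complex.one_re]
  have h5 := (abs_le.1 ((Complex.abs_re_le_norm _).trans h4)).1
  calc 1 / (4 * N) = 1 / N * (1 / 4) := by field_simp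
    _ ≤ _ := by gcongr; linarith

namespace SimpleClosedCurve

variable (c : SimpleClosedCurve)

theorem exists_deriv_ne_zero : ∃ t ∈ Set.Ioo (0 : ℝ) 1, t ∉ c.corners ∧ deriv c.path t ≠ 0 := by
  by_contra! H
  have h := MeasureTheory.integral_eq_of_hasDerivAt_off_countable_of_le c.path
    (fun _ => 0) (a := 0) (b := 1 / 2) (by norm_num) (s := (c.corners : Set ℝ))
    c.corners.countable_toSet (c.continuousOn.mono (Set.Icc_subset_Icc_right (by norm_num)))
    (fun t ht => by
      have h1 : t ∈ Set.Ioo (0 : ℝ) 1 := ⟨ht.1.1, ht.1.2.trans (by norm_num)⟩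
      rw [← H t h1 ht.2]
      exact c.hasDerivAt h1 ht.2) (by simp)
  simp only [intervalIntegral.integral_zero] at h
  have := c.simple (show (1 / 2 : ℝ) ∈ Set.Ico (0 : ℝ) 1 by norm_num)
    (show (0 : ℝ) ∈ Set.Ico (0 : ℝ) 1 by norm_num) (sub_eq_zero.1 h.symm)
  norm_num at this

/-- The winding number is not constant near the curve: it jumps across the curve at a point where
the derivative does not vanish. -/
theorem exists_winding_jump : ∃ p ∈ c.trace, ∀ δ > 0, ∃ z ∈ Metric.ball p δ,
    ∃ w ∈ Metric.ball p δ, z ∉ c.trace ∧ w ∉ c.trace ∧ winding c.path z ≠ winding c.path w := by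
  obtain ⟨t₀, ht₀, hcor, hw⟩ := c.exists_deriv_ne_zero
  set p := c.path t₀ with hp
  set w₀ := deriv c.path t₀ with hw₀
  refine ⟨p, c.mem_trace (Set.Ioo_subset_Icc_self ht₀), fun δ hδ => ?_⟩
  have hwpos : 0 < ‖w₀‖ := norm_pos_iff.2 hw
  -- the rescaled curve `g`, with `g t₀ = 0` and `g' t₀ = 1`
  set g : ℝ → ℂ := fun t => (c.path t - p) / w₀ with hg
  set g' : ℝ → ℂ := fun t => deriv c.path t / w₀ with hg'
  have hgc : ContinuousOn g (Set.Icc 0 1) := (c.continuousOn.sub continuousOn_const).div_const _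
  -- a neighbourhood of `t₀` where `g'` is close to `1`
  obtain ⟨η, hη, hloc⟩ : ∃ η > 0, ∀ t, |t - t₀| < η → t ∈ Set.Ioo (0 : ℝ) 1 ∧
      HasDerivAt c.path (deriv c.path t) t ∧ ‖g' t - 1‖ ≤ 1 / 8 := by
    have h1 : ∀ᶠ t in nhds t₀, ContDiffAt ℝ 1 c.path t :=
      (c.smooth t₀ ht₀ hcor).eventually (by simp)
    have h2 : ContinuousAt (deriv c.path) t₀ :=
      (ContDiffAt.derivWithin (m := 0) (c.smooth t₀ ht₀ hcor) (by simp)).continuousAt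
    have h3 : ∀ᶠ t in nhds t₀, ‖g' t - 1‖ < 1 / 8 := by
      have : ContinuousAt (fun t => ‖g' t - 1‖) t₀ := ((h2.div_const _).sub_const 1).norm
      refine this.eventually_lt continuousAt_const ?_
      simp [hg', ← hw₀, div_self hw]
    have h4 := h1.and (h3.and (isOpen_Ioo.mem_nhds ht₀))
    obtain ⟨η, hη, h⟩ := Metric.eventually_nhds_iff.1 h4
    refine ⟨η, hη, fun t ht => ?_⟩
    have := h (y := t) (by rwa [Real.dist_eq])
    exact ⟨this.2.2, (this.1.differentiableAt one_ne_zero).hasDerivAt, this.2.1.le⟩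
  have hclose (t : ℝ) (ht : |t - t₀| < η) : ‖g t - ((t - t₀ : ℝ) : ℂ)‖ ≤ |t - t₀| / 8 := by
    have hd : ∀ x ∈ Metric.ball t₀ η,
        HasDerivWithinAt (fun t => g t - ((t - t₀ : ℝ) : ℂ)) (g' x - 1) (Metric.ball t₀ η) x := by
      intro x hx
      refine HasDerivAt.hasDerivWithinAt (HasDerivAt.sub ?_ ?_)
      · exact ((hloc x (by rwa [Metric.mem_ball, Real.dist_eq] at hx)).2.1.sub_const p).div_const _
      · exact ((hasDerivAt_id x).sub_const t₀).ofReal_comp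
    have := (convex_ball t₀ η).norm_image_sub_le_of_norm_hasDerivWithin_le hd
      (fun x hx => (hloc x (by rwa [Metric.mem_ball, Real.dist_eq] at hx)).2.2)
      (Metric.mem_ball_self hη) (show t ∈ Metric.ball t₀ η by rwa [Metric.mem_ball, Real.dist_eq])
    simp only [hg, ← hp, sub_self, zero_div, Complex.ofReal_zero, sub_zero,
      Real.norm_eq_abs] at this
    simp only [hg]
    linarith
  -- the rest of the curve stays away from `p`
  obtain ⟨ρ, hρ, hfar⟩ : ∃ ρ > 0, ∀ t ∈ Set.Icc (0 : ℝ) 1, η ≤ |t - t₀| → ρ ≤ ‖g t‖ := by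
    have hK : IsCompact (Set.Icc (0 : ℝ) 1 ∩ {t | η ≤ |t - t₀|}) :=
      isCompact_Icc.inter_right (isClosed_le continuous_const (by fun_prop))
    rcases (Set.Icc (0 : ℝ) 1 ∩ {t | η ≤ |t - t₀|}).eq_empty_or_nonempty with he | hne
    · exact ⟨1, one_pos, fun t ht h => absurd (he ▸ (⟨ht, h⟩ : t ∈ Set.Icc (0 : ℝ) 1 ∩
        {t | η ≤ |t - t₀|})) (Set.notMem_empty t)⟩
    · obtain ⟨s, hs, hmin⟩ := hK.exists_isMinOn hne (hgc.norm.mono Set.inter_subset_left)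
      refine ⟨‖g s‖, ?_, fun t ht h => hmin ⟨ht, h⟩⟩
      rw [gt_iff_lt, norm_pos_iff]
      intro h0
      have h1 : c.path s = c.path t₀ := by
        simpa [hg, hw, sub_eq_zero] using h0
      have hst : s ≠ t₀ := by
        rintro rfl
        have := hs.2
        simp only [Set.mem_ofPred_eq, sub_self, abs_zero] at this
        linarith
      rcases hs.1.2.eq_or_lt with h | h
      · rw [h, ← c.closed] at h1
        have := c.simple ⟨le_rfl, one_pos⟩ ⟨ht₀.1.le, ht₀.2⟩ h1
        exact ht₀.1.ne this
      · exact hst (c.simple ⟨hs.1.1, h⟩ ⟨ht₀.1.le, ht₀.2⟩ h1)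
  -- choice of the distance `ε` to the curve
  set K : ℝ := ∫ t in (0 : ℝ)..1, ‖g' t‖ with hK
  have hK0 : 0 ≤ K := intervalIntegral.integral_nonneg zero_le_one fun t _ => norm_nonneg _
  obtain ⟨ε, hε, hε1, hε2, hε3, hε4⟩ : ∃ ε : ℝ, 0 < ε ∧ ε < η ∧ ε ^ 2 ≤ ρ ^ 2 / 2 ∧
      ε * ‖w₀‖ < δ ∧ ε * (2 / ρ ^ 2) * K < 1 / 4 := by
    have hev : ∀ᶠ ε in nhdsWithin (0 : ℝ) (Set.Ioi 0), 0 < ε ∧ ε < η ∧ ε ^ 2 < ρ ^ 2 / 2 ∧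
        ε * ‖w₀‖ < δ ∧ ε * (2 / ρ ^ 2) * K < 1 / 4 := by
      refine (eventually_mem_nhdsWithin).and ?_
      refine Filter.Eventually.filter_mono nhdsWithin_le_nhds ?_
      refine (eventually_lt_nhds hη).and (Filter.Eventually.and ?_ (Filter.Eventually.and ?_ ?_))
      · exact ContinuousAt.eventually_lt (by fun_prop) continuousAt_const
          (by simpa using pow_pos hρ 2)
      · exact ContinuousAt.eventually_lt (by fun_prop) continuousAt_const (by simpa using hδ)
      · exact ContinuousAt.eventually_lt (by fun_prop) continuousAt_const (by norm_num)
    obtain ⟨ε, h1, h2, h3, h4, h5⟩ := hev.exists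
    exact ⟨ε, h1, h2, h3.le, h4, h5⟩
  have hfar' (t : ℝ) (ht : t ∈ Set.Icc (0 : ℝ) 1) (h : η ≤ |t - t₀|) :
      ρ ^ 2 / 2 ≤ ‖g t ^ 2 + (ε : ℂ) ^ 2‖ := by
    have h1 := norm_sub_norm_le (g t ^ 2) (-((ε : ℂ) ^ 2))
    rw [sub_neg_eq_add, norm_neg, norm_pow, norm_pow, Complex.norm_of_nonneg hε.le] at h1
    have h2 : ρ ^ 2 ≤ ‖g t‖ ^ 2 := pow_le_pow_left₀ hρ.le (hfar t ht h) 2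
    linarith
  have hne (t : ℝ) (ht : t ∈ Set.Icc (0 : ℝ) 1) : g t ^ 2 + (ε : ℂ) ^ 2 ≠ 0 := by
    rcases lt_or_ge |t - t₀| η with h | h
    · exact (re_div_ge hε (hclose t h) (hloc t h).2.2).1
    · intro h0
      have := hfar' t ht h
      rw [h0, norm_zero] at this
      nlinarith
  -- the points at distance `ε ‖w₀‖` from `p`, on both sides of the curve
  set z := p + Complex.I * ε * w₀ with hz
  set w := p - Complex.I * ε * w₀ with hwd
  have hfz (t : ℝ) : c.path t - z = w₀ * (g t - Complex.I * ε) := by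
    simp only [hg, hz]; field_simp; ring
  have hfw (t : ℝ) : c.path t - w = w₀ * (g t + Complex.I * ε) := by
    simp only [hg, hwd]; field_simp; ring
  have hprod (t : ℝ) : (g t - Complex.I * ε) * (g t + Complex.I * ε) = g t ^ 2 + (ε : ℂ) ^ 2 := by
    ring_nf; rw [Complex.I_sq]; ring
  have hz0 (t : ℝ) (ht : t ∈ Set.Icc (0 : ℝ) 1) : c.path t - z ≠ 0 := by
    rw [hfz]; exact mul_ne_zero hw (left_ne_zero_of_mul (hprod t ▸ hne t ht))
  have hw0 (t : ℝ) (ht : t ∈ Set.Icc (0 : ℝ) 1) : c.path t - w ≠ 0 := by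
    rw [hfw]; exact mul_ne_zero hw (right_ne_zero_of_mul (hprod t ▸ hne t ht))
  have hnorm : ‖Complex.I * ε * w₀‖ = ε * ‖w₀‖ := by
    rw [norm_mul, norm_mul, Complex.norm_I, one_mul, Complex.norm_of_nonneg hε.le]
  have hzt : z ∉ c.trace := by
    rintro ⟨t, ht, h⟩; exact hz0 t ht (sub_eq_zero.2 h)
  have hwt : w ∉ c.trace := by
    rintro ⟨t, ht, h⟩; exact hw0 t ht (sub_eq_zero.2 h)
  refine ⟨z, ?_, w, ?_, hzt, hwt, fun heq => ?_⟩
  · rw [Metric.mem_ball, dist_eq_norm, hz, add_sub_cancel_left, hnorm]; exact hε3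
  · rw [Metric.mem_ball, dist_eq_norm, hwd, sub_sub_cancel_left, norm_neg, hnorm]; exact hε3
  -- the difference of the winding numbers as an integral
  have hi {y : ℂ} (hy : y ∉ c.trace) : IntervalIntegrable
      (fun t => (c.path t - y)⁻¹ * deriv c.path t) MeasureTheory.volume 0 1 := by
    refine c.intervalIntegrable (f := fun v => (v - y)⁻¹) fun v hv => ?_
    refine ContinuousAt.continuousWithinAt (ContinuousAt.inv₀ (by fun_prop) ?_)
    rw [sub_ne_zero]; rintro rfl; exact hy hv
  have hdiff (t : ℝ) (ht : t ∈ Set.Icc (0 : ℝ) 1) :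
      (c.path t - z)⁻¹ * deriv c.path t - (c.path t - w)⁻¹ * deriv c.path t =
        2 * Complex.I * (ε * (g' t / (g t ^ 2 + (ε : ℂ) ^ 2))) := by
    have h1 : deriv c.path t = w₀ * g' t := by simp only [hg']; field_simp
    have h2 := left_ne_zero_of_mul (hprod t ▸ hne t ht)
    have h3 := right_ne_zero_of_mul (hprod t ▸ hne t ht)
    rw [hfz, hfw, h1, ← hprod]
    field_simp
    ring
  have hint : IntervalIntegrable (fun t => (ε : ℂ) * (g' t / (g t ^ 2 + (ε : ℂ) ^ 2)))
      MeasureTheory.volume 0 1 := by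
    have := ((hi hzt).sub (hi hwt)).const_mul (2 * Complex.I)⁻¹
    refine this.congr fun t ht => ?_
    rw [Set.uIoc_of_le zero_le_one] at ht
    rw [hdiff t (Set.Ioc_subset_Icc_self ht), inv_mul_cancel_left₀ (by simp)]
  have hzero : ∫ t in (0 : ℝ)..1, (ε : ℂ) * (g' t / (g t ^ 2 + (ε : ℂ) ^ 2)) = 0 := by
    have h1 : ∫ t in (0 : ℝ)..1, 2 * Complex.I * (ε * (g' t / (g t ^ 2 + (ε : ℂ) ^ 2))) = 0 := by
      rw [← intervalIntegral.integral_congr (fun t ht => hdiff t (by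
        rwa [Set.uIcc_of_le zero_le_one] at ht)), intervalIntegral.integral_sub (hi hzt) (hi hwt),
        sub_eq_zero]
      exact mul_left_cancel₀ (inv_ne_zero Complex.two_pi_I_ne_zero) heq
    rw [intervalIntegral.integral_const_mul] at h1
    exact (mul_eq_zero.1 h1).resolve_left (by simp)
  have hre : ∫ t in (0 : ℝ)..1, ((ε : ℂ) * (g' t / (g t ^ 2 + (ε : ℂ) ^ 2))).re = 0 := by
    have := Complex.reCLM.intervalIntegral_comp_comm hint
    rw [hzero] at this
    simpa using this
  -- a lower bound for the integrand, whose integral is positive: near `t₀` by `re_div_ge`, and far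
  -- from `t₀` since the integrand is `O(ε)`
  set L : ℝ → ℝ := fun t => (Set.Ioc (t₀ - ε) (t₀ + ε)).indicator (fun _ => 1 / (8 * ε)) t -
    ε * (2 / ρ ^ 2) * ‖g' t‖ with hL
  have hg'i : IntervalIntegrable (fun t => ‖g' t‖) MeasureTheory.volume 0 1 :=
    (c.rectifiable.div_const _).norm
  have hind : IntervalIntegrable ((Set.Ioc (t₀ - ε) (t₀ + ε)).indicator
      (fun _ => 1 / (8 * ε))) MeasureTheory.volume 0 1 := by
    rw [intervalIntegrable_iff]
    exact (MeasureTheory.integrableOn_const (by simp)).indicator measurableSet_Ioc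
  have hsub : Set.Ioc (t₀ - ε) (t₀ + ε) ⊆ Set.Ioc 0 1 := by
    have hl := (hloc (t₀ - ε) (by rw [sub_sub_cancel_left, abs_neg, abs_of_pos hε]; exact hε1)).1
    have hr := (hloc (t₀ + ε) (by rw [add_sub_cancel_left, abs_of_pos hε]; exact hε1)).1
    exact Set.Ioc_subset_Ioc hl.1.le hr.2.le
  have hLint : ∫ t in (0 : ℝ)..1, L t = 1 / 4 - ε * (2 / ρ ^ 2) * K := by
    rw [intervalIntegral.integral_sub hind (hg'i.const_mul _),
      intervalIntegral.integral_const_mul, hK, intervalIntegral.integral_of_le zero_le_one,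
      MeasureTheory.setIntegral_indicator measurableSet_Ioc, Set.inter_eq_self_of_subset_right hsub,
      MeasureTheory.setIntegral_const]
    simp only [MeasureTheory.measureReal_def, Real.volume_Ioc, smul_eq_mul]
    rw [ENNReal.toReal_ofReal (by linarith)]
    field_simp
    ring
  have hle : ∫ t in (0 : ℝ)..1, L t ≤
      ∫ t in (0 : ℝ)..1, ((ε : ℂ) * (g' t / (g t ^ 2 + (ε : ℂ) ^ 2))).re := by
    refine intervalIntegral.integral_mono_on zero_le_one (hind.sub (hg'i.const_mul _))
      ⟨Complex.reCLM.integrable_comp hint.1, Complex.reCLM.integrable_comp hint.2⟩ fun t ht => ?_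
    rw [Complex.re_ofReal_mul]
    have hpos : 0 ≤ ε * (2 / ρ ^ 2) * ‖g' t‖ := by positivity
    rcases lt_or_ge |t - t₀| η with h | h
    · have h1 := (re_div_ge hε (hclose t h) (hloc t h).2.2).2
      by_cases hm : t ∈ Set.Ioc (t₀ - ε) (t₀ + ε)
      · have h2 : 1 / (8 * ε) ≤ ε * (1 / (4 * ((t - t₀) ^ 2 + ε ^ 2))) := by
          have h3 : (t - t₀) ^ 2 ≤ ε ^ 2 := by
            rw [sq_le_sq, abs_of_pos hε, abs_le]
            exact ⟨by linarith [hm.1], by linarith [hm.2]⟩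
          rw [mul_one_div, div_le_div_iff₀ (by positivity) (by positivity)]
          nlinarith
        have h4 := mul_le_mul_of_nonneg_left h1 hε.le
        simp only [hL, Set.indicator_of_mem hm]
        linarith
      · have h4 : 0 ≤ ε * (g' t / (g t ^ 2 + (ε : ℂ) ^ 2)).re :=
          mul_nonneg hε.le (le_trans (by positivity) h1)
        simp only [hL, Set.indicator_of_notMem hm]
        linarith
    · have hm : t ∉ Set.Ioc (t₀ - ε) (t₀ + ε) := by
        intro hm
        have : |t - t₀| ≤ ε := abs_le.2 ⟨by linarith [hm.1], by linarith [hm.2]⟩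
        linarith
      have h1 : ‖g' t / (g t ^ 2 + (ε : ℂ) ^ 2)‖ ≤ 2 / ρ ^ 2 * ‖g' t‖ := by
        rw [norm_div, div_le_iff₀ (lt_of_lt_of_le (by positivity) (hfar' t ht h))]
        calc ‖g' t‖ = 2 / ρ ^ 2 * ‖g' t‖ * (ρ ^ 2 / 2) := by field_simp
          _ ≤ _ := by gcongr; exact hfar' t ht h
      have h2 := (abs_le.1 ((Complex.abs_re_le_norm _).trans h1)).1
      have h3 := mul_le_mul_of_nonneg_left h2 hε.le
      simp only [hL, Set.indicator_of_notMem hm]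
      linarith
  rw [hre, hLint] at hle
  linarith

end SimpleClosedCurve

end Curves

/-! ### Residue calculus for Jordan curves -/

section Residues

namespace JordanCurve

variable (C : JordanCurve)

/-- The union of the components of a Jordan curve. -/
def trace : Set ℂ := ⋃ k, (C.curve k).trace

theorem trace_subset (k : Fin C.num) : (C.curve k).trace ⊆ C.trace :=
  Set.subset_iUnion (fun k => (C.curve k).trace) k

/-- A point enclosed by one component is neither on another component nor enclosed by it. If it
were on the other component, the latter would lie, being connected, in the inner domain of the
first component; and its own inner domain, which reaches the curve by the jump of the winding
number, would meet the inner domain of the first component. -/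
theorem winding_of_mem_inner {k l : Fin C.num} (hkl : k ≠ l) {z : ℂ}
    (hz : z ∈ (C.curve k).inner) :
    z ∉ (C.curve l).trace ∧ winding (C.curve l).path z = 0 := by
  have hin (y : ℂ) (hy : y ∈ (C.curve k).inner) (hy' : y ∉ (C.curve l).trace) :
      winding (C.curve l).path y = 0 :=
    ((C.curve l).positive y hy').resolve_right fun h =>
      Set.disjoint_left.1 (C.disjoint_inner hkl) hy ⟨hy', h⟩
  suffices h : z ∉ (C.curve l).trace from ⟨h, hin z hz h⟩
  intro hzl
  obtain ⟨p, hp, hjump⟩ := (C.curve l).exists_winding_jump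
  have hpk : p ∈ (C.curve k).inner := by
    refine ⟨Set.disjoint_left.1 (C.disjoint_trace hkl.symm) hp, ?_⟩
    rw [(C.curve k).winding_eq_of_isPreconnected (C.curve l).isPreconnected_trace
      (C.disjoint_trace hkl.symm) hp hzl, hz.2]
  obtain ⟨δ, hδ, hb⟩ := Metric.isOpen_iff.1 (C.curve k).isOpen_inner p hpk
  obtain ⟨y, hy, w, hw, hyt, hwt, hne⟩ := hjump δ hδ
  exact hne ((hin y (hb hy) hyt).trans (hin w (hb hw) hwt).symm)

theorem notMem_trace_of_inside {z : ℂ} (hz : z ∈ C.inside) : z ∉ C.trace := by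
  obtain ⟨k, hk⟩ := Set.mem_iUnion.1 hz
  intro h
  obtain ⟨l, hl⟩ := Set.mem_iUnion.1 h
  by_cases hkl : k = l
  · subst hkl; exact hk.1 hl
  · exact (C.winding_of_mem_inner hkl hk).1 hl

theorem notMem_trace_of_outside {z : ℂ} (hz : z ∈ C.outside) : z ∉ C.trace := by
  intro h
  obtain ⟨l, hl⟩ := Set.mem_iUnion.1 h
  exact (hz l).1 hl

theorem disjoint_inside_outside : Disjoint C.inside C.outside := by
  rw [Set.disjoint_left]
  intro z hz hz'
  obtain ⟨k, hk⟩ := Set.mem_iUnion.1 hz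
  exact (hz' k).2 hk

theorem continuousOn_inv_pow {z : ℂ} (hz : z ∉ C.trace) (n : ℕ) :
    ContinuousOn (fun v => ((v - z) ^ n)⁻¹) C.trace := fun v hv => by
  refine ContinuousAt.continuousWithinAt (ContinuousAt.inv₀ (by fun_prop) (pow_ne_zero _ ?_))
  rw [sub_ne_zero]; rintro rfl; exact hz hv

theorem integral_congr {f g : ℂ → ℂ} (H : Set.EqOn f g C.trace) : C.integral f = C.integral g := by
  refine Finset.sum_congr rfl fun k _ => ?_
  rw [pathIntegral, pathIntegral]
  congr 1
  refine intervalIntegral.integral_congr fun t ht => ?_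
  rw [Set.uIcc_of_le zero_le_one] at ht
  simp only [H (C.trace_subset k ((C.curve k).mem_trace ht))]

theorem integral_add {f g : ℂ → ℂ} (hf : ContinuousOn f C.trace) (hg : ContinuousOn g C.trace) :
    C.integral (fun v => f v + g v) = C.integral f + C.integral g := by
  simp only [integral, ← Finset.sum_add_distrib]
  refine Finset.sum_congr rfl fun k _ => ?_
  simp only [pathIntegral, add_mul]
  rw [intervalIntegral.integral_add ((C.curve k).intervalIntegrable (hf.mono (C.trace_subset k)))
    ((C.curve k).intervalIntegrable (hg.mono (C.trace_subset k))), mul_add]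

theorem integral_const_mul (a : ℂ) (f : ℂ → ℂ) :
    C.integral (fun v => a * f v) = a * C.integral f := by
  simp only [integral, Finset.mul_sum]
  refine Finset.sum_congr rfl fun k _ => ?_
  simp only [pathIntegral, mul_assoc, intervalIntegral.integral_const_mul]
  ring

theorem integral_zero : C.integral (fun _ => 0) = 0 := by
  simpa using C.integral_const_mul 0 (fun _ => 0)

theorem integral_sub {f g : ℂ → ℂ} (hf : ContinuousOn f C.trace) (hg : ContinuousOn g C.trace) :
    C.integral (fun v => f v - g v) = C.integral f - C.integral g := by
  have := C.integral_add hf (hg.const_mul (-1) : ContinuousOn (fun v => -1 * g v) C.trace)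
  rw [C.integral_const_mul] at this
  simpa [sub_eq_add_neg] using this

theorem integral_sum {ι : Type*} (s : Finset ι) {f : ι → ℂ → ℂ}
    (hf : ∀ i ∈ s, ContinuousOn (f i) C.trace) :
    C.integral (fun v => ∑ i ∈ s, f i v) = ∑ i ∈ s, C.integral (f i) := by
  classical
  induction s using Finset.induction_on with
  | empty => simpa using C.integral_zero
  | insert i s hi ih =>
    simp only [Finset.sum_insert hi]
    rw [C.integral_add (hf i (Finset.mem_insert_self i s)) (continuousOn_finsetSum s fun j hj =>
      hf j (Finset.mem_insert_of_mem hj)), ih fun j hj => hf j (Finset.mem_insert_of_mem hj)]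

theorem integral_eq_zero_of_primitive {F f : ℂ → ℂ} (hF : ∀ v ∈ C.trace, HasDerivAt F (f v) v)
    (hf : ContinuousOn f C.trace) : C.integral f = 0 :=
  Finset.sum_eq_zero fun k _ => (C.curve k).pathIntegral_eq_zero_of_primitive
    (fun v hv => hF v (C.trace_subset k hv)) (hf.mono (C.trace_subset k))

theorem integral_eval (p : ℂ[X]) : C.integral (fun v => p.eval v) = 0 := by
  have hm (k : ℕ) : C.integral (fun v => v ^ k) = 0 := by
    refine C.integral_eq_zero_of_primitive (F := fun v => ((k + 1 : ℕ) : ℂ)⁻¹ * v ^ (k + 1))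
      (fun v _ => ?_) (by fun_prop)
    have := (hasDerivAt_pow (k + 1) v).const_mul ((k + 1 : ℕ) : ℂ)⁻¹
    rwa [Nat.add_sub_cancel, inv_mul_cancel_left₀ (by exact_mod_cast k.succ_ne_zero)] at this
  induction p using Polynomial.induction_on' with
  | add p q hp hq =>
    simp only [Polynomial.eval_add]
    rw [C.integral_add p.continuous.continuousOn q.continuous.continuousOn, hp, hq, add_zero]
  | monomial k c =>
    simp only [Polynomial.eval_monomial]
    rw [C.integral_const_mul, hm, mul_zero]

theorem integral_inv_pow {z : ℂ} (hz : z ∉ C.trace) (n : ℕ) :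
    C.integral (fun v => ((v - z) ^ (n + 2))⁻¹) = 0 := by
  refine C.integral_eq_zero_of_primitive
    (F := fun v => -((n + 1 : ℕ) : ℂ)⁻¹ * ((v - z) ^ (n + 1))⁻¹) (fun v hv => ?_)
    (C.continuousOn_inv_pow hz _)
  have h0 : v - z ≠ 0 := by rw [sub_ne_zero]; rintro rfl; exact hz hv
  have := ((((hasDerivAt_id v).sub_const z).pow (n + 1)).inv (pow_ne_zero _ h0)).const_mul
    (-((n + 1 : ℕ) : ℂ)⁻¹)
  refine this.congr_deriv ?_
  have h1 : ((n : ℂ) + 1) ≠ 0 := by exact_mod_cast n.succ_ne_zero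
  simp only [Pi.pow_apply, id_eq, Nat.add_sub_cancel, mul_one]
  push_cast
  field_simp
  ring

theorem integral_inv_inside {z : ℂ} (hz : z ∈ C.inside) :
    C.integral (fun v => (v - z)⁻¹) = 1 := by
  obtain ⟨k, hk⟩ := Set.mem_iUnion.1 hz
  rw [integral, Finset.sum_eq_single_of_mem k (Finset.mem_univ k)]
  · exact hk.2
  · exact fun l _ hl => (C.winding_of_mem_inner (Ne.symm hl) hk).2

theorem integral_inv_outside {z : ℂ} (hz : z ∈ C.outside) :
    C.integral (fun v => (v - z)⁻¹) = 0 :=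
  Finset.sum_eq_zero fun k _ => ((C.curve k).positive z (hz k).1).resolve_right
    fun h => (hz k).2 ⟨(hz k).1, h⟩

theorem continuousOn_inv_prod {m : Multiset ℂ} (hm : ∀ z ∈ m, z ∉ C.trace) :
    ContinuousOn (fun v => ((m.map fun z => v - z).prod)⁻¹) C.trace := by
  refine ContinuousOn.inv₀ (Continuous.continuousOn
    (continuous_multiset_prod m fun z _ => by fun_prop)) fun v hv => ?_
  rw [Ne, Multiset.prod_eq_zero_iff, Multiset.mem_map]
  rintro ⟨z, hz, h⟩
  rw [sub_eq_zero] at h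
  exact hm z hz (h ▸ hv)

/-- `∮ dv / ∏ (v - λ_i) = 0` if all `λ_i` are outside of the curve. -/
theorem integral_inv_prod (n : ℕ) (m : Multiset ℂ) (hn : m.card = n + 1)
    (hm : ∀ z ∈ m, z ∈ C.outside) :
    C.integral (fun v => ((m.map fun z => v - z).prod)⁻¹) = 0 := by
  induction n generalizing m with
  | zero =>
    obtain ⟨a, rfl⟩ := Multiset.card_eq_one.1 hn
    simpa using C.integral_inv_outside (hm a (by simp))
  | succ n ih =>
    obtain ⟨a, m', rfl⟩ : ∃ a m', m = a ::ₘ m' := by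
      obtain ⟨a, ha⟩ := Multiset.exists_mem_of_ne_zero
        (show m ≠ 0 by rintro rfl; simp at hn)
      exact ⟨a, _, (Multiset.cons_erase ha).symm⟩
    rw [Multiset.card_cons, Nat.add_right_cancel_iff] at hn
    have ht (z : ℂ) (hz : z ∈ a ::ₘ m') : z ∉ C.trace := C.notMem_trace_of_outside (hm z hz)
    by_cases hall : ∀ b ∈ m', b = a
    · obtain rfl : m' = Multiset.replicate (n + 1) a :=
        Multiset.eq_replicate.2 ⟨hn, hall⟩
      rw [← Multiset.replicate_succ]
      simp only [Multiset.map_replicate, Multiset.prod_replicate]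
      exact C.integral_inv_pow (ht a (by simp)) n
    · push Not at hall
      obtain ⟨b, hb, hba⟩ := hall
      obtain ⟨m'', rfl⟩ : ∃ m'', m' = b ::ₘ m'' := ⟨_, (Multiset.cons_erase hb).symm⟩
      have hn' : m''.card = n := by simpa using hn
      have ha' : ∀ z ∈ a ::ₘ m'', z ∈ C.outside := fun z hz => hm z (by
        rcases Multiset.mem_cons.1 hz with rfl | h
        · simp
        · simp [h])
      have hb' : ∀ z ∈ b ::ₘ m'', z ∈ C.outside := fun z hz => hm z (by
        rcases Multiset.mem_cons.1 hz with rfl | h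
        · simp
        · simp [h])
      -- partial fractions for two distinct poles
      rw [C.integral_congr (g := fun v => (a - b)⁻¹ *
        ((((a ::ₘ m'').map fun z => v - z).prod)⁻¹ - (((b ::ₘ m'').map fun z => v - z).prod)⁻¹)),
        C.integral_const_mul,
        C.integral_sub (C.continuousOn_inv_prod fun z hz => C.notMem_trace_of_outside (ha' z hz))
          (C.continuousOn_inv_prod fun z hz => C.notMem_trace_of_outside (hb' z hz)),
        ih _ (by simpa using hn') ha', ih _ (by simpa using hn') hb', sub_self, mul_zero]
      intro v hv
      have h1 : v - a ≠ 0 := by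
        rw [sub_ne_zero]; rintro rfl; exact ht v (by simp) hv
      have h2 : v - b ≠ 0 := by
        rw [sub_ne_zero]; rintro rfl; exact ht v (by simp) hv
      have h3 : (m''.map fun z => v - z).prod ≠ 0 := by
        rw [Ne, Multiset.prod_eq_zero_iff, Multiset.mem_map]
        rintro ⟨z, hz, h⟩
        rw [sub_eq_zero] at h
        exact ht z (by simp [hz]) (h ▸ hv)
      have h4 : a - b ≠ 0 := sub_ne_zero.2 (Ne.symm hba)
      simp only [Multiset.map_cons, Multiset.prod_cons]
      field_simp
      ring

theorem continuousOn_eval_div {N D : ℂ[X]} (hD : ∀ v ∈ C.trace, D.eval v ≠ 0) :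
    ContinuousOn (fun v => N.eval v / D.eval v) C.trace :=
  N.continuous.continuousOn.div D.continuous.continuousOn hD

/-- `∮ N / D = 0` if the roots of `D` are outside of the curve. -/
theorem integral_eval_div {D : ℂ[X]} (hD : ∀ z, D.eval z = 0 → z ∈ C.outside)
    (N : ℂ[X]) : C.integral (fun v => N.eval v / D.eval v) = 0 := by
  have key (n : ℕ) (m : Multiset ℂ) (hn : m.card = n) (hm : ∀ z ∈ m, z ∈ C.outside) (N : ℂ[X]) :
      C.integral (fun v => N.eval v * ((m.map fun z => v - z).prod)⁻¹) = 0 := by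
    induction n generalizing m N with
    | zero =>
      obtain rfl := Multiset.card_eq_zero.1 hn
      simpa using C.integral_eval N
    | succ n ih =>
      obtain ⟨a, m', rfl⟩ : ∃ a m', m = a ::ₘ m' := by
        obtain ⟨a, ha⟩ := Multiset.exists_mem_of_ne_zero
          (show m ≠ 0 by rintro rfl; simp at hn)
        exact ⟨a, _, (Multiset.cons_erase ha).symm⟩
      have hm' : ∀ z ∈ m', z ∈ C.outside := fun z hz => hm z (by simp [hz])
      obtain ⟨N', hN'⟩ : Polynomial.X - Polynomial.C a ∣ N - Polynomial.C (N.eval a) :=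
        Polynomial.X_sub_C_dvd_sub_C_eval
      have hc1 := C.continuousOn_inv_prod fun z hz => C.notMem_trace_of_outside (hm z hz)
      have hc2 := C.continuousOn_inv_prod fun z hz => C.notMem_trace_of_outside (hm' z hz)
      rw [C.integral_congr (g := fun v => N.eval a * (((a ::ₘ m').map fun z => v - z).prod)⁻¹ +
          N'.eval v * ((m'.map fun z => v - z).prod)⁻¹),
        C.integral_add (continuousOn_const.fun_mul hc1) (N'.continuous.continuousOn.fun_mul hc2),
        C.integral_const_mul, C.integral_inv_prod n _ hn hm,
        ih m' (by simpa using hn) hm' N', mul_zero, add_zero]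
      intro v hv
      have h1 : v - a ≠ 0 := by
        rw [sub_ne_zero]; rintro rfl
        exact C.notMem_trace_of_outside (hm v (by simp)) hv
      have h2 : N.eval v = N.eval a + (v - a) * N'.eval v := by
        have := congrArg (Polynomial.eval v) hN'
        simp only [Polynomial.eval_sub, Polynomial.eval_C, Polynomial.eval_mul,
          Polynomial.eval_X] at this
        linear_combination this
      simp only [Multiset.map_cons, Multiset.prod_cons, mul_inv]
      rw [h2]
      field_simp
  have hsp := IsAlgClosed.splits D
  have heval (v : ℂ) : D.eval v = D.leadingCoeff * (D.roots.map fun z => v - z).prod := by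
    conv_lhs => rw [hsp.eq_prod_roots]
    rw [Polynomial.eval_mul, Polynomial.eval_C, Polynomial.eval_multiset_prod, Multiset.map_map]
    simp
  have := key _ D.roots rfl (fun z hz => hD z (Polynomial.isRoot_of_mem_roots hz)) N
  rw [C.integral_congr (g := fun v => D.leadingCoeff⁻¹ *
    (N.eval v * ((D.roots.map fun z => v - z).prod)⁻¹)), C.integral_const_mul, this, mul_zero]
  intro v _
  simp only [heval, div_eq_mul_inv, mul_inv]
  ring

end JordanCurve

/-! ### Scalar functionals and jets -/

/-- The functional `p ↦ p^{(n)}(z) / n!`. -/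
def jet (z : ℂ) (n : ℕ) : Functional ℂ :=
  (Polynomial.lcoeff ℂ n).comp (Polynomial.taylor z)

theorem jet_mul_zero (z : ℂ) (p : ℂ[X]) : jet z 0 ((Polynomial.X - Polynomial.C z) * p) = 0 := by
  simp [jet, Polynomial.taylor_mul]

theorem jet_mul_succ (z : ℂ) (n : ℕ) (p : ℂ[X]) :
    jet z (n + 1) ((Polynomial.X - Polynomial.C z) * p) = jet z n p := by
  simp [jet, Polynomial.taylor_mul, Polynomial.coeff_X_mul]

theorem jet_C_zero (z a : ℂ) : jet z 0 (Polynomial.C a) = a := by simp [jet]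

theorem jet_C_succ (z a : ℂ) (n : ℕ) : jet z (n + 1) (Polynomial.C a) = 0 := by simp [jet]

theorem exists_eq_add_X_sub_C_mul (z : ℂ) (p : ℂ[X]) :
    ∃ p', p = Polynomial.C (p.eval z) + (Polynomial.X - Polynomial.C z) * p' := by
  obtain ⟨p', h⟩ : Polynomial.X - Polynomial.C z ∣ p - Polynomial.C (p.eval z) :=
    Polynomial.X_sub_C_dvd_sub_C_eval
  exact ⟨p', by rw [← h]; ring⟩

/-- The jets at `z` are the functionals of the rational functions `(u - z)^{-n-1}`. -/
theorem hasValue_jet {z v : ℂ} (h : v ≠ z) (n : ℕ) :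
    HasValue (jet z n) v (((v - z) ^ (n + 1))⁻¹) := by
  have h0 : v - z ≠ 0 := sub_ne_zero.2 h
  induction n with
  | zero =>
    refine ⟨Polynomial.C (v - z)⁻¹, fun p => ?_, by rw [jet_C_zero]; simp⟩
    have : (Polynomial.C v - Polynomial.X) * Polynomial.C (v - z)⁻¹ * p =
        p - (Polynomial.X - Polynomial.C z) * (Polynomial.C (v - z)⁻¹ * p) := by
      have : (Polynomial.C v - Polynomial.C z) * Polynomial.C (v - z)⁻¹ = (1 : ℂ[X]) := by
        rw [← map_sub, ← map_mul, mul_inv_cancel₀ h0, map_one]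
      linear_combination p * this
    rw [this, map_sub, jet_mul_zero, sub_zero]
  | succ n ih =>
    obtain ⟨g, hg, hv⟩ := ih
    -- `1 / (v - X) = (1 + (X - z) / (v - X)) / (v - z)`
    refine ⟨Polynomial.C (v - z)⁻¹ * (1 + (Polynomial.X - Polynomial.C z) * g), fun p => ?_, ?_⟩
    · have : (Polynomial.C v - Polynomial.X) * (Polynomial.C (v - z)⁻¹ *
          (1 + (Polynomial.X - Polynomial.C z) * g)) * p = p +
          (Polynomial.X - Polynomial.C z) * ((Polynomial.C v - Polynomial.X) * g *
            (Polynomial.C (v - z)⁻¹ * p) - Polynomial.C (v - z)⁻¹ * p) := by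
        have : (Polynomial.C v - Polynomial.C z) * Polynomial.C (v - z)⁻¹ = (1 : ℂ[X]) := by
          rw [← map_sub, ← map_mul, mul_inv_cancel₀ h0, map_one]
        linear_combination p * this
      rw [this, map_add, jet_mul_succ, map_sub, hg, sub_self, add_zero]
    · rw [← Polynomial.smul_eq_C_mul, map_smul, map_add, jet_mul_succ, ← hv, ← map_one Polynomial.C,
        jet_C_succ, zero_add, pow_succ (v - z) (n + 1), mul_inv, smul_eq_mul, mul_comm]

/-- The space spanned by the jets at the points of `S`. -/
def jetSpan (S : Set ℂ) : Submodule ℂ (Functional ℂ) :=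
  Submodule.span ℂ {Y | ∃ z ∈ S, ∃ n, Y = jet z n}

/-- Multiplication by `X - z` is surjective on the span of the jets: a jet at `z` comes from the
next jet at `z`, and on the jets at `w ≠ z` it is `w - z` plus a nilpotent operator. -/
theorem jetSpan_surjective {S : Set ℂ} {z : ℂ} (hz : z ∈ S) {Y : Functional ℂ}
    (hY : Y ∈ jetSpan S) :
    ∃ Z ∈ jetSpan S, Z.comp (LinearMap.mulLeft ℂ (Polynomial.X - Polynomial.C z)) = Y := by
  have hj {w : ℂ} (hw : w ∈ S) (n : ℕ) : jet w n ∈ jetSpan S :=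
    Submodule.subset_span ⟨w, hw, n, rfl⟩
  induction hY using Submodule.span_induction with
  | zero => exact ⟨0, zero_mem _, by simp⟩
  | add Y Y' _ _ h h' =>
    obtain ⟨Z, hZ, rfl⟩ := h
    obtain ⟨Z', hZ', rfl⟩ := h'
    exact ⟨Z + Z', add_mem hZ hZ', by rw [LinearMap.add_comp]⟩
  | smul a Y _ h =>
    obtain ⟨Z, hZ, rfl⟩ := h
    exact ⟨a • Z, Submodule.smul_mem _ a hZ, by rw [LinearMap.smul_comp]⟩
  | mem Y h =>
    obtain ⟨w, hw, n, rfl⟩ := h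
    by_cases hwz : w = z
    · subst hwz
      exact ⟨jet w (n + 1), hj hw _, LinearMap.ext fun p => jet_mul_succ w n p⟩
    have h0 : w - z ≠ 0 := sub_ne_zero.2 hwz
    have hsplit (p : ℂ[X]) : (Polynomial.X - Polynomial.C z) * p =
        (Polynomial.X - Polynomial.C w) * p + (w - z) • p := by
      rw [Polynomial.smul_eq_C_mul, map_sub]; ring
    induction n with
    | zero =>
      refine ⟨(w - z)⁻¹ • jet w 0, Submodule.smul_mem _ _ (hj hw 0), LinearMap.ext fun p => ?_⟩
      rw [LinearMap.comp_apply, LinearMap.mulLeft_apply, hsplit, LinearMap.smul_apply, map_add,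
        jet_mul_zero, map_smul, zero_add, smul_smul, inv_mul_cancel₀ h0, one_smul]
    | succ n ih =>
      obtain ⟨Z, hZ, hZn⟩ := ih
      refine ⟨(w - z)⁻¹ • (jet w (n + 1) - Z),
        Submodule.smul_mem _ _ (sub_mem (hj hw _) hZ), LinearMap.ext fun p => ?_⟩
      have h1 := LinearMap.congr_fun hZn p
      rw [LinearMap.comp_apply, LinearMap.mulLeft_apply] at h1
      rw [LinearMap.comp_apply, LinearMap.mulLeft_apply, LinearMap.smul_apply, LinearMap.sub_apply,
        h1, hsplit, map_add, jet_mul_succ, map_smul, add_sub_cancel_left, smul_smul,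
        inv_mul_cancel₀ h0, one_smul]

/-- A functional killed by a polynomial is a combination of jets at its roots. -/
theorem mem_jetSpan {q : ℂ[X]} (hq0 : q ≠ 0) {Y : Functional ℂ} (hY : Kills q Y) :
    Y ∈ jetSpan {z | q.eval z = 0} := by
  have key (n : ℕ) (m : Multiset ℂ) (hn : m.card = n) (S : Set ℂ) (hm : ∀ z ∈ m, z ∈ S)
      (Y : Functional ℂ) (hY : Kills (m.map fun z => Polynomial.X - Polynomial.C z).prod Y) :
      Y ∈ jetSpan S := by
    induction n generalizing m Y with
    | zero =>
      obtain rfl := Multiset.card_eq_zero.1 hn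
      have : Y = 0 := LinearMap.ext fun p => by simpa using hY p
      rw [this]; exact zero_mem _
    | succ n ih =>
      obtain ⟨a, m', rfl⟩ : ∃ a m', m = a ::ₘ m' := by
        obtain ⟨a, ha⟩ := Multiset.exists_mem_of_ne_zero
          (show m ≠ 0 by rintro rfl; simp at hn)
        exact ⟨a, _, (Multiset.cons_erase ha).symm⟩
      rw [Multiset.map_cons, Multiset.prod_cons] at hY
      have h1 := ih m' (by simpa using hn) (fun z hz => hm z (by simp [hz]))
        (Y.comp (LinearMap.mulLeft ℂ (Polynomial.X - Polynomial.C a))) fun p => by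
          rw [LinearMap.comp_apply, LinearMap.mulLeft_apply, ← mul_assoc, hY]
      have ha : a ∈ S := hm a (by simp)
      obtain ⟨Z, hZ, hZY⟩ := jetSpan_surjective ha h1
      have h2 : Y = Z + (Y - Z) 1 • jet a 0 := by
        refine LinearMap.ext fun p => ?_
        obtain ⟨p', hp'⟩ := exists_eq_add_X_sub_C_mul a p
        have h3 : Z ((Polynomial.X - Polynomial.C a) * p') =
            Y ((Polynomial.X - Polynomial.C a) * p') := LinearMap.congr_fun hZY p'
        have h4 (Y : Functional ℂ) (t : ℂ) : Y (Polynomial.C t) = t * Y 1 := by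
          rw [← mul_one (Polynomial.C t), ← Polynomial.smul_eq_C_mul, map_smul, smul_eq_mul]
        rw [hp']
        simp only [LinearMap.add_apply, LinearMap.smul_apply, LinearMap.sub_apply, map_add,
          jet_mul_zero, jet_C_zero, h3, h4 Y, h4 Z, smul_eq_mul]
        ring
      rw [h2]
      exact add_mem hZ (Submodule.smul_mem _ _ (Submodule.subset_span ⟨a, ha, 0, rfl⟩))
  refine key _ q.roots rfl _ (fun z hz => Polynomial.isRoot_of_mem_roots hz) Y ?_
  have := hY.mul_left (Polynomial.C q.leadingCoeff⁻¹)
  have h1 := (IsAlgClosed.splits q).eq_prod_roots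
  have h2 : Polynomial.C q.leadingCoeff⁻¹ * q =
      (q.roots.map fun z => Polynomial.X - Polynomial.C z).prod := by
    refine (congrArg (Polynomial.C q.leadingCoeff⁻¹ * ·) h1).trans ?_
    rw [← mul_assoc, ← map_mul, inv_mul_cancel₀ (Polynomial.leadingCoeff_ne_zero.2 hq0), map_one,
      one_mul]
  rwa [h2] at this

namespace JordanCurve

variable (C : JordanCurve)

/-- Cauchy's formula for the derivatives of a polynomial. -/
theorem integral_eval_jet {z : ℂ} (hz : z ∈ C.inside) (n : ℕ) (p : ℂ[X]) :
    C.integral (fun v => p.eval v * ((v - z) ^ (n + 1))⁻¹) = jet z n p := by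
  have ht := C.notMem_trace_of_inside hz
  have hne {v : ℂ} (hv : v ∈ C.trace) : v - z ≠ 0 := by
    rw [sub_ne_zero]; rintro rfl; exact ht hv
  induction n generalizing p with
  | zero =>
    obtain ⟨p', hp'⟩ := exists_eq_add_X_sub_C_mul z p
    rw [C.integral_congr (g := fun v => p.eval z * ((v - z) ^ 1)⁻¹ + p'.eval v),
      C.integral_add (continuousOn_const.fun_mul (C.continuousOn_inv_pow ht 1))
        p'.continuous.continuousOn, C.integral_const_mul, C.integral_eval]
    · conv_rhs => rw [hp']
      simp only [pow_one]
      rw [C.integral_inv_inside hz, map_add, jet_mul_zero, jet_C_zero]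
      ring
    · intro v hv
      have := hne hv
      have h2 := congrArg (Polynomial.eval v) hp'
      simp only [Polynomial.eval_add, Polynomial.eval_C, Polynomial.eval_mul, Polynomial.eval_sub,
        Polynomial.eval_X] at h2
      simp only [h2]
      field_simp
      ring
  | succ n ih =>
    obtain ⟨p', hp'⟩ := exists_eq_add_X_sub_C_mul z p
    rw [C.integral_congr (g := fun v => p.eval z * ((v - z) ^ (n + 2))⁻¹ +
        p'.eval v * ((v - z) ^ (n + 1))⁻¹),
      C.integral_add (continuousOn_const.fun_mul (C.continuousOn_inv_pow ht _))
        (p'.continuous.continuousOn.fun_mul (C.continuousOn_inv_pow ht _)), C.integral_const_mul,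
      C.integral_inv_pow ht, ih]
    · conv_rhs => rw [hp']
      rw [map_add, jet_mul_succ, jet_C_succ]
      ring
    · intro v hv
      have := hne hv
      have h2 := congrArg (Polynomial.eval v) hp'
      simp only [Polynomial.eval_add, Polynomial.eval_C, Polynomial.eval_mul, Polynomial.eval_sub,
        Polynomial.eval_X] at h2
      simp only [h2]
      field_simp
      ring

/-- `∮ p(v) Y((v - X)⁻¹) dv = Y(p)` if the poles are inside. -/
theorem integral_eval_mul {q : ℂ[X]} (hq0 : q ≠ 0) (hq : ∀ z, q.eval z = 0 → z ∈ C.inside)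
    {Y : Functional ℂ} (hY : Kills q Y) {x : ℂ → ℂ} (hx : ∀ v ∈ C.trace, HasValue Y v (x v)) :
    ContinuousOn x C.trace ∧ ∀ p : ℂ[X], C.integral (fun v => p.eval v * x v) = Y p := by
  obtain ⟨x', hx', hc, hint⟩ : ∃ x' : ℂ → ℂ, (∀ v ∈ C.trace, HasValue Y v (x' v)) ∧
      ContinuousOn x' C.trace ∧ ∀ p : ℂ[X], C.integral (fun v => p.eval v * x' v) = Y p := by
    have := mem_jetSpan hq0 hY
    clear hx hY
    induction this using Submodule.span_induction with
    | zero => exact ⟨0, fun v _ => hasValue_zero v, continuousOn_const, fun p => by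
        simpa using C.integral_zero⟩
    | add Y Y' _ _ h h' =>
      obtain ⟨x, h1, h2, h3⟩ := h
      obtain ⟨x', h1', h2', h3'⟩ := h'
      refine ⟨x + x', fun v hv => (h1 v hv).add (h1' v hv), h2.add h2', fun p => ?_⟩
      simp only [Pi.add_apply, mul_add]
      rw [C.integral_add (p.continuous.continuousOn.fun_mul h2)
        (p.continuous.continuousOn.fun_mul h2'),
        h3, h3', LinearMap.add_apply]
    | smul a Y _ h =>
      obtain ⟨x, h1, h2, h3⟩ := h
      refine ⟨a • x, fun v hv => (h1 v hv).smul a, h2.const_smul a, fun p => ?_⟩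
      simp only [Pi.smul_apply, smul_eq_mul, mul_left_comm _ a]
      rw [C.integral_const_mul, h3, LinearMap.smul_apply, smul_eq_mul]
    | mem Y h =>
      obtain ⟨z, hz, n, rfl⟩ := h
      have ht := C.notMem_trace_of_inside (hq z hz)
      exact ⟨fun v => ((v - z) ^ (n + 1))⁻¹, fun v hv => hasValue_jet
        (by rintro rfl; exact ht hv) n, C.continuousOn_inv_pow ht _,
        C.integral_eval_jet (hq z hz) n⟩
  have he : Set.EqOn x x' C.trace := fun v hv => (hx v hv).unique (hx' v hv)
  refine ⟨hc.congr he, fun p => ?_⟩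
  rw [← hint p]
  exact C.integral_congr fun v hv => by simp only [he hv]

/-- `∮ N(v) / D(v) Y((v - X)⁻¹) dv = Y(α N)`, where `α D ≡ 1` modulo a polynomial `q` killing `Y`,
if the roots of `q` are inside and those of `D` outside. -/
theorem integral_eval_div_mul {q D α β : ℂ[X]} (hq0 : q ≠ 0)
    (hq : ∀ z, q.eval z = 0 → z ∈ C.inside)
    (hD : ∀ z, D.eval z = 0 → z ∈ C.outside) (hαβ : α * D + β * q = 1)
    {Y : Functional ℂ} (hY : Kills q Y) {x : ℂ → ℂ} (hx : ∀ v ∈ C.trace, HasValue Y v (x v))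
    (N : ℂ[X]) : C.integral (fun v => N.eval v / D.eval v * x v) = Y (α * N) := by
  obtain ⟨hc, hint⟩ := C.integral_eval_mul hq0 hq hY hx
  -- the polynomial `q(v) x(v)`
  obtain ⟨Q, hQ⟩ : ∃ Q : ℂ[X], ∀ v ∈ C.trace, q.eval v * x v = Q.eval v := by
    set φ : ℂ⟦X⟧ := PowerSeries.mk fun n => if n = 0 then 0 else Y (Polynomial.X ^ (n - 1)) with hφ
    have hφY : modeF φ = Y := poly_ext fun r => by rw [modeF_X_pow, hφ, PowerSeries.coeff_mk]; simp
    have hφ0 : PowerSeries.coeff 0 φ = 0 := by rw [hφ, PowerSeries.coeff_mk]; simp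
    refine ⟨polyPart φ q, fun v hv => ?_⟩
    have hqv : q.eval v ≠ 0 := fun h => C.notMem_trace_of_inside (hq v h) hv
    have h1 := ratValue_eq (φ := φ) (u := v) (e := x v) (by rw [hφY]; exact hx v hv)
    rw [ratValue_eq_eval (D := q) (by rwa [hφY]) hqv, hφ0, zero_add] at h1
    rw [← h1, smul_eq_mul, mul_inv_cancel_left₀ hqv]
    rfl
  have hDt : ∀ v ∈ C.trace, D.eval v ≠ 0 := fun v hv h => C.notMem_trace_of_outside (hD v h) hv
  rw [C.integral_congr (g := fun v => (α * N).eval v * x v + (N * β * Q).eval v / D.eval v),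
    C.integral_add ((α * N).continuous.continuousOn.fun_mul hc) (C.continuousOn_eval_div hDt), hint,
    C.integral_eval_div hD, add_zero]
  intro v hv
  have h1 := congrArg (Polynomial.eval v) hαβ
  simp only [Polynomial.eval_add, Polynomial.eval_mul, Polynomial.eval_one] at h1
  have h2 := hDt v hv
  simp only [Polynomial.eval_mul, ← hQ v hv]
  field_simp
  linear_combination -(N.eval v * x v) * h1

section Vector

variable {E : Type*} [Ring E] [Algebra ℂ E] [FiniteDimensional ℂ E]

theorem vecIntegral_congr {F G : ℂ → E} (H : Set.EqOn F G C.trace) :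
    C.vecIntegral F = C.vecIntegral G := by
  refine Finset.sum_congr rfl fun k _ => ?_
  rw [C.integral_congr (g := fun v => (Module.finBasis ℂ E).repr (G v) k) fun v hv => by
    simp only [H hv]]

/-- `∮ P(v) / D(v) x(v) dv = (α P · Y)(1)` for the rational function `x(v) = Y((v - X)⁻¹)`, where
`α D ≡ 1` modulo a polynomial `q` killing `Y`, if the roots of `q` are inside and those of `D`
outside. -/
theorem vecIntegral_eval_div_mul {q D α β : ℂ[X]} (hq0 : q ≠ 0)
    (hq : ∀ z, q.eval z = 0 → z ∈ C.inside)
    (hD : ∀ z, D.eval z = 0 → z ∈ C.outside) (hαβ : α * D + β * q = 1)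
    {Y : Functional E} (hY : Kills q Y) {x : ℂ → E} (hx : ∀ v ∈ C.trace, HasValue Y v (x v))
    (P : E[X]) :
    C.vecIntegral (fun v => (D.eval v)⁻¹ • (P.eval (algebraMap ℂ E v) * x v)) =
      act (scalarPoly α * P) Y 1 := by
  set b := Module.finBasis ℂ E with hb
  refine b.ext_elem fun j => ?_
  set ℓ : E →ₗ[ℂ] ℂ := b.coord j with hℓ
  have h1 : b.repr (C.vecIntegral (fun v => (D.eval v)⁻¹ • (P.eval (algebraMap ℂ E v) * x v))) j =
      C.integral fun v => ℓ ((D.eval v)⁻¹ • (P.eval (algebraMap ℂ E v) * x v)) := by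
    rw [vecIntegral, map_sum, Finsupp.finsetSum_apply]
    simp only [map_smul, ← hb, b.repr_self, Finsupp.smul_apply, Finsupp.single_apply, smul_eq_mul,
      mul_ite, mul_one, mul_zero]
    rw [Finset.sum_ite_eq' Finset.univ j, if_pos (Finset.mem_univ j)]
    rfl
  have hx' (c : E) : ∀ v ∈ C.trace,
      HasValue ((ℓ.comp (LinearMap.mulLeft ℂ c)).comp Y) v (ℓ (c * x v)) :=
    fun v hv => (hx v hv).map (ℓ.comp (LinearMap.mulLeft ℂ c))
  have hY' (c : E) : Kills q ((ℓ.comp (LinearMap.mulLeft ℂ c)).comp Y) := fun p => by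
    simp [hY p]
  have hterm (k : ℕ) (c : E) :=
    C.integral_eval_div_mul hq0 hq hD hαβ (hY' c) (hx' c) (Polynomial.X ^ k)
  have hDt : ∀ v ∈ C.trace, D.eval v ≠ 0 := fun v hv h => C.notMem_trace_of_outside (hD v h) hv
  rw [h1]
  change _ = ℓ _
  rw [C.integral_congr (g := fun v => ∑ k ∈ P.support,
    ((Polynomial.X ^ k : ℂ[X]).eval v / D.eval v * ℓ (P.coeff k * x v))), C.integral_sum]
  · simp only [hterm]
    rw [(scalarPoly_comm α P).eq, act_mul_apply, act_apply, Polynomial.sum, map_sum]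
    refine Finset.sum_congr rfl fun k _ => ?_
    rw [act_scalar]
    simp
  · exact fun k _ => (C.continuousOn_eval_div hDt).mul
      (C.integral_eval_mul hq0 hq (hY' _) (hx' _)).1
  · intro v hv
    simp only [Polynomial.eval_eq_sum (p := P), Polynomial.sum, Finset.sum_mul, Finset.smul_sum,
      map_sum, map_smul, smul_eq_mul, Polynomial.eval_pow, Polynomial.eval_X]
    refine Finset.sum_congr rfl fun k _ => ?_
    have : P.coeff k * algebraMap ℂ E v ^ k * x v = v ^ k • (P.coeff k * x v) := by
      rw [← map_pow, ← Algebra.commutes, mul_assoc, ← Algebra.smul_def]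
    rw [this, map_smul, smul_eq_mul]
    ring

end Vector

end JordanCurve

end Residues

/-! ### Existence of Jordan curves -/

section Circles

/-- The parametrisation of a circle by `[0, 1]`. -/
def circlePath (a : ℂ) (r : ℝ) (t : ℝ) : ℂ := circleMap a r (2 * Real.pi * t)

theorem hasDerivAt_circlePath (a : ℂ) (r t : ℝ) : HasDerivAt (circlePath a r)
    ((2 * Real.pi : ℝ) • deriv (circleMap a r) (2 * Real.pi * t)) t := by
  have h := (differentiable_circleMap a r (2 * Real.pi * t)).hasDerivAt
  have h2 : HasDerivAt (fun t : ℝ => 2 * Real.pi * t) (2 * Real.pi) t := by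
    simpa using (hasDerivAt_id t).const_mul (2 * Real.pi)
  exact h.scomp t h2

theorem pathIntegral_circlePath (a : ℂ) (r : ℝ) (f : ℂ → ℂ) :
    pathIntegral (circlePath a r) f = (2 * (Real.pi : ℂ) * Complex.I)⁻¹ * ∮ z in C(a, r), f z := by
  rw [pathIntegral, circleIntegral]
  congr 1
  have h := intervalIntegral.smul_integral_comp_mul_left (a := 0) (b := 1)
    (fun θ => deriv (circleMap a r) θ • f (circleMap a r θ)) (2 * Real.pi)
  rw [mul_zero, mul_one] at h
  rw [← h, ← intervalIntegral.integral_smul]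
  refine intervalIntegral.integral_congr fun t _ => ?_
  simp only [(hasDerivAt_circlePath a r t).deriv, circlePath, smul_eq_mul]
  rw [mul_comm, smul_mul_assoc]

theorem winding_circlePath_inside {a z : ℂ} {r : ℝ} (hz : z ∈ Metric.ball a r) :
    winding (circlePath a r) z = 1 := by
  rw [winding, pathIntegral_circlePath, circleIntegral.integral_sub_inv_of_mem_ball hz,
    inv_mul_cancel₀ Complex.two_pi_I_ne_zero]

theorem winding_circlePath_outside {a z : ℂ} {r : ℝ} (hr : 0 ≤ r)
    (hz : z ∉ Metric.closedBall a r) : winding (circlePath a r) z = 0 := by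
  have hne {v : ℂ} (hv : v ∈ Metric.closedBall a r) : v - z ≠ 0 := by
    rw [sub_ne_zero]; rintro rfl; exact hz hv
  rw [winding, pathIntegral_circlePath,
    Complex.circleIntegral_eq_zero_of_differentiable_on_off_countable hr Set.countable_empty,
    mul_zero]
  · exact fun v hv => ContinuousAt.continuousWithinAt (ContinuousAt.inv₀ (by fun_prop) (hne hv))
  · exact fun v hv => DifferentiableAt.inv (by fun_prop) (hne (Metric.ball_subset_closedBall hv.1))

theorem image_circlePath (a : ℂ) {r : ℝ} (hr : 0 ≤ r) :
    circlePath a r '' Set.Icc 0 1 = Metric.sphere a r := by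
  refine Set.Subset.antisymm ?_ fun z hz => ?_
  · rintro _ ⟨t, _, rfl⟩
    exact circleMap_mem_sphere a hr _
  · rw [← abs_of_nonneg hr, ← image_circleMap_Ioc a r] at hz
    obtain ⟨θ, hθ, rfl⟩ := hz
    have hπ := Real.two_pi_pos
    refine ⟨θ / (2 * Real.pi), ⟨by have := hθ.1.le; positivity, ?_⟩, ?_⟩
    · rw [div_le_one hπ]; exact hθ.2
    · rw [circlePath, mul_div_cancel₀ _ hπ.ne']

/-- A circle as a simple closed curve. -/
def circleCurve (a : ℂ) (r : ℝ) (hr : 0 < r) : SimpleClosedCurve where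
  path := circlePath a r
  continuousOn := fun t _ => (hasDerivAt_circlePath a r t).continuousAt.continuousWithinAt
  closed := by
    have := periodic_circleMap a r 0
    simp only [circlePath, mul_zero, mul_one]
    rw [← this, zero_add]
  simple := by
    intro t ht s hs h
    have hπ := Real.two_pi_pos
    have hmem {t : ℝ} (ht : t ∈ Set.Ico (0 : ℝ) 1) :
        2 * Real.pi * t ∈ Set.Ico 0 (2 * Real.pi) :=
      ⟨mul_nonneg hπ.le ht.1, by nlinarith [ht.2]⟩
    exact mul_left_cancel₀ hπ.ne'
      (injOn_circleMap_of_abs_sub_le' hr.ne' (by simp) (hmem ht) (hmem hs) h)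
  corners := ∅
  smooth := fun t _ _ => by
    have : ContDiff ℝ 1 (circlePath a r) :=
      (contDiff_circleMap a r).comp (by fun_prop)
    exact this.contDiffAt
  rectifiable := by
    have : deriv (circlePath a r) =
        fun t => (2 * Real.pi : ℝ) • deriv (circleMap a r) (2 * Real.pi * t) :=
      funext fun t => (hasDerivAt_circlePath a r t).deriv
    rw [this]
    refine Continuous.intervalIntegrable ?_ 0 1
    simp only [deriv_circleMap]
    fun_prop
  positive := fun z hz => by
    rw [image_circlePath a hr.le] at hz
    rcases lt_trichotomy (dist z a) r with h | h | h
    · exact Or.inr (winding_circlePath_inside h)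
    · exact absurd h hz
    · exact Or.inl (winding_circlePath_outside hr.le (by simpa using h))

theorem trace_circleCurve (a : ℂ) (r : ℝ) (hr : 0 < r) :
    (circleCurve a r hr).trace = Metric.sphere a r := image_circlePath a hr.le

theorem inner_circleCurve (a : ℂ) (r : ℝ) (hr : 0 < r) :
    (circleCurve a r hr).inner = Metric.ball a r := by
  ext z
  rw [SimpleClosedCurve.inner, trace_circleCurve, Set.mem_ofPred_eq]
  constructor
  · rintro ⟨h1, h2⟩
    by_contra h3
    have h4 : z ∉ Metric.closedBall a r := fun h4 => h1 (le_antisymm h4 (not_lt.1 h3))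
    have h5 : winding (circlePath a r) z = 1 := h2
    rw [winding_circlePath_outside hr.le h4] at h5
    exact zero_ne_one h5
  · intro h
    exact ⟨fun h1 => (ne_of_lt h) h1, winding_circlePath_inside h⟩

/-- Small circles separate two disjoint finite sets. -/
theorem exists_jordanCurve {S T : Set ℂ} (hS : S.Finite) (hT : T.Finite) (hST : Disjoint S T) :
    ∃ C : JordanCurve, S ⊆ C.inside ∧ T ⊆ C.outside := by
  obtain ⟨r, hr, hsep⟩ : ∃ r : ℝ, 0 < r ∧ ∀ a ∈ S ∪ T, ∀ b ∈ S ∪ T, a ≠ b → 2 * r < dist a b := by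
    have hfin : ((S ∪ T) ×ˢ (S ∪ T)).Finite := (hS.union hT).prod (hS.union hT)
    have : ∀ᶠ r in nhdsWithin (0 : ℝ) (Set.Ioi 0), 0 < r ∧
        ∀ p ∈ (S ∪ T) ×ˢ (S ∪ T), p.1 ≠ p.2 → 2 * r < dist p.1 p.2 := by
      refine eventually_mem_nhdsWithin.and ?_
      refine Filter.Eventually.filter_mono nhdsWithin_le_nhds ?_
      rw [Filter.eventually_all_finite hfin]
      intro p _
      by_cases hp : p.1 = p.2
      · exact Filter.Eventually.of_forall fun _ h => absurd hp h
      · have : ∀ᶠ r in nhds (0 : ℝ), 2 * r < dist p.1 p.2 :=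
          ContinuousAt.eventually_lt (by fun_prop) continuousAt_const (by simpa using hp)
        exact this.mono fun r hr _ => hr
    obtain ⟨r, hr, h⟩ := this.exists
    exact ⟨r, hr, fun a ha b hb hab => h (a, b) ⟨ha, hb⟩ hab⟩
  have := hS.fintype
  set e := (Fintype.equivFin S).symm with he
  have hcl {k l : Fin (Fintype.card S)} (hkl : k ≠ l) :
      Disjoint (Metric.closedBall (e k : ℂ) r) (Metric.closedBall (e l : ℂ) r) := by
    refine Metric.closedBall_disjoint_closedBall ?_
    have := hsep (e k) (Or.inl (e k).2) (e l) (Or.inl (e l).2)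
      (fun h => hkl (e.injective (Subtype.ext h)))
    linarith
  refine ⟨⟨Fintype.card S, fun k => circleCurve (e k) r hr, ?_, ?_⟩, ?_, ?_⟩
  · intro k l hkl
    simp only [trace_circleCurve]
    exact (hcl hkl).mono Metric.sphere_subset_closedBall Metric.sphere_subset_closedBall
  · intro k l hkl
    simp only [inner_circleCurve]
    exact (hcl hkl).mono Metric.ball_subset_closedBall Metric.ball_subset_closedBall
  · intro z hz
    refine Set.mem_iUnion.2 ⟨e.symm ⟨z, hz⟩, ?_⟩
    simp only [inner_circleCurve, Equiv.apply_symm_apply]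
    exact Metric.mem_ball_self hr
  · intro z hz k
    have hne : z ≠ (e k : ℂ) := by
      rintro h; exact Set.disjoint_left.1 hST (e k).2 (h ▸ hz)
    have := hsep z (Or.inr hz) (e k) (Or.inl (e k).2) hne
    simp only [trace_circleCurve, inner_circleCurve, Metric.mem_sphere, Metric.mem_ball]
    exact ⟨by linarith [this], by linarith [this]⟩

end Circles

/-! ### The quadratic relations -/

section Quadratic

variable {I : Type*} {E : Type*} [Ring E] [Algebra ℂ E]

/-- The relations of the Yangian other than the Serre relations, for operators `ξ_{i,r}` and
`x^±_{i,r}`. -/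
structure QuadRel (A : Matrix I I ℤ) (d : I → ℂ) (h : ℂ) (ξ : I → ℕ → E)
    (x : ℤˣ → I → ℕ → E) : Prop where
  y1 : ∀ i j r s, comm (ξ i r) (ξ j s) = 0
  y2 : ∀ e i j s, comm (ξ i 0) (x e j s) = (sgn e * (d i * A i j)) • x e j s
  y3 : ∀ e i j r s, comm (ξ i (r + 1)) (x e j s) - comm (ξ i r) (x e j (s + 1)) =
    (sgn e * (h * (d i * A i j) / 2)) • (ξ i r * x e j s + x e j s * ξ i r)
  y4 : ∀ e i j r s, comm (x e i (r + 1)) (x e j s) - comm (x e i r) (x e j (s + 1)) =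
    (sgn e * (h * (d i * A i j) / 2)) • (x e i r * x e j s + x e j s * x e i r)
  y5_same : ∀ i r s, comm (x 1 i r) (x (-1) i s) = ξ i (r + s)
  y5_ne : ∀ i j r s, i ≠ j → comm (x 1 i r) (x (-1) j s) = 0

/-- Conditions on the Cartan matrix and the symmetrising numbers. These are the only properties of
the Cartan data that the tensor product depends on. -/
structure CartanConditions (A : Matrix I I ℤ) (d : I → ℂ) : Prop where
  diag : ∀ i, A i i = 2
  ne_zero : ∀ i, d i ≠ 0
  symm : ∀ i j, d i * A i j = d j * A j i

theorem Rep.quadRel {A : Matrix I I ℤ} {d : I → ℂ} {h : ℂ} {V : Type*} [AddCommGroup V]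
    [Module ℂ V] (ρ : Rep A d h V) :
    QuadRel A d h (fun i r => ρ (yxi A d h i r)) (fun e i r => ρ (yx A d h e i r)) where
  y1 i j r s := by
    have := congrArg ρ (rel_eq (Rel.y1 (A := A) (d := d) (h := h) i j r s))
    simp only [map_sub, map_mul, map_zero] at this
    exact this
  y2 e i j s := by
    have := congrArg ρ (rel_eq (Rel.y2 (A := A) (d := d) (h := h) e i j s))
    simp only [map_sub, map_mul, map_smul] at this
    exact this
  y3 e i j r s := by
    have := congrArg ρ (rel_eq (Rel.y3 (A := A) (d := d) (h := h) e i j r s))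
    simp only [map_sub, map_mul, map_smul, map_add] at this
    exact this
  y4 e i j r s := by
    have := congrArg ρ (rel_eq (Rel.y4 (A := A) (d := d) (h := h) e i j r s))
    simp only [map_sub, map_mul, map_smul, map_add] at this
    exact this
  y5_same i r s := by
    have := congrArg ρ (rel_eq (Rel.y5_same (A := A) (d := d) (h := h) i r s))
    simp only [map_sub, map_mul] at this
    exact this
  y5_ne i j r s hij := by
    have := congrArg ρ (rel_eq (Rel.y5_ne (A := A) (d := d) (h := h) i j r s hij))
    simp only [map_sub, map_mul, map_zero] at this
    exact this

/-- The series `1 + h ∑ y_r u^{-r-1}`. -/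
def oneSeries (h : ℂ) (y : ℕ → E) : E⟦X⟧ :=
  PowerSeries.mk fun n => match n with
    | 0 => 1
    | r + 1 => h • y r

theorem coeff_oneSeries_zero (h : ℂ) (y : ℕ → E) : PowerSeries.coeff 0 (oneSeries h y) = 1 := by
  rw [oneSeries, PowerSeries.coeff_mk]

theorem coeff_oneSeries_succ (h : ℂ) (y : ℕ → E) (r : ℕ) :
    PowerSeries.coeff (r + 1) (oneSeries h y) = h • y r := by
  rw [oneSeries, PowerSeries.coeff_mk]

/-- The series `1 + h ∑ y_r u^{-r-1}` is invertible. -/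
theorem oneSeries_mul_inv (h : ℂ) (y : ℕ → E) :
    oneSeries h y * PowerSeries.invOfUnit (oneSeries h y) 1 = 1 :=
  PowerSeries.mul_invOfUnit _ _ (by
    rw [← PowerSeries.coeff_zero_eq_constantCoeff_apply, coeff_oneSeries_zero]; rfl)

theorem inv_mul_oneSeries (h : ℂ) (y : ℕ → E) :
    PowerSeries.invOfUnit (oneSeries h y) 1 * oneSeries h y = 1 :=
  PowerSeries.invOfUnit_mul _ _ (by
    rw [← PowerSeries.coeff_zero_eq_constantCoeff_apply, coeff_oneSeries_zero]; rfl)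

/-- The commutation relation of `ξ(u)` with two consecutive modes `y`, `z` of `x`, as an identity
of power series in `u⁻¹`. -/
theorem oneSeries_comm_iff {h b c : ℂ} (hh : h ≠ 0) (hb : 2 * b = h * c) (ξ : ℕ → E) (y z : E) :
    oneSeries h ξ * (PowerSeries.C y - PowerSeries.X * PowerSeries.C (z + b • y)) =
      (PowerSeries.C y - PowerSeries.X * PowerSeries.C (z - b • y)) * oneSeries h ξ ↔
    comm (ξ 0) y = c • y ∧ ∀ r, comm (ξ (r + 1)) y - comm (ξ r) z = b • (ξ r * y + y * ξ r) := by
  have e0 : comm (ξ 0) y = c • y ↔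
      h • ξ 0 * y - (z + b • y) = y * h • ξ 0 - (z - b • y) := by
    rw [← sub_eq_zero, ← sub_eq_zero (b := y * h • ξ 0 - (z - b • y)),
      ← smul_eq_zero_iff_right hh]
    have : h • (comm (ξ 0) y - c • y) =
        h • ξ 0 * y - (z + b • y) - (y * h • ξ 0 - (z - b • y)) := by
      rw [smul_sub, smul_smul, ← hb, two_mul, add_smul]
      simp only [comm, smul_sub, smul_mul_assoc, mul_smul_comm]
      abel
    rw [this]
  have e1 (r : ℕ) : comm (ξ (r + 1)) y - comm (ξ r) z = b • (ξ r * y + y * ξ r) ↔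
      h • ξ (r + 1) * y - h • ξ r * (z + b • y) =
        y * h • ξ (r + 1) - (z - b • y) * h • ξ r := by
    rw [← sub_eq_zero, ← sub_eq_zero (b := y * h • ξ (r + 1) - (z - b • y) * h • ξ r),
      ← smul_eq_zero_iff_right hh]
    have : h • (comm (ξ (r + 1)) y - comm (ξ r) z - b • (ξ r * y + y * ξ r)) =
        h • ξ (r + 1) * y - h • ξ r * (z + b • y) -
          (y * h • ξ (r + 1) - (z - b • y) * h • ξ r) := by
      simp only [comm, smul_sub, smul_add, smul_mul_assoc, mul_smul_comm, mul_add, add_mul, mul_sub,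
        sub_mul, smul_comm h b]
      abel
    rw [this]
  have l0 (φ : E⟦X⟧) (w : E) : PowerSeries.coeff 0 (φ * (PowerSeries.C y -
      PowerSeries.X * PowerSeries.C w)) = PowerSeries.coeff 0 φ * y := by
    rw [mul_sub, map_sub, PowerSeries.coeff_mul_C, ← mul_assoc, PowerSeries.coeff_mul_C]
    simp
  have l0' (φ : E⟦X⟧) (w : E) : PowerSeries.coeff 0 ((PowerSeries.C y -
      PowerSeries.X * PowerSeries.C w) * φ) = y * PowerSeries.coeff 0 φ := by
    rw [sub_mul, map_sub, PowerSeries.coeff_C_mul, mul_assoc]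
    simp
  have l1 (φ : E⟦X⟧) (w : E) (n : ℕ) : PowerSeries.coeff (n + 1) (φ * (PowerSeries.C y -
      PowerSeries.X * PowerSeries.C w)) =
      PowerSeries.coeff (n + 1) φ * y - PowerSeries.coeff n φ * w := by
    rw [mul_sub, map_sub, PowerSeries.coeff_mul_C, ← mul_assoc, PowerSeries.coeff_mul_C,
      PowerSeries.coeff_succ_mul_X]
  have l1' (φ : E⟦X⟧) (w : E) (n : ℕ) : PowerSeries.coeff (n + 1) ((PowerSeries.C y -
      PowerSeries.X * PowerSeries.C w) * φ) =
      y * PowerSeries.coeff (n + 1) φ - w * PowerSeries.coeff n φ := by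
    rw [sub_mul, map_sub, PowerSeries.coeff_C_mul, mul_assoc, PowerSeries.coeff_succ_X_mul,
      PowerSeries.coeff_C_mul]
  rw [PowerSeries.ext_iff, e0, forall_congr' e1]
  constructor
  · intro H
    refine ⟨?_, fun r => ?_⟩
    · have := H 1
      rw [l1, l1'] at this
      simpa only [coeff_oneSeries_zero, coeff_oneSeries_succ, zero_add, one_mul, mul_one] using this
    · have := H (r + 2)
      rw [l1, l1'] at this
      simpa only [coeff_oneSeries_succ] using this
  · rintro ⟨H0, H1⟩ (_ | _ | r)
    · rw [l0, l0', coeff_oneSeries_zero, one_mul, mul_one]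
    · rw [l1, l1']
      simpa only [coeff_oneSeries_zero, coeff_oneSeries_succ, zero_add, one_mul, mul_one] using H0
    · rw [l1, l1']
      simpa only [coeff_oneSeries_succ] using H1 r

variable {A : Matrix I I ℤ} {d : I → ℂ} {h : ℂ} {ξ : I → ℕ → E} {x : ℤˣ → I → ℕ → E}

theorem QuadRel.series_comm (hh : h ≠ 0) (H : QuadRel A d h ξ x) (e : ℤˣ) (i j : I) (s : ℕ) :
    oneSeries h (ξ i) * (PowerSeries.C (x e j s) - PowerSeries.X *
        PowerSeries.C (x e j (s + 1) + (sgn e * (h * (d i * A i j) / 2)) • x e j s)) =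
      (PowerSeries.C (x e j s) - PowerSeries.X *
        PowerSeries.C (x e j (s + 1) - (sgn e * (h * (d i * A i j) / 2)) • x e j s)) *
        oneSeries h (ξ i) :=
  (oneSeries_comm_iff hh (c := sgn e * (d i * A i j)) (by ring) _ _ _).2
    ⟨H.y2 e i j s, fun r => H.y3 e i j r s⟩

/-! ### Derivations from the logarithmic derivative of `ξ(u)` -/

/-- The derivation `z d/dz` of power series in `z`. -/
def eulerD (φ : E⟦X⟧) : E⟦X⟧ := PowerSeries.mk fun n => n • PowerSeries.coeff n φ

theorem eulerD_mul (φ ψ : E⟦X⟧) : eulerD (φ * ψ) = eulerD φ * ψ + φ * eulerD ψ := by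
  ext n
  simp only [eulerD, PowerSeries.coeff_mk, PowerSeries.coeff_mul, map_add, ← Finset.sum_add_distrib,
    Finset.smul_sum]
  refine Finset.sum_congr rfl fun p hp => ?_
  rw [← Finset.HasAntidiagonal.mem_antidiagonal.1 hp, add_smul, smul_mul_assoc, mul_smul_comm]

theorem eulerD_sub (φ ψ : E⟦X⟧) : eulerD (φ - ψ) = eulerD φ - eulerD ψ := by
  ext n
  simp [eulerD, mul_sub]

theorem eulerD_C (a : E) : eulerD (PowerSeries.C a) = 0 := by
  ext n
  simp only [eulerD, PowerSeries.coeff_mk, PowerSeries.coeff_C, map_zero]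
  split_ifs with h
  · simp [h]
  · simp

theorem eulerD_X_mul_C (a : E) :
    eulerD (PowerSeries.X * PowerSeries.C a) = PowerSeries.X * PowerSeries.C a := by
  ext n
  rcases n with _ | n
  · simp [eulerD]
  · simp only [eulerD, PowerSeries.coeff_mk, PowerSeries.coeff_succ_X_mul, PowerSeries.coeff_C]
    split_ifs with h
    · simp [h]
    · simp

/-- The polynomials `(v + b)^n - (v - b)^n`, by the linear recursion with characteristic roots
`v + b` and `v - b`. -/
def diffPoly (b : ℂ) : ℕ → ℂ[X]
  | 0 => 0
  | 1 => Polynomial.C (2 * b)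
  | n + 2 => 2 * Polynomial.X * diffPoly b (n + 1) -
      (Polynomial.X + Polynomial.C b) * (Polynomial.X - Polynomial.C b) * diffPoly b n

theorem diffPoly_succ (b : ℂ) (n : ℕ) : (diffPoly b (n + 1)).natDegree ≤ n ∧
    (diffPoly b (n + 1)).coeff n = 2 * b * (n + 1) := by
  suffices h : ((diffPoly b (n + 1)).natDegree ≤ n ∧
      (diffPoly b (n + 1)).coeff n = 2 * b * (n + 1)) ∧
      ((diffPoly b (n + 2)).natDegree ≤ n + 1 ∧
      (diffPoly b (n + 2)).coeff (n + 1) = 2 * b * (n + 2)) from h.1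
  have hexp (p : ℂ[X]) : (Polynomial.X + Polynomial.C b) * (Polynomial.X - Polynomial.C b) * p =
      Polynomial.X * (Polynomial.X * p) - Polynomial.C (b ^ 2) * p := by
    rw [map_pow]; ring
  induction n with
  | zero =>
    refine ⟨⟨(Polynomial.natDegree_C _).le, by
      simp only [diffPoly, zero_add, Polynomial.coeff_C_zero]; push_cast; ring⟩, ?_, ?_⟩
    · simp only [diffPoly, mul_zero, sub_zero]
      compute_degree
    · simp only [diffPoly, mul_zero, sub_zero, mul_assoc]
      rw [← Polynomial.C_ofNat, Polynomial.coeff_C_mul, zero_add, Polynomial.coeff_X_mul,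
        Polynomial.coeff_C_zero]
      push_cast
      ring
  | succ n ih =>
    refine ⟨⟨ih.2.1, by rw [ih.2.2]; push_cast; ring⟩, ?_, ?_⟩
    · rw [diffPoly]
      refine (Polynomial.natDegree_sub_le _ _).trans (max_le ?_ ?_)
      · refine Polynomial.natDegree_mul_le.trans ?_
        have : (2 * Polynomial.X : ℂ[X]).natDegree ≤ 1 := by compute_degree
        have h' : (diffPoly b (n + 1 + 1)).natDegree ≤ n + 1 := ih.2.1
        omega
      · refine Polynomial.natDegree_mul_le.trans ?_
        have : ((Polynomial.X + Polynomial.C b) *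
            (Polynomial.X - Polynomial.C b)).natDegree ≤ 2 := by
          compute_degree
        have := ih.1.1
        omega
    · rw [diffPoly, hexp, mul_assoc, Polynomial.coeff_sub, Polynomial.coeff_sub,
        ← Polynomial.C_ofNat, Polynomial.coeff_C_mul, Polynomial.coeff_X_mul,
        Polynomial.coeff_X_mul, Polynomial.coeff_X_mul, Polynomial.coeff_C_mul, ih.2.2, ih.1.2,
        Polynomial.coeff_eq_zero_of_natDegree_lt (p := diffPoly b (n + 1)) (n := n + 2)
          (by have := ih.1.1; omega)]
      push_cast
      ring

/-- The relation `ξ_i(u) (u - v - b) x_j(v) = (u - v + b) x_j(v) ξ_i(u)`, where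
`b = ± h d_i a_ij / 2`, on the modes of `x_j(v)`. -/
theorem QuadRel.series_comm_poly (hh : h ≠ 0) (H : QuadRel A d h ξ x) (e : ℤˣ) (i j : I)
    (p : ℂ[X]) :
    oneSeries h (ξ i) * (PowerSeries.C (modeMap (x e j) p) - PowerSeries.X *
        PowerSeries.C (modeMap (x e j) ((Polynomial.X +
          Polynomial.C (sgn e * (h * (d i * A i j) / 2))) * p))) =
      (PowerSeries.C (modeMap (x e j) p) - PowerSeries.X *
        PowerSeries.C (modeMap (x e j) ((Polynomial.X -
          Polynomial.C (sgn e * (h * (d i * A i j) / 2))) * p))) * oneSeries h (ξ i) := by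
  induction p using Polynomial.induction_on' with
  | add p q hp hq =>
    simp only [mul_add, map_add]
    have := congrArg₂ (· + ·) hp hq
    simp only [← mul_add, ← add_mul] at this
    convert this using 2 <;> noncomm_ring
  | monomial s c =>
    have := congrArg (PowerSeries.C (algebraMap ℂ E c) * ·) (H.series_comm hh e i j s)
    beta_reduce at this
    have hc (φ : E⟦X⟧) : Commute (PowerSeries.C (algebraMap ℂ E c)) φ := by
      ext n
      rw [PowerSeries.coeff_C_mul, PowerSeries.coeff_mul_C, Algebra.commutes]
    have k1 (y z : E) : PowerSeries.C (algebraMap ℂ E c) *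
        (PowerSeries.C y - PowerSeries.X * PowerSeries.C z) =
        PowerSeries.C (algebraMap ℂ E c * y) -
          PowerSeries.X * PowerSeries.C (algebraMap ℂ E c * z) := by
      rw [mul_sub, ← mul_assoc, (hc PowerSeries.X).eq, mul_assoc, ← map_mul, ← map_mul]
    rw [← mul_assoc, (hc (oneSeries h (ξ i))).eq, mul_assoc, k1,
      ← mul_assoc (PowerSeries.C (algebraMap ℂ E c)), k1] at this
    have e1 : modeMap (x e j) (Polynomial.monomial s c) = algebraMap ℂ E c * x e j s := by
      rw [← Polynomial.C_mul_X_pow_eq_monomial, ← Polynomial.smul_eq_C_mul, map_smul,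
        modeMap_X_pow, Algebra.smul_def]
    have e2 (b : ℂ) : modeMap (x e j) ((Polynomial.X + Polynomial.C b) *
        Polynomial.monomial s c) = algebraMap ℂ E c * (x e j (s + 1) + b • x e j s) := by
      rw [← Polynomial.C_mul_X_pow_eq_monomial, mul_left_comm, ← Polynomial.smul_eq_C_mul, map_smul,
        add_mul, ← pow_succ', ← Polynomial.smul_eq_C_mul, map_add, map_smul, modeMap_X_pow,
        modeMap_X_pow, Algebra.smul_def]
    rw [sub_eq_add_neg (x e j (s + 1)), ← neg_smul] at this
    rw [sub_eq_add_neg (Polynomial.X : ℂ[X]), ← map_neg, e1, e2, e2]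
    exact this

/-- The coefficients `T_n` of `-u d/du log ξ_i(u)` act on the modes of `x_j(v)` as the
multiplication by `(v + b)^n - (v - b)^n`, where `b = ± h d_i a_ij / 2`. -/
theorem QuadRel.exists_derivations (hh : h ≠ 0) (H : QuadRel A d h ξ x) (i : I) :
    ∃ T : ℕ → E, ∀ (n : ℕ) (e : ℤˣ) (j : I) (p : ℂ[X]), comm (T n) (modeMap (x e j) p) =
      modeMap (x e j) (diffPoly (sgn e * (h * (d i * A i j) / 2)) n * p) := by
  set φ := oneSeries h (ξ i) with hφ
  set ψ := PowerSeries.invOfUnit φ 1 with hψ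
  have h1 : φ * ψ = 1 := oneSeries_mul_inv h (ξ i)
  have h2 : ψ * φ = 1 := inv_mul_oneSeries h (ξ i)
  set T := eulerD φ * ψ with hT
  have hTφ : eulerD φ = T * φ := by rw [hT, mul_assoc, h2, mul_one]
  refine ⟨fun n => PowerSeries.coeff n T, fun n e j => ?_⟩
  set b := sgn e * (h * (d i * A i j) / 2) with hb
  set Y := modeMap (x e j) with hY
  set f : ℂ[X] → E⟦X⟧ := fun p => PowerSeries.C (Y p) with hf
  set α : ℂ[X] := Polynomial.X - Polynomial.C b with hα
  set β : ℂ[X] := Polynomial.X + Polynomial.C b with hβ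
  have fsub (p q : ℂ[X]) : f (p - q) = f p - f q := by simp only [hf, map_sub]
  have R (p : ℂ[X]) : φ * (f p - PowerSeries.X * f (β * p)) =
      (f p - PowerSeries.X * f (α * p)) * φ := H.series_comm_poly hh e i j p
  have hX (ψ : E⟦X⟧) : PowerSeries.X * ψ = ψ * PowerSeries.X := PowerSeries.X_mul
  -- `K` is the commutator of `T(u)` with `(1 - (v - b) / u) Y(v)`; differentiating the relation `R`
  -- gives `(1 - (v + b) / u) K = (2b / u) Y(v)`
  set K : ℂ[X] → E⟦X⟧ := fun p => T * (f p - PowerSeries.X * f (α * p)) -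
    (f p - PowerSeries.X * f (α * p)) * T with hK
  have hKφ (p : ℂ[X]) : K p * φ = PowerSeries.X * (φ * f (β * p) - f (α * p) * φ) := by
    have h3 := congrArg eulerD (R p)
    have h0 (q : ℂ[X]) : eulerD (f q) = 0 := eulerD_C _
    have h0' (q : ℂ[X]) : eulerD (PowerSeries.X * f q) = PowerSeries.X * f q := eulerD_X_mul_C _
    rw [eulerD_mul, eulerD_mul, eulerD_sub, eulerD_sub, h0, h0', h0', zero_sub, zero_sub] at h3
    change eulerD φ * (f p - PowerSeries.X * f (β * p)) + φ * -(PowerSeries.X * f (β * p)) =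
      -(PowerSeries.X * f (α * p)) * φ + (f p - PowerSeries.X * f (α * p)) * eulerD φ at h3
    rw [hTφ, mul_assoc T, R] at h3
    have h4 : φ * (PowerSeries.X * f (β * p)) = PowerSeries.X * (φ * f (β * p)) := by
      rw [← mul_assoc, ← hX, mul_assoc]
    rw [mul_neg, h4] at h3
    have h5 : K p * φ = T * ((f p - PowerSeries.X * f (α * p)) * φ) -
        (f p - PowerSeries.X * f (α * p)) * (T * φ) := by
      rw [← mul_assoc, ← mul_assoc, ← sub_mul]
    have h6 : T * ((f p - PowerSeries.X * f (α * p)) * φ) = -(PowerSeries.X * f (α * p)) * φ +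
        (f p - PowerSeries.X * f (α * p)) * (T * φ) + PowerSeries.X * (φ * f (β * p)) := by
      rw [← h3]; abel
    rw [h5, h6, neg_mul, mul_assoc PowerSeries.X, mul_sub]
    abel
  have hKK (p : ℂ[X]) : K p - PowerSeries.X * K (β * p) =
      PowerSeries.X * f (Polynomial.C (2 * b) * p) := by
    have h3 : (K p - PowerSeries.X * K (β * p)) * φ =
        PowerSeries.X * f (Polynomial.C (2 * b) * p) * φ := by
      have h4 := R (β * p)
      rw [sub_mul, mul_assoc PowerSeries.X, hKφ, hKφ, ← mul_sub, mul_assoc]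
      congr 1
      have h5 : Polynomial.C (2 * b) * p = β * p - α * p := by
        rw [hα, hβ, map_mul, Polynomial.C_ofNat]; ring
      rw [h5, fsub, sub_mul (f (β * p))]
      have h6 : φ * (PowerSeries.X * f (β * (β * p))) = PowerSeries.X * (φ * f (β * (β * p))) := by
        rw [← mul_assoc, ← hX, mul_assoc]
      have h7 : β * (α * p) = α * (β * p) := by ring
      rw [mul_sub, h6, sub_mul, mul_assoc PowerSeries.X] at h4
      rw [mul_sub]
      have h8 : φ * f (β * p) = f (β * p) * φ - PowerSeries.X * (f (α * (β * p)) * φ) +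
          PowerSeries.X * (φ * f (β * (β * p))) := by
        rw [← h4]; abel
      rw [h8]
      generalize f (β * p) * φ = a1
      generalize f (α * p) * φ = a2
      generalize PowerSeries.X * (f (α * (β * p)) * φ) = a3
      generalize PowerSeries.X * (φ * f (β * (β * p))) = a4
      abel
    have h9 := congrArg (· * ψ) h3
    simpa only [mul_assoc, h1, mul_one] using h9
  -- comparison of coefficients: the commutators `[T_n, Y(v)]` satisfy the recursion of `diffPoly`
  have hrec0 (p : ℂ[X]) : comm (PowerSeries.coeff 0 T) (Y p) = 0 := by
    have : PowerSeries.coeff 0 T = 0 := by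
      rw [hT, PowerSeries.coeff_mul]; simp [eulerD]
    rw [this, comm, zero_mul, mul_zero, sub_zero]
  have hf0 (p : ℂ[X]) : PowerSeries.coeff 0 (f p) = Y p := by
    change PowerSeries.coeff 0 (PowerSeries.C (Y p)) = _
    simp
  have hfs (p : ℂ[X]) (n : ℕ) : PowerSeries.coeff (n + 1) (f p) = 0 := by
    change PowerSeries.coeff (n + 1) (PowerSeries.C (Y p)) = _
    simp [PowerSeries.coeff_C]
  have hTf (p : ℂ[X]) (n : ℕ) : PowerSeries.coeff n (T * f p - f p * T) =
      comm (PowerSeries.coeff n T) (Y p) := by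
    rw [map_sub, PowerSeries.coeff_mul_C, PowerSeries.coeff_C_mul]
  have hKf (p : ℂ[X]) : K p = (T * f p - f p * T) -
      PowerSeries.X * (T * f (α * p) - f (α * p) * T) := by
    simp only [hK, mul_sub, sub_mul]
    have : T * (PowerSeries.X * f (α * p)) = PowerSeries.X * (T * f (α * p)) := by
      rw [← mul_assoc, ← hX, mul_assoc]
    rw [this, mul_assoc PowerSeries.X]
    abel
  have hK0 (p : ℂ[X]) : PowerSeries.coeff 0 (K p) = comm (PowerSeries.coeff 0 T) (Y p) := by
    rw [hKf, map_sub, hTf]; simp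
  have hKs (p : ℂ[X]) (n : ℕ) : PowerSeries.coeff (n + 1) (K p) =
      comm (PowerSeries.coeff (n + 1) T) (Y p) - comm (PowerSeries.coeff n T) (Y (α * p)) := by
    rw [hKf, map_sub, hTf, PowerSeries.coeff_succ_X_mul, hTf]
  have key (n : ℕ) (p : ℂ[X]) : comm (PowerSeries.coeff (n + 1) T) (Y p) -
      comm (PowerSeries.coeff n T) (Y (α * p)) - PowerSeries.coeff n (K (β * p)) =
      PowerSeries.coeff n (f (Polynomial.C (2 * b) * p)) := by
    have := congrArg (PowerSeries.coeff (n + 1)) (hKK p)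
    rwa [map_sub, hKs, PowerSeries.coeff_succ_X_mul, PowerSeries.coeff_succ_X_mul] at this
  have main (n : ℕ) : (∀ p, comm (PowerSeries.coeff n T) (Y p) = Y (diffPoly b n * p)) ∧
      ∀ p, comm (PowerSeries.coeff (n + 1) T) (Y p) = Y (diffPoly b (n + 1) * p) := by
    induction n with
    | zero =>
      refine ⟨fun p => by rw [hrec0]; simp [diffPoly], fun p => ?_⟩
      have := key 0 p
      rw [hK0, hrec0, hrec0, sub_zero, sub_zero, hf0] at this
      rw [this]; simp [diffPoly]
    | succ n ih =>
      refine ⟨ih.2, fun p => ?_⟩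
      have := key (n + 1) p
      rw [hKs, hfs, ih.2, ih.2, ih.1, sub_eq_zero, sub_eq_iff_eq_add] at this
      rw [this, ← map_sub, ← map_add, diffPoly]
      congr 1
      rw [hα, hβ]
      ring
  exact (main n).1

end Quadratic

/-! ### The Serre relations -/

section Serre

variable {I : Type*} {E : Type*} [Ring E] [Algebra ℂ E]

theorem nestedComm_zero (a : Fin 0 → E) (b : E) : nestedComm a b = b := by
  simp [nestedComm]

theorem nestedComm_succ {m : ℕ} (a : Fin (m + 1) → E) (b : E) :
    nestedComm a b = comm (a 0) (nestedComm (fun k => a k.succ) b) := by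
  simp [nestedComm, adL_apply]

theorem comm_nestedComm {m : ℕ} (t : E) (a : Fin m → E) (b : E) :
    comm t (nestedComm a b) =
      ∑ l, nestedComm (Function.update a l (comm t (a l))) b + nestedComm a (comm t b) := by
  induction m with
  | zero => simp [nestedComm_zero]
  | succ m ih =>
    have jac (u v : E) : comm t (comm u v) = comm (comm t u) v + comm u (comm t v) := by
      simp only [comm]; noncomm_ring
    have h0 (c : E) : (fun k : Fin m => Function.update a 0 c k.succ) = fun k => a k.succ := by
      ext k; rw [Function.update_of_ne (Fin.succ_ne_zero k)]
    have h1 (c : E) (l : Fin m) : (fun k : Fin m => Function.update a l.succ c k.succ) =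
        Function.update (fun k => a k.succ) l c := by
      ext k
      by_cases hk : k = l
      · subst hk; simp
      · rw [Function.update_of_ne hk, Function.update_of_ne (by simpa using hk)]
    have hadd (u : E) (f : Fin m → E) (v : E) :
        comm u (∑ l, f l + v) = ∑ l, comm u (f l) + comm u v := by
      rw [← adL_apply, map_add, map_sum]; rfl
    rw [nestedComm_succ, jac, ih, hadd, Fin.sum_univ_succ, nestedComm_succ, h0,
      Function.update_self, nestedComm_succ a (comm t b), add_assoc]
    congr 2
    refine Finset.sum_congr rfl fun l _ => ?_
    rw [nestedComm_succ, h1, Function.update_of_ne (Fin.succ_ne_zero l).symm]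

/-- The left-hand side of the Serre relation, for the modes `X^r ↦ y_r`. -/
def serreSum {m : ℕ} (y : ℂ[X] →ₗ[ℂ] E) (p : Fin m → ℂ[X]) (z : E) : E :=
  ∑ σ : Equiv.Perm (Fin m), nestedComm (fun k => y (p (σ k))) z

theorem serreSum_comp {m : ℕ} (y : ℂ[X] →ₗ[ℂ] E) (p : Fin m → ℂ[X]) (z : E)
    (τ : Equiv.Perm (Fin m)) : serreSum y (p ∘ τ) z = serreSum y p z :=
  Fintype.sum_equiv (Equiv.mulLeft τ) _ _ fun _ => rfl

theorem comm_serreSum {m : ℕ} {y : ℂ[X] →ₗ[ℂ] E} {t : E} {g : ℂ[X]}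
    (ht : ∀ p, comm t (y p) = y (g * p)) (p : Fin m → ℂ[X]) (z : E) :
    comm t (serreSum y p z) =
      ∑ l, serreSum y (Function.update p l (g * p l)) z + serreSum y p (comm t z) := by
  have hsum : comm t (serreSum y p z) =
      ∑ σ : Equiv.Perm (Fin m), comm t (nestedComm (fun k => y (p (σ k))) z) := by
    rw [serreSum, ← adL_apply, map_sum]; rfl
  rw [hsum]
  simp only [comm_nestedComm, Finset.sum_add_distrib, ht]
  congr 1
  simp only [serreSum]
  rw [Finset.sum_comm (s := Finset.univ (α := Fin m))]
  refine Finset.sum_congr rfl fun σ _ => ?_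
  refine Fintype.sum_equiv σ _ _ fun l => ?_
  congr 1
  ext k
  by_cases hk : k = l
  · subst hk; simp
  · rw [Function.update_of_ne hk, Function.update_of_ne (fun h => hk (σ.injective h))]

/-- The left-hand side of the Serre relation is linear in each of the polynomials. -/
theorem exists_linear_serreSum {m : ℕ} (y : ℂ[X] →ₗ[ℂ] E) (p : Fin m → ℂ[X]) (l : Fin m)
    (z : E) : ∃ L : ℂ[X] →ₗ[ℂ] E, ∀ g, L g = serreSum y (Function.update p l g) z := by
  let F : MultilinearMap ℂ (fun _ : Fin m => ℂ[X]) E :=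
    ((LinearMap.applyₗ z).compMultilinearMap
      (MultilinearMap.mkPiAlgebraFin ℂ m (Module.End ℂ E))).compLinearMap
      (fun _ => (adL E).comp y)
  have hF (f : Fin m → ℂ[X]) : F f = nestedComm (fun k => y (f k)) z := rfl
  refine ⟨(∑ σ : Equiv.Perm (Fin m), F.domDomCongr σ).toLinearMap p l, fun g => ?_⟩
  rw [MultilinearMap.toLinearMap_apply, _root_.sum_apply, serreSum]
  rfl

/-- The polynomials `(v + b)^n - (v - b)^n` span all polynomials when `b ≠ 0`. -/
theorem span_diffPoly {b : ℂ} (hb : b ≠ 0) :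
    Submodule.span ℂ (Set.range fun n => diffPoly b (n + 1)) = ⊤ := by
  have hne (n : ℕ) : (diffPoly b (n + 1)).coeff n ≠ 0 := by
    rw [(diffPoly_succ b n).2]
    exact mul_ne_zero (mul_ne_zero two_ne_zero hb) (by exact_mod_cast n.succ_ne_zero)
  have hdeg (n : ℕ) : (diffPoly b (n + 1)).degree = n := by
    have h1 := Polynomial.natDegree_eq_of_le_of_coeff_ne_zero (diffPoly_succ b n).1 (hne n)
    rw [Polynomial.degree_eq_natDegree (fun h => hne n (by rw [h, Polynomial.coeff_zero])), h1]
  exact Polynomial.Sequence.span ⟨fun n => diffPoly b (n + 1), hdeg⟩ fun n =>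
    isUnit_iff_ne_zero.2 (Polynomial.leadingCoeff_ne_zero.2
      (fun h => hne n (by
        change diffPoly b (n + 1) = 0 at h
        rw [h, Polynomial.coeff_zero])))

/-- If the Serre relation holds for the lowest modes `r = 0`, it holds for all modes: the
derivations with eigenvalues `(v + b)^n - (v - b)^n` raise the modes. -/
theorem serreSum_eq_zero {m : ℕ} {y : ℂ[X] →ₗ[ℂ] E} {w : ℂ[X] →ₗ[ℂ] E} {b b' : ℂ} (hb : b ≠ 0)
    {T : ℕ → E} (hT : ∀ n p, comm (T n) (y p) = y (diffPoly b n * p))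
    (hT' : ∀ n p, comm (T n) (w p) = w (diffPoly b' n * p))
    (h0 : ∀ q, serreSum y (fun _ : Fin m => 1) (w q) = 0) (p : Fin m → ℂ[X]) (q : ℂ[X]) :
    serreSum y p (w q) = 0 := by
  classical
  -- the effect of the derivations on a relation that holds for all `q`
  have raise (p : Fin m → ℂ[X]) (hp : ∀ q, serreSum y p (w q) = 0) (g q : ℂ[X]) :
      ∑ l, serreSum y (Function.update p l (g * p l)) (w q) = 0 := by
    choose L hL using fun l => exists_linear_serreSum y p l (w q)
    let M : ℂ[X] →ₗ[ℂ] E := ∑ l, (L l).comp (LinearMap.mulRight ℂ (p l))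
    have hM (g : ℂ[X]) : M g = ∑ l, serreSum y (Function.update p l (g * p l)) (w q) := by
      simp only [M, LinearMap.sum_apply, LinearMap.comp_apply, LinearMap.mulRight_apply, hL]
    rw [← hM]
    suffices h : M = 0 by rw [h, LinearMap.zero_apply]
    refine LinearMap.ext_on_range (span_diffPoly hb) fun n => ?_
    have := comm_serreSum (hT (n + 1)) p (w q)
    rw [hp, hT', hp, add_zero, comm, mul_zero, zero_mul, sub_zero] at this
    rw [hM, ← this, LinearMap.zero_apply]
  suffices h : ∀ k, ∀ p : Fin m → ℂ[X], (Finset.univ.filter fun l => p l ≠ 1).card = k →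
      ∀ q, serreSum y p (w q) = 0 from h _ p rfl q
  -- induction on the number of entries that differ from `1`
  intro k
  induction k using Nat.strong_induction_on with
  | _ k ih =>
    intro p hpk q
    by_cases hall : ∀ l, p l = 1
    · rw [show p = fun _ => 1 from funext hall]; exact h0 q
    · push Not at hall
      obtain ⟨l₀, hl₀⟩ := hall
      -- lower the entry `l₀` of `p` to `1`, and raise the result by the derivation with eigenvalue
      -- `p l₀`: raising an entry `1` gives back `p` up to a permutation, and raising any other
      -- entry gives zero by induction
      set p' := Function.update p l₀ 1 with hp'
      have hsub (l : Fin m) (c : ℂ[X]) (hl : p' l ≠ 1) :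
          (Finset.univ.filter fun l' => Function.update p' l c l' ≠ 1).card < k := by
        rw [← hpk]
        refine Finset.card_lt_card (Finset.ssubset_iff_of_subset ?_ |>.2 ⟨l₀, by simpa, ?_⟩)
        · intro l' hl'
          simp only [Finset.mem_filter, Finset.mem_univ, true_and] at hl' ⊢
          have hl1 : l ≠ l₀ := by
            rintro rfl; exact hl (by simp [hp'])
          by_cases h1 : l' = l
          · subst h1
            rwa [hp', Function.update_of_ne hl1] at hl
          · rw [Function.update_of_ne h1] at hl'
            by_cases h2 : l' = l₀
            · rw [h2]; exact hl₀
            · rwa [hp', Function.update_of_ne h2] at hl'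
        · simp only [Finset.mem_filter, Finset.mem_univ, true_and, not_not]
          have hl1 : l₀ ≠ l := by
            rintro rfl; exact hl (by simp [hp'])
          rw [Function.update_of_ne hl1]; simp [hp']
      have hlt : (Finset.univ.filter fun l' => p' l' ≠ 1).card < k := by
        rw [← hpk]
        refine Finset.card_lt_card
          (Finset.ssubset_iff_of_subset ?_ |>.2 ⟨l₀, by simpa, by simp [hp']⟩)
        intro l' hl'
        simp only [Finset.mem_filter, Finset.mem_univ, true_and] at hl' ⊢
        by_cases h2 : l' = l₀
        · rw [h2]; exact hl₀
        · rwa [hp', Function.update_of_ne h2] at hl'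
      have key := raise p' (fun q => ih _ hlt p' rfl q) (p l₀) q
      have hterm (l : Fin m) : serreSum y (Function.update p' l (p l₀ * p' l)) (w q) =
          if p' l = 1 then serreSum y p (w q) else 0 := by
        split_ifs with hl
        · rw [hl, mul_one]
          have : Function.update p' l (p l₀) = p ∘ Equiv.swap l l₀ := by
            ext1 l'
            rw [Function.comp_apply]
            by_cases h1 : l' = l
            · subst h1; simp
            · rw [Function.update_of_ne h1]
              by_cases h2 : l' = l₀
              · subst h2
                rw [Equiv.swap_apply_right]
                have h3 : p' l = p l := by rw [hp', Function.update_of_ne (Ne.symm h1)]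
                rw [← h3, hl]; simp [hp']
              · rw [Equiv.swap_apply_of_ne_of_ne h1 h2, hp', Function.update_of_ne h2]
          rw [this, serreSum_comp]
        · exact ih _ (hsub l _ hl) _ rfl q
      simp only [hterm] at key
      rw [← Finset.sum_filter, Finset.sum_const, ← Nat.cast_smul_eq_nsmul ℂ, smul_eq_zero] at key
      refine key.resolve_left ?_
      exact Nat.cast_ne_zero.2 (Finset.card_ne_zero.2 ⟨l₀, by simp [hp']⟩)

theorem adL_smul_pow (c : ℂ) (a b : E) (n : ℕ) :
    ((adL E (c • a)) ^ n) b = c ^ n • ((adL E a) ^ n) b := by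
  rw [map_smul, smul_pow, LinearMap.smul_apply]

variable {A : Matrix I I ℤ} {d : I → ℂ} {h : ℂ} {ξ : I → ℕ → E} {x : ℤˣ → I → ℕ → E}

theorem sgn_one : sgn 1 = 1 := by
  rw [sgn, Units.val_one, Int.cast_one]

theorem sgn_neg (e : ℤˣ) : sgn (-e) = -sgn e := by
  rw [sgn, sgn, Units.val_neg, Int.cast_neg]

theorem sgn_mul_self (e : ℤˣ) : sgn e * sgn e = 1 := by
  rw [sgn, ← Int.cast_mul, ← Units.val_mul, Int.units_mul_self, Units.val_one, Int.cast_one]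

theorem sgn_ne_zero (e : ℤˣ) : sgn e ≠ 0 := fun h0 => by
  simpa [h0] using sgn_mul_self e

/-- The Serre relation for the modes `r = 0`, by the representation theory of `sl₂`: the vector
`x_{j,s}` is primitive, of weight `-a_ij`, for the adjoint action of the `i`-th `sl₂`-triple. -/
theorem QuadRel.serre_base [FiniteDimensional ℂ E] (hA : CartanConditions A d)
    (H : QuadRel A d h ξ x) (e : ℤˣ) {i j : I} (hij : i ≠ j) {m : ℕ} (hm : (m : ℤ) = 1 - A i j)
    (s : ℕ) : ((adL E (x e i 0)) ^ m) (x e j s) = 0 := by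
  have hd := hA.ne_zero i
  have y5 (e : ℤˣ) : comm (x (-e) i 0) (x e i 0) = -(sgn e) • ξ i 0 := by
    rcases Int.units_eq_one_or e with rfl | rfl
    · have := H.y5_same i 0 0
      simp only [comm] at this ⊢
      rw [← neg_sub, this, sgn_one]; simp
    · have := H.y5_same i 0 0
      simp only [comm, neg_neg] at this ⊢
      rw [this, sgn_neg, sgn_one]; simp
  have y5' (e : ℤˣ) : comm (x (-e) i 0) (x e j s) = 0 := by
    rcases Int.units_eq_one_or e with rfl | rfl
    · have := H.y5_ne j i s 0 hij.symm
      simp only [comm] at this ⊢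
      rw [← neg_sub, this]; simp
    · have := H.y5_ne i j 0 s hij
      simpa only [comm, neg_neg] using this
  have y2 (e : ℤˣ) := H.y2 e i i 0
  simp only [hA.diag] at y2
  -- the triple `(η, x_{i,0}^∓, f)`; the normalisation gives `x_{j,s}` the weight `-a_ij`
  set η : E := (-(sgn e) * (d i)⁻¹) • ξ i 0 with hη
  set f : E := (d i)⁻¹ • x e i 0 with hf
  have hwt : comm η (x e j s) = (-(A i j : ℂ)) • x e j s := by
    have : comm η (x e j s) = (-(sgn e) * (d i)⁻¹) • comm (ξ i 0) (x e j s) := by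
      rw [hη, comm, smul_mul_assoc, mul_smul_comm, ← smul_sub]
    rw [this, H.y2, smul_smul]
    congr 1
    linear_combination (-(d i)⁻¹ * (d i * (A i j : ℂ))) * sgn_mul_self e -
      (A i j : ℂ) * inv_mul_cancel₀ hd
  by_cases hx : x e j s = 0
  · rw [hx, map_zero]
  by_cases h0 : η = 0
  -- if `ξ_{i,0} = 0`, then `x_{i,0} = 0`, and the weight `-a_ij` of `x_{j,s} ≠ 0` is zero
  · have hξ : ξ i 0 = 0 := by
      rw [hη, smul_eq_zero] at h0
      exact h0.resolve_left (mul_ne_zero (neg_ne_zero.2 (sgn_ne_zero e)) (inv_ne_zero hd))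
    have hx0 : x e i 0 = 0 := by
      have := y2 e
      rw [hξ, comm, zero_mul, mul_zero, sub_zero, eq_comm, smul_eq_zero] at this
      refine this.resolve_left (mul_ne_zero (sgn_ne_zero e) (mul_ne_zero hd (by norm_num)))
    rw [h0, comm, zero_mul, mul_zero, sub_zero, eq_comm, smul_eq_zero] at hwt
    have hA0 : A i j = 0 := by
      have := hwt.resolve_right hx
      exact_mod_cast neg_eq_zero.1 this
    have hm1 : m = 1 := by
      rw [hA0] at hm; omega
    rw [hm1, pow_one, hx0, map_zero, LinearMap.zero_apply]
  · let _ : LieRing E := LieRing.ofAssociativeRing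
    have t : IsSl2Triple η (x (-e) i 0) f := by
      refine ⟨h0, ?_, ?_, ?_⟩
      · rw [Ring.lie_def, hf, mul_smul_comm, smul_mul_assoc, ← smul_sub, hη, mul_comm, mul_smul]
        congr 1
        exact y5 e
      · have h1 := y2 (-e)
        simp only [comm] at h1
        rw [Ring.lie_def, hη, mul_smul_comm, smul_mul_assoc, ← smul_sub, h1, smul_smul,
          ← Nat.cast_smul_eq_nsmul ℂ]
        congr 1
        rw [sgn_neg]
        push_cast
        field_simp
        linear_combination sgn_mul_self e
      · have h1 := y2 e
        simp only [comm] at h1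
        rw [Ring.lie_def, hη, hf, smul_mul_smul_comm, smul_mul_smul_comm,
          mul_comm (d i)⁻¹ (-(sgn e) * (d i)⁻¹), ← smul_sub, h1, smul_smul,
          ← Nat.cast_smul_eq_nsmul ℂ, smul_smul, ← neg_smul]
        congr 1
        push_cast
        field_simp
        linear_combination -sgn_mul_self e
    have P : t.HasPrimitiveVectorWith (x e j s) (-(A i j : ℂ)) :=
      ⟨hx, hwt, y5' e⟩
    obtain ⟨n, hn⟩ := P.exists_nat
    have hmn : m = n + 1 := by
      have : (n : ℤ) = -A i j := by exact_mod_cast hn.symm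
      omega
    have h2 := P.pow_toEnd_f_eq_zero_of_eq_nat hn
    have h3 : LieModule.toEnd ℂ E E f = adL E f := rfl
    rw [h3, hf, adL_smul_pow, smul_eq_zero] at h2
    rw [hmn]
    exact h2.resolve_left (pow_ne_zero _ (inv_ne_zero hd))

/-- In a finite-dimensional algebra, the Serre relations follow from the other relations: the lowest
one holds by the theory of `sl₂`, and the derivations given by `log ξ_i(u)` yield the others. -/
theorem QuadRel.serre [FiniteDimensional ℂ E] (hh : h ≠ 0) (hA : CartanConditions A d)
    (H : QuadRel A d h ξ x) (e : ℤˣ) {i j : I} (hij : i ≠ j) {m : ℕ} (hm : (m : ℤ) = 1 - A i j)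
    (r : Fin m → ℕ) (s : ℕ) :
    ∑ p : Equiv.Perm (Fin m), nestedComm (fun k => x e i (r (p k))) (x e j s) = 0 := by
  obtain ⟨T, hT⟩ := H.exists_derivations hh i
  have hb : sgn e * (h * (d i * (A i i : ℂ)) / 2) ≠ 0 := by
    rw [hA.diag]
    have := hA.ne_zero i
    have := sgn_ne_zero e
    simp [*]
  have h0 (q : ℂ[X]) : serreSum (modeMap (x e i)) (fun _ : Fin m => 1) (modeMap (x e j) q) = 0 := by
    have h1 (z : E) : serreSum (modeMap (x e i)) (fun _ : Fin m => 1) z =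
        (m.factorial : ℂ) • ((adL E (x e i 0)) ^ m) z := by
      have : modeMap (x e i) 1 = x e i 0 := by rw [← pow_zero Polynomial.X, modeMap_X_pow]
      simp [serreSum, nestedComm, this, List.ofFn_const, Fintype.card_perm, nsmul_eq_mul,
        Nat.cast_smul_eq_nsmul]
    have h2 : (((adL E (x e i 0)) ^ m).comp (modeMap (x e j))) = 0 := by
      refine poly_ext fun s => ?_
      rw [LinearMap.comp_apply, modeMap_X_pow, H.serre_base hA e hij hm, LinearMap.zero_apply]
    rw [h1, ← LinearMap.comp_apply, h2, LinearMap.zero_apply, smul_zero]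
  have := serreSum_eq_zero hb (fun n p => hT n e i p) (fun n p => hT n e j p) h0
    (fun k => Polynomial.X ^ r k) (Polynomial.X ^ s)
  simpa only [serreSum, modeMap_X_pow] using this

/-- Values of the generators under the representation defined by `ξ` and `x`. -/
def genVal (ξ : I → ℕ → E) (x : ℤˣ → I → ℕ → E) : Gen I → E
  | .xi i r => ξ i r
  | .x e i r => x e i r

/-- The representation on a finite-dimensional space defined by operators that satisfy the relations
other than the Serre relations. -/
theorem exists_rep_of_quadRel {U : Type*} [AddCommGroup U] [Module ℂ U] [FiniteDimensional ℂ U]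
    (hh : h ≠ 0) (hA : CartanConditions A d) {ξ : I → ℕ → Module.End ℂ U}
    {x : ℤˣ → I → ℕ → Module.End ℂ U} (H : QuadRel A d h ξ x) :
    ∃ ρ : Rep A d h U, (∀ i r, ρ (yxi A d h i r) = ξ i r) ∧
      ∀ e i r, ρ (yx A d h e i r) = x e i r := by
  let f : FreeAlgebra ℂ (Gen I) →ₐ[ℂ] Module.End ℂ U := FreeAlgebra.lift ℂ (genVal ξ x)
  have hf (g : Gen I) : f (FreeAlgebra.ι ℂ g) = genVal ξ x g := FreeAlgebra.lift_ι_apply _ _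
  refine ⟨RingQuot.liftAlgHom ℂ ⟨f, ?_⟩, fun i r => ?_, fun e i r => ?_⟩
  · intro p q hpq
    cases hpq with
    | y1 i j r s =>
      simp only [map_sub, map_mul, hf, map_zero]; exact H.y1 i j r s
    | y2 e i j s =>
      simp only [map_sub, map_mul, map_smul, hf, map_zero]; exact H.y2 e i j s
    | y3 e i j r s =>
      simp only [map_sub, map_mul, map_smul, map_add, hf, map_zero]; exact H.y3 e i j r s
    | y4 e i j r s =>
      simp only [map_sub, map_mul, map_smul, map_add, hf, map_zero]; exact H.y4 e i j r s
    | y5_same i r s =>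
      simp only [map_sub, map_mul, hf, map_zero]; exact H.y5_same i r s
    | y5_ne i j r s hij =>
      simp only [map_sub, map_mul, hf, map_zero]; exact H.y5_ne i j r s hij
    | y6 e i j m r s hij hm =>
      simp only [map_sum, map_nestedComm, hf, map_zero]; exact H.serre hh hA e hij hm r s
  · rw [yxi, yg, RingQuot.liftAlgHom_mkAlgHom_apply]; exact hf _
  · rw [yx, yg, RingQuot.liftAlgHom_mkAlgHom_apply]; exact hf _

/-- Two representations that agree on the generators are equal. -/
theorem rep_ext {B : Type*} [Ring B] [Algebra ℂ B] {ρ ρ' : Yangian A d h →ₐ[ℂ] B}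
    (h1 : ∀ i r, ρ (yxi A d h i r) = ρ' (yxi A d h i r))
    (h2 : ∀ e i r, ρ (yx A d h e i r) = ρ' (yx A d h e i r)) : ρ = ρ' := by
  refine RingQuot.ringQuot_ext' ℂ _ _ (FreeAlgebra.hom_ext (funext fun g => ?_))
  cases g with
  | xi i r => exact h1 i r
  | x e i r => exact h2 e i r

end Serre

/-! ### Arithmetic of rational series -/

section Clearing

variable {E : Type*} [Ring E] [Algebra ℂ E]

theorem modeF_add (φ ψ : E⟦X⟧) : modeF (φ + ψ) = modeF φ + modeF ψ :=
  poly_ext fun r => by simp [modeF_X_pow]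

theorem modeF_sub (φ ψ : E⟦X⟧) : modeF (φ - ψ) = modeF φ - modeF ψ :=
  poly_ext fun r => by simp [modeF_X_pow]

theorem clears_of_polL {φ : E⟦X⟧} {D : ℂ[X]} {P : E[X]}
    (H : polL (scalarPoly D) * toL φ = polL P) : Clears φ D := by
  rw [clears_iff, kills_iff, ← resF_toL, ← resF_polL_mul, H, resF_polL]

theorem Clears.polL_eq {φ : E⟦X⟧} {D : ℂ[X]} (H : Clears φ D) :
    polL (scalarPoly D) * toL φ = polL (polyPart φ D) :=
  (kills_iff_polL φ D).1 ((clears_iff φ D).1 H)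

theorem Clears.add {φ ψ : E⟦X⟧} {D : ℂ[X]} (H : Clears φ D) (H' : Clears ψ D) :
    Clears (φ + ψ) D := by
  rw [clears_iff] at *
  rw [modeF_add]
  exact Kills.add H H'

theorem Clears.sub {φ ψ : E⟦X⟧} {D : ℂ[X]} (H : Clears φ D) (H' : Clears ψ D) :
    Clears (φ - ψ) D := by
  rw [clears_iff] at *
  rw [modeF_sub]
  exact Kills.sub H H'

theorem Clears.of_dvd {φ : E⟦X⟧} {D D' : ℂ[X]} (H : Clears φ D) (hd : D ∣ D') : Clears φ D' := by
  rw [clears_iff] at *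
  exact Kills.of_dvd H hd

theorem Clears.mul {φ ψ : E⟦X⟧} {D D' : ℂ[X]} (H : Clears φ D) (H' : Clears ψ D') :
    Clears (φ * ψ) (D * D') := by
  refine clears_of_polL (P := polyPart φ D * polyPart ψ D') ?_
  rw [map_mul, map_mul, map_mul, map_mul, ← H.polL_eq, ← H'.polL_eq, mul_assoc, mul_assoc,
    ← mul_assoc _ (toL φ), (polL_scalar_comm D' (toL φ)).eq, mul_assoc]

theorem clears_one (D : ℂ[X]) : Clears (1 : E⟦X⟧) D :=
  clears_of_polL (P := scalarPoly D) (by rw [map_one, mul_one])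

theorem clears_zero (D : ℂ[X]) : Clears (0 : E⟦X⟧) D :=
  clears_of_polL (P := 0) (by rw [map_zero, map_zero, mul_zero])

/-- Cancellation of coprime factors of a denominator. -/
theorem Clears.of_coprime {φ : E⟦X⟧} {D q r : ℂ[X]} (hc : IsCoprime D q) (H : Clears φ (D * r))
    (H' : Clears φ (q * r)) : Clears φ r := by
  rw [clears_iff, ← mem_annIdeal] at *
  obtain ⟨a, b, hab⟩ := hc
  have : r = a * (D * r) + b * (q * r) := by
    rw [← mul_assoc, ← mul_assoc, ← add_mul, hab, one_mul]
  rw [this]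
  exact add_mem (Ideal.mul_mem_left _ _ H) (Ideal.mul_mem_left _ _ H')

theorem Clears.modeF_eq_zero {φ : E⟦X⟧} {D q : ℂ[X]} (hc : IsCoprime D q) (H : Clears φ D)
    (H' : Clears φ q) : modeF φ = 0 :=
  Kills.eq_zero hc ((clears_iff _ _).1 H) ((clears_iff _ _).1 H')

/-- A series is determined by its constant coefficient and its negative powers of `u`. -/
theorem series_ext {φ ψ : E⟦X⟧} (h0 : PowerSeries.coeff 0 φ = PowerSeries.coeff 0 ψ)
    (h1 : modeF φ = modeF ψ) : φ = ψ := by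
  ext n
  rcases n with _ | n
  · exact h0
  · rw [← modeF_X_pow, h1, modeF_X_pow]

theorem modeF_map {E' : Type*} [Ring E'] [Algebra ℂ E'] (f : E →ₐ[ℂ] E') (φ : E⟦X⟧) :
    modeF (PowerSeries.map (f : E →+* E') φ) = (f.toLinearMap).comp (modeF φ) :=
  poly_ext fun r => by
    rw [modeF_X_pow, LinearMap.comp_apply, modeF_X_pow, PowerSeries.coeff_map]; rfl

theorem Clears.map {E' : Type*} [Ring E'] [Algebra ℂ E'] (f : E →ₐ[ℂ] E') {φ : E⟦X⟧} {D : ℂ[X]}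
    (H : Clears φ D) : Clears (PowerSeries.map (f : E →+* E') φ) D := by
  rw [clears_iff] at *
  rw [modeF_map]
  intro p
  rw [LinearMap.comp_apply, H p, map_zero]

theorem Clears.of_map {E' : Type*} [Ring E'] [Algebra ℂ E'] {f : E →ₐ[ℂ] E'}
    (hf : Function.Injective f) {φ : E⟦X⟧} {D : ℂ[X]}
    (H : Clears (PowerSeries.map (f : E →+* E') φ) D) : Clears φ D := by
  rw [clears_iff] at *
  rw [modeF_map] at H
  intro p
  exact hf ((H p).trans (map_zero f).symm)

/-! ### Regularity at a point -/

theorem RegularAt.add {φ ψ : E⟦X⟧} {u : ℂ} (H : RegularAt φ u) (H' : RegularAt ψ u) :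
    RegularAt (φ + ψ) u := by
  obtain ⟨D, hD, hu⟩ := H
  obtain ⟨D', hD', hu'⟩ := H'
  exact ⟨D * D', (hD.of_dvd (Dvd.intro _ rfl)).add (hD'.of_dvd (Dvd.intro_left _ rfl)), by
    rw [Polynomial.eval_mul]; exact mul_ne_zero hu hu'⟩

theorem RegularAt.sub {φ ψ : E⟦X⟧} {u : ℂ} (H : RegularAt φ u) (H' : RegularAt ψ u) :
    RegularAt (φ - ψ) u := by
  obtain ⟨D, hD, hu⟩ := H
  obtain ⟨D', hD', hu'⟩ := H'
  exact ⟨D * D', (hD.of_dvd (Dvd.intro _ rfl)).sub (hD'.of_dvd (Dvd.intro_left _ rfl)), by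
    rw [Polynomial.eval_mul]; exact mul_ne_zero hu hu'⟩

theorem RegularAt.mul {φ ψ : E⟦X⟧} {u : ℂ} (H : RegularAt φ u) (H' : RegularAt ψ u) :
    RegularAt (φ * ψ) u := by
  obtain ⟨D, hD, hu⟩ := H
  obtain ⟨D', hD', hu'⟩ := H'
  exact ⟨D * D', hD.mul hD', by rw [Polynomial.eval_mul]; exact mul_ne_zero hu hu'⟩

theorem RegularAt.of_map {E' : Type*} [Ring E'] [Algebra ℂ E'] {f : E →ₐ[ℂ] E'}
    (hf : Function.Injective f) {φ : E⟦X⟧} {u : ℂ}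
    (H : RegularAt (PowerSeries.map (f : E →+* E') φ) u) : RegularAt φ u := by
  obtain ⟨D, hD, hu⟩ := H
  exact ⟨D, hD.of_map hf, hu⟩

/-- The value at a regular point. -/
theorem RegularAt.hasValue {φ : E⟦X⟧} {u : ℂ} (H : RegularAt φ u) :
    HasValue (modeF φ) u (ratValue φ u - PowerSeries.coeff 0 φ) := by
  obtain ⟨g, hg⟩ := regularAt_iff.1 H
  have : HasValue (modeF φ) u (modeF φ g) := ⟨g, hg, rfl⟩
  rwa [ratValue_eq this, add_sub_cancel_left]

theorem ratValue_map {E' : Type*} [Ring E'] [Algebra ℂ E'] (f : E →ₐ[ℂ] E') {φ : E⟦X⟧} {u : ℂ}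
    (H : RegularAt φ u) :
    ratValue (PowerSeries.map (f : E →+* E') φ) u = f (ratValue φ u) := by
  have := H.hasValue.map f.toLinearMap
  rw [← modeF_map] at this
  rw [ratValue_eq this, PowerSeries.coeff_map]
  simp

theorem ratValue_add {φ ψ : E⟦X⟧} {u : ℂ} (H : RegularAt φ u) (H' : RegularAt ψ u) :
    ratValue (φ + ψ) u = ratValue φ u + ratValue ψ u := by
  have := H.hasValue.add H'.hasValue
  rw [← modeF_add] at this
  rw [ratValue_eq this, map_add]
  abel

/-- Evaluation of polynomials with coefficients in `E` at a scalar. -/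
def evalScalar (u : ℂ) : E[X] →+* E :=
  Polynomial.eval₂RingHom' (RingHom.id E) (algebraMap ℂ E u) fun a => Algebra.commutes' u a |>.symm

theorem evalScalar_apply (u : ℂ) (P : E[X]) : evalScalar u P = P.eval (algebraMap ℂ E u) := rfl

theorem ratValue_mul {φ ψ : E⟦X⟧} {u : ℂ} (H : RegularAt φ u) (H' : RegularAt ψ u) :
    ratValue (φ * ψ) u = ratValue φ u * ratValue ψ u := by
  obtain ⟨D, hD, hu⟩ := H
  obtain ⟨D', hD', hu'⟩ := H'
  have hu2 : (D * D').eval u ≠ 0 := by rw [Polynomial.eval_mul]; exact mul_ne_zero hu hu'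
  have hP : polyPart (φ * ψ) (D * D') = polyPart φ D * polyPart ψ D' := by
    refine polL_injective ?_
    rw [← (hD.mul hD').polL_eq, map_mul, map_mul, map_mul, map_mul, ← hD.polL_eq, ← hD'.polL_eq,
      mul_assoc, mul_assoc, ← mul_assoc _ (toL φ), (polL_scalar_comm D' (toL φ)).eq, mul_assoc]
  rw [ratValue_eq_eval ((clears_iff _ _).1 hD) hu, ratValue_eq_eval ((clears_iff _ _).1 hD') hu',
    ratValue_eq_eval ((clears_iff _ _).1 (hD.mul hD')) hu2, hP, ← evalScalar_apply, map_mul,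
    smul_mul_smul_comm, Polynomial.eval_mul, mul_inv]
  rfl

/-- A series with an inverse that is regular at `u` has an invertible value at `u`. -/
theorem ratValue_mul_eq_one {φ ψ : E⟦X⟧} {u : ℂ} (H : RegularAt φ u) (H' : RegularAt ψ u)
    (h : φ * ψ = 1) : ratValue φ u * ratValue ψ u = 1 := by
  have h1 : HasValue (modeF (1 : E⟦X⟧)) u 0 := by
    have : modeF (1 : E⟦X⟧) = 0 := poly_ext fun r => by
      rw [modeF_X_pow, PowerSeries.coeff_one, if_neg (Nat.succ_ne_zero r), LinearMap.zero_apply]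
    rw [this]; exact hasValue_zero u
  rw [← ratValue_mul H H', h, ratValue_eq h1]
  simp

/-! ### Translations of the variable -/

/-- `p(X) ↦ p(X + a)`. -/
def compAdd (a : ℂ) : ℂ[X] →ₐ[ℂ] ℂ[X] := Polynomial.aeval (Polynomial.X + Polynomial.C a)

theorem compAdd_X (a : ℂ) : compAdd a Polynomial.X = Polynomial.X + Polynomial.C a :=
  Polynomial.aeval_X _

theorem compAdd_C (a b : ℂ) : compAdd a (Polynomial.C b) = Polynomial.C b :=
  Polynomial.aeval_C _ _

theorem compAdd_comp (a b : ℂ) (p : ℂ[X]) : compAdd a (compAdd b p) = compAdd (a + b) p := by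
  have : (compAdd a).comp (compAdd b) = compAdd (a + b) := by
    ext
    simp [compAdd_X, compAdd_C, add_assoc]
  exact AlgHom.congr_fun this p

theorem compAdd_zero (p : ℂ[X]) : compAdd 0 p = p := by
  have : compAdd 0 = AlgHom.id ℂ ℂ[X] := by
    ext
    simp [compAdd_X, compAdd_C]
  exact AlgHom.congr_fun this p

theorem compAdd_eval (a u : ℂ) (p : ℂ[X]) : (compAdd a p).eval u = p.eval (u + a) := by
  have : (Polynomial.aeval u).comp (compAdd a) = Polynomial.aeval (R := ℂ) (u + a) := by
    ext
    simp [compAdd_X]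
  exact AlgHom.congr_fun this p

/-- The series `φ(u - a)`. -/
def translate (a : ℂ) (φ : E⟦X⟧) : E⟦X⟧ :=
  PowerSeries.mk fun n => match n with
    | 0 => PowerSeries.coeff 0 φ
    | r + 1 => modeF φ ((Polynomial.X + Polynomial.C a) ^ r)

theorem coeff_zero_translate (a : ℂ) (φ : E⟦X⟧) :
    PowerSeries.coeff 0 (translate a φ) = PowerSeries.coeff 0 φ := by
  rw [translate, PowerSeries.coeff_mk]

theorem modeF_translate (a : ℂ) (φ : E⟦X⟧) (p : ℂ[X]) :
    modeF (translate a φ) p = modeF φ (compAdd a p) := by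
  have : modeF (translate a φ) = (modeF φ).comp (compAdd a).toLinearMap :=
    poly_ext fun r => by
      rw [modeF_X_pow, translate, PowerSeries.coeff_mk]
      simp [compAdd_X]
  rw [this]; rfl

theorem translate_translate (a b : ℂ) (φ : E⟦X⟧) :
    translate a (translate b φ) = translate (a + b) φ := by
  refine series_ext ?_ (LinearMap.ext fun p => ?_)
  · simp only [coeff_zero_translate]
  · rw [modeF_translate, modeF_translate, modeF_translate, compAdd_comp, add_comm]

theorem translate_zero (φ : E⟦X⟧) : translate 0 φ = φ := by
  refine series_ext (coeff_zero_translate 0 φ) (LinearMap.ext fun p => ?_)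
  rw [modeF_translate, compAdd_zero]

theorem translate_sub (a : ℂ) (φ ψ : E⟦X⟧) :
    translate a (φ - ψ) = translate a φ - translate a ψ := by
  refine series_ext ?_ (LinearMap.ext fun p => ?_)
  · simp only [coeff_zero_translate, map_sub]
  · simp only [modeF_translate, modeF_sub, LinearMap.sub_apply]

theorem translate_one (a : ℂ) : translate a (1 : E⟦X⟧) = 1 := by
  have h0 : modeF (1 : E⟦X⟧) = 0 := poly_ext fun r => by
    rw [modeF_X_pow, PowerSeries.coeff_one, if_neg (Nat.succ_ne_zero r), LinearMap.zero_apply]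
  refine series_ext (coeff_zero_translate a 1) (LinearMap.ext fun p => ?_)
  rw [modeF_translate, h0]; rfl

/-- The product of two series without constant coefficients, on functionals; this is
`(Y ⊗ Z)((p(u) - p(v)) / (u - v))`. -/
def convF (Y Z : Functional E) : Functional E :=
  modeMap fun r => ∑ k ∈ Finset.range r, Y (Polynomial.X ^ k) * Z (Polynomial.X ^ (r - 1 - k))

theorem convF_X_mul (Y Z : Functional E) (p : ℂ[X]) :
    convF Y Z (Polynomial.X * p) = convF (shiftX Y) Z p + Y 1 * Z p := by
  have : (convF Y Z).comp (LinearMap.mulLeft ℂ Polynomial.X) =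
      convF (shiftX Y) Z + (LinearMap.mulLeft ℂ (Y 1)).comp Z := poly_ext fun r => by
    rw [LinearMap.comp_apply, LinearMap.mulLeft_apply, ← pow_succ', LinearMap.add_apply, convF,
      convF, modeMap_X_pow, modeMap_X_pow, Finset.sum_range_succ']
    simp only [shiftX, LinearMap.coe_mk, AddHom.coe_mk, LinearMap.comp_apply,
      LinearMap.mulLeft_apply, pow_zero, ← pow_succ']
    congr 1
    refine Finset.sum_congr rfl fun k _ => ?_
    congr 3; omega
  exact LinearMap.congr_fun this p

theorem convF_add_smul (Y Y' Z : Functional E) (a : ℂ) :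
    convF (Y + a • Y') Z = convF Y Z + a • convF Y' Z := poly_ext fun r => by
  simp only [convF, LinearMap.add_apply, LinearMap.smul_apply, modeMap_X_pow, Finset.smul_sum,
    ← Finset.sum_add_distrib, add_mul, smul_mul_assoc]

theorem convF_one (Y Z : Functional E) : convF Y Z 1 = 0 := by
  rw [← pow_zero Polynomial.X, convF, modeMap_X_pow, Finset.range_zero, Finset.sum_empty]

theorem convF_compAdd (a : ℂ) (Y Z : Functional E) (p : ℂ[X]) :
    convF (Y.comp (compAdd a).toLinearMap) (Z.comp (compAdd a).toLinearMap) p =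
      convF Y Z (compAdd a p) := by
  suffices h : convF (Y.comp (compAdd a).toLinearMap) (Z.comp (compAdd a).toLinearMap) =
      (convF Y Z).comp (compAdd a).toLinearMap from LinearMap.congr_fun h p
  refine poly_ext fun r => ?_
  induction r generalizing Y with
  | zero => simp [convF_one]
  | succ r ih =>
    have h1 : shiftX (Y.comp (compAdd a).toLinearMap) =
        (shiftX Y + a • Y).comp (compAdd a).toLinearMap := by
      refine LinearMap.ext fun p => ?_
      simp only [shiftX, LinearMap.coe_mk, AddHom.coe_mk, LinearMap.comp_apply,
        LinearMap.mulLeft_apply, LinearMap.add_apply, LinearMap.smul_apply,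
        AlgHom.toLinearMap_apply, map_mul, compAdd_X, add_mul, map_add]
      rw [← Polynomial.smul_eq_C_mul, map_smul]
    rw [pow_succ', convF_X_mul, h1, ih, convF_add_smul]
    simp only [LinearMap.comp_apply, LinearMap.add_apply, LinearMap.smul_apply,
      AlgHom.toLinearMap_apply, map_mul, compAdd_X, map_one, add_mul, map_add, convF_X_mul]
    rw [← Polynomial.smul_eq_C_mul, map_smul]
    abel

theorem modeF_mul (φ ψ : E⟦X⟧) (p : ℂ[X]) : modeF (φ * ψ) p =
    PowerSeries.coeff 0 φ * modeF ψ p + modeF φ p * PowerSeries.coeff 0 ψ +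
      convF (modeF φ) (modeF ψ) p := by
  have : modeF (φ * ψ) = (LinearMap.mulLeft ℂ (PowerSeries.coeff 0 φ)).comp (modeF ψ) +
      (LinearMap.mulRight ℂ (PowerSeries.coeff 0 ψ)).comp (modeF φ) +
      convF (modeF φ) (modeF ψ) := poly_ext fun r => by
    simp only [LinearMap.add_apply, LinearMap.comp_apply, LinearMap.mulLeft_apply,
      LinearMap.mulRight_apply, convF, modeMap_X_pow, modeF_X_pow]
    rw [PowerSeries.coeff_mul, Finset.Nat.sum_antidiagonal_eq_sum_range_succ_mk,
      Finset.sum_range_succ, Finset.sum_range_succ']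
    simp only [Nat.sub_zero, Nat.sub_self]
    rw [add_comm (Finset.sum _ _), add_assoc, add_assoc, add_comm (Finset.sum _ _)]
    congr 2
    refine Finset.sum_congr rfl fun k hk => ?_
    rw [Finset.mem_range] at hk
    congr 3; omega
  rw [this]; rfl

theorem translate_mul (a : ℂ) (φ ψ : E⟦X⟧) :
    translate a (φ * ψ) = translate a φ * translate a ψ := by
  refine series_ext ?_ (LinearMap.ext fun p => ?_)
  · simp only [coeff_zero_translate, PowerSeries.coeff_mul,
      Finset.HasAntidiagonal.antidiagonal_zero, Finset.sum_singleton]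
  · have h (χ : E⟦X⟧) : modeF (translate a χ) = (modeF χ).comp (compAdd a).toLinearMap :=
      LinearMap.ext (modeF_translate a χ)
    rw [modeF_translate, modeF_mul, modeF_mul, modeF_translate, modeF_translate,
      coeff_zero_translate, coeff_zero_translate, h, h, convF_compAdd]

theorem Clears.translate {φ : E⟦X⟧} {D : ℂ[X]} (H : Clears φ D) (a : ℂ) :
    Clears (translate a φ) (compAdd (-a) D) := by
  rw [clears_iff] at *
  intro p
  rw [modeF_translate, map_mul, compAdd_comp, add_neg_cancel, compAdd_zero]
  exact H _

theorem RegularAt.translate {φ : E⟦X⟧} {u : ℂ} (H : RegularAt φ u) (a : ℂ) :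
    RegularAt (translate a φ) (u + a) := by
  obtain ⟨D, hD, hu⟩ := H
  exact ⟨_, hD.translate a, by rwa [compAdd_eval, add_neg_cancel_right]⟩

theorem regularAt_translate {φ : E⟦X⟧} {u a : ℂ} :
    RegularAt (translate a φ) u ↔ RegularAt φ (u - a) := by
  refine ⟨fun H => ?_, fun H => ?_⟩
  · have := H.translate (-a)
    rwa [translate_translate, neg_add_cancel, translate_zero, ← sub_eq_add_neg] at this
  · have := H.translate a
    rwa [sub_add_cancel] at this

theorem poles_translate (a : ℂ) (φ : E⟦X⟧) : poles (translate a φ) = a +ᵥ poles φ := by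
  ext u
  rw [Set.mem_vadd_set_iff_neg_vadd_mem]
  simp only [poles, Set.mem_ofPred_eq, regularAt_translate, vadd_eq_add]
  rw [neg_add_eq_sub]

theorem ratValue_translate (a : ℂ) (φ : E⟦X⟧) (u : ℂ) :
    ratValue (translate a φ) u = ratValue φ (u - a) := by
  by_cases H : RegularAt φ (u - a)
  · obtain ⟨g, hg⟩ := regularAt_iff.1 H
    rw [ratValue_eq ⟨g, hg, rfl⟩, ratValue_eq (e := modeF φ g), coeff_zero_translate]
    refine ⟨compAdd (-a) g, fun p => ?_, ?_⟩
    · rw [modeF_translate, modeF_translate, map_mul (compAdd a), map_mul (compAdd a), compAdd_comp,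
        add_neg_cancel, compAdd_zero, ← hg (compAdd a p), map_sub, compAdd_X, compAdd_C, map_sub]
      congr 3; ring
    · rw [modeF_translate, compAdd_comp, add_neg_cancel, compAdd_zero]
  · rw [ratValue_eq_zero H, ratValue_eq_zero]
    exact fun h => H (regularAt_translate.1 h)

/-! ### The part of a product with prescribed poles -/

/-- `z` is the part of the rational function `φ(u) y(u)` with the poles of `y`, the poles of `φ`
and `y` being disjoint. The constant coefficient of `z` is arbitrary, and only `modeF z` is
determined by `φ` and `y`. -/
def IsTwist (φ y z : E⟦X⟧) : Prop :=
  ∃ D q : ℂ[X], IsCoprime D q ∧ Clears φ D ∧ Clears y q ∧ Clears z q ∧ Clears (φ * y - z) D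

theorem IsTwist.clears {φ y z : E⟦X⟧} (H : IsTwist φ y z) {q : ℂ[X]} (hy : Clears y q) :
    Clears z q := by
  obtain ⟨D, q', hc, h1, -, h3, h4⟩ := H
  refine Clears.of_coprime hc ?_ (h3.of_dvd (Dvd.intro _ rfl))
  have := (h1.mul hy).sub (h4.of_dvd (D' := D * q) (Dvd.intro _ rfl))
  rwa [sub_sub_cancel] at this

theorem IsTwist.clears_sub {φ y z : E⟦X⟧} (H : IsTwist φ y z) {D : ℂ[X]} (hφ : Clears φ D) :
    Clears (φ * y - z) D := by
  obtain ⟨D', q, hc, h1, h2, h3, h4⟩ := H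
  refine Clears.of_coprime hc (h4.of_dvd (Dvd.intro _ rfl)) ?_
  rw [mul_comm]
  exact (hφ.mul h2).sub (h3.of_dvd (Dvd.intro_left _ rfl))

theorem IsTwist.unique {φ y z z' : E⟦X⟧} (H : IsTwist φ y z) (H' : IsTwist φ y z') :
    modeF z = modeF z' := by
  obtain ⟨D, q, hc, h1, h2, h3, h4⟩ := H
  rw [← sub_eq_zero, ← modeF_sub]
  refine Clears.modeF_eq_zero hc ?_ (h3.sub (H'.clears h2))
  have := (H'.clears_sub h1).sub h4
  rwa [sub_sub_sub_cancel_left] at this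

theorem IsTwist.translate {φ y z : E⟦X⟧} (H : IsTwist φ y z) (a : ℂ) :
    IsTwist (translate a φ) (translate a y) (translate a z) := by
  obtain ⟨D, q, hc, h1, h2, h3, h4⟩ := H
  refine ⟨compAdd (-a) D, compAdd (-a) q, hc.map (compAdd (-a)).toRingHom, h1.translate a,
    h2.translate a, h3.translate a, ?_⟩
  rw [← translate_mul, ← translate_sub]
  exact h4.translate a

theorem IsTwist.map {E' : Type*} [Ring E'] [Algebra ℂ E'] (f : E →ₐ[ℂ] E') {φ y z : E⟦X⟧}
    (H : IsTwist φ y z) : IsTwist (PowerSeries.map (f : E →+* E') φ)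
      (PowerSeries.map (f : E →+* E') y) (PowerSeries.map (f : E →+* E') z) := by
  obtain ⟨D, q, hc, h1, h2, h3, h4⟩ := H
  refine ⟨D, q, hc, h1.map f, h2.map f, h3.map f, ?_⟩
  rw [← map_mul, ← map_sub]
  exact h4.map f

/-- The twist as the action of a polynomial on functionals. Modulo the denominator `q` of `y`, the
function `φ = P / D` is the polynomial `α P`, where `α D ≡ 1`. -/
theorem isTwist_iff {φ y z : E⟦X⟧} {D q α β : ℂ[X]} (hαβ : α * D + β * q = 1)
    (hφ : Clears φ D) (hy : Clears y q) : IsTwist φ y z ↔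
      modeF z = act (scalarPoly α * polyPart φ D) (modeF y) := by
  have key : act (scalarPoly D) (modeF (φ * y)) = act (polyPart φ D) (modeF y) := by
    rw [← resF_toL, ← resF_polL_mul, map_mul, ← mul_assoc, hφ.polL_eq, resF_polL_mul, resF_toL]
  have hyq : act (scalarPoly q) (modeF y) = 0 := (kills_iff _ _).1 ((clears_iff _ _).1 hy)
  constructor
  · intro H
    have h1 := (kills_iff _ _).1 ((clears_iff _ _).1 (H.clears_sub hφ))
    rw [modeF_sub, map_sub, key, sub_eq_zero] at h1
    have h2 := (kills_iff _ _).1 ((clears_iff _ _).1 (H.clears hy))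
    rw [act_mul_apply, h1, ← act_mul_apply, ← map_mul, eq_sub_of_add_eq hαβ, map_sub, map_sub,
      map_one, map_one, map_mul, LinearMap.sub_apply, act_mul_apply, h2, map_zero, sub_zero]
    rfl
  · intro H
    refine ⟨D, q, ⟨α, β, hαβ⟩, hφ, hy, ?_, ?_⟩
    · rw [clears_iff, H]
      exact Kills.act ((clears_iff _ _).1 hy) _
    · rw [clears_iff, kills_iff, modeF_sub, map_sub, key, H, ← act_mul_apply, ← mul_assoc,
        ← map_mul, mul_comm D, eq_sub_of_add_eq hαβ, map_sub, map_one, sub_mul, one_mul, map_sub,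
        LinearMap.sub_apply, sub_sub_cancel, (scalarPoly_comm _ _).eq, act_mul_apply,
        map_mul scalarPoly, act_mul_apply, hyq, map_zero, map_zero]

end Clearing

/-! ### Rationality on finite-dimensional representations -/

section Rationality

variable {E : Type*} [Ring E] [Algebra ℂ E]

theorem modeF_oneSeries (h : ℂ) (y : ℕ → E) : modeF (oneSeries h y) = h • modeMap y :=
  poly_ext fun r => by
    rw [modeF_X_pow, coeff_oneSeries_succ, LinearMap.smul_apply, modeMap_X_pow]

/-- A functional on polynomials that satisfies a linear recursion with coefficients in a
finite-dimensional algebra is killed by a scalar polynomial. -/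
theorem exists_kills_of_act_eq_zero [FiniteDimensional ℂ E] {P : E[X]} (hP : P.Monic)
    {Y : Functional E} (H : act P Y = 0) : ∃ D : ℂ[X], D ≠ 0 ∧ Kills D Y := by
  -- for reasons of dimension, some `D ≠ 0` kills `Y` on the polynomials of degree less than that of
  -- `P`, and the recursion extends this to all degrees
  set n := P.natDegree
  let L : ℂ[X] →ₗ[ℂ] (Fin n → E) :=
    LinearMap.pi fun k => Y.comp (LinearMap.mulRight ℂ (Polynomial.X ^ (k : ℕ)))
  have hL : ¬ Function.Injective L := fun h =>
    Polynomial.not_finite (R := ℂ) (Module.Finite.of_injective L h)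
  rw [← LinearMap.ker_eq_bot, Submodule.eq_bot_iff] at hL
  push Not at hL
  obtain ⟨D, hD, hD0⟩ := hL
  refine ⟨D, hD0, ?_⟩
  have h0 (k : ℕ) (hk : k < n) : Y (D * Polynomial.X ^ k) = 0 :=
    congrFun (LinearMap.mem_ker.1 hD) ⟨k, hk⟩
  have h1 (k : ℕ) : Y (D * Polynomial.X ^ k) = 0 := by
    induction k using Nat.strong_induction_on with
    | _ k ih =>
      rcases lt_or_ge k n with hk | hk
      · exact h0 k hk
      · have h2 := LinearMap.congr_fun H (D * Polynomial.X ^ (k - n))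
        rw [act_apply, Polynomial.sum_over_range _ (by simp), Finset.sum_range_succ,
          Finset.sum_eq_zero, zero_add, hP.coeff_natDegree, one_mul, LinearMap.zero_apply] at h2
        · rw [← h2, mul_left_comm, ← pow_add]
          congr 3; omega
        · intro j hj
          rw [Finset.mem_range] at hj
          rw [mul_left_comm, ← pow_add, ih _ (by omega), mul_zero]
  have : Y.comp (LinearMap.mulLeft ℂ D) = 0 := poly_ext fun k => h1 k
  exact fun p => LinearMap.congr_fun this p

theorem coeff_polyPart_of_le {φ : E⟦X⟧} {D : ℂ[X]} {m : ℕ} (hm : D.natDegree ≤ m) :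
    (polyPart φ D).coeff m = D.coeff m • PowerSeries.coeff 0 φ := by
  simp only [polyPart, Polynomial.finsetSum_coeff, Polynomial.coeff_monomial]
  rcases hm.lt_or_eq with h | h
  · rw [Polynomial.coeff_eq_zero_of_natDegree_lt h, zero_smul]
    refine Finset.sum_eq_zero fun k hk => Finset.sum_eq_zero fun j hj => if_neg ?_
    rw [Finset.mem_range] at hk hj
    omega
  · rw [Finset.sum_range_succ, Finset.sum_eq_zero, zero_add, Finset.sum_range_succ,
      Finset.sum_eq_zero, zero_add, h, if_pos rfl, Nat.sub_self]
    · intro j hj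
      rw [Finset.mem_range] at hj
      exact if_neg (by omega)
    · refine fun k hk => Finset.sum_eq_zero fun j hj => if_neg ?_
      rw [Finset.mem_range] at hk hj
      omega

/-- The inverse of a rational series is rational: if `D φ` is a polynomial `P`, then `P` kills the
functional of the inverse of `φ`. -/
theorem exists_clears_inv [FiniteDimensional ℂ E] {φ ψ : E⟦X⟧}
    (h0 : PowerSeries.coeff 0 φ = 1) (h : φ * ψ = 1) (H : ∃ D : ℂ[X], D ≠ 0 ∧ Clears φ D) :
    ∃ D : ℂ[X], D ≠ 0 ∧ Clears ψ D := by
  obtain ⟨D, hD0, hD⟩ := H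
  set D₁ := Polynomial.C D.leadingCoeff⁻¹ * D with hD₁
  have hm : D₁.Monic := by
    rw [hD₁, mul_comm]; exact Polynomial.monic_mul_leadingCoeff_inv hD0
  have hc : Clears φ D₁ := hD.of_dvd (Dvd.intro_left _ rfl)
  have hP : (polyPart φ D₁).Monic := by
    refine Polynomial.monic_of_natDegree_le_of_coeff_eq_one D₁.natDegree ?_ ?_
    · rw [Polynomial.natDegree_le_iff_coeff_eq_zero]
      intro m hm
      rw [coeff_polyPart_of_le hm.le, Polynomial.coeff_eq_zero_of_natDegree_lt hm, zero_smul]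
    · rw [coeff_polyPart_of_le le_rfl, hm.coeff_natDegree, one_smul, h0]
  obtain ⟨D', hD', hk⟩ := exists_kills_of_act_eq_zero hP (Y := modeF ψ) (by
    rw [← resF_toL, ← resF_polL_mul, ← hc.polL_eq, mul_assoc, ← map_mul, h, map_one, mul_one,
      resF_polL])
  exact ⟨D', hD', (clears_iff _ _).2 hk⟩

variable {I : Type*} {A : Matrix I I ℤ} {d : I → ℂ} {h : ℂ} {ξ : I → ℕ → E} {x : ℤˣ → I → ℕ → E}

/-- The modes of `x_i` are obtained from one another by the commutator with
`ξ_{i,1} - (h/2) ξ_{i,0}²`. -/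
theorem QuadRel.comm_eq (hA : CartanConditions A d) (H : QuadRel A d h ξ x) (e : ℤˣ) (i : I)
    (s : ℕ) : comm (ξ i 1 - (h / 2) • (ξ i 0 * ξ i 0)) (x e i s) =
      (2 * sgn e * d i) • x e i (s + 1) := by
  have h2 := H.y2 e i i
  have h3 := H.y3 e i i 0 s
  rw [hA.diag] at h2 h3
  have h4 : comm (ξ i 0 * ξ i 0) (x e i s) =
      (2 * sgn e * d i) • (ξ i 0 * x e i s + x e i s * ξ i 0) := by
    have h5 : comm (ξ i 0 * ξ i 0) (x e i s) =
        ξ i 0 * comm (ξ i 0) (x e i s) + comm (ξ i 0) (x e i s) * ξ i 0 := by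
      simp only [comm]; noncomm_ring
    rw [h5, h2, mul_smul_comm, smul_mul_assoc, ← smul_add]
    congr 1
    push_cast; ring
  have h6 : comm (ξ i 1 - (h / 2) • (ξ i 0 * ξ i 0)) (x e i s) =
      (comm (ξ i 1) (x e i s) - comm (ξ i 0) (x e i (s + 1))) + comm (ξ i 0) (x e i (s + 1)) -
        (h / 2) • comm (ξ i 0 * ξ i 0) (x e i s) := by
    simp only [comm, sub_mul, mul_sub, smul_sub, smul_mul_assoc, mul_smul_comm]
    abel
  rw [zero_add] at h3
  rw [h6, h3, h4, h2, smul_smul]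
  have e1 : sgn e * (h * (d i * ((2 : ℤ) : ℂ)) / 2) = h / 2 * (2 * sgn e * d i) := by
    push_cast; ring
  have e2 : sgn e * (d i * ((2 : ℤ) : ℂ)) = 2 * sgn e * d i := by push_cast; ring
  rw [e1, e2]
  abel

/-- The series `x_i(u)` is rational: its modes are the iterates of an operator `T`, whose minimal
polynomial is a denominator. -/
theorem QuadRel.exists_kills_x [FiniteDimensional ℂ E] (hA : CartanConditions A d)
    (H : QuadRel A d h ξ x) (e : ℤˣ) (i : I) :
    ∃ D : ℂ[X], D ≠ 0 ∧ Kills D (modeMap (x e i)) := by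
  set c := 2 * sgn e * d i with hc
  have hc0 : c ≠ 0 := mul_ne_zero (mul_ne_zero two_ne_zero (sgn_ne_zero e)) (hA.ne_zero i)
  set T : Module.End ℂ E := adL E (c⁻¹ • (ξ i 1 - (h / 2) • (ξ i 0 * ξ i 0))) with hT
  have hTs (s : ℕ) : T (x e i s) = x e i (s + 1) := by
    rw [hT, map_smul, LinearMap.smul_apply, adL_apply, H.comm_eq hA, smul_smul,
      inv_mul_cancel₀ hc0, one_smul]
  have hpow (s : ℕ) : (T ^ s) (x e i 0) = x e i s := by
    induction s with
    | zero => rfl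
    | succ s ih => rw [pow_succ', Module.End.mul_apply, ih, hTs]
  have hY (p : ℂ[X]) : modeMap (x e i) p = Polynomial.aeval T p (x e i 0) := by
    have : modeMap (x e i) =
        (LinearMap.applyₗ (x e i 0)).comp (Polynomial.aeval T).toLinearMap :=
      poly_ext fun s => by simp [modeMap_X_pow, hpow]
    rw [this]; rfl
  refine ⟨minpoly ℂ T, minpoly.ne_zero (Algebra.IsIntegral.isIntegral T), fun p => ?_⟩
  rw [hY, map_mul, minpoly.aeval, zero_mul, LinearMap.zero_apply]

theorem QuadRel.modeMap_y5 (H : QuadRel A d h ξ x) (i : I) (p p' : ℂ[X]) :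
    comm (modeMap (x 1 i) p) (modeMap (x (-1) i) p') = modeMap (ξ i) (p * p') := by
  have key : (adL E).compl₁₂ (modeMap (x 1 i)) (modeMap (x (-1) i)) =
      (LinearMap.mul ℂ ℂ[X]).compr₂ (modeMap (ξ i)) := by
    refine poly_ext₂ fun r s => ?_
    simp only [LinearMap.compl₁₂_apply, LinearMap.compr₂_apply, LinearMap.mul_apply', ← pow_add,
      modeMap_X_pow, adL_apply, H.y5_same]
  exact LinearMap.congr_fun (LinearMap.congr_fun key p) p'

theorem QuadRel.modeMap_y5_ne (H : QuadRel A d h ξ x) {i j : I} (hij : i ≠ j) (p p' : ℂ[X]) :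
    comm (modeMap (x 1 i) p) (modeMap (x (-1) j) p') = 0 := by
  have key : (adL E).compl₁₂ (modeMap (x 1 i)) (modeMap (x (-1) j)) = 0 := by
    refine poly_ext₂ fun r s => ?_
    simp only [LinearMap.compl₁₂_apply, modeMap_X_pow, adL_apply, H.y5_ne i j r s hij,
      LinearMap.zero_apply]
  exact LinearMap.congr_fun (LinearMap.congr_fun key p) p'

theorem QuadRel.exists_kills_xi [FiniteDimensional ℂ E] (hA : CartanConditions A d)
    (H : QuadRel A d h ξ x) (i : I) : ∃ D : ℂ[X], D ≠ 0 ∧ Kills D (modeMap (ξ i)) := by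
  obtain ⟨D, hD, hk⟩ := H.exists_kills_x hA 1 i
  refine ⟨D, hD, fun p => ?_⟩
  rw [← mul_one (D * p), ← H.modeMap_y5, hk p, comm, zero_mul, mul_zero, sub_zero]

end Rationality

/-! ### Denominators of a representation -/

section Denominators

variable {I : Type*} {A : Matrix I I ℤ} {d : I → ℂ} {h : ℂ}
variable {V : Type*} [AddCommGroup V] [Module ℂ V] {U : Type*} [AddCommGroup U] [Module ℂ U]

theorem xiSeries_eq (ρ : Rep A d h V) (i : I) :
    xiSeries ρ i = oneSeries h fun r => ρ (yxi A d h i r) := rfl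

theorem coeff_zero_xiSeries (ρ : Rep A d h V) (i : I) : PowerSeries.coeff 0 (xiSeries ρ i) = 1 :=
  coeff_oneSeries_zero _ _

theorem coeff_zero_xSeries (ρ : Rep A d h V) (e : ℤˣ) (i : I) :
    PowerSeries.coeff 0 (xSeries ρ e i) = 0 := by
  rw [xSeries, PowerSeries.coeff_mk]

theorem modeF_xSeries (ρ : Rep A d h V) (e : ℤˣ) (i : I) :
    modeF (xSeries ρ e i) = h • modeMap fun r => ρ (yx A d h e i r) :=
  poly_ext fun r => by
    rw [modeF_X_pow, xSeries, PowerSeries.coeff_mk, LinearMap.smul_apply, modeMap_X_pow]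

theorem modeF_xiSeries (ρ : Rep A d h V) (i : I) :
    modeF (xiSeries ρ i) = h • modeMap fun r => ρ (yxi A d h i r) := modeF_oneSeries _ _

theorem xiSeries_mul_inv (ρ : Rep A d h V) (i : I) : xiSeries ρ i * xiInvSeries ρ i = 1 :=
  oneSeries_mul_inv _ _

theorem xiInv_mul_xiSeries (ρ : Rep A d h V) (i : I) : xiInvSeries ρ i * xiSeries ρ i = 1 :=
  inv_mul_oneSeries _ _

theorem eq_xiInvSeries {ρ : Rep A d h V} {i : I} {ψ : (Module.End ℂ V)⟦X⟧}
    (H : xiSeries ρ i * ψ = 1) : ψ = xiInvSeries ρ i := by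
  rw [← mul_one (xiInvSeries ρ i), ← H, ← mul_assoc, xiInv_mul_xiSeries, one_mul]

/-- A common denominator of the rational functions `ξ_i(u)^{±1}`, `x_i^±(u)`. -/
structure IsDenominator (q : ℂ[X]) (ρ : Rep A d h V) : Prop where
  xi : ∀ i, Clears (xiSeries ρ i) q
  xiInv : ∀ i, Clears (xiInvSeries ρ i) q
  x : ∀ e i, Clears (xSeries ρ e i) q

theorem mem_sigma_iff {ρ : Rep A d h V} {u : ℂ} : u ∉ sigma ρ ↔
    (∀ i, RegularAt (xiSeries ρ i) u) ∧ (∀ i, RegularAt (xiInvSeries ρ i) u) ∧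
      ∀ e i, RegularAt (xSeries ρ e i) u := by
  simp only [sigma, Set.mem_iUnion, Set.mem_union, poles, Set.mem_ofPred_eq, not_exists, not_or,
    not_not]
  constructor
  · intro H
    refine ⟨fun i => (H i).1.1, fun i => (H i).1.2, fun e i => ?_⟩
    rcases Int.units_eq_one_or e with rfl | rfl
    exacts [(H i).2.1, (H i).2.2]
  · rintro ⟨h1, h2, h3⟩ i
    exact ⟨⟨h1 i, h2 i⟩, h3 1 i, h3 (-1) i⟩

theorem IsDenominator.notMem_sigma {q : ℂ[X]} {ρ : Rep A d h V} (H : IsDenominator q ρ) {u : ℂ}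
    (hu : q.eval u ≠ 0) : u ∉ sigma ρ :=
  mem_sigma_iff.2 ⟨fun i => ⟨q, H.xi i, hu⟩, fun i => ⟨q, H.xiInv i, hu⟩,
    fun e i => ⟨q, H.x e i, hu⟩⟩

/-- A finite-dimensional representation has a common denominator with set of roots `σ(V)`. -/
theorem exists_isDenominator [Finite I] [FiniteDimensional ℂ V] (hA : CartanConditions A d)
    (ρ : Rep A d h V) :
    ∃ q : ℂ[X], q ≠ 0 ∧ IsDenominator q ρ ∧ ∀ u, q.eval u = 0 ↔ u ∈ sigma ρ := by
  have hx (e : ℤˣ) (i : I) := exists_kills_eq_poles (φ := xSeries ρ e i) (by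
    obtain ⟨D, hD, hk⟩ := ρ.quadRel.exists_kills_x hA e i
    exact ⟨D, hD, fun p => by rw [modeF_xSeries, LinearMap.smul_apply, hk, smul_zero]⟩)
  have hxi' (i : I) : ∃ D : ℂ[X], D ≠ 0 ∧ Kills D (modeF (xiSeries ρ i)) := by
    obtain ⟨D, hD, hk⟩ := ρ.quadRel.exists_kills_xi hA i
    exact ⟨D, hD, fun p => by rw [modeF_xiSeries, LinearMap.smul_apply, hk, smul_zero]⟩
  have hxi (i : I) := exists_kills_eq_poles (hxi' i)
  have hinv (i : I) := exists_kills_eq_poles (φ := xiInvSeries ρ i) (by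
    simp only [← clears_iff] at hxi' ⊢
    exact exists_clears_inv (coeff_zero_xiSeries ρ i) (xiSeries_mul_inv ρ i) (hxi' i))
  choose a ha0 ha ha' using hx
  choose b hb0 hb hb' using hxi
  choose c hc0 hc hc' using hinv
  have := Fintype.ofFinite I
  have hq (i : I) : (b i * c i * (a 1 i * a (-1) i)) ∣ ∏ i, b i * c i * (a 1 i * a (-1) i) :=
    Finset.dvd_prod_of_mem _ (Finset.mem_univ i)
  refine ⟨∏ i, b i * c i * (a 1 i * a (-1) i), ?_, ⟨fun i => ?_, fun i => ?_, fun e i => ?_⟩,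
    fun u => ?_⟩
  · exact Finset.prod_ne_zero_iff.2 fun i _ => mul_ne_zero (mul_ne_zero (hb0 i) (hc0 i))
      (mul_ne_zero (ha0 1 i) (ha0 (-1) i))
  · exact ((clears_iff _ _).2 (hb i)).of_dvd
      (((Dvd.intro _ rfl).trans (Dvd.intro _ rfl)).trans (hq i))
  · exact ((clears_iff _ _).2 (hc i)).of_dvd
      (((Dvd.intro_left _ rfl).trans (Dvd.intro _ rfl)).trans (hq i))
  · rcases Int.units_eq_one_or e with rfl | rfl
    · exact ((clears_iff _ _).2 (ha 1 i)).of_dvd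
        (((Dvd.intro _ rfl).trans (Dvd.intro_left _ rfl)).trans (hq i))
    · exact ((clears_iff _ _).2 (ha (-1) i)).of_dvd
        (((Dvd.intro_left _ rfl).trans (Dvd.intro_left _ rfl)).trans (hq i))
  · rw [Polynomial.eval_prod, Finset.prod_eq_zero_iff]
    simp only [sigma, Set.mem_iUnion, Set.mem_union, Polynomial.eval_mul, mul_eq_zero, ha', hb',
      hc', Finset.mem_univ, true_and]

theorem finite_sigma [Finite I] [FiniteDimensional ℂ V] (hA : CartanConditions A d)
    (ρ : Rep A d h V) : (sigma ρ).Finite := by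
  obtain ⟨q, hq0, -, hq⟩ := exists_isDenominator hA ρ
  refine (q.roots.toFinset.finite_toSet).subset fun u hu => ?_
  simpa [hq0] using (hq u).2 hu

/-- The push-forward of a representation along a homomorphism of algebras of operators. -/
def Rep.push (f : Module.End ℂ V →ₐ[ℂ] Module.End ℂ U) (ρ : Rep A d h V) : Rep A d h U :=
  f.comp ρ

variable (f : Module.End ℂ V →ₐ[ℂ] Module.End ℂ U) (ρ : Rep A d h V)

theorem xiSeries_push (i : I) : xiSeries (ρ.push f) i =
    PowerSeries.map (f : Module.End ℂ V →+* Module.End ℂ U) (xiSeries ρ i) := by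
  ext1 n
  rw [PowerSeries.coeff_map]
  rcases n with _ | n
  · rw [coeff_zero_xiSeries, coeff_zero_xiSeries, map_one]
  · rw [xiSeries_eq, xiSeries_eq, coeff_oneSeries_succ, coeff_oneSeries_succ]
    exact (map_smul f h _).symm

theorem xSeries_push (e : ℤˣ) (i : I) : xSeries (ρ.push f) e i =
    PowerSeries.map (f : Module.End ℂ V →+* Module.End ℂ U) (xSeries ρ e i) := by
  ext1 n
  rw [PowerSeries.coeff_map]
  rcases n with _ | n
  · rw [coeff_zero_xSeries, coeff_zero_xSeries, map_zero]
  · rw [xSeries, xSeries, PowerSeries.coeff_mk, PowerSeries.coeff_mk]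
    exact (map_smul f h _).symm

theorem xiInvSeries_push (i : I) : xiInvSeries (ρ.push f) i =
    PowerSeries.map (f : Module.End ℂ V →+* Module.End ℂ U) (xiInvSeries ρ i) := by
  refine (eq_xiInvSeries ?_).symm
  rw [xiSeries_push, ← map_mul, xiSeries_mul_inv, map_one]

variable {ρ} in
theorem IsDenominator.push {q : ℂ[X]} (H : IsDenominator q ρ) : IsDenominator q (ρ.push f) where
  xi i := by rw [xiSeries_push]; exact (H.xi i).map f
  xiInv i := by rw [xiInvSeries_push]; exact (H.xiInv i).map f
  x e i := by rw [xSeries_push]; exact (H.x e i).map f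

theorem sigma_push_of_injective (hf : Function.Injective f) : sigma ρ ⊆ sigma (ρ.push f) := by
  intro u
  contrapose
  simp only [mem_sigma_iff, xiSeries_push, xiInvSeries_push, xSeries_push]
  exact fun H => ⟨fun i => (H.1 i).of_map hf, fun i => (H.2.1 i).of_map hf,
    fun e i => (H.2.2 e i).of_map hf⟩

/-! ### Shifted representations -/

theorem tau_yxi (a : ℂ) (i : I) (r : ℕ) :
    tau A d h a (yxi A d h i r) = shiftSeq a (yxi A d h i) r := by
  rw [tau, yxi, yg, RingQuot.liftAlgHom_mkAlgHom_apply]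
  exact FreeAlgebra.lift_ι_apply _ _

theorem tau_yx (a : ℂ) (e : ℤˣ) (i : I) (r : ℕ) :
    tau A d h a (yx A d h e i r) = shiftSeq a (yx A d h e i) r := by
  rw [tau, yx, yg, RingQuot.liftAlgHom_mkAlgHom_apply]
  exact FreeAlgebra.lift_ι_apply _ _

theorem map_shiftSeq {B B' : Type*} [AddCommGroup B] [Module ℂ B] [AddCommGroup B'] [Module ℂ B']
    (f : B →ₗ[ℂ] B') (a : ℂ) (y : ℕ → B) (r : ℕ) :
    f (shiftSeq a y r) = shiftSeq a (fun k => f (y k)) r := by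
  simp only [shiftSeq, map_sum, map_smul]

theorem xiSeries_shift (a : ℂ) (i : I) : xiSeries (ρ.shift a) i = translate a (xiSeries ρ i) := by
  refine series_ext ?_ (poly_ext fun r => ?_)
  · rw [coeff_zero_translate, coeff_zero_xiSeries, coeff_zero_xiSeries]
  · rw [modeF_translate, modeF_xiSeries, modeF_xiSeries, LinearMap.smul_apply,
      LinearMap.smul_apply, modeMap_X_pow, map_pow, compAdd_X, ← shiftSeq_eq]
    congr 1
    exact (congrArg ρ (tau_yxi a i r)).trans (map_shiftSeq ρ.toLinearMap a _ r)

theorem xSeries_shift (a : ℂ) (e : ℤˣ) (i : I) :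
    xSeries (ρ.shift a) e i = translate a (xSeries ρ e i) := by
  refine series_ext ?_ (poly_ext fun r => ?_)
  · rw [coeff_zero_translate, coeff_zero_xSeries, coeff_zero_xSeries]
  · rw [modeF_translate, modeF_xSeries, modeF_xSeries, LinearMap.smul_apply,
      LinearMap.smul_apply, modeMap_X_pow, map_pow, compAdd_X, ← shiftSeq_eq]
    congr 1
    exact (congrArg ρ (tau_yx a e i r)).trans (map_shiftSeq ρ.toLinearMap a _ r)

theorem xiInvSeries_shift (a : ℂ) (i : I) :
    xiInvSeries (ρ.shift a) i = translate a (xiInvSeries ρ i) := by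
  refine (eq_xiInvSeries ?_).symm
  rw [xiSeries_shift, ← translate_mul, xiSeries_mul_inv, translate_one]

theorem sigma_shift (a : ℂ) : sigma (ρ.shift a) = a +ᵥ sigma ρ := by
  simp only [sigma, xiSeries_shift, xiInvSeries_shift, xSeries_shift, poles_translate,
    Set.vadd_set_iUnion, Set.vadd_set_union]

theorem xiFun_shift (a : ℂ) (i : I) (u : ℂ) : xiFun (ρ.shift a) i u = xiFun ρ i (u - a) := by
  rw [xiFun, xiSeries_shift, ratValue_translate]; rfl

theorem xFun_shift (a : ℂ) (e : ℤˣ) (i : I) (u : ℂ) :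
    xFun (ρ.shift a) e i u = xFun ρ e i (u - a) := by
  rw [xFun, xSeries_shift, ratValue_translate]; rfl

/-- Representations are determined by their generating series. -/
theorem rep_ext_series (hh : h ≠ 0) {ρ ρ' : Rep A d h V}
    (h1 : ∀ i, xiSeries ρ i = xiSeries ρ' i) (h2 : ∀ e i, xSeries ρ e i = xSeries ρ' e i) :
    ρ = ρ' := by
  refine rep_ext (fun i r => ?_) fun e i r => ?_
  · have := congrArg (PowerSeries.coeff (r + 1)) (h1 i)
    rw [xiSeries_eq, xiSeries_eq, coeff_oneSeries_succ, coeff_oneSeries_succ] at this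
    exact smul_right_injective _ hh this
  · have := congrArg (PowerSeries.coeff (r + 1)) (h2 e i)
    rw [xSeries, xSeries, PowerSeries.coeff_mk, PowerSeries.coeff_mk] at this
    exact smul_right_injective _ hh this

theorem shift_shift (hh : h ≠ 0) (a b : ℂ) : (ρ.shift a).shift b = ρ.shift (a + b) :=
  rep_ext_series hh
    (fun i => by rw [xiSeries_shift, xiSeries_shift, xiSeries_shift, translate_translate, add_comm])
    (fun e i => by rw [xSeries_shift, xSeries_shift, xSeries_shift, translate_translate, add_comm])

theorem shift_zero (hh : h ≠ 0) : ρ.shift 0 = ρ :=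
  rep_ext_series hh (fun i => by rw [xiSeries_shift, translate_zero])
    (fun e i => by rw [xSeries_shift, translate_zero])

theorem push_shift (a : ℂ) : (ρ.push f).shift a = (ρ.shift a).push f := rfl

end Denominators

/-! ### Relations between currents -/

section Currents

variable {E : Type*} [Ring E] [Algebra ℂ E]

/-- The relation `φ(u) (u - v - b) Y(v) = (u - v + b) Y(v) φ(u)`, modulo terms that are polynomial
in `v`. -/
def LinRel (φ : E⟦X⟧) (b : ℂ) (Y : Functional E) : Prop :=
  ∀ p, φ * (PowerSeries.C (Y p) -
      PowerSeries.X * PowerSeries.C (Y ((Polynomial.X + Polynomial.C b) * p))) =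
    (PowerSeries.C (Y p) -
      PowerSeries.X * PowerSeries.C (Y ((Polynomial.X - Polynomial.C b) * p))) * φ

/-- The same relation, for a polynomial `Θ(u)` in place of a power series in `u⁻¹`. -/
def PolyRel (Θ : E[X]) (b : ℂ) (Y : Functional E) : Prop :=
  ∀ p, Θ * (Polynomial.monomial 1 (Y p) -
      Polynomial.C (Y ((Polynomial.X + Polynomial.C b) * p))) =
    (Polynomial.monomial 1 (Y p) -
      Polynomial.C (Y ((Polynomial.X - Polynomial.C b) * p))) * Θ

/-- The relation `(u - v - b) Y(u) Z(v) = (u - v + b) Z(v) Y(u)`, modulo terms that are polynomial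
in `u` or in `v`. -/
def PairRel (b : ℂ) (Y Z : Functional E) : Prop :=
  ∀ p r, Y (Polynomial.X * p) * Z r - Y p * Z (Polynomial.X * r) - b • (Y p * Z r) =
    Z r * Y (Polynomial.X * p) - Z (Polynomial.X * r) * Y p + b • (Z r * Y p)

theorem X_add_C_apply (Y : Functional E) (b : ℂ) (p : ℂ[X]) :
    Y ((Polynomial.X + Polynomial.C b) * p) = Y (Polynomial.X * p) + b • Y p := by
  rw [add_mul, map_add, ← Polynomial.smul_eq_C_mul, map_smul]

theorem X_sub_C_apply (Y : Functional E) (b : ℂ) (p : ℂ[X]) :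
    Y ((Polynomial.X - Polynomial.C b) * p) = Y (Polynomial.X * p) - b • Y p := by
  rw [sub_mul, map_sub, ← Polynomial.smul_eq_C_mul, map_smul]

theorem commute_C {φ : E⟦X⟧} {y : E} (H : ∀ n, Commute (PowerSeries.coeff n φ) y) :
    Commute φ (PowerSeries.C y) := by
  ext n
  rw [PowerSeries.coeff_mul_C, PowerSeries.coeff_C_mul, (H n).eq]

theorem commute_pair {φ : E⟦X⟧} {y z : E} (Hy : Commute φ (PowerSeries.C y))
    (Hz : Commute φ (PowerSeries.C z)) :
    Commute φ (PowerSeries.C y - PowerSeries.X * PowerSeries.C z) :=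
  Hy.sub_right (Commute.mul_right (PowerSeries.X_mul (φ := φ)).symm Hz)

theorem LinRel.add {φ : E⟦X⟧} {b : ℂ} {Y Z : Functional E} (H : LinRel φ b Y)
    (H' : LinRel φ b Z) : LinRel φ b (Y + Z) := fun p => by
  have := congrArg₂ (· + ·) (H p) (H' p)
  simp only [← mul_add, ← add_mul] at this
  simp only [LinearMap.add_apply, map_add]
  convert this using 2 <;> noncomm_ring

/-- A relation with `φ` is also a relation with `φ ψ`, if `ψ` commutes with the current. -/
theorem LinRel.mul_right {φ ψ : E⟦X⟧} {b : ℂ} {Y : Functional E} (H : LinRel φ b Y)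
    (hψ : ∀ p, Commute ψ (PowerSeries.C (Y p))) : LinRel (φ * ψ) b Y := fun p => by
  rw [mul_assoc, (commute_pair (hψ _) (hψ _)).eq, ← mul_assoc, H p, mul_assoc]

theorem LinRel.mul_left {φ ψ : E⟦X⟧} {b : ℂ} {Y : Functional E} (H : LinRel ψ b Y)
    (hφ : ∀ p, Commute φ (PowerSeries.C (Y p))) : LinRel (φ * ψ) b Y := fun p => by
  rw [mul_assoc, H p, ← mul_assoc, (commute_pair (hφ _) (hφ _)).eq, mul_assoc]

theorem act_eq_sum (Θ : E[X]) (Y : Functional E) :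
    act Θ Y = ∑ k ∈ Θ.support, act (Polynomial.monomial k (Θ.coeff k)) Y := by
  conv_lhs => rw [Θ.as_sum_support, map_sum, LinearMap.sum_apply]

theorem LinRel.act {φ : E⟦X⟧} {b : ℂ} {Y : Functional E} (H : LinRel φ b Y) {Θ : E[X]}
    (hΘ : ∀ k n, Commute (PowerSeries.coeff n φ) (Θ.coeff k)) : LinRel φ b (act Θ Y) := by
  have hmono (k : ℕ) : LinRel φ b (DrinfeldYangian.act (Polynomial.monomial k (Θ.coeff k)) Y) := by
    intro p
    set c := Θ.coeff k
    have hc : Commute φ (PowerSeries.C c) := commute_C (hΘ k)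
    have hs (y z : E) : PowerSeries.C (c * y) - PowerSeries.X * PowerSeries.C (c * z) =
        PowerSeries.C c * (PowerSeries.C y - PowerSeries.X * PowerSeries.C z) := by
      rw [mul_sub, ← mul_assoc, ← PowerSeries.X_mul (φ := PowerSeries.C c), map_mul, map_mul,
        mul_assoc]
    rw [act_monomial, act_monomial, act_monomial, hs, hs, mul_left_comm (Polynomial.X ^ k),
      mul_left_comm (Polynomial.X ^ k), ← mul_assoc, hc.eq, mul_assoc, H, mul_assoc]
  rw [act_eq_sum]
  induction Θ.support using Finset.cons_induction with
  | empty => intro p; simp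
  | cons k s hk ih => rw [Finset.sum_cons]; exact (hmono k).add ih

theorem toL_pair (y z : E) : polL (scalarPoly Polynomial.X) *
    toL (PowerSeries.C y - PowerSeries.X * PowerSeries.C z) =
      polL (Polynomial.monomial 1 y - Polynomial.C z) := by
  rw [map_sub, map_mul, HahnSeries.ofPowerSeries_X, map_sub, polL_C, polL_monomial,
    HahnSeries.ofPowerSeries_C, HahnSeries.ofPowerSeries_C, scalarPoly, Polynomial.coe_mapRingHom,
    Polynomial.map_X, ← Polynomial.monomial_one_one_eq_X, polL_monomial, mul_sub, ← mul_assoc,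
    HahnSeries.single_mul_single, HahnSeries.C_apply, HahnSeries.C_apply,
    HahnSeries.single_mul_single, HahnSeries.single_mul_single]
  simp

/-- The relation for a rational series yields the relation for its numerator. -/
theorem LinRel.polyRel {φ : E⟦X⟧} {b : ℂ} {Y : Functional E} (H : LinRel φ b Y) {D : ℂ[X]}
    (hD : Clears φ D) (α : ℂ[X]) : PolyRel (scalarPoly α * polyPart φ D) b Y := by
  intro p
  have hP : PolyRel (polyPart φ D) b Y := by
    intro p
    refine polL_injective ?_
    have hX (χ : LaurentSeries E) := (polL_scalar_comm (E := E) Polynomial.X χ).eq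
    have hDc (χ : LaurentSeries E) := (polL_scalar_comm (E := E) D χ).eq
    rw [map_mul polL, map_mul polL, ← hD.polL_eq, ← toL_pair, ← toL_pair]
    have H' := congrArg toL (H p)
    rw [map_mul toL, map_mul toL] at H'
    rw [mul_assoc, ← mul_assoc (toL φ), ← hX (toL φ), mul_assoc _ (toL φ), H',
      mul_assoc _ (toL _) (_ * _), ← mul_assoc (toL _) (polL (scalarPoly D)), ← hDc,
      mul_assoc (polL (scalarPoly D)), ← mul_assoc (polL (scalarPoly D)),
      ← mul_assoc (polL (scalarPoly Polynomial.X)) (polL (scalarPoly D)), hDc (polL _)]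
  rw [mul_assoc, hP p, ← mul_assoc, ← mul_assoc, (scalarPoly_comm α _).eq]

theorem PairRel.symm {b : ℂ} {Y Z : Functional E} (H : PairRel b Y Z) : PairRel b Z Y := by
  intro p r
  have := H r p
  rw [← sub_eq_zero] at this ⊢
  rw [← this]
  abel

theorem PairRel.add_left {b : ℂ} {Y Y' Z : Functional E} (H : PairRel b Y Z)
    (H' : PairRel b Y' Z) : PairRel b (Y + Y') Z := by
  intro p r
  have := congrArg₂ (· + ·) (H p r) (H' p r)
  simp only [LinearMap.add_apply, add_mul, mul_add, smul_add] at this ⊢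
  convert this using 1 <;> abel

theorem PairRel.add_right {b : ℂ} {Y Z Z' : Functional E} (H : PairRel b Y Z)
    (H' : PairRel b Y Z') : PairRel b Y (Z + Z') :=
  (H.symm.add_left H'.symm).symm

theorem pairRel_zero (b : ℂ) (Z : Functional E) : PairRel b 0 Z := fun p r => by simp

theorem act_mul_C {Θ : E[X]} {Y : Functional E} {c : E} (hc : ∀ p, Commute (Y p) c) (p : ℂ[X]) :
    act (Θ * Polynomial.C c) Y p = act Θ Y p * c := by
  have h1 : act (Polynomial.C c) Y = (LinearMap.mulRight ℂ c).comp Y := LinearMap.ext fun p => by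
    rw [← Polynomial.monomial_zero_left, act_monomial, pow_zero, one_mul, LinearMap.comp_apply,
      LinearMap.mulRight_apply, (hc p).eq]
  rw [act_mul_apply, h1, act_apply, act_apply, Polynomial.sum, Polynomial.sum, Finset.sum_mul]
  refine Finset.sum_congr rfl fun k _ => ?_
  rw [LinearMap.comp_apply, LinearMap.mulRight_apply, mul_assoc]

theorem act_C_mul (Θ : E[X]) (Y : Functional E) (c : E) (p : ℂ[X]) :
    act (Polynomial.C c * Θ) Y p = c * act Θ Y p := by
  rw [act_mul_apply, ← Polynomial.monomial_zero_left, act_monomial, pow_zero, one_mul]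

theorem act_mul_X (Θ : E[X]) (Y : Functional E) (p : ℂ[X]) :
    act (Θ * Polynomial.X) Y p = act Θ Y (Polynomial.X * p) := by
  rw [act_apply_mul, act_mul_apply, scalarPoly, Polynomial.coe_mapRingHom, Polynomial.map_X]

/-- If `Y` and `Z` commute, a linear relation between `Θ` and `Y` is a relation between the currents
`Θ(u) Z(u)` and `Y(v)`. -/
theorem PolyRel.pairRel {Θ : E[X]} {b : ℂ} {Y Z : Functional E} (H : PolyRel Θ b Y)
    (hc : ∀ p r, Commute (Z p) (Y r)) : PairRel b (act Θ Z) Y := by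
  intro p r
  have hm (y : E) : Polynomial.monomial 1 y = Polynomial.C y * Polynomial.X := by
    rw [← pow_one Polynomial.X, Polynomial.C_mul_X_pow_eq_monomial]
  have hm' (y : E) : Polynomial.monomial 1 y = Polynomial.X * Polynomial.C y := by
    rw [hm, Polynomial.X_mul]
  have h0 := congrArg (fun Ψ => act Ψ Z p) (H r)
  have h1 : act (Θ * (Polynomial.monomial 1 (Y r) -
      Polynomial.C (Y ((Polynomial.X + Polynomial.C b) * r)))) Z p =
      act Θ Z (Polynomial.X * p) * Y r -
        act Θ Z p * Y ((Polynomial.X + Polynomial.C b) * r) := by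
    rw [mul_sub, hm', ← mul_assoc, map_sub, LinearMap.sub_apply, LinearMap.sub_apply,
      act_mul_C fun q => hc q _, act_mul_C fun q => hc q _, act_mul_X]
  have h2 : act ((Polynomial.monomial 1 (Y r) -
      Polynomial.C (Y ((Polynomial.X - Polynomial.C b) * r))) * Θ) Z p =
      Y r * act Θ Z (Polynomial.X * p) -
        Y ((Polynomial.X - Polynomial.C b) * r) * act Θ Z p := by
    rw [sub_mul, hm, mul_assoc, Polynomial.X_mul, map_sub, LinearMap.sub_apply,
      LinearMap.sub_apply, act_C_mul, act_C_mul, act_mul_X]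
  beta_reduce at h0
  rw [h1, h2, X_add_C_apply, X_sub_C_apply, mul_add, sub_mul, mul_smul_comm, smul_mul_assoc] at h0
  rw [sub_sub, h0]
  abel

theorem PairRel.act_left {b : ℂ} {Y Z : Functional E} (H : PairRel b Y Z) {Θ : E[X]}
    (hΘ : ∀ k p, Commute (Θ.coeff k) (Z p)) : PairRel b (act Θ Y) Z := by
  have hmono (k : ℕ) : PairRel b (act (Polynomial.monomial k (Θ.coeff k)) Y) Z := by
    intro p r
    have := congrArg (Θ.coeff k * ·) (H (Polynomial.X ^ k * p) r)
    simp only [mul_sub, mul_add, mul_smul_comm] at this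
    simp only [act_monomial, mul_left_comm (Polynomial.X ^ k)]
    have hc (r : ℂ[X]) (y : E) : Z r * (Θ.coeff k * y) = Θ.coeff k * (Z r * y) := by
      rw [← mul_assoc, ← (hΘ k r).eq, mul_assoc]
    simpa only [hc, mul_assoc] using this
  rw [act_eq_sum]
  induction Θ.support using Finset.cons_induction with
  | empty => simpa using pairRel_zero b Z
  | cons k s hk ih => rw [Finset.sum_cons]; exact (hmono k).add_left ih

/-- The commutator with `c` of a current `Θ(u) Y(u)`. -/
theorem comm_act {Θ : E[X]} {Y : Functional E} {c : E} (hc : ∀ k, Commute c (Θ.coeff k))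
    (p : ℂ[X]) : comm c (act Θ Y p) = act Θ ((adL E c).comp Y) p := by
  rw [act_apply, act_apply, Polynomial.sum, Polynomial.sum, ← adL_apply, map_sum]
  refine Finset.sum_congr rfl fun k _ => ?_
  rw [LinearMap.comp_apply, adL_apply, adL_apply, comm, comm, mul_sub, ← mul_assoc, (hc k).eq,
    mul_assoc, mul_assoc]

theorem act_comp_mulLeft (Θ : E[X]) (Y : Functional E) (p r : ℂ[X]) :
    act Θ (Y.comp (LinearMap.mulLeft ℂ p)) r = act Θ Y (p * r) := by
  have : Y.comp (LinearMap.mulLeft ℂ p) = act (scalarPoly p) Y :=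
    LinearMap.ext fun s => (act_scalar p Y s).symm
  rw [this, act_apply_mul]

/-- A bilinear form supported on `u - v + a = 0` vanishes if its first argument is killed by
`q(u)`, its second argument by `g(v)`, and `q(v - a)` is prime to `g(v)`. -/
theorem bilin_eq_zero {N : ℂ[X] →ₗ[ℂ] ℂ[X] →ₗ[ℂ] E} {a : ℂ} {q g : ℂ[X]}
    (hN : ∀ p r, N (Polynomial.X * p) r - N p (Polynomial.X * r) + a • N p r = 0)
    (hq : ∀ p r, N (q * p) r = 0) (hg : ∀ p r, N p (g * r) = 0)
    (hc : IsCoprime (compAdd (-a) q) g) (p r : ℂ[X]) : N p r = 0 := by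
  have key (f : ℂ[X]) : ∀ p r, N (f * p) r = N p (compAdd (-a) f * r) := by
    induction f using Polynomial.induction_on with
    | C c =>
      intro p r
      rw [compAdd_C, ← Polynomial.smul_eq_C_mul, ← Polynomial.smul_eq_C_mul, map_smul, map_smul,
        LinearMap.smul_apply]
    | add f f' h h' =>
      intro p r
      rw [add_mul, map_add, map_add, add_mul, map_add, LinearMap.add_apply, h, h']
    | monomial n c ih =>
      intro p r
      rw [pow_succ, ← mul_assoc, mul_assoc _ Polynomial.X, ih,
        map_mul (compAdd (-a)) _ Polynomial.X,
        compAdd_X, map_neg, ← sub_eq_add_neg, mul_assoc _ (_ - _)]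
      have h1 := hN p (compAdd (-a) (Polynomial.C c * Polynomial.X ^ n) * r)
      rw [sub_add, sub_eq_zero] at h1
      have h2 (Q : ℂ[X]) : (Polynomial.X - Polynomial.C a) * Q = Polynomial.X * Q - a • Q := by
        rw [sub_mul, Polynomial.smul_eq_C_mul]
      rw [h1, mul_left_comm (compAdd (-a) _), h2, map_sub, map_smul]
  obtain ⟨s, t, hst⟩ := hc
  have : r = compAdd (-a) q * (s * r) + g * (t * r) := by
    rw [← mul_assoc, ← mul_assoc, ← add_mul, mul_comm _ s, mul_comm _ t, hst, one_mul]
  rw [this, map_add, ← key, hq, hg, add_zero]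

/-- The currents `x⁺ = Θ(u) x(u)` and `x⁻ = Θ'(v) y(v)` of a fused representation commute up to
terms supported on `u - v + a = 0`. -/
theorem twisted_comm {Θ Θ' : E[X]} {x y : Functional E} {a : ℂ} (H : PolyRel Θ (-a) y)
    (H' : PolyRel Θ' a x) (hxy : ∀ p r, Commute (x p) (y r))
    (hy : ∀ k p, Commute (Θ'.coeff k) (y p))
    (hx : ∀ k p, Commute (Θ.coeff k) (x p)) (hΘ : ∀ k l, Commute (Θ.coeff k) (Θ'.coeff l))
    (p r : ℂ[X]) :
    comm (act Θ x (Polynomial.X * p)) (act Θ' y r) -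
        comm (act Θ x p) (act Θ' y (Polynomial.X * r)) +
      a • comm (act Θ x p) (act Θ' y r) = 0 := by
  -- `S` is the product `y(v) Θ(u) x(u) Θ'(v)`, in this order. By the relation of `Θ(u)` with
  -- `y(v)`, `(u - v + a) x⁺(u) x⁻(v) = (u - v - a) S`; by that of `Θ'(v)` with `x(u)`,
  -- `(u - v - a) S = (u - v + a) x⁻(v) x⁺(u)`.
  let S (p r : ℂ[X]) : E := ∑ l ∈ Θ'.support, ∑ k ∈ Θ.support,
    y (Polynomial.X ^ l * r) * (Θ.coeff k * (x (Polynomial.X ^ k * p) * Θ'.coeff l))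
  let W (l : ℕ) : Functional E := (LinearMap.mulRight ℂ (Θ'.coeff l)).comp x
  let W' (k : ℕ) : Functional E := (LinearMap.mulRight ℂ (Θ.coeff k)).comp y
  have hW (l : ℕ) : PairRel (-a) (act Θ (W l)) y := H.pairRel fun p r => by
    exact (hxy p r).mul_left (hy l r)
  have hW' (k : ℕ) : PairRel a x (act Θ' (W' k)) := (H'.pairRel fun p r => by
    exact (hxy r p).symm.mul_left (hx k r)).symm
  have a1 (p r : ℂ[X]) : act Θ x p * act Θ' y r =
      ∑ l ∈ Θ'.support, act Θ (W l) p * y (Polynomial.X ^ l * r) := by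
    rw [act_apply Θ', Polynomial.sum, Finset.mul_sum]
    refine Finset.sum_congr rfl fun l _ => ?_
    rw [← mul_assoc, act_apply, act_apply, Polynomial.sum, Polynomial.sum, Finset.sum_mul]
    congr 1
    refine Finset.sum_congr rfl fun k _ => ?_
    simp only [W, LinearMap.comp_apply, LinearMap.mulRight_apply, mul_assoc]
  have a2 (p r : ℂ[X]) : ∑ l ∈ Θ'.support, y (Polynomial.X ^ l * r) * act Θ (W l) p = S p r := by
    refine Finset.sum_congr rfl fun l _ => ?_
    rw [act_apply, Polynomial.sum, Finset.mul_sum]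
    rfl
  have a3 (p r : ℂ[X]) : ∑ k ∈ Θ.support, x (Polynomial.X ^ k * p) * act Θ' (W' k) r = S p r := by
    simp only [S]
    rw [Finset.sum_comm]
    refine Finset.sum_congr rfl fun k _ => ?_
    rw [act_apply, Polynomial.sum, Finset.mul_sum]
    refine Finset.sum_congr rfl fun l _ => ?_
    have c1 : Commute (x (Polynomial.X ^ k * p) * Θ'.coeff l)
        (y (Polynomial.X ^ l * r) * Θ.coeff k) :=
      (Commute.mul_right (hxy _ _) (hx k _).symm).mul_left
        (Commute.mul_right (hy l _) (hΘ k l).symm)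
    simp only [W', LinearMap.comp_apply, LinearMap.mulRight_apply]
    rw [← mul_assoc, c1.eq, mul_assoc]
  have a4 (p r : ℂ[X]) : act Θ' y r * act Θ x p =
      ∑ k ∈ Θ.support, act Θ' (W' k) r * x (Polynomial.X ^ k * p) := by
    rw [act_apply Θ, Polynomial.sum, Finset.mul_sum]
    refine Finset.sum_congr rfl fun k _ => ?_
    rw [← mul_assoc, act_apply, act_apply, Polynomial.sum, Polynomial.sum, Finset.sum_mul]
    congr 1
    refine Finset.sum_congr rfl fun l _ => ?_
    simp only [W', LinearMap.comp_apply, LinearMap.mulRight_apply, mul_assoc]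
  have b1 : act Θ x (Polynomial.X * p) * act Θ' y r - act Θ x p * act Θ' y (Polynomial.X * r) +
      a • (act Θ x p * act Θ' y r) =
      S (Polynomial.X * p) r - S p (Polynomial.X * r) - a • S p r := by
    simp only [a1, ← a2, Finset.smul_sum, ← Finset.sum_sub_distrib, ← Finset.sum_add_distrib]
    refine Finset.sum_congr rfl fun l _ => ?_
    have := hW l p (Polynomial.X ^ l * r)
    rw [neg_smul, neg_smul, sub_neg_eq_add, ← sub_eq_add_neg] at this
    rw [mul_left_comm (Polynomial.X ^ l)]
    exact this
  have b2 : S (Polynomial.X * p) r - S p (Polynomial.X * r) - a • S p r =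
      act Θ' y r * act Θ x (Polynomial.X * p) - act Θ' y (Polynomial.X * r) * act Θ x p +
        a • (act Θ' y r * act Θ x p) := by
    simp only [a4, ← a3, Finset.smul_sum, ← Finset.sum_sub_distrib, ← Finset.sum_add_distrib]
    refine Finset.sum_congr rfl fun k _ => ?_
    have := hW' k (Polynomial.X ^ k * p) r
    rw [mul_left_comm (Polynomial.X ^ k)]
    exact this
  have b3 := b1.trans b2
  rw [← sub_eq_zero] at b3
  rw [← b3]
  simp only [comm, smul_sub]
  abel

/-- If a current `Y(v)` satisfies the linear relation with an invertible series `φ(u)`, its minimal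
annihilator has no root `λ` such that `λ - a` is a root of `q`. Indeed, on the part of `Y` with a
simple pole at `λ`, the relation at `u = λ - a` reads `0 = -2a Y φ(λ - a)`. -/
theorem LinRel.exists_kills_isCoprime {φ ψ : E⟦X⟧} {a : ℂ} {Y : Functional E} (H : LinRel φ (-a) Y)
    (hφψ : φ * ψ = 1) {D q : ℂ[X]} (hD0 : D ≠ 0) (hφ : Clears φ D) (hψ : Clears ψ D)
    (hY : Kills D Y) (hc : IsCoprime D q) :
    ∃ g, Kills g Y ∧ IsCoprime (compAdd (-a) q) g := by
  have hroot (u : ℂ) (hu : q.eval u = 0) : D.eval u ≠ 0 := fun h => by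
    obtain ⟨s, t, hst⟩ := hc
    have := congrArg (Polynomial.eval u) hst
    simp [hu, h] at this
  -- `g` generates the ideal of polynomials killing `Y`
  obtain ⟨g, hg⟩ := IsPrincipalIdealRing.principal (annIdeal Y)
  have hgm : Kills g Y := by
    rw [← mem_annIdeal, hg]; exact Ideal.mem_span_singleton_self g
  have hdvd (D' : ℂ[X]) (h : Kills D' Y) : g ∣ D' := by
    rw [← mem_annIdeal, hg] at h; exact Ideal.mem_span_singleton.1 h
  have hg0 : g ≠ 0 := by
    rintro rfl; exact hD0 (zero_dvd_iff.1 (hdvd D hY))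
  refine ⟨g, hgm, ?_⟩
  rw [Polynomial.isCoprime_iff_aeval_ne_zero_of_isAlgClosed ℂ ℂ]
  intro l
  simp only [Polynomial.coe_aeval_eq_eval, compAdd_eval]
  by_contra! hl
  obtain ⟨hlq, hlg⟩ := hl
  have hDμ := hroot _ hlq
  rw [← sub_eq_add_neg] at hDμ
  by_cases ha : a = 0
  · subst ha
    obtain ⟨c, rfl⟩ := hdvd D hY
    rw [sub_zero, Polynomial.eval_mul, hlg, zero_mul] at hDμ
    exact hDμ rfl
  · obtain ⟨g', hg'⟩ : Polynomial.X - Polynomial.C l ∣ g := Polynomial.dvd_iff_isRoot.2 hlg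
    have hP := H.polyRel hφ 1
    rw [map_one, one_mul] at hP
    set F := evalScalar (l - a) (polyPart φ D) with hF
    have hFinv : F * ratValue ψ (l - a) = algebraMap ℂ E (D.eval (l - a)) := by
      have h1 := ratValue_mul_eq_one ⟨D, hφ, hDμ⟩ ⟨D, hψ, hDμ⟩ hφψ
      rw [ratValue_eq_eval ((clears_iff _ _).1 hφ) hDμ, smul_mul_assoc, inv_smul_eq_iff₀ hDμ] at h1
      rw [hF, evalScalar_apply, h1, Algebra.algebraMap_eq_smul_one]
    have hev (y : E) : evalScalar (l - a) (Polynomial.monomial 1 y) = (l - a) • y := by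
      rw [evalScalar_apply, Polynomial.eval_monomial, pow_one, ← Algebra.commutes,
        ← Algebra.smul_def]
    have hev' (y : E) : evalScalar (l - a) (Polynomial.C y) = y := by
      rw [evalScalar_apply, Polynomial.eval_C]
    -- `g / (X - l)` kills `Y` as well, in contradiction with the choice of `g`
    have hk : Kills g' Y := fun p => by
      have h1 := congrArg (evalScalar (l - a)) (hP (g' * p))
      rw [map_mul (evalScalar (l - a)), map_mul (evalScalar (l - a)), map_sub, map_sub, hev, hev',
        hev', X_add_C_apply, X_sub_C_apply,
        ← hF] at h1
      have h2 : Y (Polynomial.X * (g' * p)) = l • Y (g' * p) := by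
        have h3 := hgm p
        rw [hg', mul_assoc, X_sub_C_apply, sub_eq_zero] at h3
        exact h3
      rw [h2, ← add_smul, ← sub_smul, ← sub_smul, ← sub_smul] at h1
      have e1 : l - a - (l + -a) = 0 := by ring
      have e2 : l - a - (l - -a) = -(2 * a) := by ring
      rw [e1, e2, zero_smul, mul_zero, smul_mul_assoc, eq_comm, smul_eq_zero] at h1
      have h4 := h1.resolve_left (neg_ne_zero.2 (mul_ne_zero two_ne_zero ha))
      have h5 : Y (g' * p) * (F * ratValue ψ (l - a)) = 0 := by
        rw [← mul_assoc, h4, zero_mul]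
      rw [hFinv, ← Algebra.commutes, ← Algebra.smul_def, smul_eq_zero] at h5
      exact h5.resolve_left hDμ
    obtain ⟨c, hc⟩ := hdvd g' hk
    have hg'0 : g' ≠ 0 := by rintro rfl; exact hg0 (by rw [hg', mul_zero])
    have h6 : g' * ((Polynomial.X - Polynomial.C l) * c) = g' * 1 := by
      rw [mul_one, mul_left_comm, ← mul_assoc, ← hg', ← hc]
    have h7 := mul_left_cancel₀ hg'0 h6
    have h8 := congrArg (Polynomial.eval l) h7
    simp at h8

end Currents

/-! ### Fusion of commuting representations -/

section Fusion

variable {I : Type*} {E : Type*} [Ring E] [Algebra ℂ E]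
variable {A : Matrix I I ℤ} {d : I → ℂ} {h : ℂ}

theorem modeMap_mem (S : Subalgebra ℂ E) {y : ℕ → E} (hy : ∀ r, y r ∈ S) (p : ℂ[X]) :
    modeMap y p ∈ S := by
  rw [modeMap_apply]
  exact sum_mem fun k _ => S.smul_mem (hy k) _

theorem coeff_oneSeries_mem (S : Subalgebra ℂ E) {y : ℕ → E} (hy : ∀ r, y r ∈ S) (n : ℕ) :
    PowerSeries.coeff n (oneSeries h y) ∈ S := by
  rcases n with _ | n
  · rw [coeff_oneSeries_zero]; exact one_mem S
  · rw [coeff_oneSeries_succ]; exact S.smul_mem (hy n) _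

theorem coeff_numerator_mem (S : Subalgebra ℂ E) {φ : E⟦X⟧} (hφ : ∀ n, PowerSeries.coeff n φ ∈ S)
    (α D : ℂ[X]) (k : ℕ) : (scalarPoly α * polyPart φ D).coeff k ∈ S := by
  rw [Polynomial.coeff_mul]
  refine sum_mem fun p _ => mul_mem ?_ ?_
  · rw [scalarPoly, Polynomial.coe_mapRingHom, Polynomial.coeff_map]
    exact S.algebraMap_mem _
  · rw [polyPart, Polynomial.finsetSum_coeff]
    refine sum_mem fun l _ => ?_
    rw [Polynomial.finsetSum_coeff]
    refine sum_mem fun j _ => ?_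
    rw [Polynomial.coeff_monomial]
    split_ifs
    · exact S.smul_mem (hφ _) _
    · exact zero_mem S

theorem coeff_act_mem (S : Subalgebra ℂ E) {Θ : E[X]} (hΘ : ∀ k, Θ.coeff k ∈ S) {Y : Functional E}
    (hY : ∀ p, Y p ∈ S) (p : ℂ[X]) : act Θ Y p ∈ S := by
  rw [act_apply]
  exact sum_mem fun k _ => mul_mem (hΘ k) (hY _)

variable {ξ : I → ℕ → E} {x : ℤˣ → I → ℕ → E}

theorem QuadRel.linRel (hh : h ≠ 0) (H : QuadRel A d h ξ x) (e : ℤˣ) (i j : I) :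
    LinRel (oneSeries h (ξ i)) (sgn e * (h * (d i * A i j) / 2)) (modeMap (x e j)) :=
  H.series_comm_poly hh e i j

theorem QuadRel.pairRel (H : QuadRel A d h ξ x) (e : ℤˣ) (i j : I) :
    PairRel (sgn e * (h * (d i * A i j) / 2)) (modeMap (x e i)) (modeMap (x e j)) := by
  set b := sgn e * (h * (d i * A i j) / 2) with hb
  set Y := modeMap (x e i)
  set Z := modeMap (x e j)
  have key : (LinearMap.mul ℂ E).compl₁₂ (Y.comp (LinearMap.mulLeft ℂ Polynomial.X)) Z -
      (LinearMap.mul ℂ E).compl₁₂ Y (Z.comp (LinearMap.mulLeft ℂ Polynomial.X)) -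
      b • (LinearMap.mul ℂ E).compl₁₂ Y Z =
      (LinearMap.mul ℂ E).flip.compl₁₂ (Y.comp (LinearMap.mulLeft ℂ Polynomial.X)) Z -
      (LinearMap.mul ℂ E).flip.compl₁₂ Y (Z.comp (LinearMap.mulLeft ℂ Polynomial.X)) +
      b • (LinearMap.mul ℂ E).flip.compl₁₂ Y Z := by
    refine poly_ext₂ fun r s => ?_
    simp only [LinearMap.compl₁₂_apply, LinearMap.sub_apply, LinearMap.smul_apply,
      LinearMap.comp_apply, LinearMap.mulLeft_apply, ← pow_succ', LinearMap.add_apply,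
      LinearMap.flip_apply, LinearMap.mul_apply', Y, Z, modeMap_X_pow]
    have := H.y4 e i j r s
    rw [← hb, smul_add] at this
    simp only [comm] at this
    rw [← sub_eq_zero] at this ⊢
    rw [← this]
    abel
  intro p r
  have := LinearMap.congr_fun (LinearMap.congr_fun key p) r
  simpa only [LinearMap.compl₁₂_apply, LinearMap.sub_apply, LinearMap.smul_apply,
      LinearMap.comp_apply, LinearMap.mulLeft_apply, LinearMap.add_apply,
      LinearMap.flip_apply, LinearMap.mul_apply'] using this

/-- Two commuting families of operators with the relations of the Yangian, whose rational
generating functions have disjoint sets of poles: `D` and `q` are coprime denominators. -/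
structure FusionData (A : Matrix I I ℤ) (d : I → ℂ) (h : ℂ) (ξ ξ' : I → ℕ → E)
    (x x' : ℤˣ → I → ℕ → E) (D q : ℂ[X]) : Prop where
  left : QuadRel A d h ξ x
  right : QuadRel A d h ξ' x'
  xi_xi : ∀ i j r s, Commute (ξ i r) (ξ' j s)
  xi_x : ∀ i e j r s, Commute (ξ i r) (x' e j s)
  x_xi : ∀ e i j r s, Commute (x e i r) (ξ' j s)
  x_x : ∀ e i e' j r s, Commute (x e i r) (x' e' j s)
  ne_zero : D ≠ 0
  ne_zero' : q ≠ 0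
  clears_left : ∀ i, Clears (oneSeries h (ξ i)) D
  clears_inv_left : ∀ i, Clears (PowerSeries.invOfUnit (oneSeries h (ξ i)) 1) D
  kills_left : ∀ e i, Kills D (modeMap (x e i))
  clears_right : ∀ i, Clears (oneSeries h (ξ' i)) q
  clears_inv_right : ∀ i, Clears (PowerSeries.invOfUnit (oneSeries h (ξ' i)) 1) q
  kills_right : ∀ e i, Kills q (modeMap (x' e i))

variable {ξ' : I → ℕ → E} {x' : ℤˣ → I → ℕ → E} {D q : ℂ[X]}

theorem FusionData.symm (F : FusionData A d h ξ ξ' x x' D q) : FusionData A d h ξ' ξ x' x q D where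
  left := F.right
  right := F.left
  xi_xi i j r s := (F.xi_xi j i s r).symm
  xi_x i e j r s := (F.x_xi e j i s r).symm
  x_xi e i j r s := (F.xi_x j e i s r).symm
  x_x e i e' j r s := (F.x_x e' j e i s r).symm
  ne_zero := F.ne_zero'
  ne_zero' := F.ne_zero
  clears_left := F.clears_right
  clears_inv_left := F.clears_inv_right
  kills_left := F.kills_right
  clears_right := F.clears_left
  clears_inv_right := F.clears_inv_left
  kills_right := F.kills_left

theorem mem_centralizer_of_commute {s : Set E} {y : E} (H : ∀ z ∈ s, Commute z y) :
    y ∈ Subalgebra.centralizer ℂ s :=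
  Subalgebra.mem_centralizer_iff ℂ |>.2 H

theorem commute_of_mem_centralizer {y z : E} (H : z ∈ Subalgebra.centralizer ℂ {y}) : Commute y z :=
  Subalgebra.mem_centralizer_iff ℂ |>.1 H y rfl

/-- An element commuting with a sequence commutes with its linear extension. -/
theorem commute_modeMap {y : E} {z : ℕ → E} (H : ∀ r, Commute y (z r)) (p : ℂ[X]) :
    Commute y (modeMap z p) :=
  commute_of_mem_centralizer (modeMap_mem _ (fun r => mem_centralizer_of_commute
    (by rintro _ rfl; exact H r)) p)

theorem commute_oneSeries {y : E} {z : ℕ → E} (H : ∀ r, Commute y (z r)) (n : ℕ) :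
    Commute y (PowerSeries.coeff n (oneSeries h z)) :=
  commute_of_mem_centralizer (coeff_oneSeries_mem _ (fun r => mem_centralizer_of_commute
    (by rintro _ rfl; exact H r)) n)

theorem commute_numerator {y : E} {z : ℕ → E} (H : ∀ r, Commute y (z r)) (α D : ℂ[X]) (k : ℕ) :
    Commute y ((scalarPoly α * polyPart (oneSeries h z) D).coeff k) :=
  commute_of_mem_centralizer (coeff_numerator_mem _ (fun n => coeff_oneSeries_mem _
    (fun r => mem_centralizer_of_commute (by rintro _ rfl; exact H r)) n) α D k)

theorem commute_act {y : E} {Θ : E[X]} {Y : Functional E} (hΘ : ∀ k, Commute y (Θ.coeff k))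
    (hY : ∀ p, Commute y (Y p)) (p : ℂ[X]) : Commute y (act Θ Y p) :=
  commute_of_mem_centralizer (coeff_act_mem _
    (fun k => mem_centralizer_of_commute (by rintro _ rfl; exact hΘ k))
    (fun p => mem_centralizer_of_commute (by rintro _ rfl; exact hY p)) p)

theorem QuadRel.commute_xi (H : QuadRel A d h ξ x) (i j : I) (r s : ℕ) :
    Commute (ξ i r) (ξ j s) := sub_eq_zero.1 (H.y1 i j r s)

/-- The current `x_i(u) + ξ_i(u) x'_i(u)`, the second term being restricted to the poles of
`x'_i`. Here `D` is a denominator of `ξ_i(u)`, and `α D ≡ 1` modulo a denominator of `x'_i(u)`. -/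
def fusedMode (h : ℂ) (ξ : I → ℕ → E) (x x' : ℤˣ → I → ℕ → E) (α D : ℂ[X]) (e : ℤˣ) (i : I) :
    Functional E :=
  modeMap (x e i) + act (scalarPoly α * polyPart (oneSeries h (ξ i)) D) (modeMap (x' e i))

/-- The relations between `ξ_i(u) ξ'_i(u)` and the fused currents: each of the two terms of the
current satisfies the relation with one factor and commutes with the other. -/
theorem FusionData.linRel (hh : h ≠ 0) (F : FusionData A d h ξ ξ' x x' D q) (α : ℂ[X]) (e : ℤˣ)
    (i j : I) : LinRel (oneSeries h (ξ i) * oneSeries h (ξ' i))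
      (sgn e * (h * (d i * A i j) / 2)) (fusedMode h ξ x x' α D e j) := by
  refine LinRel.add ?_ ?_
  · exact (F.left.linRel hh e i j).mul_right fun p => commute_C fun n =>
      (commute_oneSeries (fun r => (commute_modeMap (fun s => (F.x_xi e j i s r).symm) p).symm)
        n).symm
  · refine LinRel.mul_left ((F.right.linRel hh e i j).act fun k n => ?_)
      fun p => commute_C fun n => ?_
    · exact (commute_oneSeries (fun r => (commute_numerator (fun s => (F.xi_xi j i s r).symm)
        α D k).symm) n).symm
    · refine commute_act (fun k => ?_) (fun p => ?_) p
      · exact (commute_oneSeries (fun r => (commute_numerator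
          (fun s => F.left.commute_xi i j r s) α D k).symm) n).symm
      · exact (commute_oneSeries (fun r => (commute_modeMap (fun s => F.xi_x i e j r s) p).symm)
          n).symm

/-- The relations between fused currents of the same sign. For the mixed terms, these are the
relations of `ξ_i(u)` with `x_j(v)`, which match because `d_i a_ij` is symmetric. -/
theorem FusionData.pairRel (hh : h ≠ 0) (hA : CartanConditions A d)
    (F : FusionData A d h ξ ξ' x x' D q) (α : ℂ[X]) (e : ℤˣ) (i j : I) :
    PairRel (sgn e * (h * (d i * A i j) / 2)) (fusedMode h ξ x x' α D e i)
      (fusedMode h ξ x x' α D e j) := by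
  have hxx (i j : I) (p r : ℂ[X]) : Commute (modeMap (x' e i) p) (modeMap (x e j) r) :=
    commute_modeMap (fun s => (commute_modeMap (fun t => F.x_x e j e i s t) p).symm) r
  have hΘ (i j : I) (k : ℕ) (p : ℂ[X]) : Commute
      ((scalarPoly α * polyPart (oneSeries h (ξ i)) D).coeff k) (modeMap (x' e j) p) :=
    (commute_numerator (fun r => (commute_modeMap (fun s => F.xi_x i e j r s) p).symm) α D k).symm
  refine PairRel.add_left (PairRel.add_right (F.left.pairRel e i j) ?_) (PairRel.add_right ?_ ?_)
  · have := ((F.left.linRel hh e j i).polyRel (F.clears_left j) α).pairRel (hxx j i)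
    rw [← hA.symm i j] at this
    exact this.symm
  · exact ((F.left.linRel hh e i j).polyRel (F.clears_left i) α).pairRel (hxx i j)
  · refine PairRel.act_left (PairRel.symm (PairRel.act_left (F.right.pairRel e i j).symm (hΘ j i)))
      fun k p => ?_
    refine commute_act (fun l => ?_) (hΘ i j k) p
    exact commute_numerator (fun r => (commute_numerator
      (fun s => F.left.commute_xi j i r s) α D k).symm) α D l

/-- The commutators of the fused currents `x_i⁺(u)` and `x_j⁻(v)`: the commutator of the two twisted
terms vanishes, being supported on `u - v + a = 0`, where `u` is a pole of `x'_i⁺` and `v` a root of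
the minimal annihilator of `x_j⁻`. -/
theorem FusionData.comm_eq (hh : h ≠ 0) (hA : CartanConditions A d)
    (F : FusionData A d h ξ ξ' x x' D q) {α β : ℂ[X]} (hαβ : α * D + β * q = 1) (i j : I)
    (p r : ℂ[X]) :
    comm (fusedMode h ξ x x' α D 1 i p) (fusedMode h ξ' x' x β q (-1) j r) =
      comm (modeMap (x 1 i) p)
        (act (scalarPoly β * polyPart (oneSeries h (ξ' j)) q) (modeMap (x (-1) j)) r) +
      comm (act (scalarPoly α * polyPart (oneSeries h (ξ i)) D) (modeMap (x' 1 i)) p)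
        (modeMap (x' (-1) j) r) := by
  set Θ := scalarPoly α * polyPart (oneSeries h (ξ i)) D with hΘdef
  set Θ' := scalarPoly β * polyPart (oneSeries h (ξ' j)) q with hΘ'def
  have h1 : comm (modeMap (x 1 i) p) (modeMap (x' (-1) j) r) = 0 :=
    sub_eq_zero.2 (commute_modeMap (fun s => (commute_modeMap
      (fun t => (F.x_x 1 i (-1) j t s).symm) p).symm) r).eq
  have hxy (p r : ℂ[X]) : Commute (modeMap (x' 1 i) p) (modeMap (x (-1) j) r) :=
    commute_modeMap (fun s => (commute_modeMap (fun t => F.x_x (-1) j 1 i s t) p).symm) r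
  have hy (k : ℕ) (p : ℂ[X]) : Commute (Θ'.coeff k) (modeMap (x (-1) j) p) :=
    (commute_numerator (fun r => (commute_modeMap
      (fun s => (F.x_xi (-1) j j s r).symm) p).symm) β q k).symm
  have hx (k : ℕ) (p : ℂ[X]) : Commute (Θ.coeff k) (modeMap (x' 1 i) p) :=
    (commute_numerator (fun r => (commute_modeMap (fun s => F.xi_x i 1 i r s) p).symm) α D k).symm
  have hΘ (k l : ℕ) : Commute (Θ.coeff k) (Θ'.coeff l) :=
    commute_numerator (fun r => (commute_numerator (fun s => (F.xi_xi i j s r).symm) α D k).symm)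
      β q l
  have hL : LinRel (oneSeries h (ξ i)) (-(h * (d i * A i j) / 2)) (modeMap (x (-1) j)) := by
    have := F.left.linRel hh (-1) i j
    rwa [sgn_neg, sgn_one, neg_one_mul] at this
  have hL' : LinRel (oneSeries h (ξ' j)) (h * (d i * A i j) / 2) (modeMap (x' 1 i)) := by
    have := F.right.linRel hh 1 j i
    rwa [sgn_one, one_mul, ← hA.symm i j] at this
  obtain ⟨g, hg, hgc⟩ := hL.exists_kills_isCoprime (oneSeries_mul_inv _ _) F.ne_zero
    (F.clears_left i) (F.clears_inv_left i) (F.kills_left (-1) j) ⟨α, β, hαβ⟩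
  have h2 : comm (act Θ (modeMap (x' 1 i)) p) (act Θ' (modeMap (x (-1) j)) r) = 0 := by
    refine bilin_eq_zero (N := (adL E).compl₁₂ (act Θ (modeMap (x' 1 i)))
      (act Θ' (modeMap (x (-1) j)))) (a := h * (d i * A i j) / 2) (q := q) (g := g)
      (fun p r => ?_) (fun p r => ?_) (fun p r => ?_) hgc p r
    · exact twisted_comm (hL.polyRel (F.clears_left i) α) (hL'.polyRel (F.clears_right j) β)
        hxy hy hx hΘ p r
    · rw [LinearMap.compl₁₂_apply, (F.kills_right 1 i).act Θ p, map_zero, LinearMap.zero_apply]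
    · rw [LinearMap.compl₁₂_apply, hg.act Θ' r, map_zero]
  have h3 (a b c e : E) : comm (a + b) (c + e) = comm a c + comm a e + (comm b c + comm b e) := by
    simp only [comm]; noncomm_ring
  rw [fusedMode, fusedMode, LinearMap.add_apply, LinearMap.add_apply, h3, h1, zero_add]
  rw [← hΘdef, ← hΘ'def, h2, add_zero]

theorem commute_series {φ ψ : E⟦X⟧}
    (H : ∀ m n, Commute (PowerSeries.coeff m φ) (PowerSeries.coeff n ψ)) : Commute φ ψ := by
  ext n
  rw [PowerSeries.coeff_mul, PowerSeries.coeff_mul, ← Finset.Nat.sum_antidiagonal_swap]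
  exact Finset.sum_congr rfl fun p _ => (H p.2 p.1).eq

theorem FusionData.commute_series (F : FusionData A d h ξ ξ' x x' D q) (i : I) :
    Commute (oneSeries h (ξ i)) (oneSeries h (ξ' i)) :=
  DrinfeldYangian.commute_series fun m n => commute_oneSeries (fun r =>
    (commute_oneSeries (fun s => (F.xi_xi i i s r).symm) m).symm) n

/-- The residue identity: the two parts of `ξ_i(u) ξ'_i(u)`, with the poles of either factor. -/
theorem FusionData.modeF_mul (F : FusionData A d h ξ ξ' x x' D q) {α β : ℂ[X]}
    (hαβ : α * D + β * q = 1) (i : I) :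
    modeF (oneSeries h (ξ i) * oneSeries h (ξ' i)) =
      act (scalarPoly β * polyPart (oneSeries h (ξ' i)) q) (modeF (oneSeries h (ξ i))) +
      act (scalarPoly α * polyPart (oneSeries h (ξ i)) D) (modeF (oneSeries h (ξ' i))) := by
  set φ := oneSeries h (ξ i)
  set φ' := oneSeries h (ξ' i)
  have hc : φ' * φ = φ * φ' := (F.commute_series i).eq.symm
  rw [← resF_toL, ← resF_toL, ← resF_toL, ← resF_polL_mul, ← resF_polL_mul, ← resF_add,
    map_mul polL, map_mul polL, ← (F.clears_left i).polL_eq, ← (F.clears_right i).polL_eq]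
  congr 1
  rw [mul_assoc, mul_assoc, mul_assoc, mul_assoc, ← map_mul toL, ← map_mul toL, hc, ← mul_assoc,
    ← mul_assoc, ← add_mul, ← map_mul polL, ← map_mul polL, ← map_add polL, ← map_mul scalarPoly,
    ← map_mul scalarPoly, ← map_add scalarPoly, add_comm, hαβ, map_one, map_one, one_mul]

/-- The fused family of operators satisfies the relations of the Yangian, other than the Serre
relations. -/
theorem FusionData.exists_quadRel (hh : h ≠ 0) (hA : CartanConditions A d)
    (F : FusionData A d h ξ ξ' x x' D q) {α β : ℂ[X]} (hαβ : α * D + β * q = 1) :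
    ∃ (ξR : I → ℕ → E) (xR : ℤˣ → I → ℕ → E), QuadRel A d h ξR xR ∧
      (∀ i, oneSeries h (ξR i) = oneSeries h (ξ i) * oneSeries h (ξ' i)) ∧
      (∀ i, modeMap (xR 1 i) = fusedMode h ξ x x' α D 1 i) ∧
      ∀ i, modeMap (xR (-1) i) = fusedMode h ξ' x' x β q (-1) i := by
  set φ : I → E⟦X⟧ := fun i => oneSeries h (ξ i) * oneSeries h (ξ' i) with hφ
  set ξR : I → ℕ → E := fun i r => h⁻¹ • PowerSeries.coeff (r + 1) (φ i) with hξR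
  set G : ℤˣ → I → Functional E := fun e i =>
    if e = 1 then fusedMode h ξ x x' α D e i else fusedMode h ξ' x' x β q e i with hG
  set xR : ℤˣ → I → ℕ → E := fun e i r => G e i (Polynomial.X ^ r) with hxR
  have hφR (i : I) : oneSeries h (ξR i) = φ i := by
    ext n
    rcases n with _ | n
    · rw [coeff_oneSeries_zero]
      simp only [hφ, PowerSeries.coeff_mul, Finset.HasAntidiagonal.antidiagonal_zero,
        Finset.sum_singleton, coeff_oneSeries_zero, one_mul]
    · rw [coeff_oneSeries_succ, hξR, smul_smul, mul_inv_cancel₀ hh, one_smul]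
  have hGR (e : ℤˣ) (i : I) : modeMap (xR e i) = G e i :=
    poly_ext fun r => by rw [modeMap_X_pow]
  have hG1 (i : I) : G 1 i = fusedMode h ξ x x' α D 1 i := if_pos rfl
  have hGm (i : I) : G (-1) i = fusedMode h ξ' x' x β q (-1) i := if_neg (by decide)
  have hcφ (i : I) : oneSeries h (ξ' i) * oneSeries h (ξ i) = φ i := (F.commute_series i).eq.symm
  have hlin (e : ℤˣ) (i j : I) : LinRel (φ i) (sgn e * (h * (d i * A i j) / 2)) (G e j) := by
    rcases Int.units_eq_one_or e with rfl | rfl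
    · rw [hG1]; exact F.linRel hh α 1 i j
    · rw [hGm, ← hcφ]; exact F.symm.linRel hh β (-1) i j
  have hpair (e : ℤˣ) (i j : I) : PairRel (sgn e * (h * (d i * A i j) / 2)) (G e i) (G e j) := by
    rcases Int.units_eq_one_or e with rfl | rfl
    · rw [hG1, hG1]; exact F.pairRel hh hA α 1 i j
    · rw [hGm, hGm]; exact F.symm.pairRel hh hA β (-1) i j
  have h23 (e : ℤˣ) (i j : I) (s : ℕ) := (oneSeries_comm_iff (ξ := ξR i) (y := xR e j s)
    (z := xR e j (s + 1)) (b := sgn e * (h * (d i * A i j) / 2)) (c := sgn e * (d i * A i j)) hh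
    (by ring)).1 (by
      have := hlin e i j (Polynomial.X ^ s)
      rw [X_add_C_apply, X_sub_C_apply, ← pow_succ'] at this
      rw [hφR]
      exact this)
  refine ⟨ξR, xR, ⟨fun i j r s => ?_, fun e i j s => (h23 e i j s).1,
    fun e i j r s => (h23 e i j s).2 r, fun e i j r s => ?_, fun i r s => ?_,
    fun i j r s hij => ?_⟩, hφR, fun i => (hGR 1 i).trans (hG1 i), fun i => (hGR _ i).trans (hGm i)⟩
  · -- the coefficients of `ξ_i(u) ξ'_i(u)` commute
    have hc (y : E) (i : I) (h1 : ∀ r, Commute y (ξ i r)) (h2 : ∀ r, Commute y (ξ' i r)) (r : ℕ) :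
        Commute y (ξR i r) := by
      refine Commute.smul_right ?_ _
      rw [hφ, PowerSeries.coeff_mul]
      exact Commute.sum_right _ _ _ fun p _ =>
        (commute_oneSeries h1 p.1).mul_right (commute_oneSeries h2 p.2)
    refine sub_eq_zero.2 (hc _ j (fun s => ?_) (fun s => ?_) s).eq
    · exact (hc _ i (fun r => F.left.commute_xi j i s r) (fun r => F.xi_xi j i s r) r).symm
    · exact (hc _ i (fun r => (F.xi_xi i j r s).symm) (fun r => F.right.commute_xi j i s r) r).symm
  · -- the relations between currents of the same sign
    have := hpair e i j (Polynomial.X ^ r) (Polynomial.X ^ s)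
    rw [← pow_succ', ← pow_succ'] at this
    simp only [comm, hxR, smul_add]
    rw [← sub_eq_zero] at this ⊢
    rw [← this]
    abel
  · -- the commutator of `x_i⁺` and `x_i⁻`: the two terms of `F.comm_eq` are the two parts of
    -- `ξ_i(u) ξ'_i(u)`
    change comm (G 1 i _) (G (-1) i _) = h⁻¹ • PowerSeries.coeff (r + s + 1) (φ i)
    rw [hG1, hGm, F.comm_eq hh hA hαβ, ← modeF_X_pow, F.modeF_mul hαβ, comm_act,
      LinearMap.add_apply, smul_add, pow_add]
    · have e1 : (adL E (modeMap (x 1 i) (Polynomial.X ^ r))).comp (modeMap (x (-1) i)) =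
          (modeMap (ξ i)).comp (LinearMap.mulLeft ℂ (Polynomial.X ^ r)) :=
        LinearMap.ext fun p => F.left.modeMap_y5 i _ p
      have e2 : (adL E (modeMap (x' (-1) i) (Polynomial.X ^ s))).comp (modeMap (x' 1 i)) =
          -(modeMap (ξ' i)).comp (LinearMap.mulLeft ℂ (Polynomial.X ^ s)) :=
        LinearMap.ext fun p => by
          have := F.right.modeMap_y5 i p (Polynomial.X ^ s)
          rw [LinearMap.comp_apply, adL_apply, LinearMap.neg_apply, LinearMap.comp_apply,
            LinearMap.mulLeft_apply, mul_comm _ p, ← this, comm, comm, neg_sub]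
      rw [e1, act_comp_mulLeft, modeF_oneSeries, modeF_oneSeries, map_smul, map_smul,
        LinearMap.smul_apply, LinearMap.smul_apply, smul_smul, smul_smul, inv_mul_cancel₀ hh,
        one_smul, one_smul]
      congr 1
      rw [comm, ← neg_sub]
      change -comm (modeMap (x' (-1) i) _) _ = _
      rw [comm_act, e2, map_neg, LinearMap.neg_apply, neg_neg, act_comp_mulLeft, mul_comm]
      exact fun k => commute_numerator (fun t => (commute_modeMap
        (fun u => F.xi_x i (-1) i t u) _).symm) α D k
    · exact fun k => commute_numerator (fun t => (commute_modeMap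
        (fun u => (F.x_xi 1 i i u t).symm) _).symm) β q k
  · -- for `i ≠ j` both terms of `F.comm_eq` vanish
    change comm (G 1 i _) (G (-1) j _) = 0
    have e1 : (adL E (modeMap (x 1 i) (Polynomial.X ^ r))).comp (modeMap (x (-1) j)) = 0 :=
      LinearMap.ext fun p => F.left.modeMap_y5_ne hij _ p
    have e2 : (adL E (modeMap (x' (-1) j) (Polynomial.X ^ s))).comp (modeMap (x' 1 i)) = 0 :=
      LinearMap.ext fun p => by
        have := F.right.modeMap_y5_ne hij p (Polynomial.X ^ s)
        rw [LinearMap.comp_apply, adL_apply, LinearMap.zero_apply, ← neg_zero, ← this, comm, comm,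
          neg_sub]
    rw [hG1, hGm, F.comm_eq hh hA hαβ, comm_act, e1, map_zero, LinearMap.zero_apply, zero_add, comm,
      ← neg_sub]
    · change -comm (modeMap (x' (-1) j) _) _ = _
      rw [comm_act, e2, map_zero, LinearMap.zero_apply, neg_zero]
      exact fun k => commute_numerator (fun t => (commute_modeMap
        (fun u => F.xi_x i (-1) j t u) _).symm) α D k
    · exact fun k => commute_numerator (fun t => (commute_modeMap
        (fun u => (F.x_xi 1 i j u t).symm) _).symm) β q k

end Fusion

/-! ### Fusion of representations -/

section RepFusion

variable {I : Type*} {A : Matrix I I ℤ} {d : I → ℂ} {h : ℂ}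
variable {U : Type*} [AddCommGroup U] [Module ℂ U]

/-- `R` is the fusion of the commuting representations `S` and `T` on the same space: `x_i⁺(u)` is
that of `S`, plus the part of `ξ_i^S(u) x_i^{T,+}(u)` with the poles of the second factor, and
symmetrically for `x_i⁻(u)`. -/
structure IsFusion (S T R : Rep A d h U) : Prop where
  xi : ∀ i, xiSeries R i = xiSeries S i * xiSeries T i
  plus : ∀ i, IsTwist (xiSeries S i) (xSeries T 1 i) (xSeries R 1 i - xSeries S 1 i)
  minus : ∀ i, IsTwist (xiSeries T i) (xSeries S (-1) i) (xSeries R (-1) i - xSeries T (-1) i)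

variable {S T R : Rep A d h U}

theorem IsFusion.unique (hh : h ≠ 0) {R' : Rep A d h U} (H : IsFusion S T R)
    (H' : IsFusion S T R') : R = R' := by
  refine rep_ext_series hh (fun i => (H.xi i).trans (H'.xi i).symm) fun e i => ?_
  refine series_ext ((coeff_zero_xSeries _ _ _).trans (coeff_zero_xSeries _ _ _).symm) ?_
  rcases Int.units_eq_one_or e with rfl | rfl
  · have := (H.plus i).unique (H'.plus i)
    rwa [modeF_sub, modeF_sub, sub_left_inj] at this
  · have := (H.minus i).unique (H'.minus i)
    rwa [modeF_sub, modeF_sub, sub_left_inj] at this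

theorem IsDenominator.kills_x (hh : h ≠ 0) {q : ℂ[X]} (H : IsDenominator q S) (e : ℤˣ) (i : I) :
    Kills q (modeMap fun r => S (yx A d h e i r)) := fun p => by
  have := (clears_iff _ _).1 (H.x e i) p
  rw [modeF_xSeries, LinearMap.smul_apply, smul_eq_zero] at this
  exact this.resolve_left hh

/-- Commuting representations with disjoint sets of poles have a fusion. -/
theorem exists_isFusion [FiniteDimensional ℂ U] (hh : h ≠ 0) (hA : CartanConditions A d)
    (hc : ∀ y y', Commute (S y) (T y')) {D q : ℂ[X]} (hD0 : D ≠ 0) (hq0 : q ≠ 0)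
    (hDq : IsCoprime D q) (hD : IsDenominator D S) (hq : IsDenominator q T) :
    ∃ R, IsFusion S T R := by
  obtain ⟨α, β, hαβ⟩ := hDq
  have F : FusionData A d h (fun i r => S (yxi A d h i r)) (fun i r => T (yxi A d h i r))
      (fun e i r => S (yx A d h e i r)) (fun e i r => T (yx A d h e i r)) D q :=
    { left := S.quadRel
      right := T.quadRel
      xi_xi := fun _ _ _ _ => hc _ _
      xi_x := fun _ _ _ _ _ => hc _ _
      x_xi := fun _ _ _ _ _ => hc _ _
      x_x := fun _ _ _ _ _ _ => hc _ _
      ne_zero := hD0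
      ne_zero' := hq0
      clears_left := hD.xi
      clears_inv_left := hD.xiInv
      kills_left := hD.kills_x hh
      clears_right := hq.xi
      clears_inv_right := hq.xiInv
      kills_right := hq.kills_x hh }
  obtain ⟨ξR, xR, HR, h1, h2, h3⟩ := F.exists_quadRel hh hA hαβ
  obtain ⟨R, hR1, hR2⟩ := exists_rep_of_quadRel hh hA HR
  have e1 (e : ℤˣ) (i : I) : modeF (xSeries R e i) = h • modeMap (xR e i) := by
    rw [modeF_xSeries]; simp only [hR2]
  refine ⟨R, fun i => ?_, fun i => ?_, fun i => ?_⟩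
  · rw [xiSeries_eq, xiSeries_eq, xiSeries_eq]
    simp only [hR1]
    exact h1 i
  · rw [isTwist_iff hαβ (hD.xi i) (hq.x 1 i), modeF_sub, e1, modeF_xSeries, modeF_xSeries, h2 i,
      fusedMode, smul_add, add_sub_cancel_left, map_smul]
    rfl
  · have hβα : β * q + α * D = 1 := by rw [add_comm, hαβ]
    rw [isTwist_iff hβα (hq.xi i) (hD.x (-1) i), modeF_sub, e1, modeF_xSeries, modeF_xSeries, h3 i,
      fusedMode, smul_add, add_sub_cancel_left, map_smul]
    rfl

theorem IsFusion.xiInv (H : IsFusion S T R) (i : I) :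
    xiInvSeries R i = xiInvSeries T i * xiInvSeries S i := by
  refine (eq_xiInvSeries ?_).symm
  rw [H.xi, mul_assoc, ← mul_assoc (xiSeries T i), xiSeries_mul_inv, one_mul, xiSeries_mul_inv]

/-- The poles of a fused representation are poles of one of its factors. -/
theorem IsFusion.isDenominator (H : IsFusion S T R) {D q : ℂ[X]} (hD : IsDenominator D S)
    (hq : IsDenominator q T) : IsDenominator (D * q) R where
  xi i := by rw [H.xi]; exact (hD.xi i).mul (hq.xi i)
  xiInv i := by rw [H.xiInv, mul_comm]; exact (hq.xiInv i).mul (hD.xiInv i)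
  x e i := by
    rcases Int.units_eq_one_or e with rfl | rfl
    · rw [← add_sub_cancel (xSeries S 1 i) (xSeries R 1 i)]
      exact ((hD.x 1 i).of_dvd (Dvd.intro _ rfl)).add
        (((H.plus i).clears (hq.x 1 i)).of_dvd (Dvd.intro_left _ rfl))
    · rw [← add_sub_cancel (xSeries T (-1) i) (xSeries R (-1) i)]
      exact ((hq.x (-1) i).of_dvd (Dvd.intro_left _ rfl)).add
        (((H.minus i).clears (hD.x (-1) i)).of_dvd (Dvd.intro _ rfl))

theorem IsFusion.shift (H : IsFusion S T R) (a : ℂ) :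
    IsFusion (S.shift a) (T.shift a) (R.shift a) where
  xi i := by rw [xiSeries_shift, xiSeries_shift, xiSeries_shift, H.xi, translate_mul]
  plus i := by
    rw [xiSeries_shift, xSeries_shift, xSeries_shift, xSeries_shift, ← translate_sub]
    exact (H.plus i).translate a
  minus i := by
    rw [xiSeries_shift, xSeries_shift, xSeries_shift, xSeries_shift, ← translate_sub]
    exact (H.minus i).translate a

theorem IsFusion.push {U' : Type*} [AddCommGroup U'] [Module ℂ U'] (H : IsFusion S T R)
    (f : Module.End ℂ U →ₐ[ℂ] Module.End ℂ U') : IsFusion (S.push f) (T.push f) (R.push f) where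
  xi i := by rw [xiSeries_push, xiSeries_push, xiSeries_push, H.xi, map_mul]
  plus i := by
    rw [xiSeries_push, xSeries_push, xSeries_push, xSeries_push, ← map_sub]
    exact (H.plus i).map f
  minus i := by
    rw [xiSeries_push, xSeries_push, xSeries_push, xSeries_push, ← map_sub]
    exact (H.minus i).map f

/-- If the fusion and its first factor are regular at `u`, so is the second factor. -/
theorem IsFusion.notMem_sigma_right (H : IsFusion S T R) {u : ℂ} (hS : u ∉ sigma S)
    (hR : u ∉ sigma R) : u ∉ sigma T := by
  rw [mem_sigma_iff] at hS hR ⊢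
  obtain ⟨s1, s2, s3⟩ := hS
  obtain ⟨r1, r2, r3⟩ := hR
  have t1 (i : I) : RegularAt (xiSeries T i) u := by
    have := (s2 i).mul (r1 i)
    rwa [H.xi, ← mul_assoc, xiInv_mul_xiSeries, one_mul] at this
  refine ⟨t1, fun i => ?_, fun e i => ?_⟩
  · have := (r2 i).mul (s1 i)
    rwa [H.xiInv, mul_assoc, xiInv_mul_xiSeries, mul_one] at this
  · rcases Int.units_eq_one_or e with rfl | rfl
    · obtain ⟨D, hD, hu⟩ := s1 i
      have h1 : RegularAt (xiSeries S i * xSeries T 1 i) u := by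
        have := (show RegularAt _ u from ⟨D, (H.plus i).clears_sub hD, hu⟩).add
          ((r3 1 i).sub (s3 1 i))
        rwa [sub_add_cancel] at this
      have := (s2 i).mul h1
      rwa [← mul_assoc, xiInv_mul_xiSeries, one_mul] at this
    · obtain ⟨D, hD, hu⟩ := s3 (-1) i
      have := (r3 (-1) i).sub (show RegularAt _ u from ⟨D, (H.minus i).clears hD, hu⟩)
      rwa [sub_sub_cancel] at this

/-- Associativity of the twist. The point is that `φ₁ z₂₃ - z` has the poles of `φ₁` only. -/
theorem isTwist_assoc {E : Type*} [Ring E] [Algebra ℂ E] {φ₁ φ₂ y₂ y₃ z₁₂ z z₂₃ : E⟦X⟧}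
    {q₁ q₂ q₃ : ℂ[X]} (h13 : IsCoprime q₁ q₃) (h23 : IsCoprime q₂ q₃) (h12 : IsCoprime q₁ q₂)
    (hφ₁ : Clears φ₁ q₁) (hφ₂ : Clears φ₂ q₂) (hy₂ : Clears y₂ q₂) (hy₃ : Clears y₃ q₃)
    (H12 : IsTwist φ₁ y₂ z₁₂) (H : IsTwist (φ₁ * φ₂) y₃ z) (H23 : IsTwist φ₂ y₃ z₂₃) :
    IsTwist φ₁ (y₂ + z₂₃) (z₁₂ + z) := by
  have c1 : Clears (φ₁ * z₂₃ - z) q₁ := by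
    refine Clears.of_coprime h23 ?_ ?_
    · have := (H.clears_sub (hφ₁.mul hφ₂)).sub (hφ₁.mul (H23.clears_sub hφ₂))
      rw [mul_comm]
      convert this using 1
      rw [mul_sub, mul_assoc, sub_sub_sub_cancel_left]
    · rw [mul_comm]
      exact (hφ₁.mul (H23.clears hy₃)).sub ((H.clears hy₃).of_dvd (Dvd.intro_left _ rfl))
  refine ⟨q₁, q₂ * q₃, h12.mul_right h13, hφ₁, ?_, ?_, ?_⟩
  · exact (hy₂.of_dvd (Dvd.intro _ rfl)).add ((H23.clears hy₃).of_dvd (Dvd.intro_left _ rfl))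
  · exact ((H12.clears hy₂).of_dvd (Dvd.intro _ rfl)).add
      ((H.clears hy₃).of_dvd (Dvd.intro_left _ rfl))
  · have := (H12.clears_sub hφ₁).add c1
    convert this using 1
    rw [mul_add]
    abel

/-- Associativity of the fusion of three representations with pairwise disjoint sets of poles. -/
theorem IsFusion.assoc (hh : h ≠ 0) {S₁ S₂ S₃ S₁₂ S₂₃ R R' : Rep A d h U} {q₁ q₂ q₃ : ℂ[X]}
    (hq₁ : IsDenominator q₁ S₁) (hq₂ : IsDenominator q₂ S₂) (hq₃ : IsDenominator q₃ S₃)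
    (h12 : IsCoprime q₁ q₂) (h23 : IsCoprime q₂ q₃) (h13 : IsCoprime q₁ q₃)
    (hc : ∀ y y', Commute (S₂ y) (S₃ y'))
    (H12 : IsFusion S₁ S₂ S₁₂) (H : IsFusion S₁₂ S₃ R) (H23 : IsFusion S₂ S₃ S₂₃)
    (H' : IsFusion S₁ S₂₃ R') : R = R' := by
  refine IsFusion.unique hh ⟨fun i => ?_, fun i => ?_, fun i => ?_⟩ H'
  · rw [H.xi, H12.xi, H23.xi, mul_assoc]
  · have h1 := H.plus i
    rw [H12.xi] at h1
    have := isTwist_assoc h13 h23 h12 (hq₁.xi i) (hq₂.xi i) (hq₂.x 1 i) (hq₃.x 1 i) (H12.plus i)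
      h1 (H23.plus i)
    rwa [add_sub_cancel, add_comm, sub_add_sub_cancel] at this
  · have h1 := H'.minus i
    have hcomm : xiSeries S₂ i * xiSeries S₃ i = xiSeries S₃ i * xiSeries S₂ i :=
      (commute_series fun m n => commute_oneSeries (fun r => (commute_oneSeries
        (fun s => (hc _ _).symm) m).symm) n).eq
    rw [H23.xi, hcomm] at h1
    have := isTwist_assoc h13.symm h12.symm h23.symm (hq₃.xi i) (hq₂.xi i) (hq₂.x (-1) i)
      (hq₁.x (-1) i) (H23.minus i) h1 (H12.minus i)
    rw [add_sub_cancel, add_comm, sub_add_sub_cancel] at this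
    -- by uniqueness, both representations have the same twisted part
    have h2 := this.unique (H.minus i)
    have h3 : xSeries R (-1) i = xSeries R' (-1) i := by
      refine series_ext ((coeff_zero_xSeries _ _ _).trans (coeff_zero_xSeries _ _ _).symm) ?_
      rw [modeF_sub, modeF_sub, sub_left_inj] at h2
      exact h2.symm
    rw [h3]
    exact H'.minus i

end RepFusion

/-! ### Twists as contour integrals -/

section ContourTwist

variable {E : Type*} [Ring E] [Algebra ℂ E] [FiniteDimensional ℂ E]

theorem evalScalar_scalarPoly (u : ℂ) (p : ℂ[X]) :
    evalScalar u (scalarPoly p : E[X]) = algebraMap ℂ E (p.eval u) := by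
  rw [evalScalar_apply, scalarPoly, Polynomial.coe_mapRingHom, Polynomial.eval_map,
    Polynomial.eval₂_at_apply]

variable (C : JordanCurve) {φ y z : E⟦X⟧} {D q : ℂ[X]} {F : ℂ → E}

/-- The integral of `N(v)/D'(v) φ(v) y(v)`, where the contour separates the poles of `y` from
those of the other factors. -/
theorem vecIntegral_twist (hq0 : q ≠ 0) (hq : ∀ u, q.eval u = 0 → u ∈ C.inside)
    (hD : ∀ u, D.eval u = 0 → u ∈ C.outside) (hφ : Clears φ D) (hy : Clears y q)
    (hy0 : PowerSeries.coeff 0 y = 0) (hF : ∀ v ∈ C.trace, F v = ratValue φ v * ratValue y v)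
    {D' α β : ℂ[X]} (hD' : ∀ u, D'.eval u = 0 → u ∈ C.outside) (hαβ : α * (D * D') + β * q = 1)
    (N : ℂ[X]) : C.vecIntegral (fun v => (N.eval v * (D'.eval v)⁻¹) • F v) =
      act (scalarPoly α * (scalarPoly N * polyPart φ D)) (modeF y) 1 := by
  have hqt (v : ℂ) (hv : v ∈ C.trace) : q.eval v ≠ 0 := fun h =>
    C.notMem_trace_of_inside (hq v h) hv
  have hDt (v : ℂ) (hv : v ∈ C.trace) : D.eval v ≠ 0 := fun h =>
    C.notMem_trace_of_outside (hD v h) hv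
  rw [← C.vecIntegral_eval_div_mul hq0 hq (D := D * D') (β := β) (x := ratValue y) ?_ hαβ
    ((clears_iff _ _).1 hy) ?_]
  · refine C.vecIntegral_congr fun v hv => ?_
    rw [hF v hv, ratValue_eq_eval ((clears_iff _ _).1 hφ) (hDt v hv), ← evalScalar_apply,
      ← evalScalar_apply, map_mul, evalScalar_scalarPoly, ← Algebra.smul_def, smul_mul_assoc,
      smul_mul_assoc, smul_smul, smul_smul, Polynomial.eval_mul, mul_inv]
    congr 1
    ring
  · intro u hu
    rw [Polynomial.eval_mul, mul_eq_zero] at hu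
    exact hu.elim (hD u) (hD' u)
  · intro v hv
    have := (show RegularAt y v from ⟨q, hy, hqt v hv⟩).hasValue
    rwa [hy0, sub_zero] at this

/-- The twist is given by the integral of `φ(v) y(v)` over a contour around the poles of `y`. -/
theorem isTwist_iff_vecIntegral (hq0 : q ≠ 0) (hq : ∀ u, q.eval u = 0 → u ∈ C.inside)
    (hD : ∀ u, D.eval u = 0 → u ∈ C.outside) (hDq : IsCoprime D q) (hφ : Clears φ D)
    (hy : Clears y q) (hy0 : PowerSeries.coeff 0 y = 0)
    (hF : ∀ v ∈ C.trace, F v = ratValue φ v * ratValue y v) :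
    IsTwist φ y z ↔ ∀ r : ℕ, modeF z (Polynomial.X ^ r) = C.vecIntegral fun v => v ^ r • F v := by
  obtain ⟨α, β, hαβ⟩ := hDq
  rw [isTwist_iff hαβ hφ hy]
  have key (r : ℕ) : (C.vecIntegral fun v => v ^ r • F v) =
      act (scalarPoly α * polyPart φ D) (modeF y) (Polynomial.X ^ r) := by
    have h1 := vecIntegral_twist C hq0 hq hD hφ hy hy0 hF (D' := 1) (α := α) (β := β)
      (fun u hu => absurd hu (by simp)) (by rw [mul_one, hαβ]) (Polynomial.X ^ r)
    simp only [Polynomial.eval_pow, Polynomial.eval_X, Polynomial.eval_one, inv_one, mul_one] at h1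
    rw [h1, ← mul_one (Polynomial.X ^ r), act_apply_mul, ← act_mul_apply, mul_assoc,
      mul_one, (scalarPoly_comm (Polynomial.X ^ r) (polyPart φ D)).eq]
  simp only [key]
  exact ⟨fun H r => by rw [H], fun H => poly_ext H⟩

/-- The value of the twist at a point outside of the contour. -/
theorem IsTwist.ratValue_eq_vecIntegral (H : IsTwist φ y z) (hq0 : q ≠ 0)
    (hq : ∀ u, q.eval u = 0 → u ∈ C.inside) (hD : ∀ u, D.eval u = 0 → u ∈ C.outside)
    (hDq : IsCoprime D q) (hφ : Clears φ D) (hy : Clears y q) (hy0 : PowerSeries.coeff 0 y = 0)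
    (hF : ∀ v ∈ C.trace, F v = ratValue φ v * ratValue y v) (hz0 : PowerSeries.coeff 0 z = 0)
    {u : ℂ} (hu : u ∈ C.outside) :
    ratValue z u = C.vecIntegral fun v => (u - v)⁻¹ • F v := by
  have hqu : q.eval u ≠ 0 := fun h =>
    Set.disjoint_left.1 C.disjoint_inside_outside (hq u h) hu
  have hc : IsCoprime (D * (Polynomial.C u - Polynomial.X)) q := by
    refine hDq.mul_left ?_
    obtain ⟨g, c, hg⟩ := exists_resolvent hqu
    refine ⟨g, -c, ?_⟩
    linear_combination hg
  obtain ⟨α, β, hαβ⟩ := hDq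
  obtain ⟨α', β', hαβ'⟩ := hc
  have h1 := vecIntegral_twist C hq0 hq hD hφ hy hy0 hF (D' := Polynomial.C u - Polynomial.X)
    (α := α') (β := β') (fun w hw => by
      have : w = u := by
        simpa [sub_eq_zero, eq_comm] using hw
      rw [this]; exact hu) hαβ' 1
  simp only [Polynomial.eval_one, one_mul, Polynomial.eval_sub, Polynomial.eval_C,
    Polynomial.eval_X] at h1
  rw [h1, ratValue_eq (e := modeF z (α' * D)), hz0, zero_add]
  · rw [(isTwist_iff hαβ hφ hy).1 H, map_one scalarPoly, one_mul (polyPart φ D), ← mul_one (α' * D),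
      act_apply_mul, ← act_mul_apply, mul_assoc,
      ← (scalarPoly_comm (α' * D) (polyPart φ D)).eq, ← mul_assoc, ← map_mul scalarPoly]
    have e1 : α * (α' * D) = α' + -(α' * β) * q := by
      linear_combination α' * hαβ
    have hyq : act (scalarPoly q) (modeF y) = 0 := (kills_iff _ _).1 ((clears_iff _ _).1 hy)
    rw [e1, map_add scalarPoly, add_mul, map_add act, LinearMap.add_apply, map_mul scalarPoly,
      mul_assoc, (scalarPoly_comm q _).eq, ← mul_assoc, act_mul_apply _ (scalarPoly q), hyq,
      map_zero, add_zero]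
  · refine ⟨α' * D, IsResolvent.iff_kills.2 ?_, rfl⟩
    have := ((clears_iff _ _).1 (H.clears hy)).mul_left (-β')
    convert this using 1
    linear_combination hαβ'

end ContourTwist

/-! ### The tensor product as a fusion -/

section TensorFusion

variable {I : Type*} {A : Matrix I I ℤ} {d : I → ℂ} {h : ℂ}
variable {V W : Type*} [AddCommGroup V] [Module ℂ V] [AddCommGroup W] [Module ℂ W]

variable (V W) in
/-- The homomorphism `f ↦ f ⊗ 1`. -/
abbrev leftHom : Module.End ℂ V →ₐ[ℂ] Module.End ℂ (V ⊗[ℂ] W) := Module.End.rTensorAlgHom ℂ V W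

variable (V W) in
/-- The homomorphism `g ↦ 1 ⊗ g`. -/
abbrev rightHom : Module.End ℂ W →ₐ[ℂ] Module.End ℂ (V ⊗[ℂ] W) := Module.End.lTensorAlgHom ℂ W V

theorem opTensor_eq (f : Module.End ℂ V) (g : Module.End ℂ W) :
    opTensor f g = leftHom V W f * rightHom V W g := by
  ext; rfl

theorem opTensor_eq' (f : Module.End ℂ V) (g : Module.End ℂ W) :
    opTensor f g = rightHom V W g * leftHom V W f := by
  ext; rfl

theorem commute_left_right (f : Module.End ℂ V) (g : Module.End ℂ W) :
    Commute (leftHom V W f) (rightHom V W g) :=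
  (opTensor_eq f g).symm.trans (opTensor_eq' f g)

theorem isCoprime_of_disjoint {D q : ℂ[X]} {S T : Set ℂ} (hST : Disjoint S T)
    (hD : ∀ u, D.eval u = 0 ↔ u ∈ S) (hq : ∀ u, q.eval u = 0 ↔ u ∈ T) : IsCoprime D q := by
  rw [Polynomial.isCoprime_iff_aeval_ne_zero_of_isAlgClosed ℂ ℂ]
  intro a
  by_contra! H
  simp only [Polynomial.coe_aeval_eq_eval] at H
  exact Set.disjoint_left.1 hST ((hD a).1 H.1) ((hq a).1 H.2)

variable (s : ℂ) (ρV : Rep A d h V) (ρW : Rep A d h W) (ρ : Rep A d h (V ⊗[ℂ] W))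

/-- The action of the Yangian on the first factor of `V(s) ⊗ W`. -/
abbrev leftRep (W : Type*) [AddCommGroup W] [Module ℂ W] (s : ℂ) (ρV : Rep A d h V) :
    Rep A d h (V ⊗[ℂ] W) := (ρV.shift s).push (leftHom V W)

/-- The action of the Yangian on the second factor of `V ⊗ W`. -/
abbrev rightRep (V : Type*) [AddCommGroup V] [Module ℂ V] (ρW : Rep A d h W) :
    Rep A d h (V ⊗[ℂ] W) := ρW.push (rightHom V W)

theorem commute_leftRep_rightRep (y y' : Yangian A d h) :
    Commute (leftRep W s ρV y) (rightRep V ρW y') := commute_left_right _ _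

variable {s ρV ρW ρ}

/-- The formula for `Δ_s(ξ_{i,r})` says that `ξ_i(u)` acts by `ξ_i(u - s) ⊗ ξ_i(u)`. -/
theorem xi_coeff_iff (hh : h ≠ 0) (i : I) :
    xiSeries ρ i = xiSeries (leftRep W s ρV) i * xiSeries (rightRep V ρW) i ↔
    ∀ r : ℕ, ρ (yxi A d h i r) = opTensor (ρV (tau A d h s (yxi A d h i r))) 1
      + h • ∑ p ∈ Finset.range r,
          opTensor (ρV (tau A d h s (yxi A d h i p))) (ρW (yxi A d h i (r - 1 - p)))
      + opTensor 1 (ρW (yxi A d h i r)) := by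
  have key (r : ℕ) :
      modeF (xiSeries (leftRep W s ρV) i * xiSeries (rightRep V ρW) i) (Polynomial.X ^ r) =
      h • (opTensor (ρV (tau A d h s (yxi A d h i r))) 1
      + h • ∑ p ∈ Finset.range r,
          opTensor (ρV (tau A d h s (yxi A d h i p))) (ρW (yxi A d h i (r - 1 - p)))
      + opTensor 1 (ρW (yxi A d h i r))) := by
    rw [modeF_mul, coeff_zero_xiSeries, coeff_zero_xiSeries, one_mul, mul_one, modeF_xiSeries,
      modeF_xiSeries, convF, modeMap_X_pow]
    simp only [LinearMap.smul_apply, modeMap_X_pow, smul_mul_assoc, mul_smul_comm, opTensor_eq,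
      map_one, mul_one, one_mul, smul_add, ← Finset.smul_sum]
    rw [add_comm (h • _) (h • _), add_right_comm]
    rfl
  constructor
  · intro H r
    have := congrArg (fun φ => modeF φ (Polynomial.X ^ r)) H
    simp only [key, modeF_xiSeries, LinearMap.smul_apply, modeMap_X_pow] at this
    exact smul_right_injective _ hh this
  · intro H
    refine series_ext ?_ (poly_ext fun r => ?_)
    · simp only [PowerSeries.coeff_mul, Finset.HasAntidiagonal.antidiagonal_zero,
        Finset.sum_singleton, coeff_zero_xiSeries, mul_one]
    · rw [key, modeF_xiSeries, LinearMap.smul_apply, modeMap_X_pow, H]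

theorem eq_add_smul_iff (hh : h ≠ 0) {E : Type*} [AddCommGroup E] [Module ℂ E] (a b c : E) :
    a = b + h⁻¹ • c ↔ h • a - h • b = c := by
  rw [← smul_sub, ← sub_eq_iff_eq_add', eq_comm, inv_smul_eq_iff₀ hh, eq_comm]

theorem modeF_xSeries_sub (R S : Rep A d h V) (e : ℤˣ) (i : I) (r : ℕ) :
    modeF (xSeries R e i - xSeries S e i) (Polynomial.X ^ r) =
      h • R (yx A d h e i r) - h • S (yx A d h e i r) := by
  rw [modeF_sub, modeF_xSeries, modeF_xSeries]
  simp only [LinearMap.sub_apply, LinearMap.smul_apply, modeMap_X_pow]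

/-- The common denominators of the two factors of a tensor product that is defined. -/
theorem Composable.exists_denominators [Finite I] [FiniteDimensional ℂ V] [FiniteDimensional ℂ W]
    (hA : CartanConditions A d) (H : Composable s ρV ρW) : ∃ D q : ℂ[X], D ≠ 0 ∧ q ≠ 0 ∧
      IsCoprime D q ∧ IsDenominator D (ρV.shift s) ∧ IsDenominator q ρW ∧
      (∀ u, D.eval u = 0 ↔ u ∈ s +ᵥ sigma ρV) ∧ ∀ u, q.eval u = 0 ↔ u ∈ sigma ρW := by
  obtain ⟨D, hD0, hD, hDr⟩ := exists_isDenominator hA (ρV.shift s)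
  obtain ⟨q, hq0, hq, hqr⟩ := exists_isDenominator hA ρW
  rw [sigma_shift] at hDr
  exact ⟨D, q, hD0, hq0, isCoprime_of_disjoint H hDr hqr, hD, hq, hDr, hqr⟩

theorem ratValue_left (i : I) {v : ℂ} (hv : v ∉ s +ᵥ sigma ρV) :
    ratValue (xiSeries (leftRep W s ρV) i) v = leftHom V W (xiFun ρV i (v - s)) := by
  rw [← sigma_shift, mem_sigma_iff] at hv
  rw [xiSeries_push, ratValue_map _ (hv.1 i), ← xiFun_shift]; rfl

theorem ratValue_left_x (e : ℤˣ) (i : I) {v : ℂ} (hv : v ∉ s +ᵥ sigma ρV) :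
    ratValue (xSeries (leftRep W s ρV) e i) v = leftHom V W (xFun ρV e i (v - s)) := by
  rw [← sigma_shift, mem_sigma_iff] at hv
  rw [xSeries_push, ratValue_map _ (hv.2.2 e i), ← xFun_shift]; rfl

theorem ratValue_right (i : I) {v : ℂ} (hv : v ∉ sigma ρW) :
    ratValue (xiSeries (rightRep V ρW) i) v = rightHom V W (xiFun ρW i v) := by
  rw [mem_sigma_iff] at hv
  rw [xiSeries_push, ratValue_map _ (hv.1 i)]; rfl

theorem ratValue_right_x (e : ℤˣ) (i : I) {v : ℂ} (hv : v ∉ sigma ρW) :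
    ratValue (xSeries (rightRep V ρW) e i) v = rightHom V W (xFun ρW e i v) := by
  rw [mem_sigma_iff] at hv
  rw [xSeries_push, ratValue_map _ (hv.2.2 e i)]; rfl

theorem JordanCurve.notMem_of_outside {C : JordanCurve} {S : Set ℂ} (H : S ⊆ C.outside) {v : ℂ}
    (hv : v ∈ C.trace) : v ∉ S := fun h => C.notMem_trace_of_outside (H h) hv

theorem JordanCurve.notMem_of_inside {C : JordanCurve} {S : Set ℂ} (H : S ⊆ C.inside) {v : ℂ}
    (hv : v ∈ C.trace) : v ∉ S := fun h => C.notMem_trace_of_inside (H h) hv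

variable [FiniteDimensional ℂ V] [FiniteDimensional ℂ W]

/-- The formula for `Δ_s(x⁺_{i,r})`, for any one contour, as a twist. -/
theorem plus_iff [Finite I] (hh : h ≠ 0) (hA : CartanConditions A d) (C : JordanCurve)
    (h1 : sigma ρW ⊆ C.inside) (h2 : s +ᵥ sigma ρV ⊆ C.outside) (i : I) :
    IsTwist (xiSeries (leftRep W s ρV) i) (xSeries (rightRep V ρW) 1 i)
      (xSeries ρ 1 i - xSeries (leftRep W s ρV) 1 i) ↔
    ∀ r : ℕ, ρ (yx A d h 1 i r) = opTensor (ρV (tau A d h s (yx A d h 1 i r))) 1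
        + h⁻¹ • C.vecIntegral fun v => v ^ r • opTensor (xiFun ρV i (v - s)) (xFun ρW 1 i v) := by
  have hc : Composable s ρV ρW := (C.disjoint_inside_outside.mono h1 h2).symm
  obtain ⟨D, q, hD0, hq0, hDq, hD, hq, hDr, hqr⟩ := hc.exists_denominators hA
  rw [isTwist_iff_vecIntegral C hq0 (fun u hu => h1 ((hqr u).1 hu)) (fun u hu => h2 ((hDr u).1 hu))
    hDq ((hD.push (leftHom V W)).xi i) ((hq.push (rightHom V W)).x 1 i) (coeff_zero_xSeries _ _ _)
    (F := fun v => opTensor (xiFun ρV i (v - s)) (xFun ρW 1 i v))]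
  · simp only [modeF_xSeries_sub]
    exact forall_congr' fun r => (eq_add_smul_iff hh _ _ _).symm
  · intro v hv
    rw [ratValue_left i (JordanCurve.notMem_of_outside h2 hv),
      ratValue_right_x 1 i (JordanCurve.notMem_of_inside h1 hv), opTensor_eq]

/-- The formula for `Δ_s(x⁻_{i,r})`, for any one contour, as a twist. -/
theorem minus_iff [Finite I] (hh : h ≠ 0) (hA : CartanConditions A d) (C : JordanCurve)
    (h1 : s +ᵥ sigma ρV ⊆ C.inside) (h2 : sigma ρW ⊆ C.outside) (i : I) :
    IsTwist (xiSeries (rightRep V ρW) i) (xSeries (leftRep W s ρV) (-1) i)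
      (xSeries ρ (-1) i - xSeries (rightRep V ρW) (-1) i) ↔
    ∀ r : ℕ, ρ (yx A d h (-1) i r) =
      (h⁻¹ • C.vecIntegral fun v => v ^ r • opTensor (xFun ρV (-1) i (v - s)) (xiFun ρW i v))
        + opTensor 1 (ρW (yx A d h (-1) i r)) := by
  have hc : Composable s ρV ρW := C.disjoint_inside_outside.mono h1 h2
  obtain ⟨D, q, hD0, hq0, hDq, hD, hq, hDr, hqr⟩ := hc.exists_denominators hA
  rw [isTwist_iff_vecIntegral C hD0 (fun u hu => h1 ((hDr u).1 hu)) (fun u hu => h2 ((hqr u).1 hu))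
    hDq.symm ((hq.push (rightHom V W)).xi i) ((hD.push (leftHom V W)).x (-1) i)
    (coeff_zero_xSeries _ _ _)
    (F := fun v => opTensor (xFun ρV (-1) i (v - s)) (xiFun ρW i v))]
  · simp only [modeF_xSeries_sub, add_comm (h⁻¹ • _)]
    exact forall_congr' fun r => (eq_add_smul_iff hh _ _ _).symm
  · intro v hv
    rw [ratValue_left_x (-1) i (JordanCurve.notMem_of_inside h1 hv),
      ratValue_right i (JordanCurve.notMem_of_outside h2 hv), opTensor_eq']

/-- The contour formulae characterise the fusion of the actions on the two factors. Since being a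
twist does not involve a contour, the formulae do not depend on the choice of the contours. -/
theorem isDrinfeldTensor_iff [Finite I] (hh : h ≠ 0) (hA : CartanConditions A d) :
    IsDrinfeldTensor s ρV ρW ρ ↔
      Composable s ρV ρW ∧ IsFusion (leftRep W s ρV) (rightRep V ρW) ρ := by
  have hfV : (s +ᵥ sigma ρV).Finite := by rw [← sigma_shift]; exact finite_sigma hA _
  have hfW : (sigma ρW).Finite := finite_sigma hA _
  constructor
  · intro H
    obtain ⟨C₁, h11, h12⟩ := exists_jordanCurve hfV hfW H.composable
    obtain ⟨C₂, h21, h22⟩ := exists_jordanCurve hfW hfV H.composable.symm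
    exact ⟨H.composable, fun i => (xi_coeff_iff hh i).2 (H.xi i),
      fun i => (plus_iff hh hA C₂ h21 h22 i).2 (H.x_plus C₂ h21 h22 i),
      fun i => (minus_iff hh hA C₁ h11 h12 i).2 (H.x_minus C₁ h11 h12 i)⟩
  · rintro ⟨hc, H⟩
    exact ⟨hc, fun i => (xi_coeff_iff hh i).1 (H.xi i),
      fun C h1 h2 i => (plus_iff hh hA C h1 h2 i).1 (H.plus i),
      fun C h1 h2 i => (minus_iff hh hA C h1 h2 i).1 (H.minus i)⟩

theorem IsDrinfeldTensor.unique [Finite I] (hh : h ≠ 0) (hA : CartanConditions A d)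
    {ρ' : Rep A d h (V ⊗[ℂ] W)} (H : IsDrinfeldTensor s ρV ρW ρ)
    (H' : IsDrinfeldTensor s ρV ρW ρ') : ρ = ρ' :=
  ((isDrinfeldTensor_iff hh hA).1 H).2.unique hh ((isDrinfeldTensor_iff hh hA).1 H').2

/-- If `s + σ(V)` and `σ(W)` are disjoint, the formulae `Δ_s` define a unique action. -/
theorem existsUnique_isDrinfeldTensor [Finite I] (hh : h ≠ 0) (hA : CartanConditions A d)
    (H : Composable s ρV ρW) : ∃! ρ, IsDrinfeldTensor s ρV ρW ρ := by
  obtain ⟨D, q, hD0, hq0, hDq, hD, hq, -, -⟩ := H.exists_denominators hA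
  obtain ⟨R, hR⟩ := exists_isFusion hh hA (commute_leftRep_rightRep s ρV ρW) hD0 hq0 hDq
    (hD.push _) (hq.push _)
  have hR' := (isDrinfeldTensor_iff hh hA).2 ⟨H, hR⟩
  exact ⟨R, hR', fun R' h' => h'.unique hh hA hR'⟩

/-- The poles of the tensor product. -/
theorem IsDrinfeldTensor.sigma_subset [Finite I] (hh : h ≠ 0) (hA : CartanConditions A d)
    (H : IsDrinfeldTensor s ρV ρW ρ) : sigma ρ ⊆ (s +ᵥ sigma ρV) ∪ sigma ρW := by
  obtain ⟨D, q, hD0, hq0, hDq, hD, hq, hDr, hqr⟩ := H.composable.exists_denominators hA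
  have := ((isDrinfeldTensor_iff hh hA).1 H).2.isDenominator (hD.push _) (hq.push _)
  intro u
  contrapose
  rw [Set.mem_union, not_or, ← hDr, ← hqr]
  intro hu
  refine this.notMem_sigma ?_
  rw [Polynomial.eval_mul]
  exact mul_ne_zero hu.1 hu.2

/-- The generating functions of the tensor product away from the poles and the contours. -/
theorem IsDrinfeldTensor.fieldFormulae [Finite I] (hh : h ≠ 0) (hA : CartanConditions A d)
    (H : IsDrinfeldTensor s ρV ρW ρ) : FieldFormulae s ρV ρW ρ := by
  obtain ⟨D, q, hD0, hq0, hDq, hD, hq, hDr, hqr⟩ := H.composable.exists_denominators hA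
  obtain ⟨-, F⟩ := (isDrinfeldTensor_iff hh hA).1 H
  have hD' := hD.push (leftHom V W)
  have hq' := hq.push (rightHom V W)
  refine ⟨fun i u h1 h2 => ?_, fun C h1 h2 i u hu hu' => ?_, fun C h1 h2 i u hu hu' => ?_⟩
  · rw [xiFun, F.xi, ratValue_mul ⟨D, hD'.xi i, fun h => h1 ((hDr u).1 h)⟩
      ⟨q, hq'.xi i, fun h => h2 ((hqr u).1 h)⟩, ratValue_left i h1, ratValue_right i h2,
      opTensor_eq]
  · have hu2 : u ∉ sigma ρW := fun h => Set.disjoint_left.1 C.disjoint_inside_outside (h1 h) hu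
    rw [xFun, ← add_sub_cancel (xSeries (leftRep W s ρV) 1 i) (xSeries ρ 1 i),
      ratValue_add ⟨D, hD'.x 1 i, fun h => hu' ((hDr u).1 h)⟩
        ⟨q, (F.plus i).clears (hq'.x 1 i), fun h => hu2 ((hqr u).1 h)⟩,
      ratValue_left_x 1 i hu', (F.plus i).ratValue_eq_vecIntegral C hq0
        (fun u hu => h1 ((hqr u).1 hu)) (fun u hu => h2 ((hDr u).1 hu)) hDq (hD'.xi i) (hq'.x 1 i)
        (coeff_zero_xSeries _ _ _) (F := fun v => opTensor (xiFun ρV i (v - s)) (xFun ρW 1 i v))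
        _ _ hu]
    · rfl
    · intro v hv
      rw [ratValue_left i (JordanCurve.notMem_of_outside h2 hv),
        ratValue_right_x 1 i (JordanCurve.notMem_of_inside h1 hv), opTensor_eq]
    · rw [map_sub, coeff_zero_xSeries, coeff_zero_xSeries, sub_zero]
  · have hu2 : u ∉ s +ᵥ sigma ρV := fun h =>
      Set.disjoint_left.1 C.disjoint_inside_outside (h1 h) hu
    rw [xFun, ← sub_add_cancel (xSeries ρ (-1) i) (xSeries (rightRep V ρW) (-1) i),
      ratValue_add ⟨D, (F.minus i).clears (hD'.x (-1) i), fun h => hu2 ((hDr u).1 h)⟩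
        ⟨q, hq'.x (-1) i, fun h => hu' ((hqr u).1 h)⟩,
      ratValue_right_x (-1) i hu', (F.minus i).ratValue_eq_vecIntegral C hD0
        (fun u hu => h1 ((hDr u).1 hu)) (fun u hu => h2 ((hqr u).1 hu)) hDq.symm (hq'.xi i)
        (hD'.x (-1) i) (coeff_zero_xSeries _ _ _)
        (F := fun v => opTensor (xFun ρV (-1) i (v - s)) (xiFun ρW i v)) _ _ hu]
    · rfl
    · intro v hv
      rw [ratValue_left_x (-1) i (JordanCurve.notMem_of_inside h1 hv),
        ratValue_right i (JordanCurve.notMem_of_outside h2 hv), opTensor_eq']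
    · rw [map_sub, coeff_zero_xSeries, coeff_zero_xSeries, sub_zero]

end TensorFusion

/-! ### Associativity, units and shifts -/

section Coherence

variable {I : Type*} [Finite I] {A : Matrix I I ℤ} {d : I → ℂ} {h : ℂ}
variable {V W V₁ V₂ V₃ : Type*}
  [AddCommGroup V] [Module ℂ V] [FiniteDimensional ℂ V]
  [AddCommGroup W] [Module ℂ W] [FiniteDimensional ℂ W]
  [AddCommGroup V₁] [Module ℂ V₁] [FiniteDimensional ℂ V₁]
  [AddCommGroup V₂] [Module ℂ V₂] [FiniteDimensional ℂ V₂]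
  [AddCommGroup V₃] [Module ℂ V₃] [FiniteDimensional ℂ V₃]

theorem rightHom_injective [Nontrivial V] : Function.Injective (rightHom V W) := by
  refine (injective_iff_map_eq_zero _).2 fun f hf => ?_
  exact (Module.FaithfullyFlat.zero_iff_lTensor_zero ℂ V f).2 hf

/-- If both iterated tensor products are defined and `V₂ ≠ 0`, the poles of the outer factors are
disjoint: a common pole would be a pole of `V₂ ⊗ V₃`, since it is not a pole of `V₂`. -/
theorem disjoint_outer_poles [Nontrivial V₂] (hh : h ≠ 0) (hA : CartanConditions A d) {s₁ s₂ : ℂ}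
    {ρ₁ : Rep A d h V₁} {ρ₂ : Rep A d h V₂} {ρ₃ : Rep A d h V₃} {ρ₂₃ : Rep A d h (V₂ ⊗[ℂ] V₃)}
    (H12 : Disjoint ((s₁ + s₂) +ᵥ sigma ρ₁) (s₂ +ᵥ sigma ρ₂))
    (H23 : IsDrinfeldTensor s₂ ρ₂ ρ₃ ρ₂₃) (HR : Composable (s₁ + s₂) ρ₁ ρ₂₃) :
    Disjoint ((s₁ + s₂) +ᵥ sigma ρ₁) (sigma ρ₃) := by
  rw [Set.disjoint_left]
  intro u hu hu3
  obtain ⟨D, q, -, -, -, hD, -, hDr, -⟩ := H23.composable.exists_denominators hA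
  have h2 : u ∉ sigma (leftRep V₃ s₂ ρ₂) := (hD.push _).notMem_sigma fun h =>
    Set.disjoint_left.1 H12 hu ((hDr u).1 h)
  have h23 : u ∉ sigma ρ₂₃ := Set.disjoint_left.1 HR hu
  exact ((isDrinfeldTensor_iff hh hA).1 H23).2.notMem_sigma_right h2 h23
    (sigma_push_of_injective _ _ rightHom_injective hu3)

/-- Coassociativity of the deformed Drinfeld tensor product. -/
theorem IsDrinfeldTensor.assoc (hh : h ≠ 0) (hA : CartanConditions A d) {s₁ s₂ : ℂ}
    {ρ₁ : Rep A d h V₁} {ρ₂ : Rep A d h V₂} {ρ₃ : Rep A d h V₃} {ρ₁₂ : Rep A d h (V₁ ⊗[ℂ] V₂)}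
    {ρ₂₃ : Rep A d h (V₂ ⊗[ℂ] V₃)} {ρL : Rep A d h ((V₁ ⊗[ℂ] V₂) ⊗[ℂ] V₃)}
    {ρR : Rep A d h (V₁ ⊗[ℂ] (V₂ ⊗[ℂ] V₃))}
    (H12 : IsDrinfeldTensor s₁ ρ₁ ρ₂ ρ₁₂) (HL : IsDrinfeldTensor s₂ ρ₁₂ ρ₃ ρL)
    (H23 : IsDrinfeldTensor s₂ ρ₂ ρ₃ ρ₂₃) (HR : IsDrinfeldTensor (s₁ + s₂) ρ₁ ρ₂₃ ρR) :
    ρL.transport (TensorProduct.assoc ℂ V₁ V₂ V₃) = ρR := by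
  -- if `V₂ = 0`, the outer poles need not be disjoint, but the triple product is zero
  rcases subsingleton_or_nontrivial V₂ with hV | hV
  · exact AlgHom.ext fun y => Subsingleton.elim _ _
  have d12 : Disjoint ((s₁ + s₂) +ᵥ sigma ρ₁) (s₂ +ᵥ sigma ρ₂) := by
    rw [add_comm, ← vadd_vadd, Set.disjoint_vadd_set]; exact H12.composable
  have d13 := disjoint_outer_poles hh hA d12 H23 HR.composable
  obtain ⟨q₁, -, hq₁, hr₁⟩ := exists_isDenominator hA (ρ₁.shift (s₁ + s₂))
  obtain ⟨q₂, q₃, -, -, h23, hq₂, hq₃, hr₂, hr₃⟩ := H23.composable.exists_denominators hA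
  rw [sigma_shift] at hr₁
  rw [isDrinfeldTensor_iff hh hA] at H12 HL H23 HR
  set c := ((TensorProduct.assoc ℂ V₁ V₂ V₃).conjAlgEquiv ℂ).toAlgHom with hc
  have F12 := ((H12.2.shift s₂).push (leftHom (V₁ ⊗[ℂ] V₂) V₃)).push c
  have FL := HL.2.push c
  have F23 := H23.2.push (rightHom V₁ (V₂ ⊗[ℂ] V₃))
  -- the three actions on the triple tensor product, for both ways of bracketing
  have e1 : (((leftRep V₂ s₁ ρ₁).shift s₂).push (leftHom (V₁ ⊗[ℂ] V₂) V₃)).push c =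
      leftRep (V₂ ⊗[ℂ] V₃) (s₁ + s₂) ρ₁ := by
    rw [push_shift, shift_shift _ hh]
    refine AlgHom.ext fun y => ?_
    refine TensorProduct.ext_threefold' fun a b c => ?_
    rfl
  have e2 : (((rightRep V₁ ρ₂).shift s₂).push (leftHom (V₁ ⊗[ℂ] V₂) V₃)).push c =
      (leftRep V₃ s₂ ρ₂).push (rightHom V₁ (V₂ ⊗[ℂ] V₃)) := by
    refine AlgHom.ext fun y => ?_
    refine TensorProduct.ext_threefold' fun a b c => ?_
    rfl
  have e3 : (rightRep (V₁ ⊗[ℂ] V₂) ρ₃).push c =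
      (rightRep V₂ ρ₃).push (rightHom V₁ (V₂ ⊗[ℂ] V₃)) := by
    refine AlgHom.ext fun y => ?_
    refine TensorProduct.ext_threefold' fun a b c => ?_
    rfl
  rw [e1, e2] at F12
  rw [e3] at FL
  have hcomm (y y' : Yangian A d h) :
      Commute ((leftRep V₃ s₂ ρ₂).push (rightHom V₁ (V₂ ⊗[ℂ] V₃)) y)
        ((rightRep V₂ ρ₃).push (rightHom V₁ (V₂ ⊗[ℂ] V₃)) y') :=
    (commute_leftRep_rightRep s₂ ρ₂ ρ₃ y y').map (rightHom V₁ (V₂ ⊗[ℂ] V₃))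
  exact IsFusion.assoc hh (hq₁.push _) ((hq₂.push _).push _) ((hq₃.push _).push _)
    (isCoprime_of_disjoint d12 hr₁ hr₂) h23 (isCoprime_of_disjoint d13 hr₁ hr₃) hcomm
    F12 FL F23 HR.2

/-! ### The trivial representation as a unit -/

theorem trivialRep_yg (g : Gen I) : trivialRep A d h (yg A d h g) = 0 := by
  rw [trivialRep, AlgHom.comp_apply, counit, yg, RingQuot.liftAlgHom_mkAlgHom_apply]
  simp

theorem xiSeries_trivialRep (i : I) : xiSeries (trivialRep A d h) i = 1 := by
  ext1 n
  rcases n with _ | n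
  · rw [coeff_zero_xiSeries, PowerSeries.coeff_zero_one]
  · rw [xiSeries_eq, coeff_oneSeries_succ, trivialRep_yg, smul_zero, PowerSeries.coeff_one,
      if_neg (Nat.succ_ne_zero n)]

theorem xSeries_trivialRep (e : ℤˣ) (i : I) : xSeries (trivialRep A d h) e i = 0 := by
  ext1 n
  rcases n with _ | n
  · rw [coeff_zero_xSeries, map_zero]
  · rw [xSeries, PowerSeries.coeff_mk, map_zero]
    change h • trivialRep A d h (yx A d h e i n) = 0
    rw [trivialRep_yg, smul_zero]

theorem sigma_trivialRep : sigma (trivialRep A d h) = ∅ := by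
  refine Set.eq_empty_of_forall_notMem fun u => mem_sigma_iff.2 ⟨fun i => ?_, fun i => ?_,
    fun e i => ?_⟩
  · rw [xiSeries_trivialRep]
    exact ⟨1, clears_one 1, by simp⟩
  · rw [← eq_xiInvSeries (ψ := 1) (by rw [xiSeries_trivialRep, one_mul])]
    exact ⟨1, clears_one 1, by simp⟩
  · rw [xSeries_trivialRep]
    exact ⟨1, clears_zero 1, by simp⟩

theorem trivialRep_shift (hh : h ≠ 0) (a : ℂ) :
    (trivialRep A d h).shift a = trivialRep A d h :=
  rep_ext_series hh (fun i => by rw [xiSeries_shift, xiSeries_trivialRep, translate_one])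
    fun e i => by
      have := translate_sub a (0 : (Module.End ℂ ℂ)⟦X⟧) 0
      rw [sub_self, sub_self] at this
      rw [xSeries_shift, xSeries_trivialRep, this]

theorem isTwist_one {E : Type*} [Ring E] [Algebra ℂ E] {y : E⟦X⟧} {q : ℂ[X]} (H : Clears y q) :
    IsTwist 1 y y :=
  ⟨1, q, isCoprime_one_left, clears_one _, H, H, by
    rw [one_mul, sub_self]; exact clears_zero _⟩

theorem isTwist_zero {E : Type*} [Ring E] [Algebra ℂ E] {φ : E⟦X⟧} {D : ℂ[X]} (H : Clears φ D) :
    IsTwist φ 0 0 :=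
  ⟨D, 1, isCoprime_one_right, H, clears_zero _, clears_zero _, by
    rw [mul_zero, sub_self]; exact clears_zero _⟩

variable {U : Type*} [AddCommGroup U] [Module ℂ U]

/-- Fusion with a representation by which the generators act as zero does nothing. -/
theorem isFusion_trivial_left {q : ℂ[X]} {S T : Rep A d h U} (hT : IsDenominator q T)
    (h1 : ∀ i, xiSeries S i = 1) (h2 : ∀ e i, xSeries S e i = 0) : IsFusion S T T where
  xi i := by rw [h1, one_mul]
  plus i := by rw [h1, h2, sub_zero]; exact isTwist_one (hT.x 1 i)
  minus i := by rw [h2, sub_self]; exact isTwist_zero (hT.xi i)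

theorem isFusion_trivial_right {D : ℂ[X]} {S T : Rep A d h U} (hS : IsDenominator D S)
    (h1 : ∀ i, xiSeries T i = 1) (h2 : ∀ e i, xSeries T e i = 0) : IsFusion S T S where
  xi i := by rw [h1, mul_one]
  plus i := by rw [h2, sub_self]; exact isTwist_zero (hS.xi i)
  minus i := by rw [h1, h2, sub_zero]; exact isTwist_one (hS.x (-1) i)

theorem isDrinfeldTensor_trivial_left (hh : h ≠ 0) (hA : CartanConditions A d) (s : ℂ)
    (ρ : Rep A d h V) : IsDrinfeldTensor s (trivialRep A d h) ρ
      (ρ.transport (TensorProduct.lid ℂ V).symm) := by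
  have e : ρ.transport (TensorProduct.lid ℂ V).symm = rightRep ℂ ρ := by
    refine AlgHom.ext fun y => TensorProduct.ext' fun a v => ?_
    change (1 : ℂ) ⊗ₜ[ℂ] (ρ y (a • v)) = a ⊗ₜ[ℂ] (ρ y v)
    rw [map_smul, ← TensorProduct.smul_tmul, smul_eq_mul, mul_one]
  obtain ⟨q, -, hq, -⟩ := exists_isDenominator hA ρ
  rw [isDrinfeldTensor_iff hh hA, e, leftRep, trivialRep_shift hh]
  refine ⟨?_, isFusion_trivial_left (hq.push _) (fun i => ?_) fun e i => ?_⟩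
  · rw [Composable, sigma_trivialRep, Set.vadd_set_empty]; exact Set.empty_disjoint _
  · rw [xiSeries_push, xiSeries_trivialRep, map_one]
  · rw [xSeries_push, xSeries_trivialRep, map_zero]

theorem isDrinfeldTensor_trivial_right (hh : h ≠ 0) (hA : CartanConditions A d) (s : ℂ)
    (ρ : Rep A d h V) : IsDrinfeldTensor s ρ (trivialRep A d h)
      ((ρ.shift s).transport (TensorProduct.rid ℂ V).symm) := by
  have e : (ρ.shift s).transport (TensorProduct.rid ℂ V).symm = leftRep ℂ s ρ := by
    refine AlgHom.ext fun y => TensorProduct.ext' fun v a => ?_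
    change (ρ.shift s y (a • v)) ⊗ₜ[ℂ] (1 : ℂ) = (ρ.shift s y v) ⊗ₜ[ℂ] a
    rw [map_smul, TensorProduct.smul_tmul, smul_eq_mul, mul_one]
  obtain ⟨q, -, hq, -⟩ := exists_isDenominator hA (ρ.shift s)
  rw [isDrinfeldTensor_iff hh hA, e]
  refine ⟨?_, isFusion_trivial_right (hq.push _) (fun i => ?_) fun e i => ?_⟩
  · rw [Composable, sigma_trivialRep]; exact Set.disjoint_empty _
  · rw [xiSeries_push, xiSeries_trivialRep, map_one]
  · rw [xSeries_push, xSeries_trivialRep, map_zero]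

variable {s s' : ℂ} {ρV : Rep A d h V} {ρW : Rep A d h W} {ρ : Rep A d h (V ⊗[ℂ] W)}

theorem isDrinfeldTensor_add_iff (hh : h ≠ 0) (hA : CartanConditions A d) :
    IsDrinfeldTensor (s + s') ρV ρW ρ ↔ IsDrinfeldTensor s' (ρV.shift s) ρW ρ := by
  rw [isDrinfeldTensor_iff hh hA, isDrinfeldTensor_iff hh hA, leftRep, leftRep, shift_shift _ hh,
    Composable, Composable, sigma_shift, vadd_vadd, add_comm s']

theorem IsDrinfeldTensor.shift (hh : h ≠ 0) (hA : CartanConditions A d)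
    (H : IsDrinfeldTensor s ρV ρW ρ) (s' : ℂ) :
    IsDrinfeldTensor s (ρV.shift s') (ρW.shift s') (ρ.shift s') := by
  rw [isDrinfeldTensor_iff hh hA] at H ⊢
  refine ⟨?_, ?_⟩
  · rw [Composable, sigma_shift, sigma_shift, vadd_comm, Set.disjoint_vadd_set]
    exact H.1
  · have := H.2.shift s'
    rwa [push_shift, push_shift, shift_shift _ hh, add_comm s, ← shift_shift _ hh] at this

theorem isDrinfeldTensor_shift_iff (hh : h ≠ 0) (hA : CartanConditions A d) (s' : ℂ) :
    IsDrinfeldTensor s ρV ρW ρ ↔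
      IsDrinfeldTensor s (ρV.shift s') (ρW.shift s') (ρ.shift s') := by
  refine ⟨fun H => H.shift hh hA s', fun H => ?_⟩
  have := H.shift hh hA (-s')
  simpa only [shift_shift _ hh, add_neg_cancel, shift_zero _ hh] using this

end Coherence

/-! ### Polynomial and rational families -/

section Families

variable {M N P : Type*} [AddCommGroup M] [Module ℂ M] [AddCommGroup N] [Module ℂ N]
  [AddCommGroup P] [Module ℂ P] {E : Type*} [Ring E] [Algebra ℂ E]

variable (M) in
/-- The functions `ℂ → M` that are polynomial in the parameter. -/
def polyFamilies : Submodule ℂ (ℂ → M) :=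
  Submodule.span ℂ {f | ∃ (k : ℕ) (m : M), f = fun s => s ^ k • m}

theorem const_mem_polyFamilies (m : M) : (fun _ => m) ∈ polyFamilies M :=
  Submodule.subset_span ⟨0, m, by simp⟩

theorem id_mem_polyFamilies : (fun s => s) ∈ polyFamilies ℂ :=
  Submodule.subset_span ⟨1, 1, by simp⟩

theorem map_mem_polyFamilies (L : M →ₗ[ℂ] N) {f : ℂ → M} (hf : f ∈ polyFamilies M) :
    (fun s => L (f s)) ∈ polyFamilies N := by
  have : polyFamilies M ≤ (polyFamilies N).comap (L.compLeft ℂ) := by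
    refine Submodule.span_le.2 ?_
    rintro _ ⟨k, m, rfl⟩
    refine Submodule.subset_span ⟨k, L m, ?_⟩
    ext s
    simp
  exact this hf

theorem bilin_mem_polyFamilies (B : M →ₗ[ℂ] N →ₗ[ℂ] P) {f : ℂ → M} {g : ℂ → N}
    (hf : f ∈ polyFamilies M) (hg : g ∈ polyFamilies N) :
    (fun s => B (f s) (g s)) ∈ polyFamilies P := by
  induction hf using Submodule.span_induction with
  | mem f hf =>
    obtain ⟨k, m, rfl⟩ := hf
    induction hg using Submodule.span_induction with
    | mem g hg =>
      obtain ⟨l, n, rfl⟩ := hg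
      refine Submodule.subset_span ⟨k + l, B m n, ?_⟩
      ext s
      simp [smul_smul, pow_add, mul_comm]
    | zero => simp only [Pi.zero_apply, map_zero]; exact zero_mem (polyFamilies P)
    | add g g' _ _ h1 h2 => simp only [Pi.add_apply, map_add]; exact add_mem h1 h2
    | smul a g _ h1 =>
      simp only [Pi.smul_apply, (B _).map_smul]; exact (polyFamilies P).smul_mem a h1
  | zero =>
    simp only [Pi.zero_apply, map_zero, LinearMap.zero_apply]; exact zero_mem (polyFamilies P)
  | add f f' _ _ h1 h2 =>
    simp only [Pi.add_apply, map_add, LinearMap.add_apply]; exact add_mem h1 h2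
  | smul a f _ h1 =>
    simp only [Pi.smul_apply, map_smul, LinearMap.smul_apply]; exact (polyFamilies P).smul_mem a h1

theorem mul_mem_polyFamilies {f g : ℂ → E} (hf : f ∈ polyFamilies E) (hg : g ∈ polyFamilies E) :
    (fun s => f s * g s) ∈ polyFamilies E := bilin_mem_polyFamilies (LinearMap.mul ℂ E) hf hg

theorem smul_mem_polyFamilies {f : ℂ → ℂ} {g : ℂ → M} (hf : f ∈ polyFamilies ℂ)
    (hg : g ∈ polyFamilies M) : (fun s => f s • g s) ∈ polyFamilies M :=
  bilin_mem_polyFamilies (LinearMap.lsmul ℂ M) hf hg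

theorem pow_mem_polyFamilies {f : ℂ → E} (hf : f ∈ polyFamilies E) (n : ℕ) :
    (fun s => f s ^ n) ∈ polyFamilies E := by
  induction n with
  | zero => simpa only [pow_zero] using const_mem_polyFamilies 1
  | succ n ih => simpa only [pow_succ] using mul_mem_polyFamilies ih hf

theorem sum_mem_polyFamilies {ι : Type*} (t : Finset ι) {f : ι → ℂ → M}
    (hf : ∀ i ∈ t, f i ∈ polyFamilies M) : (fun s => ∑ i ∈ t, f i s) ∈ polyFamilies M := by
  have := (polyFamilies M).sum_mem hf
  rwa [Finset.sum_fn] at this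

theorem eval_mem_polyFamilies (c : ℂ[X]) : (fun s => c.eval s) ∈ polyFamilies ℂ := by
  simp only [c.eval_eq_sum_range]
  exact sum_mem_polyFamilies _ fun k _ => mul_mem_polyFamilies (const_mem_polyFamilies _)
    (pow_mem_polyFamilies id_mem_polyFamilies k)

theorem compAdd_mem_polyFamilies {t : ℂ → ℂ} (ht : t ∈ polyFamilies ℂ) (p : ℂ[X]) :
    (fun s => compAdd (t s) p) ∈ polyFamilies ℂ[X] := by
  induction p using Polynomial.induction_on' with
  | add p q hp hq => simp only [map_add]; exact add_mem hp hq
  | monomial n a =>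
    have e (s : ℂ) : compAdd (t s) (Polynomial.monomial n a) =
        Polynomial.C a * (Polynomial.X + Polynomial.C (t s)) ^ n := by
      rw [← Polynomial.C_mul_X_pow_eq_monomial, map_mul, map_pow, compAdd_X, compAdd_C]
    simp only [e]
    refine mul_mem_polyFamilies (const_mem_polyFamilies _) (pow_mem_polyFamilies ?_ n)
    exact add_mem (const_mem_polyFamilies _)
      (map_mem_polyFamilies (Polynomial.CAlgHom (R := ℂ) (A := ℂ)).toLinearMap ht)

theorem compAdd_mem_polyFamilies' {t : ℂ → ℂ} (ht : t ∈ polyFamilies ℂ) {f : ℂ → ℂ[X]}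
    (hf : f ∈ polyFamilies ℂ[X]) : (fun s => compAdd (t s) (f s)) ∈ polyFamilies ℂ[X] := by
  induction hf using Submodule.span_induction with
  | mem f hf =>
    obtain ⟨k, m, rfl⟩ := hf
    simp only [map_smul]
    exact smul_mem_polyFamilies (pow_mem_polyFamilies id_mem_polyFamilies k)
      (compAdd_mem_polyFamilies ht m)
  | zero => simp only [Pi.zero_apply, map_zero]; exact zero_mem (polyFamilies ℂ[X])
  | add f f' _ _ h1 h2 => simp only [Pi.add_apply, map_add]; exact add_mem h1 h2
  | smul a f _ h1 =>
    simp only [Pi.smul_apply, map_smul]; exact (polyFamilies ℂ[X]).smul_mem a h1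

theorem neg_mem_polyFamilies : (fun s : ℂ => -s) ∈ polyFamilies ℂ :=
  (polyFamilies ℂ).neg_mem id_mem_polyFamilies

/-- A polynomial family with values in an algebra is given by a polynomial with coefficients in that
algebra. -/
theorem exists_polynomial_of_mem_polyFamilies {f : ℂ → E} (hf : f ∈ polyFamilies E) :
    ∃ Q : E[X], ∀ s, Q.eval (algebraMap ℂ E s) = f s := by
  induction hf using Submodule.span_induction with
  | mem f hf =>
    obtain ⟨k, m, rfl⟩ := hf
    refine ⟨Polynomial.monomial k m, fun s => ?_⟩
    rw [Polynomial.eval_monomial, ← map_pow, ← Algebra.commutes, ← Algebra.smul_def]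
  | zero => exact ⟨0, fun s => by simp⟩
  | add f f' _ _ h1 h2 =>
    obtain ⟨Q, hQ⟩ := h1
    obtain ⟨Q', hQ'⟩ := h2
    exact ⟨Q + Q', fun s => by rw [Polynomial.eval_add, hQ, hQ', Pi.add_apply]⟩
  | smul a f _ h1 =>
    obtain ⟨Q, hQ⟩ := h1
    exact ⟨Polynomial.C (algebraMap ℂ E a) * Q, fun s => by
      rw [Polynomial.eval_C_mul, hQ, Pi.smul_apply, Algebra.smul_def]⟩

/-- A function of `s ∉ S` that is rational in `s`, with poles in `S`. -/
def IsRationalFamily (S : Set ℂ) (f : ℂ → M) : Prop :=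
  ∃ c : ℂ[X], c ≠ 0 ∧ (∀ s, c.eval s = 0 → s ∈ S) ∧
    ∃ g ∈ polyFamilies M, ∀ s, s ∉ S → c.eval s • f s = g s

variable {S : Set ℂ}

theorem isRationalFamily_of_mem {f : ℂ → M} (hf : f ∈ polyFamilies M) : IsRationalFamily S f :=
  ⟨1, one_ne_zero, fun s hs => by simp at hs, f, hf, fun s _ => by simp⟩

theorem IsRationalFamily.congr {f f' : ℂ → M} (H : IsRationalFamily S f)
    (h : ∀ s, s ∉ S → f' s = f s) : IsRationalFamily S f' := by
  obtain ⟨c, hc, hcS, g, hg, hf⟩ := H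
  exact ⟨c, hc, hcS, g, hg, fun s hs => by rw [h s hs, hf s hs]⟩

theorem IsRationalFamily.bilin (B : M →ₗ[ℂ] N →ₗ[ℂ] P) {f : ℂ → M} {f' : ℂ → N}
    (H : IsRationalFamily S f) (H' : IsRationalFamily S f') :
    IsRationalFamily S fun s => B (f s) (f' s) := by
  obtain ⟨c, hc, hcS, g, hg, hf⟩ := H
  obtain ⟨c', hc', hcS', g', hg', hf'⟩ := H'
  refine ⟨c * c', mul_ne_zero hc hc', fun s hs => ?_, _, bilin_mem_polyFamilies B hg hg',
    fun s hs => ?_⟩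
  · rw [Polynomial.eval_mul, mul_eq_zero] at hs
    exact hs.elim (hcS s) (hcS' s)
  · rw [← hf s hs, ← hf' s hs, map_smul, map_smul, LinearMap.smul_apply, smul_smul,
      Polynomial.eval_mul, mul_comm]

theorem IsRationalFamily.mul {f f' : ℂ → E} (H : IsRationalFamily S f)
    (H' : IsRationalFamily S f') : IsRationalFamily S fun s => f s * f' s :=
  H.bilin (LinearMap.mul ℂ E) H'

theorem IsRationalFamily.const_smul (a : ℂ) {f : ℂ → M} (H : IsRationalFamily S f) :
    IsRationalFamily S fun s => a • f s :=
  (isRationalFamily_of_mem (const_mem_polyFamilies a)).bilin (LinearMap.lsmul ℂ M) H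

theorem IsRationalFamily.add {f f' : ℂ → M} (H : IsRationalFamily S f)
    (H' : IsRationalFamily S f') : IsRationalFamily S fun s => f s + f' s := by
  obtain ⟨c, hc, hcS, g, hg, hf⟩ := H
  obtain ⟨c', hc', hcS', g', hg', hf'⟩ := H'
  refine ⟨c * c', mul_ne_zero hc hc', fun s hs => ?_,
    fun s => c'.eval s • g s + c.eval s • g' s, add_mem
      (smul_mem_polyFamilies (eval_mem_polyFamilies c') hg)
      (smul_mem_polyFamilies (eval_mem_polyFamilies c) hg'), fun s hs => ?_⟩
  · rw [Polynomial.eval_mul, mul_eq_zero] at hs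
    exact hs.elim (hcS s) (hcS' s)
  · beta_reduce
    rw [← hf s hs, ← hf' s hs, smul_smul, smul_smul, Polynomial.eval_mul, smul_add,
      mul_comm (c'.eval s)]

/-- A Bézout identity for `D(v - s)` and `q(v)`, with coefficients polynomial in `s` and right-hand
side a polynomial `c(s)` with roots in `S`. -/
def HasBezoutFamily (S : Set ℂ) (D q : ℂ[X]) : Prop :=
  ∃ c : ℂ[X], c ≠ 0 ∧ (∀ s, c.eval s = 0 → s ∈ S) ∧ ∃ a ∈ polyFamilies ℂ[X],
    ∃ b ∈ polyFamilies ℂ[X], ∀ s, a s * compAdd (-s) D + b s * q = Polynomial.C (c.eval s)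

theorem HasBezoutFamily.mul_left {D D' q : ℂ[X]} (H : HasBezoutFamily S D q)
    (H' : HasBezoutFamily S D' q) : HasBezoutFamily S (D * D') q := by
  obtain ⟨c, hc, hcS, a, ha, b, hb, e⟩ := H
  obtain ⟨c', hc', hcS', a', ha', b', hb', e'⟩ := H'
  refine ⟨c * c', mul_ne_zero hc hc', fun s hs => ?_, _, mul_mem_polyFamilies ha ha',
    fun s => a s * compAdd (-s) D * b' s + b s * Polynomial.C (c'.eval s),
    add_mem (mul_mem_polyFamilies (mul_mem_polyFamilies ha
      (compAdd_mem_polyFamilies neg_mem_polyFamilies D)) hb') (mul_mem_polyFamilies hb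
      (map_mem_polyFamilies (Polynomial.CAlgHom (R := ℂ) (A := ℂ)).toLinearMap
        (eval_mem_polyFamilies c'))), fun s => ?_⟩
  · rw [Polynomial.eval_mul, mul_eq_zero] at hs
    exact hs.elim (hcS s) (hcS' s)
  · rw [Polynomial.eval_mul, map_mul Polynomial.C, map_mul (compAdd (-s))]
    linear_combination (a s * compAdd (-s) D) * e' s + Polynomial.C (c'.eval s) * e s

theorem HasBezoutFamily.mul_right {D q q' : ℂ[X]} (H : HasBezoutFamily S D q)
    (H' : HasBezoutFamily S D q') : HasBezoutFamily S D (q * q') := by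
  obtain ⟨c, hc, hcS, a, ha, b, hb, e⟩ := H
  obtain ⟨c', hc', hcS', a', ha', b', hb', e'⟩ := H'
  refine ⟨c * c', mul_ne_zero hc hc', fun s hs => ?_,
    fun s => a s * Polynomial.C (c'.eval s) + b s * q * a' s,
    add_mem (mul_mem_polyFamilies ha
      (map_mem_polyFamilies (Polynomial.CAlgHom (R := ℂ) (A := ℂ)).toLinearMap
        (eval_mem_polyFamilies c'))) (mul_mem_polyFamilies (mul_mem_polyFamilies hb
      (const_mem_polyFamilies q)) ha'), _, mul_mem_polyFamilies hb hb', fun s => ?_⟩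
  · rw [Polynomial.eval_mul, mul_eq_zero] at hs
    exact hs.elim (hcS s) (hcS' s)
  · rw [Polynomial.eval_mul, map_mul Polynomial.C]
    linear_combination (b s * q) * e' s + Polynomial.C (c'.eval s) * e s

theorem hasBezoutFamily_C_left {a : ℂ} (ha : a ≠ 0) (q : ℂ[X]) :
    HasBezoutFamily S (Polynomial.C a) q :=
  ⟨1, one_ne_zero, fun s hs => by simp at hs, _, const_mem_polyFamilies (Polynomial.C a⁻¹), 0,
    zero_mem _, fun s => by
      rw [compAdd_C, ← map_mul Polynomial.C, inv_mul_cancel₀ ha]; simp⟩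

theorem hasBezoutFamily_C_right {a : ℂ} (ha : a ≠ 0) (D : ℂ[X]) :
    HasBezoutFamily S D (Polynomial.C a) :=
  ⟨1, one_ne_zero, fun s hs => by simp at hs, 0, zero_mem _, _,
    const_mem_polyFamilies (Polynomial.C a⁻¹), fun s => by
      rw [← map_mul Polynomial.C, inv_mul_cancel₀ ha]; simp⟩

/-- For linear factors, `(v - μ) - (v - s - l)` is the constant `s + l - μ`. -/
theorem hasBezoutFamily_linear {l μ : ℂ} (H : μ - l ∈ S) :
    HasBezoutFamily S (Polynomial.X - Polynomial.C l) (Polynomial.X - Polynomial.C μ) := by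
  refine ⟨Polynomial.X - Polynomial.C (μ - l), Polynomial.X_sub_C_ne_zero _, fun s hs => ?_, _,
    const_mem_polyFamilies (-1), _, const_mem_polyFamilies 1, fun s => ?_⟩
  · rw [Polynomial.eval_sub, Polynomial.eval_X, Polynomial.eval_C, sub_eq_zero] at hs
    rwa [hs]
  · simp only [map_sub, compAdd_X, compAdd_C, Polynomial.eval_sub, Polynomial.eval_X,
      Polynomial.eval_C, map_neg]
    ring

/-- Induction on the factorisation of a complex polynomial into linear factors. -/
theorem linear_factors_induction {p : ℂ[X] → Prop} {D : ℂ[X]} (hD : D ≠ 0)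
    (hC : ∀ a : ℂ, a ≠ 0 → p (Polynomial.C a)) (hmul : ∀ f g, p f → p g → p (f * g))
    (hX : ∀ a, D.eval a = 0 → p (Polynomial.X - Polynomial.C a)) : p D := by
  rw [(IsAlgClosed.splits D).eq_prod_roots]
  refine hmul _ _ (hC _ (Polynomial.leadingCoeff_ne_zero.2 hD)) ?_
  have key (m : Multiset ℂ) (hm : ∀ a ∈ m, D.eval a = 0) :
      p (m.map fun a => Polynomial.X - Polynomial.C a).prod := by
    induction m using Multiset.induction_on with
    | empty => simpa using hC 1 one_ne_zero
    | cons a m ih =>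
      rw [Multiset.map_cons, Multiset.prod_cons]
      exact hmul _ _ (hX a (hm a (Multiset.mem_cons_self a m)))
        (ih fun b hb => hm b (Multiset.mem_cons_of_mem hb))
  exact key _ fun a ha => (Polynomial.mem_roots hD).1 ha

/-- Bézout identities for linear factors multiply to one for `D(v - s)` and `q(v)`. -/
theorem hasBezoutFamily {D q : ℂ[X]} (hD : D ≠ 0) (hq : q ≠ 0)
    (H : ∀ l μ, D.eval l = 0 → q.eval μ = 0 → μ - l ∈ S) : HasBezoutFamily S D q :=
  linear_factors_induction hD (p := fun D => HasBezoutFamily S D q)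
    (fun _ ha => hasBezoutFamily_C_left ha q) (fun _ _ => HasBezoutFamily.mul_left) fun l hl =>
    linear_factors_induction hq (p := fun q => HasBezoutFamily S _ q)
      (fun _ ha => hasBezoutFamily_C_right ha _) (fun _ _ => HasBezoutFamily.mul_right)
      fun μ hμ => hasBezoutFamily_linear (H l μ hl hμ)

/-- The twist of `y(v)` by `φ(v - s)`, with the parameter `s` occurring only in polynomials. -/
theorem IsTwist.modeF_translate_left {φ y z : E⟦X⟧} {D q α β : ℂ[X]} {s : ℂ}
    (H : IsTwist (DrinfeldYangian.translate s φ) y z) (hφ : Clears φ D) (hy : Clears y q)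
    (hαβ : α * compAdd (-s) D + β * q = 1) (p : ℂ[X]) :
    modeF z p = (polyPart φ D).sum fun k e =>
      e * modeF y (compAdd (-s) (Polynomial.X ^ k) * (α * p)) := by
  have h1 := H.translate (-s)
  rw [translate_translate, neg_add_cancel, translate_zero] at h1
  have e : compAdd s α * D + compAdd s β * compAdd s q = 1 := by
    have := congrArg (compAdd s) hαβ
    rwa [map_add, map_mul, map_mul, map_one, compAdd_comp, add_neg_cancel, compAdd_zero] at this
  have hy' := hy.translate (-s)
  rw [neg_neg] at hy'
  have h2 := (isTwist_iff e hφ hy').1 h1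
  have h3 := LinearMap.congr_fun h2 (compAdd s p)
  rw [modeF_translate, compAdd_comp, neg_add_cancel, compAdd_zero] at h3
  rw [h3, (scalarPoly_comm _ _).eq, act_mul_apply, act_apply]
  simp only [act_scalar, modeF_translate, map_mul, compAdd_comp, neg_add_cancel, compAdd_zero]
  refine Finset.sum_congr rfl fun k _ => ?_
  beta_reduce
  rw [mul_left_comm]

/-- The twist of `y(v - s)` by `φ(v)`, with the parameter `s` occurring only in polynomials. -/
theorem IsTwist.modeF_translate_right {φ y z : E⟦X⟧} {D q α β : ℂ[X]} {s : ℂ}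
    (H : IsTwist φ (DrinfeldYangian.translate s y) z) (hφ : Clears φ D) (hy : Clears y q)
    (hαβ : α * D + β * compAdd (-s) q = 1) (p : ℂ[X]) :
    modeF z p = (polyPart φ D).sum fun k e =>
      e * modeF y (compAdd s (Polynomial.X ^ k * (α * p))) := by
  rw [(isTwist_iff hαβ hφ (hy.translate s)).1 H, (scalarPoly_comm _ _).eq, act_mul_apply, act_apply]
  simp only [act_scalar, modeF_translate]
  refine Finset.sum_congr rfl fun k _ => ?_
  beta_reduce
  rw [mul_left_comm]

/-- The twist of `y(v)` by `φ(v - s)` is rational in `s`. -/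
theorem isRationalFamily_twist_left {φ y : E⟦X⟧} {z : ℂ → E⟦X⟧} {D q : ℂ[X]}
    (hDq : HasBezoutFamily S D q) (hφ : Clears φ D) (hy : Clears y q)
    (H : ∀ s, s ∉ S → IsTwist (translate s φ) y (z s)) (p : ℂ[X]) :
    IsRationalFamily S fun s => modeF (z s) p := by
  obtain ⟨c, hc, hcS, a, ha, b, hb, e⟩ := hDq
  refine ⟨c, hc, hcS, fun s => (polyPart φ D).sum fun k e =>
      e * modeF y (compAdd (-s) (Polynomial.X ^ k) * (a s * p)), ?_, fun s hs => ?_⟩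
  · refine sum_mem_polyFamilies _ fun k _ => mul_mem_polyFamilies (const_mem_polyFamilies _)
      (map_mem_polyFamilies (modeF y) (mul_mem_polyFamilies
        (compAdd_mem_polyFamilies neg_mem_polyFamilies _)
        (mul_mem_polyFamilies ha (const_mem_polyFamilies p))))
  · have hcs : c.eval s ≠ 0 := fun h => hs (hcS s h)
    have hαβ : (Polynomial.C (c.eval s)⁻¹ * a s) * compAdd (-s) D +
        (Polynomial.C (c.eval s)⁻¹ * b s) * q = 1 := by
      have h1 : Polynomial.C (c.eval s)⁻¹ * Polynomial.C (c.eval s) = 1 := by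
        rw [← map_mul Polynomial.C, inv_mul_cancel₀ hcs, map_one]
      linear_combination Polynomial.C (c.eval s)⁻¹ * e s + h1
    beta_reduce
    rw [(H s hs).modeF_translate_left hφ hy hαβ, Polynomial.sum, Polynomial.sum, Finset.smul_sum]
    refine Finset.sum_congr rfl fun k _ => ?_
    rw [← mul_smul_comm, ← map_smul (modeF y), mul_assoc (Polynomial.C _),
      ← Polynomial.smul_eq_C_mul, mul_smul_comm, smul_smul, mul_inv_cancel₀ hcs, one_smul]

/-- The twist of `y(v - s)` by `φ(v)` is rational in `s`. -/
theorem isRationalFamily_twist_right {φ y : E⟦X⟧} {z : ℂ → E⟦X⟧} {D q : ℂ[X]}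
    (hDq : HasBezoutFamily S q D) (hφ : Clears φ D) (hy : Clears y q)
    (H : ∀ s, s ∉ S → IsTwist φ (translate s y) (z s)) (p : ℂ[X]) :
    IsRationalFamily S fun s => modeF (z s) p := by
  obtain ⟨c, hc, hcS, a, ha, b, hb, e⟩ := hDq
  refine ⟨c, hc, hcS, fun s => (polyPart φ D).sum fun k e =>
      e * modeF y (compAdd s (Polynomial.X ^ k * (b s * p))), ?_, fun s hs => ?_⟩
  · have h1 (k : ℕ) : (fun s => compAdd s (Polynomial.X ^ k * (b s * p))) ∈ polyFamilies ℂ[X] :=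
      compAdd_mem_polyFamilies' id_mem_polyFamilies (mul_mem_polyFamilies
        (const_mem_polyFamilies _) (mul_mem_polyFamilies hb (const_mem_polyFamilies p)))
    exact sum_mem_polyFamilies _ fun k _ => mul_mem_polyFamilies (const_mem_polyFamilies _)
      (map_mem_polyFamilies (modeF y) (h1 k))
  · have hcs : c.eval s ≠ 0 := fun h => hs (hcS s h)
    have hαβ : (Polynomial.C (c.eval s)⁻¹ * b s) * D +
        (Polynomial.C (c.eval s)⁻¹ * a s) * compAdd (-s) q = 1 := by
      have h1 : Polynomial.C (c.eval s)⁻¹ * Polynomial.C (c.eval s) = 1 := by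
        rw [← map_mul Polynomial.C, inv_mul_cancel₀ hcs, map_one]
      linear_combination Polynomial.C (c.eval s)⁻¹ * e s + h1
    beta_reduce
    rw [(H s hs).modeF_translate_right hφ hy hαβ, Polynomial.sum, Polynomial.sum, Finset.smul_sum]
    refine Finset.sum_congr rfl fun k _ => ?_
    rw [← mul_smul_comm, ← map_smul (modeF y), mul_assoc (Polynomial.C _),
      ← Polynomial.smul_eq_C_mul, mul_smul_comm, map_smul (compAdd s), smul_smul,
      mul_inv_cancel₀ hcs, one_smul]

end Families

section TensorFamily

variable {I : Type*} [Finite I] {A : Matrix I I ℤ} {d : I → ℂ} {h : ℂ}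
variable {V W : Type*} [AddCommGroup V] [Module ℂ V] [FiniteDimensional ℂ V]
  [AddCommGroup W] [Module ℂ W] [FiniteDimensional ℂ W]

theorem composable_iff {s : ℂ} {ρV : Rep A d h V} {ρW : Rep A d h W} :
    Composable s ρV ρW ↔ s ∉ sigma ρW - sigma ρV := by
  rw [Composable, Set.disjoint_left]
  constructor
  · rintro H ⟨μ, hμ, l, hl, rfl⟩
    refine H (Set.mem_vadd_set.2 ⟨l, hl, ?_⟩) hμ
    rw [vadd_eq_add, sub_add_cancel]
  · rintro H _ ⟨l, hl, rfl⟩ hμ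
    refine H ⟨_, hμ, l, hl, ?_⟩
    simp only [vadd_eq_add, add_sub_cancel_right]

theorem shiftSeq_mem_polyFamilies {E : Type*} [AddCommGroup E] [Module ℂ E] (y : ℕ → E) (r : ℕ) :
    (fun s => shiftSeq s y r) ∈ polyFamilies E :=
  sum_mem_polyFamilies _ fun _ _ => smul_mem_polyFamilies
    (mul_mem_polyFamilies (const_mem_polyFamilies _) (pow_mem_polyFamilies id_mem_polyFamilies _))
    (const_mem_polyFamilies _)

theorem tau_mem_polyFamilies {E : Type*} [Ring E] [Algebra ℂ E] (f : Yangian A d h →ₐ[ℂ] E)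
    (g : Gen I) : (fun s => f (tau A d h s (yg A d h g))) ∈ polyFamilies E := by
  rcases g with ⟨i, r⟩ | ⟨e, i, r⟩
  · simp only [tau_yxi]
    exact map_mem_polyFamilies f.toLinearMap (shiftSeq_mem_polyFamilies _ r)
  · simp only [tau_yx]
    exact map_mem_polyFamilies f.toLinearMap (shiftSeq_mem_polyFamilies _ r)

/-- The action on the deformed Drinfeld tensor product is rational in the parameter. -/
theorem isRationalFamily_drinfeldTensor (hh : h ≠ 0) (hA : CartanConditions A d)
    {ρV : Rep A d h V} {ρW : Rep A d h W} {R : ℂ → Rep A d h (V ⊗[ℂ] W)}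
    (H : ∀ s, s ∉ sigma ρW - sigma ρV → IsDrinfeldTensor s ρV ρW (R s)) (y : Yangian A d h) :
    IsRationalFamily (sigma ρW - sigma ρV) fun s => R s y := by
  obtain ⟨D, hD0, hD, hDr⟩ := exists_isDenominator hA ρV
  obtain ⟨q, hq0, hq, hqr⟩ := exists_isDenominator hA ρW
  have hB : HasBezoutFamily (sigma ρW - sigma ρV) D q := hasBezoutFamily hD0 hq0
    fun l μ hl hμ => ⟨μ, (hqr μ).1 hμ, l, (hDr l).1 hl, rfl⟩
  have hF (s : ℂ) (hs : s ∉ sigma ρW - sigma ρV) := ((isDrinfeldTensor_iff hh hA).1 (H s hs)).2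
  have hleft (g : Gen I) (w : Module.End ℂ W) :
      (fun s => opTensor (ρV (tau A d h s (yg A d h g))) w) ∈ polyFamilies _ := by
    simp only [opTensor_eq]
    exact mul_mem_polyFamilies (map_mem_polyFamilies (leftHom V W).toLinearMap
      (tau_mem_polyFamilies ρV g)) (const_mem_polyFamilies _)
  obtain ⟨y, rfl⟩ := RingQuot.mkAlgHom_surjective ℂ (Rel A d h) y
  induction y using FreeAlgebra.induction with
  | grade0 a =>
    simp only [AlgHom.commutes]
    exact isRationalFamily_of_mem (const_mem_polyFamilies _)
  | add y y' h1 h2 => simp only [map_add]; exact h1.add h2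
  | mul y y' h1 h2 => simp only [map_mul]; exact h1.mul h2
  | grade1 g =>
    rcases g with ⟨i, r⟩ | ⟨e, i, r⟩
    · refine (isRationalFamily_of_mem ?_).congr fun s hs => (H s hs).xi i r
      exact add_mem (add_mem (hleft _ _) ((polyFamilies _).smul_mem h
        (sum_mem_polyFamilies _ fun p _ => hleft _ _))) (const_mem_polyFamilies _)
    · -- the generator is recovered from the corresponding coefficient of the twisted series
      have key (T : ℂ → Rep A d h (V ⊗[ℂ] W))
          (hT : (fun s => T s (yx A d h e i r)) ∈ polyFamilies _)
          (hz : IsRationalFamily (sigma ρW - sigma ρV) fun s =>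
            modeF (xSeries (R s) e i - xSeries (T s) e i) (Polynomial.X ^ r)) :
          IsRationalFamily (sigma ρW - sigma ρV) fun s => R s (yx A d h e i r) := by
        refine ((hz.const_smul h⁻¹).add (isRationalFamily_of_mem hT)).congr fun s _ => ?_
        rw [add_comm]
        exact (eq_add_smul_iff hh _ _ _).2 (modeF_xSeries_sub _ _ _ _ _).symm
      rcases Int.units_eq_one_or e with rfl | rfl
      · refine key (fun s => leftRep W s ρV) (hleft _ 1) ?_
        refine isRationalFamily_twist_left hB ((hD.push (leftHom V W)).xi i)
          ((hq.push (rightHom V W)).x 1 i) (fun s hs => ?_) _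
        have := (hF s hs).plus i
        rwa [leftRep, ← push_shift, xiSeries_shift] at this
      · refine key (fun _ => rightRep V ρW) (const_mem_polyFamilies _) ?_
        refine isRationalFamily_twist_right hB ((hq.push (rightHom V W)).xi i)
          ((hD.push (leftHom V W)).x (-1) i) (fun s hs => ?_) _
        have := (hF s hs).minus i
        rwa [leftRep, ← push_shift, xSeries_shift] at this

end TensorFamily

/-! ### The Cartan data -/

section CartanData

variable {L : Type*} [LieRing L] [LieAlgebra ℂ L] [FiniteDimensional ℂ L]
  [LieAlgebra.IsSemisimple ℂ L]
variable (H : LieSubalgebra ℂ L) [H.IsCartanSubalgebra]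

theorem cast_pairingIn (α β : H.root) :
    (((LieAlgebra.IsKilling.rootSystem H).pairingIn ℤ α β : ℤ) : ℂ) =
      (LieAlgebra.IsKilling.rootSystem H).pairing α β :=
  (LieAlgebra.IsKilling.rootSystem H).algebraMap_pairingIn ℤ α β

/-- The squared lengths are the values of Mathlib's invariant form `RootForm`. -/
theorem cast_canonicalSqLength (α : H.root) : (canonicalSqLength H α : ℂ) =
    (LieAlgebra.IsKilling.rootSystem H).RootForm ((LieAlgebra.IsKilling.rootSystem H).root α)
      ((LieAlgebra.IsKilling.rootSystem H).root α) := by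
  rw [RootPairing.rootForm_root_self, canonicalSqLength, Nat.cast_sum]
  refine Finset.sum_congr rfl fun β _ => ?_
  rw [← cast_pairingIn, Nat.cast_pow, ← sq, Nat.cast_natAbs, ← Int.cast_pow, sq_abs, Int.cast_pow]

theorem canonicalSqLength_ne_zero (α : H.root) : canonicalSqLength H α ≠ 0 := by
  intro h
  have := (Finset.sum_eq_zero_iff.1 h) α (Finset.mem_univ _)
  rw [RootPairing.pairingIn_same] at this
  norm_num at this

theorem shortSqLength_ne_zero (α : H.root) : shortSqLength H α ≠ 0 := by
  have hne : {n | ∃ β, SameComponent H α β ∧ n = canonicalSqLength H β}.Nonempty :=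
    ⟨_, α, Relation.ReflTransGen.refl, rfl⟩
  obtain ⟨β, -, hβ⟩ := Nat.sInf_mem hne
  rw [shortSqLength, hβ]
  exact canonicalSqLength_ne_zero H β

/-- Roots that are not orthogonal belong to the same simple ideal. -/
theorem shortSqLength_eq_of_pairing_ne_zero {α β : H.root}
    (hαβ : (LieAlgebra.IsKilling.rootSystem H).pairing α β ≠ 0) :
    shortSqLength H α = shortSqLength H β := by
  have hβα : (LieAlgebra.IsKilling.rootSystem H).pairing β α ≠ 0 := fun h =>
    hαβ (RootPairing.pairing_eq_zero_iff.1 h)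
  unfold shortSqLength
  congr 1
  ext n
  exact ⟨fun ⟨γ, h1, h2⟩ => ⟨γ, Relation.ReflTransGen.head hβα h1, h2⟩,
    fun ⟨γ, h1, h2⟩ => ⟨γ, Relation.ReflTransGen.head hαβ h1, h2⟩⟩

variable {H}
variable (b : (LieAlgebra.IsKilling.rootSystem H).Base)

/-- The Cartan matrix of a semisimple Lie algebra is symmetrised by `d_i = (α_i, α_i) / 2`. -/
theorem cartanConditions : CartanConditions (cartan b) (symmetriser b) where
  diag i := by rw [cartan, Matrix.of_apply, RootPairing.pairingIn_same]
  ne_zero i := div_ne_zero (Nat.cast_ne_zero.2 (canonicalSqLength_ne_zero H i))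
    (Nat.cast_ne_zero.2 (shortSqLength_ne_zero H i))
  symm i j := by
    simp only [cartan, Matrix.of_apply, symmetriser, cast_pairingIn]
    have hs := (LieAlgebra.IsKilling.rootSystem H).toInvariantForm.pairing_mul_eq_pairing_mul_swap
      (i : H.root) (j : H.root)
    rw [RootPairing.toInvariantForm_form, ← cast_canonicalSqLength, ← cast_canonicalSqLength] at hs
    by_cases h : (LieAlgebra.IsKilling.rootSystem H).pairing (i : H.root) (j : H.root) = 0
    · rw [h, RootPairing.pairing_eq_zero_iff.1 h, mul_zero, mul_zero]
    · rw [shortSqLength_eq_of_pairing_ne_zero H h, div_mul_eq_mul_div, div_mul_eq_mul_div]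
      congr 1
      linear_combination hs

end CartanData

end DrinfeldYangian

theorem mainTheorem5
    {L : Type*} [LieRing L] [LieAlgebra ℂ L] [FiniteDimensional ℂ L] [LieAlgebra.IsSemisimple ℂ L]
    (H : LieSubalgebra ℂ L) [H.IsCartanSubalgebra]
    (b : (LieAlgebra.IsKilling.rootSystem H).Base) (h : ℂ) (hh : h ≠ 0)
    {V₁ V₂ V₃ : Type*}
    [AddCommGroup V₁] [Module ℂ V₁] [FiniteDimensional ℂ V₁]
    [AddCommGroup V₂] [Module ℂ V₂] [FiniteDimensional ℂ V₂]
    [AddCommGroup V₃] [Module ℂ V₃] [FiniteDimensional ℂ V₃]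
    (ρ₁ : DrinfeldYangian.Rep (DrinfeldYangian.cartan b) (DrinfeldYangian.symmetriser b) h V₁)
    (ρ₂ : DrinfeldYangian.Rep (DrinfeldYangian.cartan b) (DrinfeldYangian.symmetriser b) h V₂)
    (ρ₃ : DrinfeldYangian.Rep (DrinfeldYangian.cartan b) (DrinfeldYangian.symmetriser b) h V₃) :
    -- (i) the contour-integral formulae define an action on `V₁ ⊗ V₂`
    (∀ s : ℂ, DrinfeldYangian.Composable s ρ₁ ρ₂ →
      (∃! ρ, DrinfeldYangian.IsDrinfeldTensor s ρ₁ ρ₂ ρ) ∧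
      ∀ ρ, DrinfeldYangian.IsDrinfeldTensor s ρ₁ ρ₂ ρ →
        DrinfeldYangian.FieldFormulae s ρ₁ ρ₂ ρ) ∧
    -- (ii) the action is rational in `s`, with poles in `σ(V₂) - σ(V₁)`
    (∀ y : DrinfeldYangian.Yangian (DrinfeldYangian.cartan b) (DrinfeldYangian.symmetriser b) h,
      ∃ (D : ℂ[X]) (N : (Module.End ℂ (V₁ ⊗[ℂ] V₂))[X]), D ≠ 0 ∧
        (∀ s, D.eval s = 0 → s ∈ DrinfeldYangian.sigma ρ₂ - DrinfeldYangian.sigma ρ₁) ∧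
        ∀ (s : ℂ) (ρ), DrinfeldYangian.IsDrinfeldTensor s ρ₁ ρ₂ ρ →
          D.eval s • ρ y = N.eval (algebraMap ℂ _ s)) ∧
    -- (iii) coassociativity, whenever both iterated tensor products are defined
    (∀ (s₁ s₂ : ℂ) (ρ₁₂ ρ₂₃ ρL ρR),
      DrinfeldYangian.IsDrinfeldTensor s₁ ρ₁ ρ₂ ρ₁₂ →
      DrinfeldYangian.IsDrinfeldTensor s₂ ρ₁₂ ρ₃ ρL →
      DrinfeldYangian.IsDrinfeldTensor s₂ ρ₂ ρ₃ ρ₂₃ →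
      DrinfeldYangian.IsDrinfeldTensor (s₁ + s₂) ρ₁ ρ₂₃ ρR →
      ∀ y t, TensorProduct.assoc ℂ V₁ V₂ V₃ (ρL y t) =
        ρR y (TensorProduct.assoc ℂ V₁ V₂ V₃ t)) ∧
    -- (iv) units
    (∀ s : ℂ,
      DrinfeldYangian.IsDrinfeldTensor s
        (DrinfeldYangian.trivialRep (DrinfeldYangian.cartan b) (DrinfeldYangian.symmetriser b) h) ρ₁
        (ρ₁.transport (TensorProduct.lid ℂ V₁).symm) ∧
      DrinfeldYangian.IsDrinfeldTensor s ρ₁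
        (DrinfeldYangian.trivialRep (DrinfeldYangian.cartan b) (DrinfeldYangian.symmetriser b) h)
        ((ρ₁.shift s).transport (TensorProduct.rid ℂ V₁).symm)) ∧
    -- (v) compatibility with shifts
    (∀ (s s' : ℂ) (ρ),
      (DrinfeldYangian.IsDrinfeldTensor (s + s') ρ₁ ρ₂ ρ ↔
        DrinfeldYangian.IsDrinfeldTensor s' (ρ₁.shift s) ρ₂ ρ) ∧
      (DrinfeldYangian.IsDrinfeldTensor s ρ₁ ρ₂ ρ ↔
        DrinfeldYangian.IsDrinfeldTensor s (ρ₁.shift s') (ρ₂.shift s') (ρ.shift s'))) ∧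
    -- (vi) the poles of the tensor product
    (∀ (s : ℂ) (ρ), DrinfeldYangian.IsDrinfeldTensor s ρ₁ ρ₂ ρ →
      DrinfeldYangian.sigma ρ ⊆ (s +ᵥ DrinfeldYangian.sigma ρ₁) ∪ DrinfeldYangian.sigma ρ₂) := by
  have hA := DrinfeldYangian.cartanConditions b
  have hu (s : ℂ) (hs : DrinfeldYangian.Composable s ρ₁ ρ₂) :=
    DrinfeldYangian.existsUnique_isDrinfeldTensor hh hA hs
  refine ⟨fun s hs => ⟨hu s hs, fun ρ H => H.fieldFormulae hh hA⟩, fun y => ?_,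
    fun s₁ s₂ ρ₁₂ ρ₂₃ ρL ρR H12 HL H23 HR y t => ?_,
    fun s => ⟨DrinfeldYangian.isDrinfeldTensor_trivial_left hh hA s ρ₁,
      DrinfeldYangian.isDrinfeldTensor_trivial_right hh hA s ρ₁⟩,
    fun s s' ρ => ⟨DrinfeldYangian.isDrinfeldTensor_add_iff hh hA,
      DrinfeldYangian.isDrinfeldTensor_shift_iff hh hA s'⟩,
    fun s ρ H => H.sigma_subset hh hA⟩
  · -- a default value for the parameters at which the tensor product is not defined
    have : Nonempty (DrinfeldYangian.Rep (DrinfeldYangian.cartan b) (DrinfeldYangian.symmetriser b)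
        h (V₁ ⊗[ℂ] V₂)) := ⟨(Algebra.ofId ℂ _).comp (DrinfeldYangian.counit _ _ _)⟩
    choose! R hR using fun s hs => (hu s hs).exists
    obtain ⟨D, hD0, hD, g, hg, H⟩ := DrinfeldYangian.isRationalFamily_drinfeldTensor hh hA
      (fun s hs => hR s (DrinfeldYangian.composable_iff.2 hs)) y
    obtain ⟨N, hN⟩ := DrinfeldYangian.exists_polynomial_of_mem_polyFamilies hg
    refine ⟨D, N, hD0, hD, fun s ρ h => ?_⟩
    rw [hN, h.unique hh hA (hR s h.composable)]
    exact H s (DrinfeldYangian.composable_iff.1 h.composable)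
  · rw [← H12.assoc hh hA HL H23 HR]
    change _ = TensorProduct.assoc ℂ V₁ V₂ V₃
      (ρL y ((TensorProduct.assoc ℂ V₁ V₂ V₃).symm (TensorProduct.assoc ℂ V₁ V₂ V₃ t)))
    rw [LinearEquiv.symm_apply_apply]
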